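/- For $L\subseteq\{2,3,4,\dots\}$ let $\langle L\rangle$ be the set of all finite sums of (not necessarily distinct) elements of $L$ (including the empty sum $0$), let $g_L$ be the greatest common divisor of $L$, and let $p_L$ be the least $p\in\mathbb N$ such that $\eta g_L\in\langle L\rangle$ for all $\eta>p$. Let $G=(V,E)$ be a complete directed graph without loops on $n$ vertices, with edge weights $w:E\to\mathbb N$ such that $w(u,v)\le w(u,x)+w(x,v)$ for distinct $u,v,x$. A cycle cover of $G$ is a set $C\subseteq E$ such that every vertex has exactly one incoming and one outgoing edge in $C$; it is an $L$-cycle cover if the length of each of its cycles is in $L$; its weight is $w(C)=\sum_{e\in C}w(e)$. The algorithm **GoeWill** is applied to a complete undirected graph with symmetric weights $w$ and to the function $f(S)=1$ if $g_L\nmid|S|$, $f(S)=0$ otherwise. It starts with $F=\emptyset$ and $d(v)=0$ for all $v$. While $(V,F)$ has a component $S$ with $f(S)=1$, it picks an edge $\{i,j\}$ joining distinct components $S_i\ni i$, $S_j\ni j$ of $(V,F)$ with $f(S_i)+f(S_j)>0$ that minimizes $\varepsilon=(w(\{i,j\})-d(i)-d(j))/(f(S_i)+f(S_j))$, adds it to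 $F$, and increases $d(v)$ by $\varepsilon f(S_v)$ for every $v$, where $S_v$ is the component of $v$ before the addition. Finally it returns the graph whose edges are those $e\in F$ for which some component $N$ of $(V,F\setminus\{e\})$ has $f(N)=1$. The algorithm **ApxUndir** returns $\bot$ if $n\notin\langle L\rangle$. Otherwise it runs GoeWill to get a forest $H$. While $H$ has components whose size is not in $\langle L\rangle$ (illegal components), it adds, for each illegal component, a lightest edge leaving it, and then discards some of the added edges to break all cycles. Finally it duplicates every edge of $H$ and, for each component, walks along an Eulerian cycle, skips vertices already visited to obtain a Hamiltonian cycle of the component, cuts this cycle into paths whose numbers of vertices are in $L$, and joins the endpoints of each path. It returns the resulting cycles (a $2$-cycle is an edge taken twice). The algorithm **ApxDir** returns $\bot$ if $n\notin\langle L\rangle$. Otherwise it runs ApxUndir on $V$ with weights $w_U(\{u,v\})=w(u,v)+w(v,u)$, gives each cycle obtained an orientation of smaller $w$-weight, and returns the union of the directed cycles. All ties and choices are resolved arbitrarily. **Theorem.** Let $L\subseteq\{2,3,4,\dots\}$. 1. For all $G$, $w$ as above, every possible output of ApxDir is correct: if the output is $\bot$, then $G$ has no $L$-cycle cover; otherwise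 the output is an $L$-cycle cover $C^{\mathrm{apx}}$ of $G$ with $w(C^{\mathrm{apx}})\le 2n\,(p_L+4)\,w(C)$ for every $L$-cycle cover $C$ of $G$. 2. ApxDir runs in time $O(n^2\log n)$: for each fixed $L$ there is a program for a unit-cost random-access machine (operations on natural-number indices and on rational numbers; only addition, subtraction, halving, comparison and array access) which on every input $G$, $w$ with $n$ vertices halts after $O(n^2\log n)$ steps with a possible output of ApxDir. The constant may depend on $L$, but not on $w$. 3. For every cycle cover $C$ of $G$, with $w_U(C_U)=\sum_{(u,v)\in C}w_U(\{u,v\})$, we have $w_U(C_U)\le n\cdot w(C)$. -/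

import Mathlib

open Asymptotics

namespace LCC

/-! ### Admissible numbers, `g_L` and `p_L` -/

/-- `⟨L⟩`: the numbers that are sums of (not necessarily distinct) elements of `L`. -/
def close (L : Set ℕ) : Set ℕ :=
  {n | ∃ l : List ℕ, (∀ x ∈ l, x ∈ L) ∧ l.sum = n}

/-- `g_L`: the greatest common divisor of all elements of `L` (`0` for `L = ∅`). -/
noncomputable def gL (L : Set ℕ) : ℕ := Nat.setGcd L

/-- `p_L`: the least natural number `p` such that `η g_L ∈ ⟨L⟩` for all `η > p`. -/
noncomputable def pL (L : Set ℕ) : ℕ :=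
  sInf {p | ∀ η > p, η * gL L ∈ close L}

/-! ### Directed cycle covers

A complete directed graph (without loops) on `V` with edge weights is a function
`w : V → V → ℕ`; only the values `w u v` with `u ≠ v` are meaningful. -/

section Covers

variable {V : Type*}

def TriangleIneq (w : V → V → ℕ) : Prop :=
  ∀ u v x, u ≠ v → u ≠ x → x ≠ v → w u v ≤ w u x + w x v

/-- A set of edges such that every vertex has exactly one incoming and exactly one outgoing
edge in it. -/
def IsCycleCover (C : Finset (V × V)) : Prop :=
  (∀ e ∈ C, e.1 ≠ e.2) ∧ (∀ v, ∃! u, (v, u) ∈ C) ∧ (∀ v, ∃! u, (u, v) ∈ C)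

/-- The length of the cycle of the cycle cover `C` that contains `v`: the number of vertices
that can be reached from `v` in `(V, C)`. -/
noncomputable def cycleLength (C : Finset (V × V)) (v : V) : ℕ :=
  {u | Relation.ReflTransGen (fun a b => (a, b) ∈ C) v u}.ncard

def IsLCycleCover (L : Set ℕ) (C : Finset (V × V)) : Prop :=
  IsCycleCover C ∧ ∀ v, cycleLength C v ∈ L

def weight (w : V → V → ℕ) (C : Finset (V × V)) : ℕ := ∑ e ∈ C, w e.1 e.2

/-- The symmetrized weights `w_U({u,v}) = w(u,v) + w(v,u)`. -/
def symWeight (w : V → V → ℕ) (u v : V) : ℕ := w u v + w v u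

/-- The directed edges of the cycle that visits the entries of the list `c` in this order. -/
def cycleEdges (c : List V) : List (V × V) := c.zip (c.rotate 1)

def cycleWeight (w : V → V → ℕ) (c : List V) : ℕ :=
  ((cycleEdges c).map fun e => w e.1 e.2).sum

end Covers

/-! ### The algorithm of Goemans and Williamson

It is run with the proper function `f` given by `f S = 1` if `g ∤ |S|` and `f S = 0` otherwise,
on an undirected complete graph whose weights are a symmetric function `w`. Ties are broken
arbitrarily, so that the algorithm is a relation between inputs and possible outputs. -/

section GoeWill

variable {V : Type*}

/-- `f(C)` for the connected component `C` of `F` that contains `v`. -/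
noncomputable def compF (g : ℕ) (F : SimpleGraph V) (v : V) : ℕ :=
  open Classical in
  if g ∣ (F.connectedComponentMk v).supp.ncard then 0 else 1

/-- The amount of growth after which the edge `{i, j}` becomes tight. -/
noncomputable def gwEps (g : ℕ) (w : V → V → ℕ) (F : SimpleGraph V) (d : V → ℚ) (i j : V) : ℚ :=
  ((w i j : ℚ) - d i - d j) / ((compF g F i : ℚ) + (compF g F j : ℚ))

/-- `{i, j}` joins two distinct components of `F`, at least one of which is active
(for all other edges the quotient `ε` is infinite or not considered). -/
def GWCandidate (g : ℕ) (F : SimpleGraph V) (i j : V) : Prop :=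
  ¬ F.Reachable i j ∧ 0 < compF g F i + compF g F j

/-- One iteration of the main loop: the state consists of the edges `F` added so far and of the
numbers `d v`. -/
def GWStep (g : ℕ) (w : V → V → ℕ) (s s' : SimpleGraph V × (V → ℚ)) : Prop :=
  ∃ i j, GWCandidate g s.1 i j ∧
    (∀ i' j', GWCandidate g s.1 i' j' → gwEps g w s.1 s.2 i j ≤ gwEps g w s.1 s.2 i' j') ∧
    s'.1 = s.1 ⊔ SimpleGraph.edge i j ∧
    s'.2 = fun v => s.2 v + gwEps g w s.1 s.2 i j * (compF g s.1 v : ℚ)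

/-- The final pruning: keep the edges `e` of `F` such that some connected component `N` of
`(V, F \ {e})` has `f(N) = 1`. -/
def gwPrune (g : ℕ) (F : SimpleGraph V) : SimpleGraph V :=
  SimpleGraph.fromEdgeSet
    {e | e ∈ F.edgeSet ∧ ∃ v, compF g (F.deleteEdges {e}) v = 1}

/-- `H` is a possible output: the main loop starts with `F = ∅`, `d = 0` and is left as soon as
no component is active. -/
def GoeWill (g : ℕ) (w : V → V → ℕ) (H : SimpleGraph V) : Prop :=
  ∃ s : SimpleGraph V × (V → ℚ),
    Relation.ReflTransGen (GWStep g w) (⊥, fun _ => 0) s ∧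
    (∀ v, compF g s.1 v = 0) ∧ H = gwPrune g s.1

end GoeWill

/-! ### ApxUndir -/

section ApxUndir

variable {V : Type*}

def Illegal (L : Set ℕ) {H : SimpleGraph V} (c : H.ConnectedComponent) : Prop :=
  c.supp.ncard ∉ close L

/-- `{a, b}` is a lightest edge connecting `S` to its complement. -/
def LightestOut (w : V → V → ℕ) (S : Set V) (e : V × V) : Prop :=
  e.1 ∈ S ∧ e.2 ∉ S ∧ ∀ a ∈ S, ∀ b ∉ S, w e.1 e.2 ≤ w a b

/-- One phase, from `H` to `H'`. For every illegal component `c` a lightest edge `e c` leaving `c`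
is added to `H`; then some of these edges are removed in order to break all cycles, which results
in a forest between `H` and the enlarged graph that has the components of the latter. -/
def Phase (L : Set ℕ) (w : V → V → ℕ) (H H' : SimpleGraph V) : Prop :=
  (∃ c : H.ConnectedComponent, Illegal L c) ∧
  ∃ e : H.ConnectedComponent → V × V,
    (∀ c, Illegal L c → LightestOut w c.supp (e c)) ∧
    ∃ K : SimpleGraph V,
      K = H ⊔ SimpleGraph.fromEdgeSet {x | ∃ c, Illegal L c ∧ x = s((e c).1, (e c).2)} ∧
      H ≤ H' ∧ H' ≤ K ∧ H'.IsAcyclic ∧ ∀ u v, K.Reachable u v → H'.Reachable u v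

/-- The entries of a list in the order of their first occurrence. -/
def firstVisits [DecidableEq V] (l : List V) : List V := l.reverse.dedup.reverse

/-- `cs` is a list of cycles constructed from the component `c` of `H`: the closed walk `p` uses
every edge of the component exactly twice, that is, it is an Eulerian cycle after each edge has
been duplicated; shortcuts turn it into a Hamiltonian cycle of the component; this cycle is cut
into paths with numbers of vertices in `L`, and each path is closed to a cycle (a cycle is given
by the list of its vertices in cyclic order; two vertices form a cycle of length two). -/
def SplitComponent [DecidableEq V] (L : Set ℕ) (H : SimpleGraph V) (c : H.ConnectedComponent)
    (cs : List (List V)) : Prop :=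
  ∃ r ∈ c.supp, ∃ p : H.Walk r r,
    (∀ u v, H.Adj u v → u ∈ c.supp → p.edges.count s(u, v) = 2) ∧
    (cs.flatten ~r firstVisits p.support) ∧
    ∀ b ∈ cs, b.length ∈ L

/-- The possible outputs of ApxUndir on the complete graph on `V` with symmetric weights `w`:
`none` stands for `⊥`, and an `L`-cycle cover is given as its set of cycles. -/
def ApxUndir [Fintype V] [DecidableEq V] (L : Set ℕ) (w : V → V → ℕ) :
    Option (Set (List V)) → Prop
  | none => Fintype.card V ∉ close L
  | some cycles => Fintype.card V ∈ close L ∧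
      ∃ H₀ H : SimpleGraph V,
        GoeWill (gL L) w H₀ ∧
        Relation.ReflTransGen (Phase L w) H₀ H ∧
        (∀ c : H.ConnectedComponent, ¬ Illegal L c) ∧
        ∃ cs : H.ConnectedComponent → List (List V),
          (∀ c, SplitComponent L H c (cs c)) ∧ cycles = {b | ∃ c, b ∈ cs c}

end ApxUndir

/-! ### ApxDir -/

/-- The possible outputs of ApxDir on the complete directed graph on `V` with weights `w`:
run ApxUndir on the symmetrized weights and give every cycle an orientation of least weight. -/
def ApxDir {V : Type*} [Fintype V] [DecidableEq V] (L : Set ℕ) (w : V → V → ℕ) :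
    Option (Finset (V × V)) → Prop
  | none => Fintype.card V ∉ close L
  | some C => Fintype.card V ∈ close L ∧
      ∃ cycles : Set (List V), ApxUndir L (symWeight w) (some cycles) ∧
        ∃ o : List V → List V,
          (∀ c ∈ cycles, (o c = c ∨ o c = c.reverse) ∧
            cycleWeight w (o c) ≤ cycleWeight w c ∧
            cycleWeight w (o c) ≤ cycleWeight w c.reverse) ∧
          ∀ e, e ∈ C ↔ ∃ c ∈ cycles, e ∈ cycleEdges (o c)

/-! ### Random-access programs with a step count

A unit-cost random-access machine with two sorts of data: indices (natural numbers) and numbers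
(rationals). It has registers and arrays of both sorts. Arithmetic is restricted to addition,
subtraction and halving. Numbers can be compared but not be converted into indices. -/

structure State where
  reg : ℕ → ℕ
  arr : ℕ → ℕ → ℕ
  qreg : ℕ → ℚ
  qarr : ℕ → ℕ → ℚ

inductive Op where
  | const (x k : ℕ)
  | add (x y z : ℕ)
  | sub (x y z : ℕ)
  | half (x y : ℕ)
  | load (x a i : ℕ)
  | store (a i x : ℕ)
  | qconst (x k : ℕ)
  | qadd (x y z : ℕ)
  | qsub (x y z : ℕ)
  | qhalf (x y : ℕ)
  | qload (x a i : ℕ)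
  | qstore (a i x : ℕ)

/-- Arguments `x y z i` name registers, `a` names an array, `k` is a constant. Array positions are
given by index registers. Subtraction of indices is truncated, halving of indices rounds down. -/
def Op.exec (s : State) : Op → State
  | .const x k => { s with reg := Function.update s.reg x k }
  | .add x y z => { s with reg := Function.update s.reg x (s.reg y + s.reg z) }
  | .sub x y z => { s with reg := Function.update s.reg x (s.reg y - s.reg z) }
  | .half x y => { s with reg := Function.update s.reg x (s.reg y / 2) }
  | .load x a i => { s with reg := Function.update s.reg x (s.arr a (s.reg i)) }
  | .store a i x =>
      { s with arr := Function.update s.arr a (Function.update (s.arr a) (s.reg i) (s.reg x)) }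
  | .qconst x k => { s with qreg := Function.update s.qreg x (k : ℚ) }
  | .qadd x y z => { s with qreg := Function.update s.qreg x (s.qreg y + s.qreg z) }
  | .qsub x y z => { s with qreg := Function.update s.qreg x (s.qreg y - s.qreg z) }
  | .qhalf x y => { s with qreg := Function.update s.qreg x (s.qreg y / 2) }
  | .qload x a i => { s with qreg := Function.update s.qreg x (s.qarr a (s.reg i)) }
  | .qstore a i x =>
      { s with qarr := Function.update s.qarr a (Function.update (s.qarr a) (s.reg i) (s.qreg x)) }

inductive Test where
  | lt (x y : ℕ)
  | eq (x y : ℕ)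
  | qlt (x y : ℕ)

def Test.holds (s : State) : Test → Prop
  | .lt x y => s.reg x < s.reg y
  | .eq x y => s.reg x = s.reg y
  | .qlt x y => s.qreg x < s.qreg y

inductive Prog where
  | skip
  | op (o : Op)
  | seq (p q : Prog)
  | ite (b : Test) (p q : Prog)
  | loop (b : Test) (p : Prog)

/-- `Run p s t s'`: started in state `s`, the program `p` halts in state `s'` after exactly `t`
steps. Every operation and every evaluation of a test is one step; `loop b p` is the loop
"while `b` do `p`". -/
inductive Run : Prog → State → ℕ → State → Prop where
  | skip (s : State) : Run .skip s 1 s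
  | op (o : Op) (s : State) : Run (.op o) s 1 (o.exec s)
  | seq {p q : Prog} {s s' s'' : State} {t t' : ℕ} :
      Run p s t s' → Run q s' t' s'' → Run (.seq p q) s (t + t') s''
  | iteTrue {b : Test} {p q : Prog} {s s' : State} {t : ℕ} :
      b.holds s → Run p s t s' → Run (.ite b p q) s (t + 1) s'
  | iteFalse {b : Test} {p q : Prog} {s s' : State} {t : ℕ} :
      ¬ b.holds s → Run q s t s' → Run (.ite b p q) s (t + 1) s'
  | loopTrue {b : Test} {p : Prog} {s s' s'' : State} {t t' : ℕ} :
      b.holds s → Run p s t s' → Run (.loop b p) s' t' s'' →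
      Run (.loop b p) s (t + t' + 1) s''
  | loopFalse {b : Test} {p : Prog} {s : State} :
      ¬ b.holds s → Run (.loop b p) s 1 s

/-- Input convention: `n` is in index register `0`, the weight `w u v` is at position `u * n + v`
of number array `0`, and everything else is `0`. -/
def inputState {n : ℕ} (w : Fin n → Fin n → ℕ) : State where
  reg x := if x = 0 then n else 0
  arr _ _ := 0
  qreg _ := 0
  qarr a k :=
    if a = 0 then ∑ u : Fin n, ∑ v : Fin n, if (u : ℕ) * n + v = k then (w u v : ℚ) else 0
    else 0

/-- Output convention: index register `1` is `0` for the answer `⊥`; otherwise index array `0`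
maps every vertex to its successor in the cycle cover. -/
def outputOf (n : ℕ) (s : State) : Option (Finset (Fin n × Fin n)) :=
  if s.reg 1 = 0 then none
  else some (Finset.univ.filter fun e => s.arr 0 (e.1 : ℕ) = (e.2 : ℕ))

end LCC

/-!
The three parts of the theorem are proved independently of each other, except that the first uses
the third.

**From directed to symmetrized weights.** Closing the cycle through an edge `(u, v)` of a cycle
cover, the triangle inequality bounds `w v u` by the weight of the other edges of this cycle. Hence
`w_U {u, v} ≤ w C` for each of the `n` edges of the cover (`weight_symWeight_le`).

**The approximation ratio.** Let `W` be the symmetrized weight of an arbitrary `L`-cycle cover. The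
cover leaves and enters each set of vertices whose size is not in `⟨L⟩` (`exists_crossing`), and
little else about it is used.

* GoeWill returns a forest of weight at most `W`. The growth of the active components that separate
  two vertices never exceeds the weight of the edge between them, and equals it for chosen edges. In
  each iteration, this growth sums up to at most `2 ε` per active component on the pruned forest,
  whose active vertices have average degree at most two after contraction, since no inactive vertex
  is a leaf (`sum_active_gwPrune_le`). On the cover, it sums up to at least `2 ε` per active
  component (`GoeWill.graphWeight_le`).
* All components of the pruned forest have sizes divisible by `g_L` (`dvd_compSize_gwPrune`). Each
  phase adds edges of weight at most `W`, since for each illegal component the chosen edge is at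
  most as heavy as the edges of the cover that leave and enter it (`Phase.graphWeight_le`). It also
  enlarges the least size of an illegal component by `g_L`, so that there are at most `p_L` phases
  (`graphWeight_phases_le`).
* Duplicating edges and closing paths loses a factor of four, and the lighter orientation of a cycle
  has at most half of its symmetrized weight. The result weighs at most `2 (p_L + 1) W`, which is at
  most `2 n (p_L + 1) w C` (`ApxDir.correct`). Weights `graphWeight` of forests are sums over
  ordered pairs, hence twice the weights just mentioned.

**The running time.** A program is given explicitly and verified in a program logic with time
bounds, `wp`. Since `⟨L⟩` is finitely generated (`exists_list_close_eq`), a table of the admissible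
numbers up to `n` takes time `O(n)`. In GoeWill, the dual variable of an active vertex is stored as
its difference to the total growth, so that it changes only when the component changes. For every
pair of components, the lightest reduced weight and the total growth at which it vanishes are
maintained; the latter are the keys of a tournament tree with `O(n ^ 2)` leaves. Joining two
components affects `O(n)` pairs, each of which takes time `O(log n)`, and there are fewer than `n`
joins (`gwBody_wp`, `gwLoop_wp`). Everything else takes time `O(n ^ 2)`: pruning counts the
descendants of every vertex in a rooted forest (`pruneProg_wp`); `p_L + 1` phases, a constant
number, are carried out by scanning all edges (`rep_phaseProg_wp`); inserting each vertex after its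
parent into a linked list yields the Hamiltonian cycles obtained from Eulerian cycles by shortcuts
(`Rooted.attach`); and these are cut with the help of the table (`cutProg_wp`).
-/

/-! ### Sums of elements of `L` -/

namespace LCC

theorem mem_close_iff {L : Set ℕ} {n : ℕ} : n ∈ close L ↔ n ∈ AddSubmonoid.closure L := by
  constructor
  · rintro ⟨l, hl, rfl⟩
    exact AddSubmonoid.list_sum_mem _ fun x hx => AddSubmonoid.subset_closure (hl x hx)
  · intro h
    obtain ⟨l, hl, h⟩ := AddSubmonoid.exists_list_of_mem_closure h
    exact ⟨l, hl, h⟩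

theorem zero_mem_close (L : Set ℕ) : 0 ∈ close L := ⟨[], by simp, rfl⟩

theorem subset_close (L : Set ℕ) : L ⊆ close L := fun x hx => ⟨[x], by simpa using hx, by simp⟩

theorem add_mem_close {L : Set ℕ} {a b : ℕ} (ha : a ∈ close L) (hb : b ∈ close L) :
    a + b ∈ close L := by
  rw [mem_close_iff] at *
  exact add_mem ha hb

theorem gL_dvd {L : Set ℕ} {n : ℕ} (h : n ∈ close L) : gL L ∣ n :=
  Nat.setGcd_dvd_of_mem_closure (mem_close_iff.1 h)

/-- The defining property of `p_L`; the set whose infimum it is contains the conductor of the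
numerical semigroup generated by `L`. -/
theorem mul_gL_mem_close {L : Set ℕ} {η : ℕ} (h : pL L < η) : η * gL L ∈ close L := by
  have hne : {p | ∀ η > p, η * gL L ∈ close L}.Nonempty := by
    obtain ⟨m, hm⟩ := Nat.exists_mem_closure_of_ge L
    refine ⟨m, fun η hη => ?_⟩
    rcases Nat.eq_zero_or_pos (gL L) with h0 | h0
    · rw [h0, mul_zero]
      exact zero_mem_close L
    · exact mem_close_iff.2 (hm _ (hη.le.trans (Nat.le_mul_of_pos_right _ h0)) (dvd_mul_left _ _))
  exact Nat.sInf_mem hne η h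

/-- Submonoids of `ℕ` are finitely generated, so finitely many elements of `L` have the same sums.
They can be built into a program. -/
theorem exists_list_close_eq (L : Set ℕ) :
    ∃ l : List ℕ, (∀ x ∈ l, x ∈ L) ∧ ∀ n, n ∈ close L ↔ n ∈ close {x | x ∈ l} := by
  classical
  obtain ⟨S, hS⟩ := Nat.addSubmonoid_fg (AddSubmonoid.closure L)
  have h1 : ∀ x : S, ∃ l : List ℕ, (∀ y ∈ l, y ∈ L) ∧ l.sum = x := fun x =>
    mem_close_iff.2 (hS ▸ AddSubmonoid.subset_closure x.2)
  choose f hf hs using h1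
  refine ⟨(Finset.univ : Finset S).toList.flatMap f, ?_, fun n => ?_⟩
  · intro x hx
    obtain ⟨a, -, ha⟩ := List.mem_flatMap.1 hx
    exact hf a x ha
  · rw [mem_close_iff, mem_close_iff]
    constructor
    · intro h
      rw [← hS] at h
      refine (AddSubmonoid.closure_le.2 ?_) h
      intro x hx
      have h2 := hs ⟨x, hx⟩
      simp only at h2
      rw [← h2]
      refine AddSubmonoid.list_sum_mem _ fun y hy => AddSubmonoid.subset_closure ?_
      exact List.mem_flatMap.2 ⟨⟨x, hx⟩, by simp, hy⟩
    · intro h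
      refine AddSubmonoid.closure_mono ?_ h
      intro x hx
      obtain ⟨a, -, ha⟩ := List.mem_flatMap.1 hx
      exact hf a x ha

/-- The recursion behind the table of admissible numbers. -/
theorem mem_close_iff_exists_sub {l : List ℕ} {n : ℕ} (hn : 0 < n) :
    n ∈ close {x | x ∈ l} ↔ ∃ x ∈ l, x ≤ n ∧ n - x ∈ close {x | x ∈ l} := by
  constructor
  · rintro ⟨m, hm, rfl⟩
    cases m with
    | nil => simp at hn
    | cons a m =>
      refine ⟨a, hm a (by simp), by simp, m, fun x hx => hm x (by simp [hx]), by simp⟩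
  · rintro ⟨x, hx, hxn, h⟩
    rw [← Nat.sub_add_cancel hxn]
    exact add_mem_close h (subset_close _ hx)

/-! ### Cycle covers as permutations -/

section Perm

variable {V : Type*} [Fintype V]

/-- A cycle cover is the graph of a fixed-point free permutation `σ`, whose cycles are the cycles
of the cover. -/
theorem IsCycleCover.exists_perm {C : Finset (V × V)} (hC : IsCycleCover C) :
    ∃ σ : Equiv.Perm V, (∀ u v, (u, v) ∈ C ↔ σ u = v) ∧ (∀ v, σ v ≠ v) ∧
      (∀ w : V → V → ℕ, weight w C = ∑ v, w v (σ v)) ∧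
      ∀ v, cycleLength C v = {u | σ.SameCycle v u}.ncard := by
  obtain ⟨h1, h2, h3⟩ := hC
  choose f hf hfu using h2
  have hinj : Function.Injective f := fun a b hab => by
    obtain ⟨u, -, hu⟩ := h3 (f a)
    rw [hu a (hf a), hu b (by rw [hab]; exact hf b)]
  let σ : Equiv.Perm V := Equiv.ofBijective f (Finite.injective_iff_bijective.1 hinj)
  have hσ : ∀ u v, (u, v) ∈ C ↔ σ u = v := fun u v =>
    ⟨fun h => (hfu u v h).symm, fun h => by rw [← h]; exact hf u⟩
  refine ⟨σ, hσ, fun v hv => h1 _ ((hσ v v).2 hv) rfl, fun w => ?_, fun v => ?_⟩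
  · have : C = Finset.univ.map ⟨fun v => (v, σ v), fun a b h => (Prod.ext_iff.1 h).1⟩ := by
      ext ⟨u, v⟩
      simp only [hσ, Finset.mem_map, Finset.mem_univ, true_and]
      constructor
      · exact fun h => ⟨u, Prod.ext rfl h⟩
      · rintro ⟨a, ha⟩
        obtain rfl : a = u := congrArg Prod.fst ha
        exact congrArg Prod.snd ha
    rw [weight, this, Finset.sum_map]
    rfl
  · unfold cycleLength
    congr 1
    ext u
    simp only [Set.mem_ofPred_eq]
    constructor
    · intro h
      induction h with
      | refl => exact Equiv.Perm.SameCycle.refl _ _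
      | tail _ h ih =>
        rw [hσ] at h
        rw [← h]
        exact Equiv.Perm.sameCycle_apply_right.2 ih
    · intro h
      obtain ⟨i, -, -, rfl⟩ := h.exists_pow_eq''
      clear h
      induction i with
      | zero => exact .refl
      | succ i ih =>
        refine ih.tail ?_
        rw [hσ, pow_succ', Equiv.Perm.mul_apply]

/-- A set of vertices that is closed under successors is a union of cycles. -/
theorem ncard_mem_close_of_closed {L : Set ℕ} (σ : Equiv.Perm V)
    (h : ∀ v, {u | σ.SameCycle v u}.ncard ∈ L) (S : Set V) (hS : ∀ v ∈ S, σ v ∈ S) :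
    S.ncard ∈ close L := by
  induction hn : S.ncard using Nat.strong_induction_on generalizing S with
  | _ n ih =>
    subst hn
    rcases S.eq_empty_or_nonempty with rfl | ⟨v, hv⟩
    · simpa using zero_mem_close L
    have hsub : {u | σ.SameCycle v u} ⊆ S := by
      intro u hu
      obtain ⟨i, -, -, rfl⟩ := Equiv.Perm.SameCycle.exists_pow_eq'' hu
      clear hu
      induction i with
      | zero => simpa using hv
      | succ i ih => rw [pow_succ', Equiv.Perm.mul_apply]; exact hS _ ih
    have hlt : (S \ {u | σ.SameCycle v u}).ncard < S.ncard :=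
      Set.ncard_lt_ncard ⟨Set.sdiff_subset, fun h' => (h' hv).2 (Equiv.Perm.SameCycle.refl _ _)⟩
    rw [← Set.ncard_sdiff_add_ncard_of_subset hsub]
    refine add_mem_close (ih _ hlt _ ?_ rfl) (subset_close L (h v))
    rintro u ⟨hu, hvu⟩
    exact ⟨hS u hu, fun h' => hvu (Equiv.Perm.sameCycle_apply_right.1 h')⟩

/-- A cycle cover with admissible cycle lengths leaves and enters every set of inadmissible size. If
it entered the set nowhere, it would permute the complement and could not leave the set either. -/
theorem exists_crossing {L : Set ℕ} (σ : Equiv.Perm V)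
    (h : ∀ v, {u | σ.SameCycle v u}.ncard ∈ L) (S : Set V) (hS : S.ncard ∉ close L) :
    (∃ v ∈ S, σ v ∉ S) ∧ ∃ v, v ∉ S ∧ σ v ∈ S := by
  have h1 : ∃ v ∈ S, σ v ∉ S := by
    by_contra! hc
    exact hS (ncard_mem_close_of_closed σ h S hc)
  refine ⟨h1, ?_⟩
  by_contra! hc
  obtain ⟨v, hv, hσ⟩ := h1
  have hb : ∀ u ∈ Sᶜ, σ u ∈ Sᶜ := fun u hu => hc u hu
  have hmaps : Set.BijOn σ Sᶜ Sᶜ :=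
    ((Set.toFinite _).injOn_iff_bijOn_of_mapsTo hb).1 σ.injective.injOn
  obtain ⟨u, hu, huv⟩ := hmaps.2.2 hσ
  exact hu ((σ.injective huv) ▸ hv)

/-- The weight bound relating a cycle cover to its symmetrization: closing the cycle through
`(u, v)` shows that `w v u` is at most the weight of the other edges. -/
theorem weight_symWeight_le {w : V → V → ℕ} (hw : TriangleIneq w) {C : Finset (V × V)}
    (hC : IsCycleCover C) : weight (symWeight w) C ≤ Fintype.card V * weight w C := by
  obtain ⟨σ, -, hne, hwt, -⟩ := hC.exists_perm
  rw [hwt, hwt]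
  have key : ∀ v, symWeight w v (σ v) ≤ ∑ u, w u (σ u) := by
    intro v
    obtain ⟨k, hk0, hk⟩ : ∃ k, 0 < k ∧ (σ ^ k) v = v :=
      ⟨orderOf σ, orderOf_pos σ, by rw [pow_orderOf_eq_one]; rfl⟩
    have hex : ∃ k, 0 < k ∧ (σ ^ k) v = v := ⟨k, hk0, hk⟩
    classical
    -- `m` is the length of the cycle through `v`
    set m := Nat.find hex with hm
    obtain ⟨hm0, hmv⟩ := Nat.find_spec hex
    have hmin : ∀ j, 0 < j → j < m → (σ ^ j) v ≠ v := fun j h0 hj h =>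
      Nat.find_min hex hj ⟨h0, h⟩
    have hinj : ∀ i < m, ∀ j < m, i ≤ j → (σ ^ i) v = (σ ^ j) v → i = j := by
      intro i hi j hj hij h
      by_contra hne
      refine hmin (j - i) (by omega) (by omega) ?_
      apply (σ ^ i).injective
      rw [← Equiv.Perm.mul_apply, ← pow_add, Nat.add_sub_cancel' hij, h]
    have hm1 : m ≠ 1 := by
      intro h
      rw [← hm, h] at hmv
      exact hne v (by simpa using hmv)
    -- shortcuts along the path `σ v, σ (σ v), …`
    have hpath : ∀ j, 0 < j → j < m → w (σ v) ((σ ^ (j + 1)) v) ≤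
        ∑ i ∈ Finset.Ico 1 (j + 1), w ((σ ^ i) v) ((σ ^ (i + 1)) v) := by
      intro j hj
      induction j, hj using Nat.le_induction with
      | base => intro _; simp
      | succ j hj ih =>
        intro hjm
        have h := ih (by omega)
        rw [Finset.sum_Ico_succ_top (by omega)]
        have hd : ∀ a b, 1 ≤ a → a < b → b ≤ m → (σ ^ a) v ≠ (σ ^ b) v := by
          intro a b ha hab hb h
          rcases hb.lt_or_eq with hb | hb
          · exact hab.ne (hinj a (by omega) b hb hab.le h)
          · rw [hb, hmv] at h
            exact hmin a (by omega) (by omega) h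
        have e1 : σ v = (σ ^ 1) v := by simp
        rw [e1] at h ⊢
        refine (hw _ _ ((σ ^ (j + 1)) v) ?_ ?_ ?_).trans (Nat.add_le_add_right h _)
        · exact hd _ _ le_rfl (by omega) (by omega)
        · exact hd _ _ le_rfl (by omega) (by omega)
        · exact hd _ _ (by omega) (by omega) (by omega)
    have hm2 : 2 ≤ m := by omega
    have h1 : w (σ v) v ≤ ∑ i ∈ Finset.Ico 1 m, w ((σ ^ i) v) ((σ ^ (i + 1)) v) := by
      have h2 := hpath (m - 1) (by omega) (by omega)
      rw [Nat.sub_add_cancel (by omega), hmv] at h2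
      exact h2
    have h3 : symWeight w v (σ v) ≤ ∑ i ∈ Finset.range m, w ((σ ^ i) v) ((σ ^ (i + 1)) v) := by
      rw [Finset.range_eq_Ico, Finset.sum_eq_sum_Ico_succ_bot (by omega)]
      simpa [symWeight] using h1
    refine h3.trans ?_
    have h4 : ∑ i ∈ Finset.range m, w ((σ ^ i) v) ((σ ^ (i + 1)) v) =
        ∑ u ∈ (Finset.range m).image (fun i => (σ ^ i) v), w u (σ u) := by
      rw [Finset.sum_image]
      · simp [pow_succ']
      · intro i hi j hj h
        simp only [Finset.coe_range, Set.mem_Iio] at hi hj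
        rcases le_total i j with hij | hij
        · exact hinj i hi j hj hij h
        · exact (hinj j hj i hi hij h.symm).symm
    rw [h4]
    exact Finset.sum_le_sum_of_subset (Finset.subset_univ _)
  calc ∑ v, symWeight w v (σ v) ≤ ∑ _v : V, ∑ u, w u (σ u) := Finset.sum_le_sum fun v _ => key v
    _ = _ := by simp

end Perm

end LCC

/-! ### Connected components and forests -/

namespace LCC

section Graph

variable {V : Type*}

/-- The number of vertices of the component of `v`. -/
noncomputable def compSize (G : SimpleGraph V) (v : V) : ℕ :=
  (G.connectedComponentMk v).supp.ncard

theorem mem_supp_mk {G : SimpleGraph V} {u v : V} :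
    u ∈ (G.connectedComponentMk v).supp ↔ G.Reachable u v := by
  rw [SimpleGraph.ConnectedComponent.mem_supp_iff, SimpleGraph.ConnectedComponent.eq]

theorem compSize_eq_ncard (G : SimpleGraph V) (v : V) :
    compSize G v = {u | G.Reachable u v}.ncard := by
  unfold compSize
  congr 1
  ext u
  exact mem_supp_mk

theorem compSize_congr {G G' : SimpleGraph V} {v v' : V}
    (h : ∀ u, G.Reachable u v ↔ G'.Reachable u v') : compSize G v = compSize G' v' := by
  rw [compSize_eq_ncard, compSize_eq_ncard]
  congr 1
  ext u
  exact h u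

theorem compSize_eq_of_reachable {G : SimpleGraph V} {v v' : V} (h : G.Reachable v v') :
    compSize G v = compSize G v' :=
  compSize_congr fun _ => ⟨fun h' => h'.trans h, fun h' => h'.trans h.symm⟩

theorem compSize_pos [Finite V] (G : SimpleGraph V) (v : V) : 0 < compSize G v := by
  rw [compSize_eq_ncard, Set.ncard_pos (Set.toFinite _)]
  exact ⟨v, SimpleGraph.Reachable.refl v⟩

theorem compF_eq_zero {g : ℕ} {G : SimpleGraph V} {v : V} :
    compF g G v = 0 ↔ g ∣ compSize G v := by
  unfold compF compSize
  split_ifs with h <;> simp [h]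

theorem compF_eq_one {g : ℕ} {G : SimpleGraph V} {v : V} :
    compF g G v = 1 ↔ ¬ g ∣ compSize G v := by
  unfold compF compSize
  split_ifs with h <;> simp [h]

theorem compF_le_one (g : ℕ) (G : SimpleGraph V) (v : V) : compF g G v ≤ 1 := by
  unfold compF
  split_ifs <;> simp

/-- A set that no edge of `G` leaves is a disjoint union of components. -/
theorem ncard_mem_of_closed [Finite V] (M : AddSubmonoid ℕ) (G : SimpleGraph V) (S : Set V)
    (hS : ∀ u ∈ S, ∀ v, G.Reachable v u → v ∈ S) (h : ∀ v ∈ S, compSize G v ∈ M) :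
    S.ncard ∈ M := by
  induction hn : S.ncard using Nat.strong_induction_on generalizing S with
  | _ n ih =>
    subst hn
    rcases S.eq_empty_or_nonempty with rfl | ⟨v, hv⟩
    · simp
    have hsub : {u | G.Reachable u v} ⊆ S := fun u hu => hS v hv u hu
    have hlt : (S \ {u | G.Reachable u v}).ncard < S.ncard :=
      Set.ncard_lt_ncard
        ⟨Set.sdiff_subset, fun h' => (h' hv).2 (SimpleGraph.Reachable.refl _)⟩
    rw [← Set.ncard_sdiff_add_ncard_of_subset hsub]
    refine add_mem (ih _ hlt _ ?_ (fun u hu => h u hu.1) rfl) ?_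
    · rintro u ⟨hu, hvu⟩ x hx
      exact ⟨hS u hu x hx, fun h' => hvu (hx.symm.trans h')⟩
    · rw [← compSize_eq_ncard]
      exact h v hv

theorem mem_multiples {g n : ℕ} : n ∈ AddSubmonoid.multiples g ↔ g ∣ n := by
  rw [AddSubmonoid.mem_multiples_iff]
  constructor
  · rintro ⟨k, rfl⟩
    simp
  · rintro ⟨k, rfl⟩
    exact ⟨k, by simp [mul_comm]⟩

theorem dvd_ncard_of_closed [Finite V] {g : ℕ} (G : SimpleGraph V) (S : Set V)
    (hS : ∀ u ∈ S, ∀ v, G.Reachable v u → v ∈ S) (h : ∀ v ∈ S, g ∣ compSize G v) :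
    g ∣ S.ncard :=
  mem_multiples.1 (ncard_mem_of_closed _ G S hS fun v hv => mem_multiples.2 (h v hv))

/-- A component of a larger graph splits into components of the smaller one. -/
theorem compSize_mem_of_le [Finite V] (M : AddSubmonoid ℕ) {G G' : SimpleGraph V} (hle : G ≤ G')
    {x : V} (h : ∀ v, G'.Reachable v x → compSize G v ∈ M) : compSize G' x ∈ M := by
  rw [compSize_eq_ncard]
  exact ncard_mem_of_closed M G _ (fun u hu v hv => (hv.mono hle).trans hu) h

/-- If all parts of a component but one have sizes divisible by `g`, so does the last one as soon
as the whole component does. -/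
theorem dvd_compSize_of_le [Finite V] {g : ℕ} {G G' : SimpleGraph V} (hle : G ≤ G') {x : V}
    (h : ∀ v, G'.Reachable v x → ¬ G.Reachable v x → g ∣ compSize G v)
    (hx : g ∣ compSize G' x) : g ∣ compSize G x := by
  have hsub : {u | G.Reachable u x} ⊆ {u | G'.Reachable u x} := fun u hu => hu.mono hle
  have h1 := Set.ncard_sdiff_add_ncard_of_subset hsub
  rw [← compSize_eq_ncard, ← compSize_eq_ncard] at h1
  refine (Nat.dvd_add_right (dvd_ncard_of_closed (g := g) G _ ?_ ?_)).1 (h1 ▸ hx)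
  · rintro u ⟨hu, hu'⟩ v hv
    exact ⟨(hv.mono hle).trans hu, fun h' => hu' (hv.symm.trans h')⟩
  · rintro u ⟨hu, hu'⟩
    exact h u hu hu'

theorem reachable_sup_edge {G : SimpleGraph V} {x y a b : V} :
    (G ⊔ SimpleGraph.edge x y).Reachable a b ↔ G.Reachable a b ∨
      (G.Reachable a x ∧ G.Reachable y b) ∨ (G.Reachable a y ∧ G.Reachable x b) := by
  constructor
  · rintro ⟨p⟩
    induction p with
    | nil => exact Or.inl (SimpleGraph.Reachable.refl _)
    | @cons u v w h p ih =>
      rw [SimpleGraph.sup_adj, SimpleGraph.edge_adj] at h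
      rcases h with h | ⟨⟨rfl, rfl⟩ | ⟨rfl, rfl⟩, -⟩
      · have := h.reachable
        rcases ih with h1 | ⟨h1, h2⟩ | ⟨h1, h2⟩
        · exact Or.inl (this.trans h1)
        · exact Or.inr (Or.inl ⟨this.trans h1, h2⟩)
        · exact Or.inr (Or.inr ⟨this.trans h1, h2⟩)
      · rcases ih with h1 | ⟨h1, h2⟩ | ⟨h1, h2⟩
        · exact Or.inr (Or.inl ⟨SimpleGraph.Reachable.refl _, h1⟩)
        · exact Or.inr (Or.inl ⟨SimpleGraph.Reachable.refl _, h2⟩)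
        · exact Or.inl h2
      · rcases ih with h1 | ⟨h1, h2⟩ | ⟨h1, h2⟩
        · exact Or.inr (Or.inr ⟨SimpleGraph.Reachable.refl _, h1⟩)
        · exact Or.inl h2
        · exact Or.inr (Or.inr ⟨SimpleGraph.Reachable.refl _, h2⟩)
  · have hle : G ≤ G ⊔ SimpleGraph.edge x y := le_sup_left
    have hxy : (G ⊔ SimpleGraph.edge x y).Reachable x y := by
      by_cases h : x = y
      · rw [h]
      · exact SimpleGraph.Adj.reachable (Or.inr (by simp [SimpleGraph.edge_adj, h]))
    rintro (h | ⟨h1, h2⟩ | ⟨h1, h2⟩)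
    · exact h.mono hle
    · exact ((h1.mono hle).trans hxy).trans (h2.mono hle)
    · exact ((h1.mono hle).trans hxy.symm).trans (h2.mono hle)

theorem deleteEdges_sup_edge {G : SimpleGraph V} {x y : V} (h : G.Adj x y) :
    G.deleteEdges {s(x, y)} ⊔ SimpleGraph.edge x y = G := by
  ext a b
  simp only [SimpleGraph.sup_adj, SimpleGraph.deleteEdges_adj, SimpleGraph.edge_adj,
    Set.mem_singleton_iff, Sym2.eq_iff]
  constructor
  · rintro (⟨h, -⟩ | ⟨⟨rfl, rfl⟩ | ⟨rfl, rfl⟩, -⟩)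
    · exact h
    · exact h
    · exact h.symm
  · intro h'
    by_cases hab : a = x ∧ b = y ∨ a = y ∧ b = x
    · exact Or.inr ⟨by grind, h'.ne⟩
    · exact Or.inl ⟨h', hab⟩

theorem not_reachable_deleteEdges {G : SimpleGraph V} (hG : G.IsAcyclic) {x y : V}
    (h : G.Adj x y) : ¬ (G.deleteEdges {s(x, y)}).Reachable x y :=
  (SimpleGraph.isBridge_iff.1 (SimpleGraph.isAcyclic_iff_forall_adj_isBridge.1 hG h))

theorem card_component_lt [Finite V] {G G' : SimpleGraph V} (hle : G ≤ G') {u v : V}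
    (h : ¬ G.Reachable u v) (h' : G'.Reachable u v) :
    Nat.card G'.ConnectedComponent < Nat.card G.ConnectedComponent := by
  have := Fintype.ofFinite G.ConnectedComponent
  have := Fintype.ofFinite G'.ConnectedComponent
  rw [Nat.card_eq_fintype_card, Nat.card_eq_fintype_card]
  refine Fintype.card_lt_of_surjective_not_injective
    (SimpleGraph.ConnectedComponent.map (SimpleGraph.Hom.ofLE hle)) ?_ ?_
  · intro c
    induction c using SimpleGraph.ConnectedComponent.ind with
    | _ v => exact ⟨G.connectedComponentMk v, rfl⟩
  · intro hinj
    exact h (SimpleGraph.ConnectedComponent.exact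
      (hinj (a₁ := G.connectedComponentMk u) (a₂ := G.connectedComponentMk v)
        (SimpleGraph.ConnectedComponent.sound h')))

/-- Every edge of a forest joins two components of the forest without this edge. -/
theorem ncard_adj_add_card_component_le [Finite V] {G₀ G : SimpleGraph V} (hle : G₀ ≤ G)
    (hG : G.IsAcyclic) :
    {e : V × V | G.Adj e.1 e.2 ∧ ¬ G₀.Adj e.1 e.2}.ncard + 2 * Nat.card G.ConnectedComponent ≤
      2 * Nat.card G₀.ConnectedComponent := by
  induction hn : {e : V × V | G.Adj e.1 e.2 ∧ ¬ G₀.Adj e.1 e.2}.ncard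
    using Nat.strong_induction_on generalizing G with
  | _ n ih =>
    subst hn
    rcases Set.eq_empty_or_nonempty {e : V × V | G.Adj e.1 e.2 ∧ ¬ G₀.Adj e.1 e.2} with h0 | h0
    · have : G = G₀ := by
        refine le_antisymm (fun u v h => ?_) hle
        by_contra hc
        exact Set.notMem_empty (u, v) (h0 ▸ ⟨h, hc⟩)
      subst this
      simp
    · obtain ⟨⟨x, y⟩, hxy, hxy'⟩ := h0
      simp only at hxy hxy'
      have hle' : G₀ ≤ G.deleteEdges {s(x, y)} := by
        intro a b hab
        rw [SimpleGraph.deleteEdges_adj]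
        refine ⟨hle hab, fun h => hxy' ?_⟩
        rw [Set.mem_singleton_iff, Sym2.eq_iff] at h
        rcases h with ⟨rfl, rfl⟩ | ⟨rfl, rfl⟩
        · exact hab
        · exact hab.symm
      have hset : {e : V × V | (G.deleteEdges {s(x, y)}).Adj e.1 e.2 ∧ ¬ G₀.Adj e.1 e.2} =
          {e : V × V | G.Adj e.1 e.2 ∧ ¬ G₀.Adj e.1 e.2} \ {(x, y), (y, x)} := by
        ext ⟨a, b⟩
        simp only [SimpleGraph.deleteEdges_adj, Set.mem_singleton_iff, Sym2.eq_iff,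
          Set.mem_ofPred_eq, Set.mem_sdiff, Set.mem_insert_iff, Prod.mk.injEq]
        tauto
      have hsub : ({(x, y), (y, x)} : Set (V × V)) ⊆
          {e : V × V | G.Adj e.1 e.2 ∧ ¬ G₀.Adj e.1 e.2} := by
        rintro e (rfl | rfl)
        · exact ⟨hxy, hxy'⟩
        · exact ⟨hxy.symm, fun h => hxy' h.symm⟩
      have hcard := Set.ncard_sdiff_add_ncard_of_subset hsub
      rw [Set.ncard_pair (by simp [hxy.ne]), ← hset] at hcard
      have h1 := ih _ (by omega) hle' (hG.anti (SimpleGraph.deleteEdges_le _)) rfl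
      have h2 := card_component_lt (SimpleGraph.deleteEdges_le (G := G) {s(x, y)})
        (not_reachable_deleteEdges hG hxy) hxy.reachable
      omega

/-! ### Pruning -/

theorem gwPrune_eq {g : ℕ} {F : SimpleGraph V} :
    gwPrune g F = F.deleteEdges {e | ∀ v, g ∣ compSize (F.deleteEdges {e}) v} := by
  ext a b
  simp only [gwPrune, SimpleGraph.fromEdgeSet_adj, SimpleGraph.deleteEdges_adj, Set.mem_ofPred_eq,
    compF_eq_one, SimpleGraph.mem_edgeSet, not_forall]
  exact ⟨fun h => h.1, fun h => ⟨h, h.1.ne⟩⟩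

theorem gwPrune_le (g : ℕ) (F : SimpleGraph V) : gwPrune g F ≤ F := by
  rw [gwPrune_eq]
  exact SimpleGraph.deleteEdges_le _

theorem reachable_iff_of_sup_edge {G : SimpleGraph V} {x y v : V} (hx : ¬ G.Reachable v x)
    (hy : ¬ G.Reachable v y) (u : V) :
    G.Reachable u v ↔ (G ⊔ SimpleGraph.edge x y).Reachable u v := by
  rw [reachable_sup_edge]
  exact ⟨Or.inl, fun h => h.resolve_right (by
    rintro (⟨-, h⟩ | ⟨-, h⟩)
    · exact hy h.symm
    · exact hx h.symm)⟩

/-- Edges of a forest that split it into components of sizes divisible by `g` can be removed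
simultaneously: all components still have sizes divisible by `g`. -/
theorem dvd_compSize_deleteEdges [Finite V] {g : ℕ} {F : SimpleGraph V} (hF : F.IsAcyclic)
    (hg : ∀ v, g ∣ compSize F v) (D : Set (Sym2 V))
    (hD : ∀ e ∈ D, ∀ v, g ∣ compSize (F.deleteEdges {e}) v) (v : V) :
    g ∣ compSize (F.deleteEdges D) v := by
  induction D, D.toFinite using Set.Finite.induction_on generalizing v with
  | empty => simpa using hg v
  | @insert e D _ _ ih =>
    have ih := ih fun e he => hD e (Set.mem_insert_of_mem _ he)
    have he := hD e (Set.mem_insert _ _)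
    have hsplit : F.deleteEdges (insert e D) = (F.deleteEdges D).deleteEdges {e} := by
      rw [SimpleGraph.deleteEdges_deleteEdges, Set.union_singleton]
    induction e using Sym2.ind with
    | _ x y =>
    by_cases hxy : (F.deleteEdges D).Adj x y
    swap
    · have : (F.deleteEdges D).deleteEdges {s(x, y)} = F.deleteEdges D := by
        rw [SimpleGraph.deleteEdges_eq_self]
        simpa using hxy
      rw [hsplit, this]
      exact ih v
    have hsup := deleteEdges_sup_edge hxy
    rw [← hsplit] at hsup
    set G := F.deleteEdges (insert s(x, y) D) with hG
    have hGle : G ≤ F.deleteEdges {s(x, y)} :=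
      SimpleGraph.deleteEdges_anti (by simp)
    have hbr := not_reachable_deleteEdges hF (SimpleGraph.deleteEdges_le _ hxy)
    -- components that contain neither `x` nor `y` are the same with and without the edge `x y`
    have hfar : ∀ t, ¬ G.Reachable t x → ¬ G.Reachable t y → g ∣ compSize G t := by
      intro t h1 h2
      rw [compSize_congr (reachable_iff_of_sup_edge h1 h2), hsup]
      exact ih t
    -- the component of `x` after removing only `x y` is the disjoint union of the new component of
    -- `x` and of components that avoid `x` and `y`
    have hx : g ∣ compSize G x := by
      refine dvd_compSize_of_le hGle (fun t ht ht' => hfar t ht' fun h => hbr ?_) (he x)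
      exact ht.symm.trans (h.mono hGle)
    have hy : g ∣ compSize G y := by
      refine dvd_compSize_of_le hGle (fun t ht ht' => hfar t (fun h => hbr ?_) ht') (he y)
      exact (h.mono hGle).symm.trans ht
    by_cases h1 : G.Reachable v x
    · rw [compSize_eq_of_reachable h1]
      exact hx
    by_cases h2 : G.Reachable v y
    · rw [compSize_eq_of_reachable h2]
      exact hy
    exact hfar v h1 h2

theorem dvd_compSize_gwPrune [Finite V] {g : ℕ} {F : SimpleGraph V} (hF : F.IsAcyclic)
    (hg : ∀ v, g ∣ compSize F v) (v : V) : g ∣ compSize (gwPrune g F) v := by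
  rw [gwPrune_eq]
  exact dvd_compSize_deleteEdges hF hg _ (fun _ he => he) v

/-- An inactive component of an intermediate forest is never a leaf of the pruned forest: a single
remaining edge at it would split the final forest into parts of sizes divisible by `g`, and
would have been pruned. -/
theorem exists_ne_adj_gwPrune [Finite V] {g : ℕ} {F₀ F : SimpleGraph V} (hle : F₀ ≤ F)
    (hF : F.IsAcyclic) (hg : ∀ v, g ∣ compSize F v) {x y : V} (hx : g ∣ compSize F₀ x)
    (hy : ¬ F₀.Reachable y x) (hxy : (gwPrune g F).Adj x y) :
    ∃ a b, (a, b) ≠ (x, y) ∧ F₀.Reachable a x ∧ ¬ F₀.Reachable b x ∧ (gwPrune g F).Adj a b := by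
  by_contra! hc
  have hFxy : F.Adj x y := gwPrune_le g F hxy
  -- the edges of `F` that leave the component of `x` in `F₀`, except for `x y`; all are pruned
  let D : Set (Sym2 V) := {e | ∃ a b, e = s(a, b) ∧ F.Adj a b ∧ (a, b) ≠ (x, y) ∧
    F₀.Reachable a x ∧ ¬ F₀.Reachable b x}
  have hDnot : ∀ e ∈ D, ∀ v, g ∣ compSize (F.deleteEdges {e}) v := by
    rintro e ⟨a, b, rfl, hab, hne, ha, hb⟩
    have := hc a b hne ha hb
    rw [gwPrune_eq, SimpleGraph.deleteEdges_adj, not_and, not_not] at this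
    exact this hab
  have h1 := dvd_compSize_deleteEdges hF hg D hDnot
  have hxyD : (F.deleteEdges D).Adj x y := by
    rw [SimpleGraph.deleteEdges_adj]
    refine ⟨hFxy, ?_⟩
    rintro ⟨a, b, hab, -, hne, ha, hb⟩
    rw [Sym2.eq_iff] at hab
    rcases hab with ⟨rfl, rfl⟩ | ⟨rfl, rfl⟩
    · exact hne rfl
    · exact hb (SimpleGraph.Reachable.refl _)
  have hsup := deleteEdges_sup_edge hxyD
  have hsplit : (F.deleteEdges D).deleteEdges {s(x, y)} = F.deleteEdges (insert s(x, y) D) := by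
    rw [SimpleGraph.deleteEdges_deleteEdges, Set.union_singleton]
  rw [hsplit] at hsup
  set G := F.deleteEdges (insert s(x, y) D) with hG
  -- without `D` and `x y`, the component of `x` in `F₀` is a component
  have hGadj : ∀ a b, G.Adj a b → F₀.Reachable a x → F₀.Reachable b x := by
    intro a b hab ha
    by_contra hb
    rw [hG, SimpleGraph.deleteEdges_adj] at hab
    refine hab.2 ?_
    by_cases hne : (a, b) = (x, y)
    · rw [Prod.mk.injEq] at hne
      rw [hne.1, hne.2]
      exact Set.mem_insert _ _
    · exact Set.mem_insert_of_mem _ ⟨a, b, rfl, hab.1, hne, ha, hb⟩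
  have hGS : ∀ u, G.Reachable u x ↔ F₀.Reachable u x := by
    intro u
    constructor
    · intro h
      obtain ⟨p⟩ := h.symm
      have : ∀ {a b : V} (p : G.Walk a b), F₀.Reachable a x → F₀.Reachable b x := by
        intro a b p
        induction p with
        | nil => exact id
        | cons h p ih => exact fun ha => ih (hGadj _ _ h ha)
      exact this p (SimpleGraph.Reachable.refl _)
    · have : ∀ {a b : V} (p : F₀.Walk a b), F₀.Reachable a x → G.Reachable a b := by
        intro a b p
        induction p with
        | nil => exact fun _ => SimpleGraph.Reachable.refl _
        | @cons a b c h p ih =>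
          intro ha
          have hb : F₀.Reachable b x := h.symm.reachable.trans ha
          refine SimpleGraph.Reachable.trans (SimpleGraph.Adj.reachable ?_) (ih hb)
          rw [hG, SimpleGraph.deleteEdges_adj]
          refine ⟨hle h, ?_⟩
          rintro (he | ⟨c, d, he, -, -, hc, hd⟩)
          · rw [Sym2.eq_iff] at he
            rcases he with ⟨rfl, rfl⟩ | ⟨rfl, rfl⟩
            · exact hy hb
            · exact hy ha
          · rw [Sym2.eq_iff] at he
            rcases he with ⟨rfl, rfl⟩ | ⟨rfl, rfl⟩
            · exact hd hb
            · exact hd ha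
      rintro ⟨p⟩
      exact this p ⟨p⟩
  have hGx : g ∣ compSize G x := by rwa [compSize_congr hGS]
  have hfar : ∀ t, ¬ G.Reachable t x → ¬ G.Reachable t y → g ∣ compSize G t := by
    intro t h1' h2'
    rw [compSize_congr (reachable_iff_of_sup_edge h1' h2'), hsup]
    exact h1 t
  have hGy : g ∣ compSize G y := by
    refine dvd_compSize_of_le (G' := F.deleteEdges D)
      (SimpleGraph.deleteEdges_anti (Set.subset_insert _ _)) (fun t ht ht' => ?_) (h1 y)
    by_cases htx : G.Reachable t x
    · rw [compSize_eq_of_reachable htx]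
      exact hGx
    · exact hfar t htx ht'
  have hall : ∀ t, g ∣ compSize G t := by
    intro t
    by_cases htx : G.Reachable t x
    · rw [compSize_eq_of_reachable htx]
      exact hGx
    by_cases hty : G.Reachable t y
    · rw [compSize_eq_of_reachable hty]
      exact hGy
    exact hfar t htx hty
  have hxy2 := hxy
  rw [gwPrune_eq, SimpleGraph.deleteEdges_adj] at hxy2
  -- removing `x y` alone leaves unions of components of `G`, so that `x y` would have been pruned
  refine hxy2.2 fun v => mem_multiples.1 ?_
  exact compSize_mem_of_le _ (G := G) (SimpleGraph.deleteEdges_anti (by simp))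
    fun t _ => mem_multiples.2 (hall t)

end Graph

end LCC

/-! ### The primal-dual analysis -/

namespace LCC

/-- The indicator of a proposition. -/
noncomputable def ind (p : Prop) : ℕ := open Classical in if p then 1 else 0

theorem ind_of {p : Prop} (h : p) : ind p = 1 := if_pos h

theorem ind_of_not {p : Prop} (h : ¬ p) : ind p = 0 := if_neg h

theorem sum_ind {α : Type*} [Fintype α] (p : α → Prop) : ∑ x, ind (p x) = {x | p x}.ncard := by
  classical
  have h : ∀ x, ind (p x) = if p x then 1 else 0 := fun x => by unfold ind; congr
  simp only [h]
  rw [← Finset.card_filter, Set.ncard_eq_toFinset_card']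
  congr 1
  ext x
  simp

section Graph

variable {V : Type*} [Fintype V]

/-- The weight of `H` summed over ordered pairs, that is, twice the weight of its edges. -/
noncomputable def graphWeight (w : V → V → ℕ) (H : SimpleGraph V) : ℕ :=
  ∑ u, ∑ v, ind (H.Adj u v) * w u v

/-- `f(c)` for a component `c`. -/
noncomputable def componentF (g : ℕ) {F : SimpleGraph V} (c : F.ConnectedComponent) : ℕ :=
  open Classical in if g ∣ c.supp.ncard then 0 else 1

/-- The number of edges of `H` that leave the component `c` of `F`. -/
noncomputable def outDegree {F : SimpleGraph V} (H : SimpleGraph V) (c : F.ConnectedComponent) :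
    ℕ :=
  ∑ u, ∑ v, ind (F.connectedComponentMk u = c ∧ F.connectedComponentMk v ≠ c ∧ H.Adj u v)

open Classical in
theorem sum_compF_mul {g : ℕ} {F : SimpleGraph V} (h : V → F.ConnectedComponent → ℕ) :
    ∑ v, compF g F v * h v (F.connectedComponentMk v) =
      ∑ c : F.ConnectedComponent, componentF g c *
        ∑ v, ind (F.connectedComponentMk v = c) * h v c := by
  simp only [Finset.mul_sum]
  rw [Finset.sum_comm]
  refine Finset.sum_congr rfl fun v _ => ?_
  rw [Finset.sum_eq_single (F.connectedComponentMk v)]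
  · rw [ind_of rfl, one_mul]
    rfl
  · intro c _ hc
    rw [ind_of_not hc.symm, zero_mul, mul_zero]
  · simp

open Classical in
/-- The handshake lemma for the forest obtained by contracting the components of `F₀`: each isolated
vertex is a tree of its own, and each tree has one edge less than vertices. -/
theorem sum_outDegree_le {F₀ H : SimpleGraph V} (hle : (F₀ ⊔ H).IsAcyclic) :
    ∑ c : F₀.ConnectedComponent, outDegree H c +
      2 * ∑ c : F₀.ConnectedComponent, ind (outDegree H c = 0) ≤
      2 * Fintype.card F₀.ConnectedComponent := by
  have h1 := ncard_adj_add_card_component_le (G₀ := F₀) le_sup_left hle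
  rw [Nat.card_eq_fintype_card (α := F₀.ConnectedComponent)] at h1
  -- an edge of `H` between two components is not an edge of `F₀`; both orientations are counted
  have h2 : ∑ c : F₀.ConnectedComponent, outDegree H c ≤
      {e : V × V | (F₀ ⊔ H).Adj e.1 e.2 ∧ ¬ F₀.Adj e.1 e.2}.ncard := by
    have : ∑ c : F₀.ConnectedComponent, outDegree H c =
        ∑ e : V × V, ind (F₀.connectedComponentMk e.2 ≠ F₀.connectedComponentMk e.1 ∧
          H.Adj e.1 e.2) := by
      simp only [outDegree]
      rw [Finset.sum_comm, Fintype.sum_prod_type]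
      refine Finset.sum_congr rfl fun u _ => ?_
      rw [Finset.sum_comm]
      refine Finset.sum_congr rfl fun v _ => ?_
      rw [Finset.sum_eq_single (F₀.connectedComponentMk u)]
      · simp
      · intro c _ hc
        exact ind_of_not fun h => hc h.1.symm
      · simp
    rw [this, sum_ind]
    refine Set.ncard_le_ncard (fun e he => ?_) (Set.toFinite _)
    exact ⟨Or.inr he.2, fun h => he.1 (SimpleGraph.ConnectedComponent.sound h.reachable.symm)⟩
  -- a component of `F₀` that no edge of `H` leaves is a component of `F₀ ⊔ H`
  have h3 : ∑ c : F₀.ConnectedComponent, ind (outDegree H c = 0) ≤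
      Nat.card (F₀ ⊔ H).ConnectedComponent := by
    rw [sum_ind, ← Set.ncard_univ]
    refine Set.ncard_le_ncard_of_injOn
      (SimpleGraph.ConnectedComponent.map (SimpleGraph.Hom.ofLE le_sup_left)) (by simp) ?_
      (Set.toFinite _)
    intro c hc c' _ hcc
    rw [Set.mem_ofPred_eq] at hc
    induction c using SimpleGraph.ConnectedComponent.ind with
    | _ u =>
    induction c' using SimpleGraph.ConnectedComponent.ind with
    | _ v =>
    have hno : ∀ a b, F₀.Reachable a u → H.Adj a b → F₀.Reachable b u := by
      intro a b ha hab
      by_contra hb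
      simp only [outDegree, Finset.sum_eq_zero_iff, Finset.mem_univ, true_implies] at hc
      have := hc a b
      rw [ind_of] at this
      · exact one_ne_zero this
      · exact ⟨SimpleGraph.ConnectedComponent.sound ha,
          fun h => hb (SimpleGraph.ConnectedComponent.exact h), hab⟩
    have hwalk : ∀ {a b : V} (p : (F₀ ⊔ H).Walk a b), F₀.Reachable a u → F₀.Reachable b u := by
      intro a b p
      induction p with
      | nil => exact id
      | cons h p ih =>
        intro ha
        rcases h with h | h
        · exact ih (h.symm.reachable.trans ha)
        · exact ih (hno _ _ ha h)
    obtain ⟨p⟩ : (F₀ ⊔ H).Reachable u v := SimpleGraph.ConnectedComponent.exact hcc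
    exact SimpleGraph.ConnectedComponent.sound (hwalk p (SimpleGraph.Reachable.refl _)).symm
  omega

/-- The average degree of the active vertices in the forest obtained from the pruned forest by
contracting the components of an intermediate forest is at most two: inactive vertices of
positive degree have degree at least two. -/
theorem sum_active_gwPrune_le {g : ℕ} {F₀ F : SimpleGraph V} (hle : F₀ ≤ F) (hF : F.IsAcyclic)
    (hg : ∀ v, g ∣ compSize F v) :
    open Classical in
    ∑ u, ∑ v, ind ((gwPrune g F).Adj u v) * (ind (¬ F₀.Reachable u v) *
      (compF g F₀ u + compF g F₀ v)) ≤ 4 * ∑ c : F₀.ConnectedComponent, componentF g c := by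
  classical
  set H := gwPrune g F with hH
  have hsym : ∑ u, ∑ v, ind (H.Adj u v) * (ind (¬ F₀.Reachable u v) *
      (compF g F₀ u + compF g F₀ v)) =
      2 * ∑ u, compF g F₀ u * ∑ v, ind (¬ F₀.Reachable u v) * ind (H.Adj u v) := by
    have h1 : ∑ u, ∑ v, ind (H.Adj u v) * (ind (¬ F₀.Reachable u v) *
      (compF g F₀ u + compF g F₀ v)) =
      (∑ u, ∑ v, ind (H.Adj u v) * (ind (¬ F₀.Reachable u v) * compF g F₀ u)) +
      ∑ u, ∑ v, ind (H.Adj u v) * (ind (¬ F₀.Reachable u v) * compF g F₀ v) := by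
      rw [← Finset.sum_add_distrib]
      refine Finset.sum_congr rfl fun u _ => ?_
      rw [← Finset.sum_add_distrib]
      exact Finset.sum_congr rfl fun v _ => by ring
    rw [h1]
    conv_lhs => rw [add_comm, Finset.sum_comm]
    rw [two_mul]
    congr 1
    · refine Finset.sum_congr rfl fun u _ => ?_
      rw [Finset.mul_sum]
      refine Finset.sum_congr rfl fun v _ => ?_
      rw [H.adj_comm, SimpleGraph.reachable_comm]
      ring
    · refine Finset.sum_congr rfl fun u _ => ?_
      rw [Finset.mul_sum]
      exact Finset.sum_congr rfl fun v _ => by ring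
  have hdeg : ∑ u, compF g F₀ u * ∑ v, ind (¬ F₀.Reachable u v) * ind (H.Adj u v) =
      ∑ c : F₀.ConnectedComponent, componentF g c * outDegree H c := by
    have h1 := sum_compF_mul (g := g) (F := F₀)
      fun u c => ∑ v, ind (F₀.connectedComponentMk v ≠ c) * ind (H.Adj u v)
    have h2 : ∀ u v, (¬ F₀.Reachable u v) =
        (F₀.connectedComponentMk v ≠ F₀.connectedComponentMk u) := by
      intro u v
      rw [Ne, SimpleGraph.ConnectedComponent.eq, SimpleGraph.reachable_comm]
    simp only [h2]
    rw [h1]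
    refine Finset.sum_congr rfl fun c _ => ?_
    congr 1
    refine Finset.sum_congr rfl fun u _ => ?_
    rw [Finset.mul_sum]
    refine Finset.sum_congr rfl fun v _ => ?_
    by_cases p : F₀.connectedComponentMk u = c <;>
      by_cases q : F₀.connectedComponentMk v = c <;> by_cases r : H.Adj u v <;>
      simp [ind, p, q, r]
  -- inactive components are isolated or have degree at least two
  have hleaf : ∀ c : F₀.ConnectedComponent, componentF g c = 0 →
      2 ≤ outDegree H c + 2 * ind (outDegree H c = 0) := by
    intro c hc
    by_cases h0 : outDegree H c = 0
    · rw [ind_of h0]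
      omega
    · rw [ind_of_not h0]
      induction c using SimpleGraph.ConnectedComponent.ind with
      | _ x₀ =>
      obtain ⟨x, -, hx⟩ := Finset.exists_ne_zero_of_sum_ne_zero h0
      obtain ⟨y, -, hy⟩ := Finset.exists_ne_zero_of_sum_ne_zero hx
      obtain ⟨h1, h2, h3⟩ : F₀.connectedComponentMk x = F₀.connectedComponentMk x₀ ∧
        F₀.connectedComponentMk y ≠ F₀.connectedComponentMk x₀ ∧ H.Adj x y := by
        by_contra hne
        exact hy (ind_of_not hne)
      have hgx : g ∣ compSize F₀ x := by
        rw [← compF_eq_zero]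
        rw [← h1] at hc
        exact hc
      obtain ⟨a, b, hne, ha, hb, hab⟩ := exists_ne_adj_gwPrune hle hF hg hgx
        (fun h => h2 (by rw [← h1]; exact SimpleGraph.ConnectedComponent.sound h)) h3
      have hP : ∀ e ∈ ({(a, b), (x, y)} : Finset (V × V)),
          ind (F₀.connectedComponentMk e.1 = F₀.connectedComponentMk x₀ ∧
            F₀.connectedComponentMk e.2 ≠ F₀.connectedComponentMk x₀ ∧ H.Adj e.1 e.2) = 1 := by
        intro e he
        rw [Finset.mem_insert, Finset.mem_singleton] at he
        rcases he with rfl | rfl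
        · refine ind_of ⟨?_, ?_, hab⟩
          · rw [← h1]
            exact SimpleGraph.ConnectedComponent.sound ha
          · rw [← h1]
            exact fun h => hb (SimpleGraph.ConnectedComponent.exact h)
        · exact ind_of ⟨h1, h2, h3⟩
      have h4 := Finset.sum_le_sum_of_subset (f := fun e : V × V =>
        ind (F₀.connectedComponentMk e.1 = F₀.connectedComponentMk x₀ ∧
            F₀.connectedComponentMk e.2 ≠ F₀.connectedComponentMk x₀ ∧ H.Adj e.1 e.2))
        (Finset.subset_univ {(a, b), (x, y)})
      rw [Finset.sum_congr rfl hP, Fintype.sum_prod_type, Finset.sum_const,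
        Finset.card_pair hne] at h4
      simpa [outDegree] using h4
  have htot := sum_outDegree_le (F₀ := F₀) (H := H)
    (hF.anti (sup_le hle (gwPrune_le g F)))
  -- sum over all components of `2 ≤ deg + 2 · [deg = 0]` if inactive, and of `2 + deg ≤ deg + 2` if
  -- active
  have hsum : ∑ c : F₀.ConnectedComponent, (2 + componentF g c * outDegree H c) ≤
      ∑ c : F₀.ConnectedComponent, (outDegree H c + 2 * ind (outDegree H c = 0) +
        2 * componentF g c) := by
    refine Finset.sum_le_sum fun c _ => ?_
    rcases Nat.eq_zero_or_pos (componentF g c) with h | h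
    · have := hleaf c h
      rw [h]
      omega
    · have : componentF g c = 1 := by
        refine le_antisymm ?_ h
        unfold componentF
        split_ifs <;> simp
      rw [this]
      omega
  simp only [Finset.sum_add_distrib, Finset.sum_const, ← Finset.mul_sum, Finset.card_univ,
    smul_eq_mul] at hsum
  rw [hsym, hdeg]
  omega

/-- Every active component is both left and entered by the cycles of `σ`. -/
theorem two_mul_sum_active_le {g : ℕ} {F₀ : SimpleGraph V} (σ : Equiv.Perm V)
    (hσ : ∀ S : Set V, ¬ g ∣ S.ncard → (∃ v ∈ S, σ v ∉ S) ∧ ∃ v, v ∉ S ∧ σ v ∈ S) :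
    open Classical in
    2 * ∑ c : F₀.ConnectedComponent, componentF g c ≤
      ∑ v, ind (¬ F₀.Reachable v (σ v)) * (compF g F₀ v + compF g F₀ (σ v)) := by
  classical
  have key : ∀ τ : Equiv.Perm V, (∀ S : Set V, ¬ g ∣ S.ncard → ∃ v ∈ S, τ v ∉ S) →
      ∑ c : F₀.ConnectedComponent, componentF g c ≤
        ∑ v, compF g F₀ v * ind (¬ F₀.Reachable v (τ v)) := by
    intro τ hτ
    have h1 := sum_compF_mul (g := g) (F := F₀)
      fun u c => ind (F₀.connectedComponentMk (τ u) ≠ c)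
    have h2 : ∀ u, (¬ F₀.Reachable u (τ u)) =
        (F₀.connectedComponentMk (τ u) ≠ F₀.connectedComponentMk u) := by
      intro u
      rw [Ne, SimpleGraph.ConnectedComponent.eq, SimpleGraph.reachable_comm]
    simp only [h2]
    rw [h1]
    refine Finset.sum_le_sum fun c _ => ?_
    unfold componentF
    split_ifs with hc
    · simp
    · obtain ⟨v, hv, hv'⟩ := hτ c.supp hc
      rw [one_mul]
      refine le_trans ?_ (Finset.single_le_sum (fun _ _ => Nat.zero_le _) (Finset.mem_univ v))
      rw [SimpleGraph.ConnectedComponent.mem_supp_iff] at hv hv'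
      rw [ind_of hv, ind_of hv']
  have h1 := key σ fun S hS => (hσ S hS).1
  -- edges of `σ` that enter a set leave it in the inverse permutation
  have h2 := key σ.symm fun S hS => by
    obtain ⟨v, hv, hv'⟩ := (hσ S hS).2
    exact ⟨σ v, hv', by simpa using hv⟩
  rw [← Equiv.sum_comp σ] at h2
  simp only [Equiv.symm_apply_apply] at h2
  have h3 : ∑ v, ind (¬ F₀.Reachable v (σ v)) * (compF g F₀ v + compF g F₀ (σ v)) =
      ∑ v, compF g F₀ v * ind (¬ F₀.Reachable v (σ v)) +
      ∑ v, compF g F₀ (σ v) * ind (¬ F₀.Reachable (σ v) v) := by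
    rw [← Finset.sum_add_distrib]
    refine Finset.sum_congr rfl fun v _ => ?_
    rw [F₀.reachable_comm (u := σ v)]
    ring
  omega

omit [Fintype V] in
theorem GWStep.isAcyclic {g : ℕ} {w : V → V → ℕ} {s : SimpleGraph V × (V → ℚ)}
    (h : Relation.ReflTransGen (GWStep g w) (⊥, fun _ => 0) s) : s.1.IsAcyclic := by
  induction h with
  | refl => exact SimpleGraph.isAcyclic_bot
  | tail _ h ih =>
    obtain ⟨i, j, hij, -, hF, -⟩ := h
    rw [hF]
    exact ih.sup_edge_of_not_reachable hij.1

omit [Fintype V] in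
theorem GWStep.le {g : ℕ} {w : V → V → ℕ} {s s' : SimpleGraph V × (V → ℚ)}
    (h : Relation.ReflTransGen (GWStep g w) s s') : s.1 ≤ s'.1 := by
  induction h with
  | refl => exact le_rfl
  | tail _ h ih =>
    obtain ⟨i, j, -, -, hF, -⟩ := h
    rw [hF]
    exact ih.trans le_sup_left

/-- The algorithm of Goemans and Williamson as a primal-dual method. For every pair `u`, `v`, let
`c u v` be the total growth of the active components that separate `u` from `v`. It never exceeds
`w u v`, it equals `w u v` for the chosen edges, and in each iteration it grows at most half as
much on the pruned forest as on a system of cycles that leaves and enters every active set. -/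
theorem GoeWill.graphWeight_le {g : ℕ} {w : V → V → ℕ} (hw : ∀ u v, w u v = w v u)
    {H : SimpleGraph V} (hH : GoeWill g w H) (σ : Equiv.Perm V) (hσ' : ∀ v, σ v ≠ v)
    (hσ : ∀ S : Set V, ¬ g ∣ S.ncard → (∃ v ∈ S, σ v ∉ S) ∧ ∃ v, v ∉ S ∧ σ v ∈ S) :
    graphWeight w H ≤ 2 * ∑ v, w v (σ v) := by
  classical
  obtain ⟨t, ht, hg, rfl⟩ := hH
  have hac := GWStep.isAcyclic ht
  have hg' : ∀ v, g ∣ compSize t.1 v := fun v => compF_eq_zero.1 (hg v)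
  set H := gwPrune g t.1 with hH
  have inv : ∀ s, Relation.ReflTransGen (GWStep g w) (⊥, fun _ => 0) s →
      Relation.ReflTransGen (GWStep g w) s t → ∃ c : V → V → ℚ,
        (∀ u v, ¬ s.1.Reachable u v → c u v = s.2 u + s.2 v) ∧
        (∀ u v, u ≠ v → c u v ≤ w u v) ∧ (∀ u v, s.1.Adj u v → c u v = w u v) ∧
        ∑ u, ∑ v, (ind (H.Adj u v) : ℚ) * c u v ≤ 2 * ∑ v, c v (σ v) := by
    intro s hs
    induction hs with
    | refl =>
      intro _
      exact ⟨fun _ _ => 0, by simp, by simp, by simp, by simp⟩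
    | @tail s s' hs hstep ih =>
      intro hst
      obtain ⟨c, h1, h2, h3, h4⟩ := ih (Relation.ReflTransGen.head hstep hst)
      have hlet : s.1 ≤ t.1 := GWStep.le (Relation.ReflTransGen.head hstep hst)
      obtain ⟨i, j, hij, hmin, hF, hd⟩ := hstep
      set ε := gwEps g w s.1 s.2 i j with hε
      have hne : ∀ u v, GWCandidate g s.1 u v → u ≠ v := fun u v h h' =>
        h.1 (h' ▸ SimpleGraph.Reachable.refl _)
      have hpos : ∀ u v, GWCandidate g s.1 u v → (0 : ℚ) < compF g s.1 u + compF g s.1 v :=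
        fun u v h => by exact_mod_cast h.2
      -- the reduced weight of a candidate is nonnegative since `c` has not exceeded `w`
      have hε0 : 0 ≤ ε := by
        refine div_nonneg ?_ (hpos i j hij).le
        have := h2 i j (hne i j hij)
        rw [h1 i j hij.1] at this
        linarith
      have hle : s.1 ≤ s'.1 := by rw [hF]; exact le_sup_left
      have hεij : ε * (compF g s.1 i + compF g s.1 j) = w i j - s.2 i - s.2 j :=
        div_mul_cancel₀ _ (hpos i j hij).ne'
      -- `c u v` grows by `ε` for each end of the pair whose component is active, if the components
      -- differ
      refine ⟨fun u v => c u v + ε * (ind (¬ s.1.Reachable u v) *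
        (compF g s.1 u + compF g s.1 v) : ℕ), ?_, ?_, ?_, ?_⟩
      · intro u v huv
        have huv' : ¬ s.1.Reachable u v := fun h => huv (h.mono hle)
        beta_reduce
        rw [h1 u v huv', hd, ind_of huv']
        push_cast
        ring
      · intro u v huv
        beta_reduce
        by_cases hr : s.1.Reachable u v
        · rw [ind_of_not (not_not.2 hr)]
          simpa using h2 u v huv
        · rw [ind_of hr]
          by_cases hc : 0 < compF g s.1 u + compF g s.1 v
          · have hcand : GWCandidate g s.1 u v := ⟨hr, hc⟩
            have := hmin u v hcand
            rw [gwEps, le_div_iff₀ (hpos u v hcand)] at this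
            rw [h1 u v hr]
            push_cast
            linarith
          · have : compF g s.1 u + compF g s.1 v = 0 := by omega
            rw [this]
            simpa using h2 u v huv
      · intro u v huv
        beta_reduce
        rw [hF, SimpleGraph.sup_adj, SimpleGraph.edge_adj] at huv
        rcases huv with huv | ⟨h, -⟩
        · rw [ind_of_not (not_not.2 huv.reachable), h3 u v huv]
          simp
        · have hr : ¬ s.1.Reachable u v := by
            rcases h with ⟨rfl, rfl⟩ | ⟨rfl, rfl⟩
            · exact hij.1
            · exact fun h => hij.1 h.symm
          rw [ind_of hr, h1 u v hr]
          push_cast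
          rcases h with ⟨rfl, rfl⟩ | ⟨rfl, rfl⟩
          · linarith
          · rw [hw]
            linarith
      · -- contracted, the pruned forest has average active degree at most two; the cycles leave and
        -- enter every active component
        have hA := sum_active_gwPrune_le (g := g) hlet hac hg'
        have hB := two_mul_sum_active_le (F₀ := s.1) σ hσ
        have hAB : ∑ u, ∑ v, ind (H.Adj u v) * (ind (¬ s.1.Reachable u v) *
            (compF g s.1 u + compF g s.1 v)) ≤ 2 * ∑ v, ind (¬ s.1.Reachable v (σ v)) *
              (compF g s.1 v + compF g s.1 (σ v)) := by
          refine hA.trans ?_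
          have : ∀ a b : ℕ, 2 * a ≤ b → 4 * a ≤ 2 * b := by omega
          exact this _ _ (by convert hB)
        have hAB' : (∑ u, ∑ v, (ind (H.Adj u v) : ℚ) * ((ind (¬ s.1.Reachable u v) *
            (compF g s.1 u + compF g s.1 v) : ℕ) : ℚ)) ≤
            2 * ∑ v, ((ind (¬ s.1.Reachable v (σ v)) *
              (compF g s.1 v + compF g s.1 (σ v)) : ℕ) : ℚ) := by
          exact_mod_cast hAB
        have hL : ∑ u, ∑ v, (ind (H.Adj u v) : ℚ) * (c u v + ε *
            ((ind (¬ s.1.Reachable u v) * (compF g s.1 u + compF g s.1 v) : ℕ) : ℚ)) =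
            ∑ u, ∑ v, (ind (H.Adj u v) : ℚ) * c u v +
            ε * ∑ u, ∑ v, (ind (H.Adj u v) : ℚ) * ((ind (¬ s.1.Reachable u v) *
            (compF g s.1 u + compF g s.1 v) : ℕ) : ℚ) := by
          simp only [Finset.mul_sum, ← Finset.sum_add_distrib]
          refine Finset.sum_congr rfl fun u _ => Finset.sum_congr rfl fun v _ => ?_
          ring
        rw [hL, Finset.sum_add_distrib, ← Finset.mul_sum]
        have := mul_le_mul_of_nonneg_left hAB' hε0
        linarith
  obtain ⟨c, -, h2, h3, h4⟩ := inv t ht .refl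
  have h5 : ((graphWeight w H : ℕ) : ℚ) ≤ 2 * ∑ v, (w v (σ v) : ℚ) := by
    have e1 : ((graphWeight w H : ℕ) : ℚ) = ∑ u, ∑ v, (ind (H.Adj u v) : ℚ) * c u v := by
      simp only [graphWeight]
      push_cast
      refine Finset.sum_congr rfl fun u _ => Finset.sum_congr rfl fun v _ => ?_
      by_cases h : H.Adj u v
      · rw [h3 u v (gwPrune_le g t.1 h)]
      · rw [ind_of_not h]
        simp
    rw [e1]
    refine h4.trans (mul_le_mul_of_nonneg_left ?_ (by norm_num))
    exact Finset.sum_le_sum fun v _ => h2 _ _ (hσ' v).symm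
  exact_mod_cast h5

end Graph

end LCC

/-! ### The phases -/

namespace LCC

section Graph

variable {V : Type*} [Fintype V]

omit [Fintype V] in
theorem illegal_mk {L : Set ℕ} {H : SimpleGraph V} {v : V} :
    Illegal L (H.connectedComponentMk v) ↔ compSize H v ∉ close L := Iff.rfl

theorem compSize_le_of_disjoint {H H' : SimpleGraph V} (hle : H ≤ H') {u v x : V}
    (hu : H'.Reachable u x) (hv : H'.Reachable v x) (huv : ¬ H.Reachable v u) :
    compSize H u + compSize H v ≤ compSize H' x := by
  simp only [compSize_eq_ncard]
  rw [← Set.ncard_union_eq _ (Set.toFinite _) (Set.toFinite _)]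
  · refine Set.ncard_le_ncard ?_ (Set.toFinite _)
    rintro y (hy | hy)
    · exact (SimpleGraph.Reachable.mono hle hy).trans hu
    · exact (SimpleGraph.Reachable.mono hle hy).trans hv
  · rw [Set.disjoint_left]
    intro y hy hy'
    exact huv ((SimpleGraph.Reachable.symm hy').trans hy)

omit [Fintype V] in
theorem Phase.le {L : Set ℕ} {w : V → V → ℕ} {H H' : SimpleGraph V} (h : Phase L w H H') :
    H ≤ H' := by
  obtain ⟨-, e, -, K, -, h, -⟩ := h
  exact h

/-- Phases preserve that all component sizes are multiples of `g_L`. -/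
theorem Phase.dvd {L : Set ℕ} {w : V → V → ℕ} {H H' : SimpleGraph V} (h : Phase L w H H')
    (hg : ∀ v, gL L ∣ compSize H v) (v : V) : gL L ∣ compSize H' v :=
  mem_multiples.1 (compSize_mem_of_le _ h.le fun u _ => mem_multiples.2 (hg u))

/-- Each phase enlarges the minimum size of an illegal component by at least `g_L`: an illegal
component arises from an illegal one by adding at least one other component. -/
theorem Phase.add_le_compSize {L : Set ℕ} {w : V → V → ℕ} {H H' : SimpleGraph V}
    (h : Phase L w H H') (hg : ∀ v, gL L ∣ compSize H v) {m : ℕ}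
    (hm : ∀ v, compSize H v ∉ close L → m ≤ compSize H v) (v : V)
    (hv : compSize H' v ∉ close L) : m + gL L ≤ compSize H' v := by
  have hle := h.le
  obtain ⟨-, e, he, K, hK, -, -, -, hr⟩ := h
  -- an illegal component contains an illegal part; the edge chosen for that part leads to another
  -- part, whose size is a positive multiple of `g_L`
  obtain ⟨u, huv, hu⟩ : ∃ u, H'.Reachable u v ∧ compSize H u ∉ close L := by
    by_contra! hc
    refine hv (mem_close_iff.2 (compSize_mem_of_le _ hle fun u hu => mem_close_iff.1 (hc u hu)))
  obtain ⟨h1, h2, -⟩ := he _ (illegal_mk.2 hu)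
  set a := (e (H.connectedComponentMk u)).1
  set b := (e (H.connectedComponentMk u)).2
  rw [mem_supp_mk] at h1 h2
  have hab : K.Reachable a b := by
    by_cases hab : a = b
    · rw [hab]
    · refine SimpleGraph.Adj.reachable ?_
      rw [hK]
      refine Or.inr ?_
      rw [SimpleGraph.fromEdgeSet_adj]
      exact ⟨⟨_, illegal_mk.2 hu, rfl⟩, hab⟩
  have hbv : H'.Reachable b v := (hr _ _ hab).symm.trans ((h1.mono hle).trans huv)
  have h3 := compSize_le_of_disjoint hle huv hbv h2
  have h4 := Nat.le_of_dvd (compSize_pos H b) (hg b)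
  have h5 := hm u hu
  omega

theorem gL_pos_of_dvd {L : Set ℕ} {H : SimpleGraph V} (hg : ∀ v, gL L ∣ compSize H v) (v : V) :
    0 < gL L := by
  rcases Nat.eq_zero_or_pos (gL L) with h | h
  · have h1 := hg v
    rw [h, zero_dvd_iff] at h1
    exact absurd h1 (compSize_pos H v).ne'
  · exact h

/-- After more than `p_L` phases there are no illegal components. -/
theorem lt_of_illegal {L : Set ℕ} {H : SimpleGraph V} (hg : ∀ v, gL L ∣ compSize H v) {k : ℕ}
    {v : V} (hv : compSize H v ∉ close L) (hm : (k + 1) * gL L ≤ compSize H v) : k < pL L := by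
  obtain ⟨η, hη⟩ := hg v
  by_contra hc
  refine hv ?_
  rw [hη, mul_comm]
  refine mul_gL_mem_close ?_
  have h0 := gL_pos_of_dvd hg v
  rw [hη, mul_comm] at hm
  have := Nat.le_of_mul_le_mul_left hm h0
  omega

theorem sum_ind_pair (w : V → V → ℕ) (a b : V) :
    ∑ u, ∑ v, ind (u = a ∧ v = b) * w u v = w a b := by
  classical
  rw [Finset.sum_eq_single a, Finset.sum_eq_single b]
  · rw [ind_of ⟨rfl, rfl⟩, one_mul]
  · intro v _ hv
    rw [ind_of_not fun h => hv h.2, zero_mul]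
  · simp
  · intro u _ hu
    refine Finset.sum_eq_zero fun v _ => ?_
    rw [ind_of_not fun h => hu h.1, zero_mul]
  · simp

/-- The lightest edges leaving the illegal components weigh at most as much as the cycle cover,
since the cover leaves and enters every illegal component. -/
theorem Phase.graphWeight_le {L : Set ℕ} {w : V → V → ℕ} (hw : ∀ u v, w u v = w v u)
    {H H' : SimpleGraph V} (h : Phase L w H H') (σ : Equiv.Perm V)
    (hσ : ∀ S : Set V, S.ncard ∉ close L → (∃ v ∈ S, σ v ∉ S) ∧ ∃ v, v ∉ S ∧ σ v ∈ S) :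
    graphWeight w H' ≤ graphWeight w H + 2 * ∑ v, w v (σ v) := by
  classical
  obtain ⟨-, e, he, K, hK, -, hle, -, -⟩ := h
  have h1 : graphWeight w H' ≤ graphWeight w H +
      ∑ c : H.ConnectedComponent, ind (Illegal L c) * (2 * w (e c).1 (e c).2) := by
    have h2 : ∀ u v, ind (H'.Adj u v) ≤ ind (H.Adj u v) +
        ∑ c : H.ConnectedComponent, ind (Illegal L c) *
          (ind (u = (e c).1 ∧ v = (e c).2) + ind (u = (e c).2 ∧ v = (e c).1)) := by
      intro u v
      by_cases h : H'.Adj u v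
      swap
      · rw [ind_of_not h]
        exact Nat.zero_le _
      rw [ind_of h]
      have h' := hle h
      rw [hK, SimpleGraph.sup_adj, SimpleGraph.fromEdgeSet_adj] at h'
      rcases h' with h' | ⟨⟨c, hc, hx⟩, -⟩
      · rw [ind_of h']
        exact Nat.le_add_right _ _
      · refine le_trans ?_ (Nat.le_add_left _ _)
        refine le_trans ?_ (Finset.single_le_sum (fun _ _ => Nat.zero_le _) (Finset.mem_univ c))
        rw [ind_of hc, one_mul]
        rw [Sym2.eq_iff] at hx
        rcases hx with hx | hx
        · rw [ind_of hx]
          exact Nat.le_add_right _ _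
        · rw [ind_of hx]
          exact Nat.le_add_left _ _
    calc graphWeight w H' ≤ ∑ u, ∑ v, (ind (H.Adj u v) +
        ∑ c : H.ConnectedComponent, ind (Illegal L c) *
          (ind (u = (e c).1 ∧ v = (e c).2) + ind (u = (e c).2 ∧ v = (e c).1))) * w u v :=
          Finset.sum_le_sum fun u _ => Finset.sum_le_sum fun v _ =>
            Nat.mul_le_mul_right _ (h2 u v)
      _ = graphWeight w H + ∑ u, ∑ v, ∑ c : H.ConnectedComponent, ind (Illegal L c) *
          (ind (u = (e c).1 ∧ v = (e c).2) * w u v + ind (u = (e c).2 ∧ v = (e c).1) * w u v) := by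
          simp only [graphWeight, ← Finset.sum_add_distrib, add_mul, Finset.sum_mul, mul_assoc]
      _ = _ := by
          congr 1
          refine (Finset.sum_congr rfl fun u _ => Finset.sum_comm).trans
            (Finset.sum_comm.trans ?_)
          refine Finset.sum_congr rfl fun c _ => ?_
          simp only [← Finset.mul_sum, Finset.sum_add_distrib, sum_ind_pair]
          rw [hw (e c).2 (e c).1, two_mul]
  -- an edge of the cover that leaves the component and one that enters it are both at least as
  -- heavy as the chosen edge, which `graphWeight` counts twice
  have h3 : ∀ c : H.ConnectedComponent, ind (Illegal L c) * (2 * w (e c).1 (e c).2) ≤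
      ∑ v, (ind (H.connectedComponentMk v = c) * w v (σ v) +
        ind (H.connectedComponentMk (σ v) = c) * w v (σ v)) := by
    intro c
    by_cases hc : Illegal L c
    swap
    · rw [ind_of_not hc, zero_mul]
      exact Nat.zero_le _
    rw [ind_of hc, one_mul, Finset.sum_add_distrib, two_mul]
    obtain ⟨-, -, hmin⟩ := he c hc
    obtain ⟨⟨a, ha, ha'⟩, b, hb, hb'⟩ := hσ c.supp hc
    refine Nat.add_le_add ?_ ?_
    · refine le_trans ?_ (Finset.single_le_sum (fun _ _ => Nat.zero_le _) (Finset.mem_univ a))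
      rw [ind_of ((SimpleGraph.ConnectedComponent.mem_supp_iff _ _).1 ha), one_mul]
      exact hmin a ha _ ha'
    · refine le_trans ?_ (Finset.single_le_sum (fun _ _ => Nat.zero_le _) (Finset.mem_univ b))
      rw [ind_of ((SimpleGraph.ConnectedComponent.mem_supp_iff _ _).1 hb'), one_mul, hw b]
      exact hmin _ hb' b hb
  -- each edge of the cover is charged by the components of its two ends only
  have h4 : ∀ x : V, ∑ c : H.ConnectedComponent, ind (H.connectedComponentMk x = c) = 1 := by
    intro x
    rw [Finset.sum_eq_single (H.connectedComponentMk x)]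
    · exact ind_of rfl
    · intro c _ hc
      exact ind_of_not hc.symm
    · simp
  refine h1.trans (Nat.add_le_add_left ((Finset.sum_le_sum fun c _ => h3 c).trans ?_) _)
  rw [Finset.sum_comm]
  simp only [Finset.sum_add_distrib, ← Finset.sum_mul, h4]
  simp [two_mul]

/-- The weight of the forest after the last phase. -/
theorem graphWeight_phases_le {L : Set ℕ} {w : V → V → ℕ} (hw : ∀ u v, w u v = w v u)
    {H₀ H : SimpleGraph V} (h : Relation.ReflTransGen (Phase L w) H₀ H)
    (hg : ∀ v, gL L ∣ compSize H₀ v) (σ : Equiv.Perm V)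
    (hσ : ∀ S : Set V, S.ncard ∉ close L → (∃ v ∈ S, σ v ∉ S) ∧ ∃ v, v ∉ S ∧ σ v ∈ S) :
    graphWeight w H ≤ graphWeight w H₀ + pL L * (2 * ∑ v, w v (σ v)) := by
  -- after `k` phases, illegal components have at least `(k + 1) g_L` vertices
  have key : ∃ k ≤ pL L, (∀ v, gL L ∣ compSize H v) ∧
      (∀ v, compSize H v ∉ close L → (k + 1) * gL L ≤ compSize H v) ∧
      graphWeight w H ≤ graphWeight w H₀ + k * (2 * ∑ v, w v (σ v)) := by
    induction h with
    | refl =>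
      refine ⟨0, Nat.zero_le _, hg, fun v _ => ?_, by simp⟩
      rw [zero_add, one_mul]
      exact Nat.le_of_dvd (compSize_pos _ v) (hg v)
    | @tail H H' _ hp ih =>
      obtain ⟨k, -, h1, h2, h3⟩ := ih
      have hk : k < pL L := by
        obtain ⟨⟨c, hc⟩, -⟩ := hp
        induction c using SimpleGraph.ConnectedComponent.ind with
        | _ v => exact lt_of_illegal h1 hc (h2 v hc)
      refine ⟨k + 1, hk, hp.dvd h1, fun v hv => ?_, ?_⟩
      · rw [add_mul (k + 1), one_mul]
        exact hp.add_le_compSize h1 h2 v hv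
      · refine (hp.graphWeight_le hw σ hσ).trans ?_
        rw [add_mul k, one_mul]
        omega
  obtain ⟨k, hk, -, -, h⟩ := key
  exact h.trans (Nat.add_le_add_left (Nat.mul_le_mul_right _ hk) _)

end Graph

/-! ### Weights of paths, cycles and closed walks -/

section Lists

variable {V : Type*}

/-- The weight of the path that visits the entries of a list in this order. -/
def pathWeight (d : V → V → ℕ) : List V → ℕ
  | [] => 0
  | [_] => 0
  | a :: b :: l => d a b + pathWeight d (b :: l)

theorem sum_zip_eq_pathWeight (d : V → V → ℕ) (a b : V) (l : List V) :
    (((a :: l).zip (l ++ [b])).map fun e => d e.1 e.2).sum = pathWeight d (a :: (l ++ [b])) := by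
  induction l generalizing a with
  | nil => simp [pathWeight]
  | cons x l ih =>
    rw [List.cons_append, List.zip_cons_cons, List.map_cons, List.sum_cons, ih]
    rfl

theorem cycleEdges_cons (a : V) (l : List V) :
    cycleEdges (a :: l) = (a :: l).zip (l ++ [a]) := by
  simp [cycleEdges]

theorem cycleWeight_cons (d : V → V → ℕ) (a : V) (l : List V) :
    cycleWeight d (a :: l) = pathWeight d (a :: (l ++ [a])) := by
  rw [cycleWeight, cycleEdges_cons, sum_zip_eq_pathWeight]

theorem cycleEdges_rotate (c : List V) (k : ℕ) :
    cycleEdges (c.rotate k) = (cycleEdges c).rotate k := by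
  unfold cycleEdges
  rw [List.rotate_rotate, add_comm, ← List.rotate_rotate, List.zip_eq_zipWith,
    List.zip_eq_zipWith, List.zipWith_rotate_distrib _ _ _ _ (by simp)]

theorem cycleWeight_rotate (d : V → V → ℕ) (c : List V) (k : ℕ) :
    cycleWeight d (c.rotate k) = cycleWeight d c := by
  unfold cycleWeight
  rw [cycleEdges_rotate, List.map_rotate]
  exact (List.rotate_perm _ _).sum_eq

theorem pathWeight_append_pair (d : V → V → ℕ) (l : List V) (a b : V) :
    pathWeight d (l ++ [a, b]) = pathWeight d (l ++ [a]) + d a b := by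
  induction l with
  | nil => simp [pathWeight]
  | cons x l ih =>
    cases l with
    | nil => simp [pathWeight]
    | cons y l =>
      simp only [List.cons_append, pathWeight] at ih ⊢
      omega

theorem pathWeight_reverse (d : V → V → ℕ) (l : List V) :
    pathWeight d l.reverse = pathWeight (fun u v => d v u) l := by
  induction l with
  | nil => rfl
  | cons a l ih =>
    cases l with
    | nil => rfl
    | cons b l =>
      rw [List.reverse_cons, List.reverse_cons, List.append_assoc, List.singleton_append,
        pathWeight_append_pair, ← List.reverse_cons, ih, pathWeight, add_comm]

theorem cycleWeight_reverse (d : V → V → ℕ) (c : List V) :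
    cycleWeight d c.reverse = cycleWeight (fun u v => d v u) c := by
  cases c with
  | nil => rfl
  | cons a l =>
    have h : (a :: l).reverse.rotate l.length = a :: l.reverse := by
      rw [List.reverse_cons]
      have := List.rotate_append_length_eq l.reverse [a]
      rw [List.length_reverse] at this
      rw [this]
      rfl
    rw [← cycleWeight_rotate d _ l.length, h, cycleWeight_cons, cycleWeight_cons,
      ← pathWeight_reverse]
    simp

theorem cycleWeight_symWeight (w : V → V → ℕ) (c : List V) :
    cycleWeight (symWeight w) c = cycleWeight w c + cycleWeight w c.reverse := by
  rw [cycleWeight_reverse]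
  unfold cycleWeight symWeight
  rw [← List.sum_map_add]

/-- A pseudometric with values in `ℕ`. -/
structure IsMetric (d : V → V → ℕ) : Prop where
  self : ∀ u, d u u = 0
  symm : ∀ u v, d u v = d v u
  triangle : ∀ u v x, d u v ≤ d u x + d x v

variable {d : V → V → ℕ}

theorem IsMetric.pathWeight_cons_le (hd : IsMetric d) (a b : V) (l : List V) :
    pathWeight d (a :: l) ≤ d a b + pathWeight d (b :: l) := by
  cases l with
  | nil => simp [pathWeight]
  | cons c l =>
    have := hd.triangle a c b
    simp only [pathWeight]
    omega

theorem IsMetric.pathWeight_sublist (hd : IsMetric d) {l l' : List V} (h : l.Sublist l') (a : V) :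
    pathWeight d (a :: l) ≤ pathWeight d (a :: l') := by
  induction h generalizing a with
  | slnil => exact le_rfl
  | cons b _ ih => exact (hd.pathWeight_cons_le a b _).trans (Nat.add_le_add_left (ih b) _)
  | cons_cons b _ ih => exact Nat.add_le_add_left (ih b) _

theorem IsMetric.le_pathWeight (hd : IsMetric d) (a b : V) (l : List V) :
    d a b ≤ pathWeight d (a :: (l ++ [b])) := by
  have := hd.pathWeight_sublist (List.sublist_append_right l [b]) a
  simpa [pathWeight] using this

/-- Joining the endpoints of a path at most doubles its weight. -/
theorem IsMetric.cycleWeight_le (hd : IsMetric d) (b : List V) :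
    cycleWeight d b ≤ 2 * pathWeight d b := by
  cases b with
  | nil => simp [cycleWeight, cycleEdges]
  | cons a l =>
    rw [cycleWeight_cons]
    rcases List.eq_nil_or_concat l with rfl | ⟨l, x, rfl⟩
    · simp [pathWeight, hd.self]
    · have h1 := pathWeight_append_pair d (a :: l) x a
      have h2 := hd.le_pathWeight a x l
      rw [hd.symm] at h2
      simp only [List.concat_eq_append, List.cons_append, List.append_assoc,
        List.nil_append] at h1 h2 ⊢
      omega

theorem pathWeight_append_le (d : V → V → ℕ) (l l' : List V) :
    pathWeight d l + pathWeight d l' ≤ pathWeight d (l ++ l') := by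
  induction l with
  | nil => simp [pathWeight]
  | cons a l ih =>
    cases l with
    | nil =>
      cases l' with
      | nil => simp [pathWeight]
      | cons b l' => simp [pathWeight]
    | cons b l =>
      simp only [List.cons_append, pathWeight] at ih ⊢
      omega

theorem sum_pathWeight_le (d : V → V → ℕ) (cs : List (List V)) :
    (cs.map (pathWeight d)).sum ≤ pathWeight d cs.flatten := by
  induction cs with
  | nil => simp
  | cons b cs ih =>
    rw [List.map_cons, List.sum_cons, List.flatten_cons]
    exact (Nat.add_le_add_left ih _).trans (pathWeight_append_le _ _ _)

theorem pathWeight_le_cycleWeight (d : V → V → ℕ) (c : List V) :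
    pathWeight d c ≤ cycleWeight d c := by
  cases c with
  | nil => simp [pathWeight]
  | cons a l =>
    rw [cycleWeight_cons, ← List.cons_append]
    exact (Nat.le_add_right _ _).trans (pathWeight_append_le d (a :: l) [a])

theorem IsMetric.sum_cycleWeight_le (hd : IsMetric d) {cs : List (List V)} {l : List V}
    (h : cs.flatten ~r l) : (cs.map (cycleWeight d)).sum ≤ 2 * cycleWeight d l := by
  obtain ⟨k, rfl⟩ := h
  rw [cycleWeight_rotate]
  refine le_trans ?_ (Nat.mul_le_mul_left 2 (pathWeight_le_cycleWeight d _))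
  refine le_trans ?_ (Nat.mul_le_mul_left 2 (sum_pathWeight_le d _))
  rw [← List.sum_map_mul_left]
  exact List.sum_le_sum fun b _ => hd.cycleWeight_le b

variable [DecidableEq V]

theorem firstVisits_nodup (l : List V) : (firstVisits l).Nodup := by
  unfold firstVisits
  rw [List.nodup_reverse]
  exact List.nodup_dedup _

theorem mem_firstVisits {l : List V} {a : V} : a ∈ firstVisits l ↔ a ∈ l := by
  simp [firstVisits]

theorem firstVisits_sublist (l : List V) : (firstVisits l).Sublist l := by
  have h := (List.dedup_sublist l.reverse).reverse
  rwa [List.reverse_reverse] at h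

theorem firstVisits_append_singleton (l : List V) (x : V) :
    firstVisits (l ++ [x]) = if x ∈ l then firstVisits l else firstVisits l ++ [x] := by
  unfold firstVisits
  rw [List.reverse_append, List.reverse_singleton, List.singleton_append]
  split_ifs with h
  · rw [List.dedup_cons_of_mem (by simpa using h)]
  · rw [List.dedup_cons_of_notMem (by simpa using h), List.reverse_cons]

theorem firstVisits_append (l l' : List V) :
    firstVisits (l ++ l') = firstVisits l ++ (firstVisits l').filter (fun x => decide (x ∉ l)) := by
  induction l' using List.reverseRecOn with
  | nil => simp [firstVisits]
  | append_singleton l' x ih =>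
    rw [← List.append_assoc, firstVisits_append_singleton, firstVisits_append_singleton, ih]
    by_cases h : x ∈ l <;> by_cases h' : x ∈ l' <;> simp [h, h', List.filter_append]

/-- Shortcuts do not increase the weight of a closed walk. -/
theorem IsMetric.cycleWeight_firstVisits_le (hd : IsMetric d) (r : V) (t : List V) :
    cycleWeight d (firstVisits (r :: (t ++ [r]))) ≤ pathWeight d (r :: (t ++ [r])) := by
  rw [← List.cons_append, firstVisits_append_singleton, if_pos (by simp),
    ← List.singleton_append, firstVisits_append]
  have h1 : firstVisits [r] = [r] := by simp [firstVisits]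
  rw [h1, List.singleton_append, cycleWeight_cons]
  refine hd.pathWeight_sublist ?_ r
  exact List.Sublist.append (List.filter_sublist.trans (firstVisits_sublist t)) (List.Sublist.refl _)

theorem IsMetric.cycleWeight_firstVisits_support_le (hd : IsMetric d) {H : SimpleGraph V} {r : V}
    (p : H.Walk r r) : cycleWeight d (firstVisits p.support) ≤ pathWeight d p.support := by
  have h1 := p.cons_tail_support
  cases p with
  | nil => simp [firstVisits, cycleWeight, cycleEdges, hd.self]
  | cons h q =>
    rw [SimpleGraph.Walk.support_cons]
    have h2 : q.support.dropLast ++ [r] = q.support := by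
      have := List.dropLast_append_getLast (SimpleGraph.Walk.support_ne_nil q)
      rwa [SimpleGraph.Walk.getLast_support] at this
    rw [← h2]
    exact hd.cycleWeight_firstVisits_le r _

end Lists

section Walks

variable {V : Type*} {H : SimpleGraph V}

theorem pathWeight_support (d : V → V → ℕ) {u v : V} (p : H.Walk u v) :
    pathWeight d p.support = ((p.darts.map fun x => x.toProd).map fun e => d e.1 e.2).sum := by
  induction p with
  | nil => simp [pathWeight]
  | cons h p ih =>
    rw [SimpleGraph.Walk.support_cons, SimpleGraph.Walk.darts_cons, List.map_cons, List.map_cons,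
      List.sum_cons, ← ih]
    cases p <;> simp [pathWeight]

variable [DecidableEq V]

theorem count_map_sym2 (l : List (V × V)) {u v : V} (huv : u ≠ v) :
    (l.map fun e => s(e.1, e.2)).count s(u, v) = l.count (u, v) + l.count (v, u) := by
  induction l with
  | nil => simp
  | cons e l ih =>
    obtain ⟨a, b⟩ := e
    rw [List.map_cons, List.count_cons, List.count_cons, List.count_cons, ih]
    by_cases h1 : a = u ∧ b = v
    · obtain ⟨rfl, rfl⟩ := h1
      simp [huv, huv.symm]
      omega
    · by_cases h2 : a = v ∧ b = u
      · obtain ⟨rfl, rfl⟩ := h2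
        simp [huv, huv.symm]
        omega
      · have h3 : s(a, b) ≠ s(u, v) := by
          rw [Ne, Sym2.eq_iff]
          tauto
        simp [h1, h2, h3]

theorem count_edges {u v a b : V} (p : H.Walk u v) (hab : a ≠ b) :
    p.edges.count s(a, b) = (p.darts.map fun x => x.toProd).count (a, b) +
      (p.darts.map fun x => x.toProd).count (b, a) := by
  rw [← count_map_sym2 _ hab, List.map_map]
  rfl

theorem sum_map_eq_sum_count {α : Type*} [Fintype α] [BEq α] [LawfulBEq α] (l : List α)
    (f : α → ℕ) : (l.map f).sum = ∑ a, l.count a * f a := by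
  classical
  induction l with
  | nil => simp
  | cons a l ih =>
    rw [List.map_cons, List.sum_cons, ih]
    simp only [List.count_cons, add_mul, Finset.sum_add_distrib]
    rw [add_comm]
    congr 1
    rw [Finset.sum_eq_single a]
    · simp
    · intro b _ hb
      simp [hb.symm]
    · simp

/-- The weight of an Eulerian cycle of a component all of whose edges have been duplicated. -/
theorem pathWeight_support_eq [Fintype V] {d : V → V → ℕ} (hsymm : ∀ u v, d u v = d v u) {r : V}
    (p : H.Walk r r)
    (hp : ∀ u v, H.Adj u v → u ∈ (H.connectedComponentMk r).supp → p.edges.count s(u, v) = 2) :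
    pathWeight d p.support =
      ∑ u, ∑ v, ind (H.connectedComponentMk u = H.connectedComponentMk r ∧ H.Adj u v) * d u v := by
  rw [pathWeight_support, sum_map_eq_sum_count, Fintype.sum_prod_type]
  set l := p.darts.map fun x => x.toProd
  have h1 : ∀ u v, l.count (u, v) + l.count (v, u) =
      2 * ind (H.connectedComponentMk u = H.connectedComponentMk r ∧ H.Adj u v) := by
    intro u v
    by_cases huv : u = v
    · subst huv
      rw [ind_of_not (fun h => h.2.ne rfl), List.count_eq_zero_of_not_mem]
      intro h
      obtain ⟨x, -, hx⟩ := List.mem_map.1 h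
      have := x.adj
      rw [hx] at this
      exact this.ne rfl
    · rw [← count_edges p huv]
      by_cases h : H.connectedComponentMk u = H.connectedComponentMk r ∧ H.Adj u v
      · rw [ind_of h, hp u v h.2 h.1]
      · rw [ind_of_not h, List.count_eq_zero_of_not_mem]
        intro he
        refine h ⟨?_, p.adj_of_mem_edges he⟩
        have := p.fst_mem_support_of_mem_edges he
        exact SimpleGraph.ConnectedComponent.sound (p.takeUntil u this).reachable.symm
  have h2 : 2 * ∑ u, ∑ v, l.count (u, v) * d u v =
      ∑ u, ∑ v, (l.count (u, v) + l.count (v, u)) * d u v := by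
    simp only [add_mul, Finset.sum_add_distrib]
    rw [two_mul]
    congr 1
    rw [Finset.sum_comm]
    exact Finset.sum_congr rfl fun u _ => Finset.sum_congr rfl fun v _ => by rw [hsymm]
  simp only [h1, mul_assoc, ← Finset.mul_sum] at h2
  exact Nat.eq_of_mul_eq_mul_left two_pos h2

theorem mem_support_of_count {r : V} (p : H.Walk r r)
    (hp : ∀ u v, H.Adj u v → u ∈ (H.connectedComponentMk r).supp → p.edges.count s(u, v) = 2)
    (u : V) : u ∈ p.support ↔ H.Reachable u r := by
  constructor
  · intro h
    exact (p.takeUntil u h).reachable.symm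
  · rintro ⟨q⟩
    cases q with
    | nil => exact p.start_mem_support
    | cons h q =>
      have h1 := hp _ _ h (mem_supp_mk.2 (h.reachable.trans q.reachable))
      have h2 : s(u, _) ∈ p.edges := List.count_pos_iff.1 (by rw [h1]; norm_num)
      exact p.fst_mem_support_of_mem_edges h2

end Walks

end LCC

/-! ### Lists of vertices as cycles -/

namespace LCC

section CycleLists

variable {V : Type*}

theorem mem_cycleEdges {l : List V} {e : V × V} : e ∈ cycleEdges l ↔
    ∃ (i : ℕ) (h : i < l.length), e = (l[i], l[(i + 1) % l.length]'(Nat.mod_lt _ (by omega))) := by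
  unfold cycleEdges
  rw [List.mem_iff_getElem]
  simp only [List.length_zip, List.length_rotate, min_self, List.getElem_zip, List.getElem_rotate]
  exact ⟨fun ⟨i, h, he⟩ => ⟨i, h, he.symm⟩, fun ⟨i, h, he⟩ => ⟨i, h, he.symm⟩⟩

theorem mem_of_mem_cycleEdges {l : List V} {e : V × V} (h : e ∈ cycleEdges l) :
    e.1 ∈ l ∧ e.2 ∈ l := by
  obtain ⟨i, hi, rfl⟩ := mem_cycleEdges.1 h
  exact ⟨List.getElem_mem _, List.getElem_mem _⟩

theorem ne_of_mem_cycleEdges {l : List V} (hl : l.Nodup) (h2 : 2 ≤ l.length) {e : V × V}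
    (h : e ∈ cycleEdges l) : e.1 ≠ e.2 := by
  obtain ⟨i, hi, rfl⟩ := mem_cycleEdges.1 h
  intro he
  rw [hl.getElem_inj_iff] at he
  rcases Nat.lt_or_ge (i + 1) l.length with h | h
  · rw [Nat.mod_eq_of_lt h] at he
    omega
  · have : i + 1 = l.length := by omega
    rw [this, Nat.mod_self] at he
    omega

theorem existsUnique_succ {l : List V} (hl : l.Nodup) {v : V} (hv : v ∈ l) :
    ∃! u, (v, u) ∈ cycleEdges l := by
  obtain ⟨i, hi, rfl⟩ := List.mem_iff_getElem.1 hv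
  refine ⟨_, mem_cycleEdges.2 ⟨i, hi, rfl⟩, fun u hu => ?_⟩
  obtain ⟨j, hj, h⟩ := mem_cycleEdges.1 hu
  rw [Prod.mk.injEq, hl.getElem_inj_iff] at h
  obtain ⟨rfl, rfl⟩ := h
  rfl

theorem existsUnique_pred {l : List V} (hl : l.Nodup) {v : V} (hv : v ∈ l) :
    ∃! u, (u, v) ∈ cycleEdges l := by
  obtain ⟨i, hi, rfl⟩ := List.mem_iff_getElem.1 hv
  have hsucc : ∀ j < l.length, (j + 1) % l.length = if j + 1 = l.length then 0 else j + 1 := by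
    intro j hj
    split_ifs with h
    · rw [h, Nat.mod_self]
    · exact Nat.mod_eq_of_lt (by omega)
  obtain ⟨k, hk, hki⟩ : ∃ k, k < l.length ∧ (k + 1) % l.length = i := by
    rcases Nat.eq_zero_or_pos i with rfl | h0
    · refine ⟨l.length - 1, by omega, ?_⟩
      rw [Nat.sub_add_cancel (by omega), Nat.mod_self]
    · refine ⟨i - 1, by omega, ?_⟩
      rw [Nat.sub_add_cancel h0, Nat.mod_eq_of_lt hi]
  subst hki
  refine ⟨l[k], mem_cycleEdges.2 ⟨k, hk, rfl⟩, fun u hu => ?_⟩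
  obtain ⟨j, hj, h⟩ := mem_cycleEdges.1 hu
  rw [Prod.mk.injEq, hl.getElem_inj_iff, hsucc j hj, hsucc k hk] at h
  obtain ⟨rfl, h⟩ := h
  rw [hl.getElem_inj_iff]
  split_ifs at h <;> omega

theorem reachable_cycleEdges {l : List V} {u v : V} (hu : u ∈ l) (hv : v ∈ l) :
    Relation.ReflTransGen (fun a b => (a, b) ∈ cycleEdges l) u v := by
  obtain ⟨i, hi, rfl⟩ := List.mem_iff_getElem.1 hu
  obtain ⟨j, hj, rfl⟩ := List.mem_iff_getElem.1 hv
  have hup : ∀ a b (hab : a ≤ b) (hb : b < l.length),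
      Relation.ReflTransGen (fun a b => (a, b) ∈ cycleEdges l) (l[a]'(by omega)) l[b] := by
    intro a b hab
    induction b, hab using Nat.le_induction with
    | base => intro _; exact .refl
    | succ b hab ih =>
      intro hb
      refine (ih (by omega)).tail (mem_cycleEdges.2 ⟨b, by omega, ?_⟩)
      simp only [Nat.mod_eq_of_lt hb]
  refine (hup i (l.length - 1) (by omega) (by omega)).trans (.head ?_ (hup 0 j (by omega) hj))
  refine mem_cycleEdges.2 ⟨l.length - 1, by omega, ?_⟩
  simp only [Nat.sub_add_cancel (show 1 ≤ l.length by omega), Nat.mod_self]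

theorem cycleWeight_congr {w w' : V → V → ℕ} {l : List V} (hl : l.Nodup) (h2 : 2 ≤ l.length)
    (h : ∀ u v, u ≠ v → w u v = w' u v) : cycleWeight w l = cycleWeight w' l := by
  unfold cycleWeight
  congr 1
  exact List.map_congr_left fun e he => h _ _ (ne_of_mem_cycleEdges hl h2 he)

/-- A partition of the vertices into cyclic lists with lengths in `L` is an `L`-cycle cover. -/
theorem isLCycleCover_of_partition {L : Set ℕ} (hL : ∀ l ∈ L, 2 ≤ l) {B : Set (List V)}
    (hnd : ∀ b ∈ B, b.Nodup) (hlen : ∀ b ∈ B, b.length ∈ L) (hex : ∀ v, ∃ b ∈ B, v ∈ b)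
    (huniq : ∀ b ∈ B, ∀ b' ∈ B, ∀ v, v ∈ b → v ∈ b' → b = b') {o : List V → List V}
    (ho : ∀ b ∈ B, o b = b ∨ o b = b.reverse) {C : Finset (V × V)}
    (hC : ∀ e, e ∈ C ↔ ∃ b ∈ B, e ∈ cycleEdges (o b)) : IsLCycleCover L C := by
  have hond : ∀ b ∈ B, (o b).Nodup := by
    intro b hb
    rcases ho b hb with h | h
    · rw [h]
      exact hnd b hb
    · rw [h]
      exact List.nodup_reverse.2 (hnd b hb)
  have holen : ∀ b ∈ B, (o b).length = b.length := by
    intro b hb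
    rcases ho b hb with h | h <;> simp [h]
  have homem : ∀ b ∈ B, ∀ v, v ∈ o b ↔ v ∈ b := by
    intro b hb v
    rcases ho b hb with h | h <;> simp [h]
  have hloc : ∀ b ∈ B, ∀ v ∈ b, ∀ u, ((v, u) ∈ C ↔ (v, u) ∈ cycleEdges (o b)) ∧
      ((u, v) ∈ C ↔ (u, v) ∈ cycleEdges (o b)) := by
    intro b hb v hv u
    refine ⟨⟨fun h => ?_, fun h => (hC _).2 ⟨b, hb, h⟩⟩,
      ⟨fun h => ?_, fun h => (hC _).2 ⟨b, hb, h⟩⟩⟩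
    · obtain ⟨b', hb', h⟩ := (hC _).1 h
      have := (homem b' hb' _).1 (mem_of_mem_cycleEdges h).1
      rwa [huniq b hb b' hb' v hv this]
    · obtain ⟨b', hb', h⟩ := (hC _).1 h
      have := (homem b' hb' _).1 (mem_of_mem_cycleEdges h).2
      rwa [huniq b hb b' hb' v hv this]
  refine ⟨⟨?_, ?_, ?_⟩, ?_⟩
  · intro e he
    obtain ⟨b, hb, h⟩ := (hC e).1 he
    exact ne_of_mem_cycleEdges (hond b hb) (by rw [holen b hb]; exact hL _ (hlen b hb)) h
  · intro v
    obtain ⟨b, hb, hv⟩ := hex v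
    simp only [fun u => (hloc b hb v hv u).1]
    exact existsUnique_succ (hond b hb) ((homem b hb v).2 hv)
  · intro v
    obtain ⟨b, hb, hv⟩ := hex v
    simp only [fun u => (hloc b hb v hv u).2]
    exact existsUnique_pred (hond b hb) ((homem b hb v).2 hv)
  · intro v
    obtain ⟨b, hb, hv⟩ := hex v
    have hset : {u | Relation.ReflTransGen (fun a b => (a, b) ∈ C) v u} = {u | u ∈ b} := by
      ext u
      constructor
      · intro h
        simp only [Set.mem_ofPred_eq] at h ⊢
        induction h with
        | refl => exact hv
        | tail _ h ih =>
          rw [(hloc b hb _ ih _).1] at h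
          exact (homem b hb _).1 (mem_of_mem_cycleEdges h).2
      · intro hu
        have := reachable_cycleEdges ((homem b hb v).2 hv) ((homem b hb u).2 hu)
        exact this.lift id fun a c h => (hC _).2 ⟨b, hb, h⟩
    unfold cycleLength
    rw [hset]
    classical
    have : {u | u ∈ b} = (b.toFinset : Set V) := by ext; simp
    rw [this, Set.ncard_coe_finset, List.toFinset_card_of_nodup (hnd b hb)]
    exact hlen b hb

end CycleLists

/-! ### The approximation ratio -/

section Ratio

variable {V : Type*} [Fintype V] [DecidableEq V]

omit [Fintype V] in
theorem isMetric_symWeight {w : V → V → ℕ} (hw : TriangleIneq w) :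
    IsMetric fun u v => if u = v then 0 else symWeight w u v where
  self u := if_pos rfl
  symm u v := by simp only [eq_comm (a := u), symWeight, add_comm]
  triangle u v x := by
    by_cases h1 : u = v
    · simp [h1]
    by_cases h2 : u = x
    · subst h2
      simp
    by_cases h3 : x = v
    · subst h3
      simp
    have h4 := hw u v x h1 h2 h3
    have h5 := hw v u x (Ne.symm h1) (Ne.symm h3) (Ne.symm h2)
    simp only [h1, h2, h3, if_false, symWeight]
    omega

omit [Fintype V] in
/-- The cycles constructed from a component partition its vertices. -/
theorem SplitComponent.perm {L : Set ℕ} {H : SimpleGraph V} {c : H.ConnectedComponent}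
    {cs : List (List V)} (h : SplitComponent L H c cs) :
    cs.flatten.Nodup ∧ (∀ v, v ∈ cs.flatten ↔ H.connectedComponentMk v = c) ∧
      ∀ b ∈ cs, b.length ∈ L := by
  obtain ⟨r, hr, p, hp, hrot, hlen⟩ := h
  rw [SimpleGraph.ConnectedComponent.mem_supp_iff] at hr
  subst hr
  refine ⟨hrot.nodup_iff.2 (firstVisits_nodup _), fun v => ?_, hlen⟩
  rw [hrot.mem_iff, mem_firstVisits, mem_support_of_count p hp, SimpleGraph.ConnectedComponent.eq]

/-- Shortcuts along the Eulerian cycle cost nothing, and closing the paths at most doubles their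
total weight. -/
theorem SplitComponent.sum_cycleWeight_le {L : Set ℕ} (hL : ∀ l ∈ L, 2 ≤ l) {w : V → V → ℕ}
    (hw : TriangleIneq w) {H : SimpleGraph V} {c : H.ConnectedComponent} {cs : List (List V)}
    (h : SplitComponent L H c cs) :
    (cs.map (cycleWeight (symWeight w))).sum ≤
      2 * ∑ u, ∑ v, ind (H.connectedComponentMk u = c ∧ H.Adj u v) * symWeight w u v := by
  have hnd := h.perm.1
  obtain ⟨r, hr, p, hp, hrot, hlen⟩ := h
  rw [SimpleGraph.ConnectedComponent.mem_supp_iff] at hr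
  subst hr
  have hd := isMetric_symWeight hw
  -- `symWeight w` need not vanish on the diagonal, where the weights are not constrained; on edges
  -- it agrees with the pseudometric `d`
  set d : V → V → ℕ := fun u v => if u = v then 0 else symWeight w u v with hdef
  have h1 : cs.map (cycleWeight (symWeight w)) = cs.map (cycleWeight d) := by
    refine List.map_congr_left fun b hb => cycleWeight_congr ?_ (hL _ (hlen b hb)) ?_
    · exact (List.nodup_flatten.1 hnd).1 b hb
    · intro u v huv
      simp only [hdef, if_neg huv]
  have h2 : ∑ u, ∑ v, ind (H.connectedComponentMk u = H.connectedComponentMk r ∧ H.Adj u v) *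
      symWeight w u v = pathWeight d p.support := by
    rw [pathWeight_support_eq hd.symm p hp]
    refine Finset.sum_congr rfl fun u _ => Finset.sum_congr rfl fun v _ => ?_
    by_cases huv : u = v
    · subst huv
      rw [ind_of_not fun h => h.2.ne rfl, zero_mul, zero_mul]
    · simp only [hdef, if_neg huv]
  rw [h1, h2]
  exact (hd.sum_cycleWeight_le hrot).trans
    (Nat.mul_le_mul_left _ (hd.cycleWeight_firstVisits_support_le p))

theorem sum_biUnion_le {α β : Type*} [DecidableEq α] [DecidableEq β] (s : Finset α)
    (t : α → Finset β) (f : β → ℕ) : ∑ x ∈ s.biUnion t, f x ≤ ∑ a ∈ s, ∑ x ∈ t a, f x := by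
  induction s using Finset.induction_on with
  | empty => simp
  | insert a s ha ih =>
    rw [Finset.biUnion_insert, Finset.sum_insert ha]
    have := Finset.sum_union_inter (s₁ := t a) (s₂ := s.biUnion t) (f := f)
    omega

/-- Every possible output of ApxDir is an `L`-cycle cover within the claimed factor. -/
theorem ApxDir.correct {L : Set ℕ} (hL : ∀ l ∈ L, 2 ≤ l) {w : V → V → ℕ}
    (hw : TriangleIneq w) {C : Finset (V × V)} (h : ApxDir L w (some C)) :
    IsLCycleCover L C ∧ ∀ C' : Finset (V × V), IsLCycleCover L C' →
      weight w C ≤ 2 * Fintype.card V * (pL L + 4) * weight w C' := by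
  classical
  obtain ⟨-, cycles, ⟨-, H₀, H, hGW, hphase, -, cs, hcs, rfl⟩, o, ho, hC⟩ := h
  have hperm := fun c => (hcs c).perm
  constructor
  · refine isLCycleCover_of_partition hL (B := {b | ∃ c, b ∈ cs c}) ?_ ?_ ?_ ?_
      (fun b hb => (ho b hb).1) hC
    · rintro b ⟨c, hb⟩
      exact (List.nodup_flatten.1 (hperm c).1).1 b hb
    · rintro b ⟨c, hb⟩
      exact (hperm c).2.2 b hb
    · intro v
      obtain ⟨b, hb, hv⟩ := List.mem_flatten.1
        (((hperm (H.connectedComponentMk v)).2.1 v).2 rfl)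
      exact ⟨b, ⟨_, hb⟩, hv⟩
    · rintro b ⟨c, hb⟩ b' ⟨c', hb'⟩ v hv hv'
      have h1 := ((hperm c).2.1 v).1 (List.mem_flatten.2 ⟨b, hb, hv⟩)
      have h2 := ((hperm c').2.1 v).1 (List.mem_flatten.2 ⟨b', hb', hv'⟩)
      rw [h1] at h2
      subst h2
      have hp := (List.nodup_flatten.1 (hperm c).1).2
      by_contra hne
      have : Std.Symm (List.Disjoint (α := V)) := ⟨fun _ _ h => h.symm⟩
      exact hp.forall hb hb' hne hv hv'
  · intro C' hC'
    obtain ⟨σ, -, hσ1, hσw, hσc⟩ := hC'.1.exists_perm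
    have hσL : ∀ v, {u | σ.SameCycle v u}.ncard ∈ L := fun v => hσc v ▸ hC'.2 v
    have hcross := fun S hS => exists_crossing σ hσL S hS
    have hsymm : ∀ u v, symWeight w u v = symWeight w v u := fun u v => add_comm _ _
    have hpr := weight_symWeight_le hw hC'.1
    rw [hσw (symWeight w)] at hpr
    set W := ∑ v, symWeight w v (σ v)
    have h0 : graphWeight (symWeight w) H₀ ≤ 2 * W :=
      hGW.graphWeight_le hsymm σ hσ1 fun S hS => hcross S fun h => hS (gL_dvd h)
    have h1 : graphWeight (symWeight w) H ≤ graphWeight (symWeight w) H₀ + pL L * (2 * W) := by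
      refine graphWeight_phases_le hsymm hphase (fun v => ?_) σ hcross
      obtain ⟨t, ht, hg, rfl⟩ := hGW
      exact dvd_compSize_gwPrune (GWStep.isAcyclic ht) (fun v => compF_eq_zero.1 (hg v)) v
    -- the lighter orientation of a cycle has at most half of its symmetrized weight
    have h2 : 2 * weight w C ≤ 2 * graphWeight (symWeight w) H := by
      have e1 : C = Finset.univ.biUnion fun c : H.ConnectedComponent =>
          ((cs c).flatMap fun b => cycleEdges (o b)).toFinset := by
        ext e
        rw [hC]
        simp only [Finset.mem_biUnion, Finset.mem_univ, true_and, List.mem_toFinset,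
          List.mem_flatMap, Set.mem_ofPred_eq]
        exact ⟨fun ⟨b, ⟨c, hb⟩, h⟩ => ⟨c, b, hb, h⟩, fun ⟨c, b, hb, h⟩ => ⟨b, ⟨c, hb⟩, h⟩⟩
      have e2 : weight w C ≤ ∑ c, ((cs c).map fun b => cycleWeight w (o b)).sum := by
        rw [weight, e1]
        refine (sum_biUnion_le _ _ _).trans (Finset.sum_le_sum fun c _ => ?_)
        have : ∀ l : List (V × V), ∑ e ∈ l.toFinset, w e.1 e.2 ≤
            (l.map fun e => w e.1 e.2).sum := by
          intro l
          induction l with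
          | nil => simp
          | cons a l ih =>
            rw [List.toFinset_cons, List.map_cons, List.sum_cons]
            by_cases h : a ∈ l.toFinset
            · rw [Finset.insert_eq_of_mem h]
              omega
            · rw [Finset.sum_insert h]
              omega
        refine (this _).trans (le_of_eq ?_)
        induction cs c with
        | nil => simp
        | cons b l ih =>
          rw [List.flatMap_cons, List.map_append, List.sum_append, ih, List.map_cons,
            List.sum_cons]
          rfl
      have e3 : ∀ c, 2 * ((cs c).map fun b => cycleWeight w (o b)).sum ≤
          ((cs c).map (cycleWeight (symWeight w))).sum := by
        intro c
        rw [← List.sum_map_mul_left]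
        refine List.sum_le_sum fun b hb => ?_
        rw [cycleWeight_symWeight]
        obtain ⟨-, h1, h2⟩ := ho b ⟨c, hb⟩
        omega
      calc 2 * weight w C ≤ ∑ c, 2 * ((cs c).map fun b => cycleWeight w (o b)).sum := by
            rw [← Finset.mul_sum]
            exact Nat.mul_le_mul_left _ e2
        _ ≤ ∑ c, 2 * ∑ u, ∑ v, ind (H.connectedComponentMk u = c ∧ H.Adj u v) *
              symWeight w u v :=
            Finset.sum_le_sum fun c _ =>
              (e3 c).trans ((hcs c).sum_cycleWeight_le hL hw)
        _ = 2 * graphWeight (symWeight w) H := by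
            rw [← Finset.mul_sum, graphWeight]
            congr 1
            rw [Finset.sum_comm]
            refine Finset.sum_congr rfl fun u _ => ?_
            rw [Finset.sum_comm]
            refine Finset.sum_congr rfl fun v _ => ?_
            rw [Finset.sum_eq_single (H.connectedComponentMk u)]
            · congr 2
              simp
            · intro c _ hc
              rw [ind_of_not fun h => hc h.1.symm, zero_mul]
            · simp
    -- the analysis gives the factor `2 (p_L + 1)`, which is better than claimed
    calc weight w C ≤ graphWeight (symWeight w) H := by omega
      _ ≤ 2 * (pL L + 1) * W := by nlinarith
      _ ≤ 2 * (pL L + 4) * W := Nat.mul_le_mul_right _ (by omega)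
      _ ≤ 2 * (pL L + 4) * (Fintype.card V * weight w C') := Nat.mul_le_mul_left _ hpr
      _ = _ := by ring

omit [DecidableEq V] in
theorem card_mem_close {L : Set ℕ} {C : Finset (V × V)} (hC : IsLCycleCover L C) :
    Fintype.card V ∈ close L := by
  obtain ⟨σ, -, -, -, hσc⟩ := hC.1.exists_perm
  have := ncard_mem_close_of_closed σ (fun v => hσc v ▸ hC.2 v) Set.univ (by simp)
  rwa [Set.ncard_univ, Nat.card_eq_fintype_card] at this

end Ratio

end LCC

/-! ### A program logic with time bounds -/

namespace LCC

/-- Started in `s`, the program `p` halts within `T` steps in a state that satisfies `Q`. -/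
def wp (p : Prog) (T : ℕ) (Q : State → Prop) (s : State) : Prop :=
  ∃ t s', t ≤ T ∧ Run p s t s' ∧ Q s'

theorem wp.mono {p : Prog} {T T' : ℕ} {Q Q' : State → Prop} {s : State} (h : wp p T Q s)
    (hT : T ≤ T') (hQ : ∀ s', Q s' → Q' s') : wp p T' Q' s := by
  obtain ⟨t, s', ht, hr, hq⟩ := h
  exact ⟨t, s', ht.trans hT, hr, hQ s' hq⟩

/-- The sequential composition of a list of programs. -/
def blk : List Prog → Prog
  | [] => .skip
  | p :: l => .seq p (blk l)

/-- A straight-line program. -/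
def ops (l : List Op) : Prog := blk (l.map .op)

/-- The index registers that an operation may change. -/
def Op.regs : Op → List ℕ
  | .const x _ | .add x _ _ | .sub x _ _ | .half x _ | .load x _ _ => [x]
  | _ => []

/-- The index arrays that an operation may change. -/
def Op.arrs : Op → List ℕ
  | .store a _ _ => [a]
  | _ => []

/-- The number registers that an operation may change. -/
def Op.qregs : Op → List ℕ
  | .qconst x _ | .qadd x _ _ | .qsub x _ _ | .qhalf x _ | .qload x _ _ => [x]
  | _ => []

/-- The number arrays that an operation may change. -/
def Op.qarrs : Op → List ℕ
  | .qstore a _ _ => [a]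
  | _ => []

/-- The index registers that a program may change. -/
def Prog.regs : Prog → List ℕ
  | .skip => []
  | .op o => o.regs
  | .seq p q => p.regs ++ q.regs
  | .ite _ p q => p.regs ++ q.regs
  | .loop _ p => p.regs

/-- The index arrays that a program may change. -/
def Prog.arrs : Prog → List ℕ
  | .skip => []
  | .op o => o.arrs
  | .seq p q => p.arrs ++ q.arrs
  | .ite _ p q => p.arrs ++ q.arrs
  | .loop _ p => p.arrs

/-- The number registers that a program may change. -/
def Prog.qregs : Prog → List ℕ
  | .skip => []
  | .op o => o.qregs
  | .seq p q => p.qregs ++ q.qregs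
  | .ite _ p q => p.qregs ++ q.qregs
  | .loop _ p => p.qregs

/-- The number arrays that a program may change. -/
def Prog.qarrs : Prog → List ℕ
  | .skip => []
  | .op o => o.qarrs
  | .seq p q => p.qarrs ++ q.qarrs
  | .ite _ p q => p.qarrs ++ q.qarrs
  | .loop _ p => p.qarrs

/-- The states `s` and `s'` agree on everything that `p` never writes. -/
structure Frame (p : Prog) (s s' : State) : Prop where
  reg : ∀ x, x ∉ p.regs → s'.reg x = s.reg x
  arr : ∀ x, x ∉ p.arrs → s'.arr x = s.arr x
  qreg : ∀ x, x ∉ p.qregs → s'.qreg x = s.qreg x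
  qarr : ∀ x, x ∉ p.qarrs → s'.qarr x = s.qarr x

theorem Frame.refl (p : Prog) (s : State) : Frame p s s :=
  ⟨fun _ _ => rfl, fun _ _ => rfl, fun _ _ => rfl, fun _ _ => rfl⟩

theorem Frame.trans {p : Prog} {s s' s'' : State} (h : Frame p s s') (h' : Frame p s' s'') :
    Frame p s s'' :=
  ⟨fun x hx => (h'.reg x hx).trans (h.reg x hx), fun x hx => (h'.arr x hx).trans (h.arr x hx),
    fun x hx => (h'.qreg x hx).trans (h.qreg x hx), fun x hx => (h'.qarr x hx).trans (h.qarr x hx)⟩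

theorem Frame.left {p q : Prog} {s s' : State} (h : Frame p s s') : Frame (.seq p q) s s' := by
  constructor <;> intro x hx <;>
    simp only [Prog.regs, Prog.arrs, Prog.qregs, Prog.qarrs, List.mem_append, not_or] at hx
  exacts [h.reg x hx.1, h.arr x hx.1, h.qreg x hx.1, h.qarr x hx.1]

theorem Frame.right {p q : Prog} {s s' : State} (h : Frame q s s') : Frame (.seq p q) s s' := by
  constructor <;> intro x hx <;>
    simp only [Prog.regs, Prog.arrs, Prog.qregs, Prog.qarrs, List.mem_append, not_or] at hx
  exacts [h.reg x hx.2, h.arr x hx.2, h.qreg x hx.2, h.qarr x hx.2]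

theorem Op.frame (o : Op) (s : State) : Frame (.op o) s (o.exec s) := by
  constructor <;> intro x hx <;> cases o <;>
    simp_all [Prog.regs, Prog.arrs, Prog.qregs, Prog.qarrs, Op.regs, Op.arrs, Op.qregs, Op.qarrs,
      Op.exec]

/-- A program does not change what it never writes. -/
theorem Run.frame {p : Prog} {s s' : State} {t : ℕ} (h : Run p s t s') : Frame p s s' := by
  induction h with
  | skip s => exact .refl _ _
  | op o s => exact o.frame s
  | seq _ _ ih ih' => exact ih.left.trans ih'.right
  | iteTrue _ _ ih => exact ⟨ih.left.reg, ih.left.arr, ih.left.qreg, ih.left.qarr⟩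
  | iteFalse _ _ ih => exact ⟨ih.right.reg, ih.right.arr, ih.right.qreg, ih.right.qarr⟩
  | loopTrue _ _ _ ih ih' => exact Frame.trans ⟨ih.reg, ih.arr, ih.qreg, ih.qarr⟩ ih'
  | loopFalse _ => exact .refl _ _

theorem wp.frame {p : Prog} {T : ℕ} {Q : State → Prop} {s : State} (h : wp p T Q s) :
    wp p T (fun s' => Q s' ∧ Frame p s s') s := by
  obtain ⟨t, s', ht, hr, hq⟩ := h
  exact ⟨t, s', ht, hr, hq, hr.frame⟩

/-- The effect of a program without loops. -/
noncomputable def Prog.eval : Prog → State → State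
  | .skip, s => s
  | .op o, s => o.exec s
  | .seq p q, s => q.eval (p.eval s)
  | .ite b p q, s => open Classical in if b.holds s then p.eval s else q.eval s
  | .loop _ _, s => s

/-- Whether a program contains no loop. -/
def Prog.loopFree : Prog → Bool
  | .skip => true
  | .op _ => true
  | .seq p q => p.loopFree && q.loopFree
  | .ite _ p q => p.loopFree && q.loopFree
  | .loop _ _ => false

/-- An upper bound on the number of steps of a program without loops. -/
def Prog.cost : Prog → ℕ
  | .skip => 1
  | .op _ => 1
  | .seq p q => p.cost + q.cost
  | .ite _ p q => max p.cost q.cost + 1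
  | .loop _ _ => 0

/-- Programs without loops are verified by computing their effect. -/
theorem wp_eval {p : Prog} {T : ℕ} {Q : State → Prop} {s : State} (hp : p.loopFree = true)
    (hT : p.cost ≤ T) (hQ : Q (p.eval s)) : wp p T Q s := by
  suffices h : ∃ t ≤ p.cost, Run p s t (p.eval s) by
    obtain ⟨t, ht, hr⟩ := h
    exact ⟨t, _, ht.trans hT, hr, hQ⟩
  clear hQ hT
  induction p generalizing s with
  | skip => exact ⟨1, le_rfl, .skip s⟩
  | op o => exact ⟨1, le_rfl, .op o s⟩
  | seq p q ih ih' =>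
    rw [Prog.loopFree, Bool.and_eq_true] at hp
    obtain ⟨t, ht, hr⟩ := ih hp.1 (s := s)
    obtain ⟨t', ht', hr'⟩ := ih' hp.2 (s := p.eval s)
    exact ⟨t + t', Nat.add_le_add ht ht', .seq hr hr'⟩
  | ite b p q ih ih' =>
    rw [Prog.loopFree, Bool.and_eq_true] at hp
    rw [Prog.eval]
    split_ifs with hb
    · obtain ⟨t, ht, hr⟩ := ih hp.1 (s := s)
      exact ⟨t + 1, Nat.add_le_add_right (ht.trans (le_max_left _ _)) 1, .iteTrue hb hr⟩
    · obtain ⟨t, ht, hr⟩ := ih' hp.2 (s := s)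
      exact ⟨t + 1, Nat.add_le_add_right (ht.trans (le_max_right _ _)) 1, .iteFalse hb hr⟩
  | loop b p => exact absurd hp (by simp [Prog.loopFree])

theorem wp_nil {T : ℕ} {Q : State → Prop} {s : State} (hT : 1 ≤ T) (hQ : Q s) :
    wp (blk []) T Q s := ⟨1, s, hT, .skip s, hQ⟩

/-- Sequential composition; what the first program does not write may be used to verify the others.
-/
theorem wp_cons {p : Prog} {l : List Prog} {T₁ T₂ : ℕ} {R Q : State → Prop} {s : State}
    (h₁ : wp p T₁ R s) (h₂ : ∀ s', R s' → Frame p s s' → wp (blk l) T₂ Q s') :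
    wp (blk (p :: l)) (T₁ + T₂) Q s := by
  obtain ⟨t, s', ht, hr, hq⟩ := h₁
  obtain ⟨t', s'', ht', hr', hq'⟩ := h₂ s' hq hr.frame
  exact ⟨t + t', s'', Nat.add_le_add ht ht', .seq hr hr', hq'⟩

theorem wp_last {p : Prog} {T : ℕ} {R Q : State → Prop} {s : State}
    (h : wp p T R s) (hQ : ∀ s', R s' → Frame p s s' → Q s') : wp (blk [p]) (T + 1) Q s :=
  wp_cons h fun s' hr hf => wp_nil le_rfl (hQ s' hr hf)

theorem wp_ite {b : Test} {p q : Prog} {T : ℕ} {Q : State → Prop} {s : State}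
    (h₁ : b.holds s → wp p T Q s) (h₂ : ¬ b.holds s → wp q T Q s) :
    wp (.ite b p q) (T + 1) Q s := by
  by_cases hb : b.holds s
  · obtain ⟨t, s', ht, hr, hq⟩ := h₁ hb
    exact ⟨t + 1, s', Nat.add_le_add_right ht 1, .iteTrue hb hr, hq⟩
  · obtain ⟨t, s', ht, hr, hq⟩ := h₂ hb
    exact ⟨t + 1, s', Nat.add_le_add_right ht 1, .iteFalse hb hr, hq⟩

/-- Loops with an invariant `I m`, where `m` decreases from iteration to iteration. The time for
an iteration is charged to the decrease of `m`. -/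
theorem wp_while {b : Test} {body : Prog} {c : ℕ} (I : ℕ → State → Prop) {m : ℕ} {s : State}
    (h0 : I m s)
    (hstep : ∀ m s', Frame (.loop b body) s s' → I m s' → b.holds s' →
      ∃ m' < m, wp body (c * (m - m')) (I m') s') :
    wp (.loop b body) ((c + 1) * m + 1) (fun s' => ∃ m', I m' s' ∧ ¬ b.holds s') s := by
  suffices h : ∀ m s', Frame (.loop b body) s s' → I m s' →
      wp (.loop b body) ((c + 1) * m + 1) (fun s' => ∃ m', I m' s' ∧ ¬ b.holds s') s' from
    h m s (.refl _ _) h0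
  intro m
  induction m using Nat.strong_induction_on with
  | _ m ih =>
    intro s' hf hI
    by_cases hb : b.holds s'
    · obtain ⟨m', hm', t, s'', ht, hr, hI'⟩ := hstep m s' hf hI hb
      have hf' : Frame (.loop b body) s' s'' :=
        ⟨hr.frame.reg, hr.frame.arr, hr.frame.qreg, hr.frame.qarr⟩
      obtain ⟨t', s''', ht', hr', hQ⟩ := ih m' hm' s'' (hf.trans hf') hI'
      refine ⟨t + t' + 1, s''', ?_, .loopTrue hb hr hr', hQ⟩
      obtain ⟨k, rfl⟩ := Nat.exists_eq_add_of_lt hm'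
      have e1 : m' + k + 1 - m' = k + 1 := by omega
      rw [e1] at ht
      nlinarith
    · exact ⟨1, s', Nat.le_add_left _ _, .loopFalse hb, m, hI, hb⟩

/-- The state `s` with the value `v` in register `x`. -/
def State.setReg (s : State) (x v : ℕ) : State := { s with reg := Function.update s.reg x v }

/-- `for i = 0, …, n - 1 do body`, where register `N` holds `n`. -/
def forTo (i N : ℕ) (body : Prog) : Prog :=
  blk [.op (.const i 0),
    .loop (.lt i N) (blk [body, .op (.const 99 1), .op (.add i i 99)])]

/-- Counting loops with an invariant `I k` that holds before the iteration with counter `k`.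
Register `99` is used for incrementing the counter. -/
theorem wp_for {i N : ℕ} {body : Prog} {T n : ℕ} (I : ℕ → State → Prop) {s : State}
    (hN : s.reg N = n) (hi : i ∉ body.regs) (hN' : N ∉ 99 :: i :: body.regs) (hi99 : i ≠ 99)
    (h0 : I 0 (s.setReg i 0))
    (hstep : ∀ k < n, ∀ s', Frame (forTo i N body) s s' → I k s' → s'.reg i = k →
      wp body T (fun s'' => I (k + 1) ((s''.setReg 99 1).setReg i (k + 1))) s') :
    wp (forTo i N body) (n * (T + 5) + 3) (I n) s := by
  simp only [List.mem_cons, not_or] at hN'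
  obtain ⟨hN99, hNi, hNb⟩ := hN'
  have hmain := wp_while (b := .lt i N)
    (body := blk [body, .op (.const 99 1), .op (.add i i 99)]) (c := T + 4) (m := n)
    (fun m s' => m ≤ n ∧ s'.reg i = n - m ∧ I (n - m) s') (s := s.setReg i 0)
    (by simpa [State.setReg] using h0) ?_
  · refine (wp_cons (T₁ := 1) (R := fun s' => s' = s.setReg i 0) (s := s)
      ⟨1, _, le_rfl, .op _ _, rfl⟩ (T₂ := (T + 4 + 1) * n + 1 + 1) (Q := I n) ?_).mono ?_
      fun _ h => h
    · rintro s' rfl -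
      refine wp_last hmain.frame ?_
      rintro s' ⟨⟨m', ⟨hm', hr, hI⟩, hb⟩, hf⟩ -
      have : s'.reg N = n := by
        rw [hf.reg]
        · simp [State.setReg, hNi, hN]
        · simp [Prog.regs, blk, Op.regs, hNi, hN99, hNb]
      simp only [Test.holds, hr, this] at hb
      rwa [show n - m' = n by omega] at hI
    · rw [mul_comm n, show T + 4 + 1 = T + 5 from rfl]
      omega
  · rintro m s' hf ⟨hm, hr, hI⟩ hb
    have hNs : s'.reg N = n := by
      rw [hf.reg]
      · simp [State.setReg, hNi, hN]
      · simp [Prog.regs, blk, Op.regs, hNi, hN99, hNb]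
    simp only [Test.holds, hr, hNs] at hb
    refine ⟨m - 1, by omega, ?_⟩
    have hf' : Frame (forTo i N body) s s' := by
      have h1 : Frame (forTo i N body) s (s.setReg i 0) :=
        Frame.left (Op.frame (.const i 0) s)
      exact h1.trans (Frame.right (Frame.left hf))
    rw [show m - (m - 1) = 1 by omega, mul_one]
    refine (wp_cons (hstep (n - m) (by omega) s' hf' hI hr)
      (T₂ := 3) (Q := fun s' => m - 1 ≤ n ∧ s'.reg i = n - (m - 1) ∧ I (n - (m - 1)) s') ?_).mono
      (by omega) fun _ h => h
    intro s'' hI' hfb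
    have hi'' : s''.reg i = n - m := by rw [hfb.reg i hi, hr]
    refine wp_eval (p := blk [.op (.const 99 1), .op (.add i i 99)]) rfl (le_refl 3) ?_
    have e : (blk [.op (.const 99 1), .op (.add i i 99)]).eval s'' =
        (s''.setReg 99 1).setReg i (n - m + 1) := by
      simp [blk, Prog.eval, Op.exec, State.setReg, hi99, hi'']
    rw [e, show n - (m - 1) = n - m + 1 by omega]
    exact ⟨by omega, by simp [State.setReg], hI'⟩

/-- A constant number of copies of a program. -/
def rep : ℕ → Prog → Prog
  | 0, _ => .skip
  | k + 1, p => .seq p (rep k p)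

theorem wp_rep {p : Prog} {T : ℕ} (I : ℕ → State → Prop) (n : ℕ) {s : State}
    (h0 : I 0 s) (hstep : ∀ k s', I k s' → wp p T (I (k + 1)) s') :
    wp (rep n p) (n * T + 1) (I n) s := by
  induction n generalizing I s with
  | zero => exact ⟨1, s, by omega, .skip s, h0⟩
  | succ n ih =>
    obtain ⟨t, s', ht, hr, hI⟩ := hstep 0 s h0
    obtain ⟨t', s'', ht', hr', hI'⟩ := ih (fun k => I (k + 1)) hI fun k s' h => hstep (k + 1) s' h
    refine ⟨t + t', s'', ?_, .seq hr hr', hI'⟩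
    rw [add_mul]
    omega

end LCC

/-!
### The layout of the memory

Index registers: `0` contains `n`, `1` the flag that tells whether a cover has been found, `2` the
number of leaves of the tournament tree. Index register `97` and number register `10` keep their
initial value `0`, and index register `98` contains `1` from the beginning of the first table
computation on. The other registers are temporary.

Index arrays: `0` successors in the cover; `1` last summands; `2` the admissible numbers; `3` the
multiples of `g_L` (with last summands in `22`); `4` offsets of matrix rows; `5`, `6`, `11`, `12`
labels, sizes and edge ends of the current forest; `7` activity of components; `8`, `9` ends of the
best edge between two components; `10` tournament tree; `13`, `14`, `15`, `16` parents, marks, links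
and order of the exploration; `17`, `18` ends of the best edge leaving a component, and before that,
in `17`, the edges that survive the pruning; `19` temporary flags; `20` illegal components.

Number arrays: `0` the weights; `1` the symmetrized weights; `2` the smallest reduced weights between
components; `3` event times; `4` weights of the best edges leaving the components.
-/

/-! ### Tables of admissible numbers -/

namespace LCC

/-- Tries all `x` in the list as the last summand of the number in register `11`: array `a` marks
the sums found so far, array `c` records the summand. -/
def dpInner (a c : ℕ) : List ℕ → Prog
  | [] => .skip
  | x :: l => .seq (blk [.op (.const 12 x), .ite (.lt 11 12) .skip
      (blk [.op (.sub 13 11 12), .op (.load 14 a 13),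
        .ite (.eq 14 98) (ops [.store a 11 98, .store c 11 12]) .skip])]) (dpInner a c l)

theorem dpInner_loopFree (a c : ℕ) (l : List ℕ) : (dpInner a c l).loopFree = true := by
  induction l with
  | nil => rfl
  | cons x l ih => simp [dpInner, Prog.loopFree, blk, ops, ih]

theorem dpInner_cost (a c : ℕ) (l : List ℕ) : (dpInner a c l).cost ≤ 12 * l.length + 1 := by
  induction l with
  | nil => simp [dpInner, Prog.cost]
  | cons x l ih =>
    simp only [dpInner, Prog.cost, blk, ops, List.map, List.length_cons]
    omega

theorem dpInner_writes (a c : ℕ) (l : List ℕ) :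
    (∀ x ∈ (dpInner a c l).regs, x = 12 ∨ x = 13 ∨ x = 14) ∧
    (∀ x ∈ (dpInner a c l).arrs, x = a ∨ x = c) ∧ (dpInner a c l).qregs = [] ∧
    (dpInner a c l).qarrs = [] := by
  induction l with
  | nil => simp [dpInner, Prog.regs, Prog.arrs, Prog.qregs, Prog.qarrs]
  | cons x l ih =>
    simp only [dpInner, Prog.regs, Prog.arrs, Prog.qregs, Prog.qarrs, blk, ops, List.map,
      Op.regs, Op.arrs, Op.qregs, Op.qarrs]
    obtain ⟨h1, h2, h3, h4⟩ := ih
    refine ⟨?_, ?_, by simp [h3], by simp [h4]⟩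
    · intro y hy
      simp at hy
      rcases hy with h | h | h | h
      · simp [h]
      · simp [h]
      · simp [h]
      · exact h1 y h
    · intro y hy
      simp at hy
      rcases hy with h | h | h
      · simp [h]
      · simp [h]
      · exact h2 y h

/-- If the table is correct below `m`, it is correct at `m` afterwards. Here `P` is what is claimed
about the stored summand. -/
theorem dpInner_eval {a c m : ℕ} (hac : a ≠ c) (A : ℕ → ℕ) (P : ℕ → Prop) (l : List ℕ)
    (hl : ∀ x ∈ l, 0 < x) (hP : ∀ x ∈ l, x ≤ m → A (m - x) = 1 → P x) {s : State}
    (h11 : s.reg 11 = m) (h98 : s.reg 98 = 1) (hA : ∀ j, j ≠ m → s.arr a j = A j)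
    (hc : s.arr a m = 1 → P (s.arr c m)) :
    (∀ j, j ≠ m → ((dpInner a c l).eval s).arr a j = A j) ∧
    (∀ j, j ≠ m → ((dpInner a c l).eval s).arr c j = s.arr c j) ∧
    (((dpInner a c l).eval s).arr a m = 1 ↔
      s.arr a m = 1 ∨ ∃ x ∈ l, x ≤ m ∧ A (m - x) = 1) ∧
    (((dpInner a c l).eval s).arr a m = 1 → P (((dpInner a c l).eval s).arr c m)) := by
  induction l generalizing s with
  | nil => simpa [dpInner, Prog.eval] using ⟨hA, hc⟩
  | cons x l ih =>
    have hx0 := hl x (by simp)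
    have hl' : ∀ x ∈ l, 0 < x := fun y hy => hl y (by simp [hy])
    have hP' : ∀ x ∈ l, x ≤ m → A (m - x) = 1 → P x := fun y hy => hP y (by simp [hy])
    rw [dpInner, Prog.eval]
    by_cases hx : x ≤ m ∧ A (m - x) = 1
    · have hAx : s.arr a (m - x) = 1 := by rw [hA _ (by omega), hx.2]
      set s₁ := (blk [.op (.const 12 x), .ite (.lt 11 12) .skip
        (blk [.op (.sub 13 11 12), .op (.load 14 a 13),
          .ite (.eq 14 98) (ops [.store a 11 98, .store c 11 12]) .skip])]).eval s with hs₁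
      have e : s₁.reg 11 = m ∧ s₁.reg 98 = 1 ∧ s₁.arr a = Function.update (s.arr a) m 1 ∧
          s₁.arr c = Function.update (s.arr c) m x := by
        rw [hs₁]
        simp [Prog.eval, blk, ops, Op.exec, Test.holds, h11, h98, hAx, not_lt.2 hx.1, hac, hac.symm]
      obtain ⟨e1, e2, e3, e4⟩ := e
      obtain ⟨r1, r2, r3, r4⟩ := ih hl' hP' e1 e2
        (fun j hj => by rw [e3, Function.update_of_ne hj, hA j hj])
        (fun _ => by rw [e4, Function.update_self]; exact hP x (by simp) hx.1 hx.2)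
      refine ⟨r1, fun j hj => by rw [r2 j hj, e4, Function.update_of_ne hj], ?_, r4⟩
      rw [r3, e3, Function.update_self]
      exact ⟨fun _ => Or.inr ⟨x, by simp, hx⟩, fun _ => Or.inl rfl⟩
    · set s₁ := (blk [.op (.const 12 x), .ite (.lt 11 12) .skip
        (blk [.op (.sub 13 11 12), .op (.load 14 a 13),
          .ite (.eq 14 98) (ops [.store a 11 98, .store c 11 12]) .skip])]).eval s with hs₁
      have e : s₁.reg 11 = m ∧ s₁.reg 98 = 1 ∧ s₁.arr = s.arr := by
        rw [hs₁]
        by_cases hxm : x ≤ m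
        · have hAx : s.arr a (m - x) ≠ 1 := by
            rw [hA _ (by omega)]
            exact fun h => hx ⟨hxm, h⟩
          simp [Prog.eval, blk, ops, Op.exec, Test.holds, h11, h98, hAx,
            not_lt.2 hxm]
        · simp [Prog.eval, blk, ops, Op.exec, Test.holds, h11, h98,
            not_le.1 hxm]
      obtain ⟨e1, e2, e3⟩ := e
      obtain ⟨r1, r2, r3, r4⟩ := ih hl' hP' e1 e2 (by rw [e3]; exact hA) (by rw [e3]; exact hc)
      refine ⟨r1, fun j hj => by rw [r2 j hj, e3], ?_, r4⟩
      rw [r3, e3]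
      constructor
      · rintro (h | ⟨y, hy, h⟩)
        · exact Or.inl h
        · exact Or.inr ⟨y, by simp [hy], h⟩
      · rintro (h | ⟨y, hy, h⟩)
        · exact Or.inl h
        · rcases List.mem_cons.1 hy with rfl | hy
          · exact absurd h hx
          · exact Or.inr ⟨y, hy, h⟩

/-- Marks in array `a` the numbers up to `n` that are sums of elements of the list `l`, and stores
in array `c` a summand that can be split off. -/
def dpProg (a c : ℕ) (l : List ℕ) : Prog :=
  blk [ops [.const 98 1, .const 10 0, .store a 10 98],
    forTo 3 0 (blk [.op (.add 11 3 98), dpInner a c l])]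

theorem dpProg_frame {a c : ℕ} {l : List ℕ} {s s' : State} (h : Frame (dpProg a c l) s s') :
    (∀ x, x ∉ [3, 10, 11, 12, 13, 14, 98, 99] → s'.reg x = s.reg x) ∧
    (∀ x, x ≠ a → x ≠ c → s'.arr x = s.arr x) ∧ s'.qreg = s.qreg ∧ s'.qarr = s.qarr := by
  obtain ⟨h1, h2, h3, h4⟩ := dpInner_writes a c l
  refine ⟨fun x hx => h.reg x ?_, fun x hx hx' => h.arr x ?_, funext fun x => h.qreg x ?_,
    funext fun x => h.qarr x ?_⟩
  · simp only [List.mem_cons, not_or] at hx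
    simp [dpProg, blk, ops, forTo, Prog.regs, Op.regs, hx]
    exact fun h => by have := h1 x h; omega
  · simp [dpProg, blk, ops, forTo, Prog.arrs, Op.arrs, hx]
    exact fun h => by have := h2 x h; omega
  · simp [dpProg, blk, ops, forTo, Prog.qregs, Op.qregs, h3]
  · simp [dpProg, blk, ops, forTo, Prog.qarrs, Op.qarrs, h4]

/-- What `dpProg` establishes for the number `m`. -/
def DpOk (l : List ℕ) (A C : ℕ → ℕ) (m : ℕ) : Prop :=
  (A m = 1 ↔ m ∈ close {x | x ∈ l}) ∧
    (0 < m → A m = 1 → C m ∈ l ∧ C m ≤ m ∧ m - C m ∈ close {x | x ∈ l})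

theorem dpProg_wp {a c n : ℕ} (hac : a ≠ c) {l : List ℕ} (hl : ∀ x ∈ l, 0 < x) {s : State}
    (hn : s.reg 0 = n) (ha : ∀ m, s.arr a m = 0) :
    wp (dpProg a c l) (n * (12 * l.length + 10) + 10)
      (fun s' => (∀ m ≤ n, DpOk l (s'.arr a) (s'.arr c) m) ∧ s'.reg 98 = 1) s := by
  obtain ⟨w1, w2, w3, w4⟩ := dpInner_writes a c l
  refine (wp_cons (T₁ := 4) (T₂ := n * (12 * l.length + 4 + 5) + 3 + 1)
    (R := fun s' => s'.reg 98 = 1 ∧ s'.reg 0 = n ∧ s'.arr a = Function.update (s.arr a) 0 1)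
    (wp_eval rfl (le_refl 4) ?_) ?_).mono ?_ fun _ h => h
  · simp [Prog.eval, blk, ops, Op.exec, hn]
  · rintro s₁ ⟨h98, h0, harr⟩ -
    refine wp_last (wp_for (n := n) (fun k s' => s'.reg 98 = 1 ∧
      (∀ m ≤ k, DpOk l (s'.arr a) (s'.arr c) m) ∧ ∀ m, k < m → s'.arr a m = 0) h0 ?_ ?_
      (by decide) ?_ ?_) ?_
    · intro h
      simp [blk, Prog.regs, Op.regs] at h
      have := w1 3 h
      omega
    · intro h
      simp [blk, Prog.regs, Op.regs] at h
      have := w1 0 h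
      omega
    · refine ⟨by simpa [State.setReg] using h98, ?_, ?_⟩
      · intro m hm
        obtain rfl : m = 0 := by omega
        refine ⟨?_, fun h => absurd h (lt_irrefl 0)⟩
        simp [State.setReg, harr, zero_mem_close]
      · intro m hm
        simp [State.setReg, harr, ha, hm.ne']
    · rintro k hk s' hf ⟨i1, i2, i3⟩ hr
      refine (wp_cons (T₁ := 1) (T₂ := 12 * l.length + 1 + 1)
        (R := fun s'' => s'' = s'.setReg 11 (k + 1)) (wp_eval rfl le_rfl ?_) ?_).mono (by omega)
        fun _ h => h
      · simp [Prog.eval, Op.exec, State.setReg, hr, i1]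
      rintro s'' rfl -
      have hev := dpInner_eval (m := k + 1) hac (s'.arr a)
        (fun x => x ∈ l ∧ x ≤ k + 1 ∧ k + 1 - x ∈ close {x | x ∈ l}) l hl
        (fun x hx hxm h => ⟨hx, hxm, ((i2 _ (by have := hl x hx; omega)).1).1 h⟩)
        (s := s'.setReg 11 (k + 1)) (by simp [State.setReg]) (by simpa [State.setReg] using i1)
        (fun _ _ => rfl) (fun h => by
          simp only [State.setReg] at h
          rw [i3 _ (by omega)] at h
          exact absurd h (by norm_num))
      refine wp_last (R := fun t => (∀ j, j ≠ k + 1 → t.arr a j = s'.arr a j) ∧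
        (∀ j, j ≠ k + 1 → t.arr c j = s'.arr c j) ∧
        (t.arr a (k + 1) = 1 ↔ s'.arr a (k + 1) = 1 ∨
          ∃ x ∈ l, x ≤ k + 1 ∧ s'.arr a (k + 1 - x) = 1) ∧
        (t.arr a (k + 1) = 1 → t.arr c (k + 1) ∈ l ∧ t.arr c (k + 1) ≤ k + 1 ∧
          k + 1 - t.arr c (k + 1) ∈ close {x | x ∈ l}))
        (wp_eval (dpInner_loopFree a c l) (dpInner_cost a c l) hev) ?_
      rintro s'' ⟨r1, r2, r3, r4⟩ hf2
      refine ⟨?_, ?_, ?_⟩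
      · have : s''.reg 98 = 1 := by
          rw [hf2.reg 98 (fun h => by have := w1 _ h; omega)]
          simpa [State.setReg] using i1
        simpa [State.setReg] using this
      · intro m hm
        simp only [State.setReg]
        rcases Nat.lt_or_ge k m with h | h
        · obtain rfl : m = k + 1 := by omega
          refine ⟨?_, fun _ => r4⟩
          rw [r3, mem_close_iff_exists_sub (by omega), i3 _ (by omega)]
          constructor
          · rintro (h | ⟨x, hx, hxm, h⟩)
            · exact absurd h (by norm_num)
            · exact ⟨x, hx, hxm, (i2 _ (by have := hl x hx; omega)).1.1 h⟩
          · rintro ⟨x, hx, hxm, h⟩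
            exact Or.inr ⟨x, hx, hxm, (i2 _ (by have := hl x hx; omega)).1.2 h⟩
        · have := i2 m h
          unfold DpOk at this ⊢
          rwa [r1 m (by omega), r2 m (by omega)]
      · intro m hm
        simp only [State.setReg]
        rw [r1 m (by omega), i3 m (by omega)]
    · rintro s' ⟨i1, i2, -⟩ -
      exact ⟨i2, i1⟩
  · have : n * (12 * l.length + 4 + 5) ≤ n * (12 * l.length + 10) :=
      Nat.mul_le_mul_left _ (by omega)
    omega

end LCC

/-! ### A tournament tree -/

namespace LCC

/-- In the complete binary tree with leaves `N, …, 2 N - 1`, the leaf `N + q` is below node `i`. -/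
def Under (N q i : ℕ) : Prop := ∃ k, (N + q) / 2 ^ k = i

theorem Under.half {N q i : ℕ} (h : Under N q i) : Under N q (i / 2) := by
  obtain ⟨k, rfl⟩ := h
  exact ⟨k + 1, by rw [pow_succ, Nat.div_div_eq_div_mul]⟩

theorem Under.child {N q i : ℕ} (h : Under N q i) (hi : i < N) :
    Under N q (2 * i) ∨ Under N q (2 * i + 1) := by
  obtain ⟨k, hk⟩ := h
  cases k with
  | zero => simp at hk; omega
  | succ k =>
    rw [pow_succ, ← Nat.div_div_eq_div_mul] at hk
    have : (N + q) / 2 ^ k = 2 * i ∨ (N + q) / 2 ^ k = 2 * i + 1 := by omega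
    exact this.imp (fun h => ⟨k, h⟩) (fun h => ⟨k, h⟩)

theorem Under.leaf {N q p : ℕ} (h : Under N q (N + p)) (hq : q < N) : q = p := by
  obtain ⟨k, hk⟩ := h
  cases k with
  | zero => simpa using hk
  | succ k =>
    have h1 : (N + q) / 2 ^ (k + 1) ≤ (N + q) / 2 :=
      Nat.div_le_div_left (by rw [pow_succ]; have := Nat.one_le_two_pow (n := k); omega) two_pos
    omega

theorem under_root {K q : ℕ} (hq : q < 2 ^ K) : Under (2 ^ K) q 1 := by
  refine ⟨K, ?_⟩
  rw [Nat.add_div_left _ (by positivity), Nat.div_eq_of_lt hq]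

/-- The entry `win i` is the present leaf with the smallest key below node `i`, or `0` if there is
none; leaf `q` is present if `win (N + q) = q`, and absent if `win (N + q) = 0`. -/
def TreeNode (N : ℕ) (key : ℕ → ℚ) (win : ℕ → ℕ) (i : ℕ) : Prop :=
  (win i = 0 ∧ ∀ q < N, Under N q i → win (N + q) = 0) ∨
  (0 < win i ∧ win i < N ∧ Under N (win i) i ∧ win (N + win i) = win i ∧
    ∀ q < N, Under N q i → win (N + q) ≠ 0 → key (win i) ≤ key q)

theorem TreeNode.congr {N : ℕ} {key : ℕ → ℚ} {win win' : ℕ → ℕ} {i : ℕ}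
    (h : TreeNode N key win i) (hi : win' i = win i)
    (hl : ∀ q < N, Under N q i → win' (N + q) = win (N + q)) : TreeNode N key win' i := by
  rcases h with ⟨h1, h2⟩ | ⟨h1, h2, h3, h4, h5⟩
  · exact Or.inl ⟨hi.trans h1, fun q hq hu => (hl q hq hu).trans (h2 q hq hu)⟩
  · refine Or.inr ⟨hi ▸ h1, hi ▸ h2, hi ▸ h3, ?_, fun q hq hu hne => ?_⟩
    · rw [hi, hl _ h2 h3, h4]
    · rw [hi]
      exact h5 q hq hu (hl q hq hu ▸ hne)

/-- A node is consistent if its entry has been computed from those of its children. -/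
theorem TreeNode.combine {N : ℕ} {key : ℕ → ℚ} {win : ℕ → ℕ} {j : ℕ} (hj : j < N)
    (h1 : TreeNode N key win (2 * j)) (h2 : TreeNode N key win (2 * j + 1)) {v : ℕ}
    (hv : (win (2 * j) = 0 ∧ v = win (2 * j + 1)) ∨
      (win (2 * j) ≠ 0 ∧ win (2 * j + 1) = 0 ∧ v = win (2 * j)) ∨
      (win (2 * j) ≠ 0 ∧ win (2 * j + 1) ≠ 0 ∧
        key (win (2 * j + 1)) < key (win (2 * j)) ∧ v = win (2 * j + 1)) ∨
      (win (2 * j) ≠ 0 ∧ win (2 * j + 1) ≠ 0 ∧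
        ¬ key (win (2 * j + 1)) < key (win (2 * j)) ∧ v = win (2 * j))) :
    TreeNode N key (Function.update win j v) j := by
  have hleaf : ∀ q, Function.update win j v (N + q) = win (N + q) := fun q =>
    Function.update_of_ne (by omega) _ _
  unfold TreeNode at *
  simp only [hleaf, Function.update_self]
  have hu1 : ∀ q, Under N q (2 * j) → Under N q j := fun q h => by
    have := h.half
    rwa [Nat.mul_div_cancel_left _ two_pos] at this
  have hu2 : ∀ q, Under N q (2 * j + 1) → Under N q j := fun q h => by
    have := h.half
    rwa [show (2 * j + 1) / 2 = j by omega] at this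
  rcases h1 with ⟨a1, a2⟩ | ⟨a1, a2, a3, a4, a5⟩ <;>
    rcases h2 with ⟨b1, b2⟩ | ⟨b1, b2, b3, b4, b5⟩
  · left
    have : v = 0 := by omega
    exact ⟨this, fun q hq h => (h.child hj).elim (a2 q hq) (b2 q hq)⟩
  · right
    have : v = win (2 * j + 1) := by omega
    rw [this]
    exact ⟨b1, b2, hu2 _ b3, b4, fun q hq h hne => (h.child hj).elim
      (fun h => absurd (a2 q hq h) hne) (fun h => b5 q hq h hne)⟩
  · right
    have : v = win (2 * j) := by omega
    rw [this]
    exact ⟨a1, a2, hu1 _ a3, a4, fun q hq h hne => (h.child hj).elim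
      (fun h => a5 q hq h hne) (fun h => absurd (b2 q hq h) hne)⟩
  · right
    rcases hv with hv | hv | ⟨-, -, hlt, rfl⟩ | ⟨-, -, hlt, rfl⟩
    · omega
    · omega
    · exact ⟨b1, b2, hu2 _ b3, b4, fun q hq h hne => (h.child hj).elim
        (fun h => hlt.le.trans (a5 q hq h hne)) (fun h => b5 q hq h hne)⟩
    · exact ⟨a1, a2, hu1 _ a3, a4, fun q hq h hne => (h.child hj).elim
        (fun h => a5 q hq h hne) (fun h => (not_lt.1 hlt).trans (b5 q hq h hne))⟩

/-- One step towards the root. -/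
def putBody : Prog :=
  blk [ops [.half 26 26, .add 27 26 26, .add 28 27 98, .load 29 10 27, .load 30 10 28],
    .ite (.eq 29 97) (.op (.store 10 26 30)) (.ite (.eq 30 97) (.op (.store 10 26 29))
      (blk [ops [.qload 2 3 29, .qload 3 3 30],
        .ite (.qlt 3 2) (.op (.store 10 26 30)) (.op (.store 10 26 29))]))]

/-- Stores the entry in register `25` at the leaf of the position in register `22` and updates the
nodes on the path to the root. -/
def putProg : Prog :=
  blk [ops [.add 26 2 22, .store 10 26 25], .loop (.lt 98 26) putBody]

theorem putBody_eval {s : State} {j : ℕ} (h26 : s.reg 26 = j) (h97 : s.reg 97 = 0)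
    (h98 : s.reg 98 = 1) : (putBody.eval s).reg 26 = j / 2 ∧
      ∃ v, (putBody.eval s).arr 10 = Function.update (s.arr 10) (j / 2) v ∧
        ∀ l r : ℕ, s.arr 10 (2 * (j / 2)) = l → s.arr 10 (2 * (j / 2) + 1) = r →
          (l = 0 ∧ v = r) ∨ (l ≠ 0 ∧ r = 0 ∧ v = l) ∨
          (l ≠ 0 ∧ r ≠ 0 ∧ s.qarr 3 r < s.qarr 3 l ∧ v = r) ∨
          (l ≠ 0 ∧ r ≠ 0 ∧ ¬ s.qarr 3 r < s.qarr 3 l ∧ v = l) := by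
  by_cases h1 : s.arr 10 (2 * (j / 2)) = 0
  · simp [putBody, Prog.eval, blk, ops, Op.exec, Test.holds, h26, h97, h98, ← two_mul, h1]
  · by_cases h2 : s.arr 10 (2 * (j / 2) + 1) = 0
    · simp [putBody, Prog.eval, blk, ops, Op.exec, Test.holds, h26, h97, h98, ← two_mul, h1, h2]
    · by_cases h3 : s.qarr 3 (s.arr 10 (2 * (j / 2) + 1)) < s.qarr 3 (s.arr 10 (2 * (j / 2)))
      · simp [putBody, Prog.eval, blk, ops, Op.exec, Test.holds, h26, h97, h98, ← two_mul, h1, h2,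
          h3]
        exact ⟨_, rfl, Or.inl rfl⟩
      · simp [putBody, Prog.eval, blk, ops, Op.exec, Test.holds, h26, h97, h98, ← two_mul, h1, h2,
          h3]
        exact not_lt.1 h3

/-- Only the ancestors of a leaf have to be updated when the leaf changes, so an update takes time
`O(K)` for `2 ^ K` leaves. -/
theorem putProg_wp {K p x : ℕ} {s : State} (h2 : s.reg 2 = 2 ^ K) (h22 : s.reg 22 = p)
    (hp : p < 2 ^ K) (hp0 : 0 < p) (h25 : s.reg 25 = x) (hx : x = 0 ∨ x = p)
    (h97 : s.reg 97 = 0) (h98 : s.reg 98 = 1)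
    (hT : ∀ i, 1 ≤ i → i < 2 * 2 ^ K → ¬ Under (2 ^ K) p i →
      TreeNode (2 ^ K) (s.qarr 3) (s.arr 10) i) :
    wp putProg (21 * K + 10) (fun s' =>
      (∀ i, 1 ≤ i → i < 2 * 2 ^ K → TreeNode (2 ^ K) (s.qarr 3) (s'.arr 10) i) ∧
      s'.arr 10 (2 ^ K + p) = x ∧
      ∀ q < 2 ^ K, q ≠ p → s'.arr 10 (2 ^ K + q) = s.arr 10 (2 ^ K + q)) s := by
  set N := 2 ^ K with hN
  have hstrict : ∀ k l, k < l → (N + p) / 2 ^ l ≤ (N + p) / 2 ^ k / 2 := by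
    intro k l hkl
    rw [Nat.div_div_eq_div_mul, ← pow_succ]
    exact Nat.div_le_div_left (Nat.pow_le_pow_right two_pos hkl) (by positivity)
  refine (wp_cons (T₁ := 3) (T₂ := 21 * K + 1 + 1)
    (R := fun s' => s'.reg 26 = N + p ∧ s'.arr 10 = Function.update (s.arr 10) (N + p) x)
    (wp_eval rfl (le_refl 3) ?_) ?_).mono (by omega) fun _ h => h
  · simp [Prog.eval, blk, ops, Op.exec, h2, h22, h25]
  rintro s₁ ⟨h26, harr⟩ hf₁
  have f97 : s₁.reg 97 = 0 := by rw [hf₁.reg 97 (by decide), h97]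
  have f98 : s₁.reg 98 = 1 := by rw [hf₁.reg 98 (by decide), h98]
  have fq : s₁.qarr 3 = s.qarr 3 := hf₁.qarr 3 (by decide)
  -- after `k` steps, only the proper ancestors of the node reached may be inconsistent
  refine wp_last (wp_while (c := 20) (m := K) (fun m s' => ∃ k, m + k = K ∧
    s'.reg 26 = (N + p) / 2 ^ k ∧
    (∀ i, 1 ≤ i → i < 2 * N → (∀ l, k < l → i ≠ (N + p) / 2 ^ l) →
      TreeNode N (s.qarr 3) (s'.arr 10) i) ∧ s'.arr 10 (N + p) = x ∧
      ∀ q < N, q ≠ p → s'.arr 10 (N + q) = s.arr 10 (N + q)) ?_ ?_) ?_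
  · refine ⟨0, rfl, by simpa using h26, ?_, by simp [harr], ?_⟩
    · intro i h1 h3 hi
      by_cases hip : i = N + p
      · subst hip
        unfold TreeNode
        rw [harr, Function.update_self]
        rcases hx with rfl | rfl
        · left
          refine ⟨rfl, fun q hq hu => ?_⟩
          rw [hu.leaf hq, Function.update_self]
        · right
          refine ⟨hp0, hp, ⟨0, by simp⟩, by rw [Function.update_self], fun q hq hu _ => ?_⟩
          rw [hu.leaf hq]
      · have hu : ¬ Under N p i := by
          rintro ⟨l, hl⟩
          rcases Nat.eq_zero_or_pos l with rfl | h0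
          · simp at hl
            omega
          · exact hi l h0 hl.symm
        refine (hT i h1 h3 hu).congr (by rw [harr, Function.update_of_ne hip]) fun q _ hq => ?_
        rw [harr, Function.update_of_ne]
        intro h
        have : q = p := by omega
        exact hu (this ▸ hq)
    · intro q _ hqp
      rw [harr, Function.update_of_ne (by omega)]
  · rintro m s' hf ⟨k, hmk, i26, hnode, hleafp, hleaf⟩ hb
    have g97 : s'.reg 97 = 0 := by rw [hf.reg 97 (by decide), f97]
    have g98 : s'.reg 98 = 1 := by rw [hf.reg 98 (by decide), f98]
    have gq : s'.qarr 3 = s.qarr 3 := by rw [hf.qarr 3 (by decide), fq]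
    simp only [Test.holds, g98, i26] at hb
    have hkK : k < K := by
      by_contra hc
      obtain rfl : k = K := by omega
      rw [hN, Nat.add_div_left _ (by positivity), Nat.div_eq_of_lt hp] at hb
      omega
    have hjN : (N + p) / 2 ^ k / 2 < N := by
      have : (N + p) / 2 ^ k ≤ N + p := Nat.div_le_self _ _
      omega
    have hj1 : 1 ≤ (N + p) / 2 ^ k / 2 := by omega
    have hjk : (N + p) / 2 ^ (k + 1) = (N + p) / 2 ^ k / 2 := by
      rw [pow_succ, Nat.div_div_eq_div_mul]
    refine ⟨m - 1, by omega, wp_eval rfl ?_ ?_⟩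
    · rw [show m - (m - 1) = 1 by omega]
      decide
    obtain ⟨e26, v, earr, hv⟩ := putBody_eval i26 g97 g98
    rw [gq] at hv
    have hv := hv _ _ rfl rfl
    have hchild : ∀ i, (N + p) / 2 ^ k / 2 < i → ∀ l, k < l → i ≠ (N + p) / 2 ^ l := by
      intro i hi l hl h
      have := hstrict k l hl
      omega
    refine ⟨k + 1, by omega, by rw [e26, hjk], ?_, ?_, ?_⟩
    · intro i h1 h3 hi
      by_cases hij : i = (N + p) / 2 ^ k / 2
      · rw [hij, earr]
        exact TreeNode.combine hjN (hnode _ (by omega) (by omega) (hchild _ (by omega)))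
          (hnode _ (by omega) (by omega) (hchild _ (by omega))) hv
      · refine (hnode i h1 h3 fun l hl h => ?_).congr (by rw [earr, Function.update_of_ne hij])
          fun q _ _ => by rw [earr, Function.update_of_ne (by omega)]
        rcases Nat.lt_or_ge (k + 1) l with h' | h'
        · exact hi l h' h
        · obtain rfl : l = k + 1 := by omega
          exact hij (h.trans hjk)
    · rw [earr, Function.update_of_ne (by omega), hleafp]
    · intro q hq hqp
      rw [earr, Function.update_of_ne (by omega), hleaf q hq hqp]
  · rintro s' ⟨m, ⟨k, hmk, i26, hnode, hleafp, hleaf⟩, hb⟩ hf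
    have g98 : s'.reg 98 = 1 := by rw [hf.reg 98 (by decide), f98]
    simp only [Test.holds, g98, i26, not_lt] at hb
    refine ⟨fun i h1 h3 => hnode i h1 h3 fun l hl h => ?_, hleafp, hleaf⟩
    have := hstrict k l hl
    omega

end LCC

/-! ### Forests in memory -/

namespace LCC

/-- The representation of a forest `F` by arrays: `lab v` is a vertex of the component of `v`, the
same one for all vertices of the component; `sz` at this vertex is the size of the component; the
edges of `F` are the pairs `(EA x, EB x)` with `EA x ≠ EB x`. There is no such pair at
labels, so that there is room for an edge whenever a label disappears. -/
structure Forest (n : ℕ) (F : SimpleGraph (Fin n)) (lab sz EA EB : ℕ → ℕ) : Prop where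
  acyclic : F.IsAcyclic
  lab_lt : ∀ u < n, lab u < n
  lab_lab : ∀ u < n, lab (lab u) = lab u
  reach : ∀ u v : Fin n, F.Reachable u v ↔ lab u = lab v
  size : ∀ u : Fin n, sz (lab u) = compSize F u
  ea_lt : ∀ x < n, EA x < n
  eb_lt : ∀ x < n, EB x < n
  adj : ∀ u v : Fin n, F.Adj u v ↔ u ≠ v ∧ ∃ x < n, (EA x = u ∧ EB x = v) ∨ (EA x = v ∧ EB x = u)
  alive : ∀ x < n, lab x = x → EA x = EB x

theorem compSize_sup_edge {V : Type*} [Finite V] {F : SimpleGraph V} {a b : V}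
    (hab : ¬ F.Reachable a b) (u : V) : compSize (F ⊔ SimpleGraph.edge a b) u =
      open Classical in if F.Reachable u a ∨ F.Reachable u b then compSize F a + compSize F b
      else compSize F u := by
  split_ifs with h
  · have hset : {v | (F ⊔ SimpleGraph.edge a b).Reachable v u} =
        {v | F.Reachable v a} ∪ {v | F.Reachable v b} := by
      ext v
      simp only [reachable_sup_edge, Set.mem_union, Set.mem_ofPred_eq]
      constructor
      · rintro (h' | ⟨h', -⟩ | ⟨h', -⟩)
        · exact h.imp h'.trans h'.trans
        · exact Or.inl h'
        · exact Or.inr h'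
      · rintro (h' | h') <;> rcases h with h | h
        · exact Or.inl (h'.trans h.symm)
        · exact Or.inr (Or.inl ⟨h', h.symm⟩)
        · exact Or.inr (Or.inr ⟨h', h.symm⟩)
        · exact Or.inl (h'.trans h.symm)
    rw [compSize_eq_ncard, hset, Set.ncard_union_eq _ (Set.toFinite _) (Set.toFinite _),
      ← compSize_eq_ncard, ← compSize_eq_ncard]
    rw [Set.disjoint_left]
    intro v hv hv'
    exact hab ((SimpleGraph.Reachable.symm hv).trans hv')
  · rw [not_or] at h
    exact (compSize_congr (reachable_iff_of_sup_edge h.1 h.2)).symm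

/-- Joining two components: the label `lab b` disappears, and its slot takes the new edge. -/
theorem Forest.join {n : ℕ} {F : SimpleGraph (Fin n)} {lab sz EA EB lab' : ℕ → ℕ}
    (h : Forest n F lab sz EA EB) {a b : Fin n} (hab : lab a ≠ lab b)
    (hlab : ∀ x < n, lab' x = if lab x = lab b then lab a else lab x) :
    Forest n (F ⊔ SimpleGraph.edge a b) lab'
      (Function.update sz (lab a) (sz (lab a) + sz (lab b)))
      (Function.update EA (lab b) a) (Function.update EB (lab b) b) := by
  have hreach : ¬ F.Reachable a b := fun h' => hab ((h.reach a b).1 h')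
  have hne : a ≠ b := fun h' => hab (by rw [h'])
  have hTn := h.lab_lt b b.2
  constructor
  · exact h.acyclic.sup_edge_of_not_reachable hreach
  · intro u hu
    rw [hlab u hu]
    split_ifs
    · exact h.lab_lt a a.2
    · exact h.lab_lt u hu
  · intro u hu
    rw [hlab u hu]
    split_ifs with h1
    · rw [hlab _ (h.lab_lt a a.2), h.lab_lab a a.2, if_neg hab]
    · rw [hlab _ (h.lab_lt u hu), h.lab_lab u hu, if_neg h1]
  · intro u v
    rw [reachable_sup_edge, h.reach, h.reach, h.reach, h.reach, h.reach, hlab u u.2, hlab v v.2]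
    split_ifs <;> grind
  · intro u
    rw [compSize_sup_edge hreach, hlab u u.2]
    have ha := h.size a
    have hb := h.size b
    have hu := h.size u
    simp only [h.reach]
    by_cases h1 : lab u = lab b
    · rw [if_pos h1, Function.update_self, if_pos (Or.inr h1), ha, hb]
    · rw [if_neg h1]
      by_cases h2 : lab u = lab a
      · rw [h2, Function.update_self, if_pos (Or.inl rfl), ha, hb]
      · rw [Function.update_of_ne h2, if_neg (by tauto), hu]
  · intro x hx
    rw [Function.update_apply]
    split_ifs
    · exact a.2
    · exact h.ea_lt x hx
  · intro x hx
    rw [Function.update_apply]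
    split_ifs
    · exact b.2
    · exact h.eb_lt x hx
  · intro u v
    have halive := h.alive (lab b) hTn (h.lab_lab b b.2)
    rw [SimpleGraph.sup_adj, SimpleGraph.edge_adj, h.adj]
    constructor
    · rintro (⟨huv, x, hx, he⟩ | ⟨he, huv⟩)
      · refine ⟨huv, x, hx, ?_⟩
        have hxT : x ≠ lab b := by
          rintro rfl
          rw [halive] at he
          exact huv (Fin.ext (by omega))
        rwa [Function.update_of_ne hxT, Function.update_of_ne hxT]
      · refine ⟨huv, lab b, hTn, ?_⟩
        rw [Function.update_self, Function.update_self]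
        rcases he with ⟨rfl, rfl⟩ | ⟨rfl, rfl⟩
        · exact Or.inl ⟨rfl, rfl⟩
        · exact Or.inr ⟨rfl, rfl⟩
    · rintro ⟨huv, x, hx, he⟩
      by_cases hxT : x = lab b
      · subst hxT
        rw [Function.update_self, Function.update_self] at he
        right
        refine ⟨he.imp (fun h => ⟨?_, ?_⟩) (fun h => ⟨?_, ?_⟩), huv⟩ <;> apply Fin.ext <;> omega
      · rw [Function.update_of_ne hxT, Function.update_of_ne hxT] at he
        exact Or.inl ⟨huv, x, hx, he⟩
  · intro x hx hxx
    rw [hlab x hx] at hxx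
    have hxb : x ≠ lab b := by
      rintro rfl
      rw [h.lab_lab b b.2, if_pos rfl] at hxx
      exact hab hxx
    rw [Function.update_of_ne hxb, Function.update_of_ne hxb]
    split_ifs at hxx with h1
    · rw [← hxx, h.lab_lab a a.2] at h1
      exact absurd h1 hab
    · exact h.alive x hx hxx

/-- Joins the components with labels in registers `34` and `35` by the edge between the vertices in
registers `32` and `33`. -/
def joinProg : Prog :=
  blk [ops [.store 11 35 32, .store 12 35 33, .load 60 6 34, .load 61 6 35, .add 60 60 61,
    .store 6 34 60],
    forTo 62 0 (blk [.op (.load 63 5 62), .ite (.eq 63 35) (.op (.store 5 62 34)) .skip])]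

theorem joinProg_wp {n : ℕ} {F : SimpleGraph (Fin n)} {s : State} (hn : s.reg 0 = n)
    (h : Forest n F (s.arr 5) (s.arr 6) (s.arr 11) (s.arr 12)) {a b : Fin n}
    (ha : s.reg 32 = a) (hb : s.reg 33 = b) (hS : s.reg 34 = s.arr 5 a)
    (hT : s.reg 35 = s.arr 5 b) (hab : s.arr 5 a ≠ s.arr 5 b) :
    wp joinProg (n * 9 + 20) (fun s' =>
      Forest n (F ⊔ SimpleGraph.edge a b) (s'.arr 5) (s'.arr 6) (s'.arr 11) (s'.arr 12) ∧
      (∀ x < n, s'.arr 5 x = if s.arr 5 x = s.arr 5 b then s.arr 5 a else s.arr 5 x) ∧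
      s'.arr 6 (s.arr 5 a) = s.arr 6 (s.arr 5 a) + s.arr 6 (s.arr 5 b) ∧
      ∀ x, x ≠ s.arr 5 a → s'.arr 6 x = s.arr 6 x) s := by
  refine (wp_cons (T₁ := 7) (T₂ := n * (4 + 5) + 3 + 1)
    (R := fun s' => s'.arr 6 = Function.update (s.arr 6) (s.arr 5 a)
        (s.arr 6 (s.arr 5 a) + s.arr 6 (s.arr 5 b)) ∧
      s'.arr 11 = Function.update (s.arr 11) (s.arr 5 b) a ∧
      s'.arr 12 = Function.update (s.arr 12) (s.arr 5 b) b)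
    (wp_eval rfl (le_refl 7) ?_) ?_).mono (by omega) fun _ h => h
  · simp [Prog.eval, blk, ops, Op.exec, ha, hb, hS, hT]
  rintro s₁ ⟨e6, e11, e12⟩ hf₁
  have f0 : s₁.reg 0 = n := by rw [hf₁.reg 0 (by decide), hn]
  have f34 : s₁.reg 34 = s.arr 5 a := by rw [hf₁.reg 34 (by decide), hS]
  have f35 : s₁.reg 35 = s.arr 5 b := by rw [hf₁.reg 35 (by decide), hT]
  have f5 : s₁.arr 5 = s.arr 5 := hf₁.arr 5 (by decide)
  refine wp_last (wp_for (n := n) (fun k s' =>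
    (∀ x < k, s'.arr 5 x = if s.arr 5 x = s.arr 5 b then s.arr 5 a else s.arr 5 x) ∧
    ∀ x, k ≤ x → s'.arr 5 x = s.arr 5 x) f0 (by decide) (by decide) (by decide) ?_ ?_) ?_
  · exact ⟨fun x hx => absurd hx (Nat.not_lt_zero x), fun x _ => by simp [State.setReg, f5]⟩
  · rintro k hk s' hf ⟨i1, i2⟩ hr
    have g34 : s'.reg 34 = s.arr 5 a := by rw [hf.reg 34 (by decide), f34]
    have g35 : s'.reg 35 = s.arr 5 b := by rw [hf.reg 35 (by decide), f35]
    refine wp_eval rfl (le_refl 4) ?_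
    have i2k := i2 k le_rfl
    by_cases hc : s.arr 5 k = s.arr 5 b
    · simp only [Prog.eval, blk, Op.exec, Test.holds, State.setReg, hr, g34, g35, i2k, hc, ne_eq,
        Nat.reduceEqDiff, not_false_eq_true, Function.update_of_ne, Function.update_self, if_true]
      constructor
      · intro x hx
        by_cases hxk : x = k
        · subst hxk
          rw [Function.update_self, if_pos hc]
        · rw [Function.update_of_ne hxk, i1 x (by omega)]
      · intro x hx
        rw [Function.update_of_ne (by omega), i2 x (by omega)]
    · simp only [Prog.eval, blk, Op.exec, Test.holds, State.setReg, hr, g35, i2k, hc, ne_eq,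
        Nat.reduceEqDiff, not_false_eq_true, Function.update_of_ne, Function.update_self, if_false]
      constructor
      · intro x hx
        by_cases hxk : x = k
        · subst hxk
          rw [if_neg hc, i2k]
        · exact i1 x (by omega)
      · intro x hx
        exact i2 x (by omega)
  · rintro s' ⟨i1, -⟩ hf
    rw [hf.arr 6 (by decide), hf.arr 11 (by decide), hf.arr 12 (by decide), e6, e11, e12]
    exact ⟨h.join hab i1, i1, Function.update_self .., fun x hx => Function.update_of_ne hx _ _⟩

end LCC

/-! ### Pairs of components and their event times -/

namespace LCC

/-- The position of the entry `(a, b)` in an array that represents an `n × n` matrix. Position `0`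
is not used, so that `0` can stand for a missing entry. -/
def pos (n a b : ℕ) : ℕ := a * n + b + 1

theorem pos_inj {n a b a' b' : ℕ} (hb : b < n) (hb' : b' < n) :
    pos n a b = pos n a' b' ↔ a = a' ∧ b = b' := by
  constructor
  · intro h
    unfold pos at h
    have h' : a * n + b = a' * n + b' := by omega
    have e1 : (a * n + b) / n = a := by
      rw [mul_comm, Nat.mul_add_div (by omega), Nat.div_eq_of_lt hb, add_zero]
    have e2 : (a' * n + b') / n = a' := by
      rw [mul_comm, Nat.mul_add_div (by omega), Nat.div_eq_of_lt hb', add_zero]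
    have : a = a' := by rw [← e1, h', e2]
    subst this
    exact ⟨rfl, by omega⟩
  · rintro ⟨rfl, rfl⟩
    rfl

theorem pos_lt {n a b : ℕ} (ha : a < n) (hb : b < n) : pos n a b < n * n + 1 := by
  have : (a + 1) * n ≤ n * n := Nat.mul_le_mul_right _ ha
  rw [add_mul] at this
  unfold pos
  omega

/-- The constants on which all parts of the program rely. -/
structure Consts (n K : ℕ) (s : State) : Prop where
  n_eq : s.reg 0 = n
  size_eq : s.reg 2 = 2 ^ K
  zero : s.reg 97 = 0
  one : s.reg 98 = 1
  qzero : s.qreg 10 = 0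
  off : ∀ a < n, s.arr 4 a = a * n + 1
  le : n * n + 1 ≤ 2 ^ K

theorem Consts.of_frame {n K : ℕ} {s s' : State} {p : Prog} (h : Consts n K s) (hf : Frame p s s')
    (h1 : ∀ x ∈ [0, 2, 97, 98], x ∉ p.regs := by decide) (h2 : 4 ∉ p.arrs := by decide)
    (h3 : 10 ∉ p.qregs := by decide) : Consts n K s' := by
  constructor
  · rw [hf.reg 0 (h1 0 (by simp)), h.n_eq]
  · rw [hf.reg 2 (h1 2 (by simp)), h.size_eq]
  · rw [hf.reg 97 (h1 97 (by simp)), h.zero]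
  · rw [hf.reg 98 (h1 98 (by simp)), h.one]
  · rw [hf.qreg 10 h3, h.qzero]
  · rw [hf.arr 4 h2]
    exact h.off
  · exact h.le

theorem Consts.pos_lt {n K : ℕ} {s : State} (h : Consts n K s) {a b : ℕ} (ha : a < n)
    (hb : b < n) : pos n a b < 2 ^ K := (LCC.pos_lt ha hb).trans_le h.le

/-- The tournament tree in array `10`, with keys in number array `3`, is consistent. -/
def Tree (K : ℕ) (s : State) : Prop :=
  ∀ i, 1 ≤ i → i < 2 * 2 ^ K → TreeNode (2 ^ K) (s.qarr 3) (s.arr 10) i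

theorem TreeNode.congr_key {N : ℕ} {key key' : ℕ → ℚ} {win : ℕ → ℕ} {i : ℕ}
    (h : TreeNode N key win i) (hk : ∀ q, Under N q i → key' q = key q) :
    TreeNode N key' win i := by
  rcases h with h | ⟨h1, h2, h3, h4, h5⟩
  · exact Or.inl h
  · refine Or.inr ⟨h1, h2, h3, h4, fun q hq hu hne => ?_⟩
    rw [hk _ h3, hk _ hu]
    exact h5 q hq hu hne

/-- `a` and `b` are labels of distinct components, at least one of which is active. -/
def Cand (s : State) (a b : ℕ) : Prop :=
  s.arr 5 a = a ∧ s.arr 5 b = b ∧ a ≠ b ∧ 0 < s.arr 7 a + s.arr 7 b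

/-- The tournament tree correctly represents the pair `(a, b)` of components. -/
def LeafOk (n K : ℕ) (s : State) (a b : ℕ) : Prop :=
  open Classical in
  s.arr 10 (2 ^ K + pos n a b) = (if Cand s a b then pos n a b else 0) ∧
  (Cand s a b → s.qarr 3 (pos n a b) * ((s.arr 7 a : ℚ) + (s.arr 7 b : ℚ)) = s.qarr 2 (pos n a b))

/-- The tournament tree is consistent, and it correctly represents all pairs that satisfy `P`. -/
structure Leaves (n K : ℕ) (P : ℕ → ℕ → Prop) (s : State) : Prop where
  tree : Tree K s
  isPos : ∀ q < 2 ^ K, s.arr 10 (2 ^ K + q) ≠ 0 → ∃ a < n, ∃ b < n, q = pos n a b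
  leaf : ∀ a < n, ∀ b < n, P a b → LeafOk n K s a b

theorem Leaves.congr {n K : ℕ} {P P' : ℕ → ℕ → Prop} {s s' : State} (h : Leaves n K P s)
    (h10 : s'.arr 10 = s.arr 10) (h3 : s'.qarr 3 = s.qarr 3)
    (hl : ∀ a < n, ∀ b < n, P' a b → P a b ∧ (LeafOk n K s a b → LeafOk n K s' a b)) :
    Leaves n K P' s' := by
  refine ⟨fun i h1 h2 => ?_, fun q hq hne => h.isPos q hq (by rwa [h10] at hne), ?_⟩
  · rw [h10, h3]
    exact h.tree i h1 h2
  · intro a ha b hb hP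
    obtain ⟨h1, h2⟩ := hl a ha b hb hP
    exact h2 (h.leaf a ha b hb h1)

/-- Recomputes the entry of the tournament tree for the pair in registers `20` and `21`. -/
def refreshProg : Prog :=
  blk [ops [.load 22 4 20, .add 22 22 21, .load 23 7 20, .load 24 7 21, .qload 1 2 22,
      .const 25 0, .load 27 5 20, .load 28 5 21],
    .ite (.eq 20 21) .skip (.ite (.eq 27 20) (.ite (.eq 28 21)
      (.ite (.eq 23 24) (.ite (.eq 23 98) (ops [.qhalf 1 1, .add 25 22 97]) .skip)
        (.op (.add 25 22 97))) .skip) .skip),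
    .op (.qstore 3 22 1), putProg]

/-- The event time of a pair of components is its reduced weight, halved if both are active; the
pair is not in the tree unless one is. -/
theorem refreshProg_wp {n K a b : ℕ} {s : State} {P : ℕ → ℕ → Prop} (hc : Consts n K s)
    (ha : s.reg 20 = a) (hb : s.reg 21 = b) (han : a < n) (hbn : b < n)
    (hact : ∀ x < n, s.arr 7 x ≤ 1) (hT : Leaves n K P s) :
    wp refreshProg (21 * K + 35) (Leaves n K fun x y => P x y ∨ x = a ∧ y = b) s := by
  classical
  set p := pos n a b with hp
  have hpK : p < 2 ^ K := hc.pos_lt han hbn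
  have hp0 : 0 < p := Nat.succ_pos _
  refine (wp_cons (T₁ := 9) (T₂ := 8 + (1 + (21 * K + 10 + 1)))
    (R := fun s' => s'.reg 22 = p ∧ s'.reg 23 = s.arr 7 a ∧ s'.reg 24 = s.arr 7 b ∧
      s'.qreg 1 = s.qarr 2 p ∧ s'.reg 25 = 0 ∧ s'.reg 27 = s.arr 5 a ∧ s'.reg 28 = s.arr 5 b)
    (wp_eval rfl (le_refl 9) ?_) ?_).mono (by omega) fun _ h => h
  · have : a * n + 1 + b = p := by rw [hp, pos]; omega
    simp [Prog.eval, blk, ops, Op.exec, ha, hb, hc.off a han, this]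
  rintro s₁ ⟨e22, e23, e24, e1, e25, e27, e28⟩ hf₁
  have c₁ := hc.of_frame hf₁
  have e20 : s₁.reg 20 = a := by rw [hf₁.reg 20 (by decide), ha]
  have e21 : s₁.reg 21 = b := by rw [hf₁.reg 21 (by decide), hb]
  refine wp_cons (T₁ := 8)
    (R := fun s' => s'.reg 22 = p ∧ s'.reg 25 = (if Cand s a b then p else 0) ∧
      (Cand s a b → s'.qreg 1 * ((s.arr 7 a : ℚ) + (s.arr 7 b : ℚ)) = s.qarr 2 p))
    (wp_eval rfl (by decide) ?_) ?_
  · have hcase : (s.arr 7 a = 0 ∨ s.arr 7 a = 1) ∧ (s.arr 7 b = 0 ∨ s.arr 7 b = 1) := by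
      have := hact a han
      have := hact b hbn
      omega
    unfold Cand
    by_cases h1 : a = b
    · simp [Prog.eval, Test.holds, e20, e21, h1, e22, e25]
    by_cases h2 : s.arr 5 a = a
    swap
    · simp [Prog.eval, Test.holds, e20, e21, h1, e22, e25, e27, h2]
    by_cases h3 : s.arr 5 b = b
    swap
    · simp [Prog.eval, Test.holds, e20, e21, h1, e22, e25, e27, e28, h2, h3]
    obtain ⟨h | h, h' | h'⟩ := hcase <;>
      simp [Prog.eval, blk, ops, Op.exec, Test.holds, e20, e21, e22, e23, e24, e1, e25, e27, e28,
        h, h', h1, h2, h3, c₁.one, c₁.zero]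
    ring
  rintro s₂ ⟨g22, g25, g1⟩ hf₂
  have c₂ := c₁.of_frame hf₂
  have hk2 : s₂.qarr 3 = s.qarr 3 := by rw [hf₂.qarr 3 (by decide), hf₁.qarr 3 (by decide)]
  have hw2 : s₂.arr 10 = s.arr 10 := by rw [hf₂.arr 10 (by decide), hf₁.arr 10 (by decide)]
  refine wp_cons (T₁ := 1)
    (R := fun s' => s'.qarr 3 = Function.update (s.qarr 3) p (s₂.qreg 1))
    (wp_eval rfl (le_refl 1) ?_) ?_
  · simp [Prog.eval, Op.exec, g22, hk2]
  rintro s₃ hk3 hf₃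
  have c₃ := c₂.of_frame hf₃
  have hw3 : s₃.arr 10 = s.arr 10 := by rw [hf₃.arr 10 (by decide), hw2]
  refine wp_last (putProg_wp (x := if Cand s a b then p else 0) c₃.size_eq
    (by rw [hf₃.reg 22 (by decide), g22]) hpK hp0 (by rw [hf₃.reg 25 (by decide), g25])
    (by split_ifs <;> simp) c₃.zero c₃.one ?_) ?_
  · intro i h1 h2 hu
    rw [hw3, hk3]
    refine (hT.tree i h1 h2).congr_key fun q hq => Function.update_of_ne ?_ _ _
    rintro rfl
    exact hu hq
  · rintro s' ⟨r1, r2, r3⟩ hf'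
    have hk' : s'.qarr 3 = s₃.qarr 3 := hf'.qarr 3 (by decide)
    have h5 : s'.arr 5 = s.arr 5 := by
      rw [hf'.arr 5 (by decide), hf₃.arr 5 (by decide), hf₂.arr 5 (by decide),
        hf₁.arr 5 (by decide)]
    have h7 : s'.arr 7 = s.arr 7 := by
      rw [hf'.arr 7 (by decide), hf₃.arr 7 (by decide), hf₂.arr 7 (by decide),
        hf₁.arr 7 (by decide)]
    have hq2 : s'.qarr 2 = s.qarr 2 := by
      rw [hf'.qarr 2 (by decide), hf₃.qarr 2 (by decide), hf₂.qarr 2 (by decide),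
        hf₁.qarr 2 (by decide)]
    have hcand : ∀ x y, Cand s' x y ↔ Cand s x y := fun x y => by simp [Cand, h5, h7]
    refine ⟨fun i h1 h2 => ?_, fun q hq hne => ?_, fun x hx y hy hP => ?_⟩
    · rw [hk']
      exact r1 i h1 h2
    · by_cases hqp : q = p
      · exact ⟨a, han, b, hbn, hqp⟩
      · rw [r3 q hq hqp, hw3] at hne
        exact hT.isPos q hq hne
    · unfold LeafOk
      simp only [hcand, h7, hq2, hk', hk3]
      by_cases hxy : x = a ∧ y = b
      · obtain ⟨rfl, rfl⟩ := hxy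
        exact ⟨r2, fun h => by rw [Function.update_self]; exact g1 h⟩
      · have hne : pos n x y ≠ p := fun h => hxy ((pos_inj hy hbn).1 h)
        obtain ⟨l1, l2⟩ := hT.leaf x hx y hy (hP.resolve_right hxy)
        rw [r3 _ (hc.pos_lt hx hy) hne, hw3, Function.update_of_ne hne]
        exact ⟨l1, l2⟩

end LCC

/-! ### Joining two components of the growing forest -/

namespace LCC

/-- Recomputes the entry of the tournament tree for the pair in registers `x` and `y`. -/
def refreshAt (x y : ℕ) : Prog := blk [ops [.add 20 x 97, .add 21 y 97], refreshProg]

theorem refreshAt_wp {n K a b x y : ℕ} {s : State} {P : ℕ → ℕ → Prop} (hc : Consts n K s)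
    (ha : s.reg x = a) (hb : s.reg y = b) (hy : y ≠ 20) (han : a < n) (hbn : b < n)
    (hact : ∀ x < n, s.arr 7 x ≤ 1) (hT : Leaves n K P s) :
    wp (refreshAt x y) (21 * K + 39) (Leaves n K fun i j => P i j ∨ i = a ∧ j = b) s := by
  refine (wp_cons (T₁ := 3) (T₂ := 21 * K + 35 + 1)
    (R := fun s' => s'.reg 20 = a ∧ s'.reg 21 = b)
    (wp_eval rfl (le_refl 3) ?_) ?_).mono (by omega) fun _ h => h
  · simp [Prog.eval, blk, ops, Op.exec, ha, hb, hc.zero, hy]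
  rintro s₁ ⟨e20, e21⟩ hf
  have hc₁ := hc.of_frame hf (by simp [ops, blk, Prog.regs, Op.regs])
    (by simp [ops, blk, Prog.arrs, Op.arrs]) (by simp [ops, blk, Prog.qregs, Op.qregs])
  have hA : ∀ a, s₁.arr a = s.arr a := fun a => hf.arr a (by simp [ops, blk, Prog.arrs, Op.arrs])
  have hQ : ∀ a, s₁.qarr a = s.qarr a := fun a =>
    hf.qarr a (by simp [ops, blk, Prog.qarrs, Op.qarrs])
  refine wp_last (refreshProg_wp hc₁ e20 e21 han hbn (by rwa [hA]) (hT.congr (hA 10) (hQ 3)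
    fun _ _ _ _ h => ⟨h, fun h => ?_⟩)) fun s' h _ => h
  unfold LeafOk Cand at *
  rwa [hA, hA, hA, hQ, hQ]

/-- Recomputes the entries of the tournament tree for all pairs that contain one of the labels in
registers `34` and `35`. -/
def refreshRow : Prog :=
  forTo 41 0 (blk [refreshAt 34 41, refreshAt 41 34, refreshAt 35 41, refreshAt 41 35])

/-- After a change of the components with labels `S` and `T`, only `O(n)` pairs are out of date. -/
theorem refreshRow_wp {n K S T : ℕ} {s : State} (hc : Consts n K s) (hS : s.reg 34 = S)
    (hT : s.reg 35 = T) (hSn : S < n) (hTn : T < n) (hact : ∀ x < n, s.arr 7 x ≤ 1)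
    (hL : Leaves n K (fun a b => a ≠ S ∧ a ≠ T ∧ b ≠ S ∧ b ≠ T) s) :
    wp refreshRow (n * (84 * K + 165) + 3) (Leaves n K fun _ _ => True) s := by
  refine (wp_for (n := n) (T := 84 * K + 160) (fun k s' => Leaves n K (fun a b =>
    ((a = S ∨ a = T) → b < k) ∧ ((b = S ∨ b = T) → a < k)) s') hc.n_eq (by decide) (by decide)
    (by decide) ?_ ?_).mono (le_refl _) ?_
  · refine hL.congr rfl rfl fun a _ b _ h => ⟨?_, fun h => h⟩
    simpa [not_or, and_assoc] using h
  · intro k hk s' hf hI hr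
    have c₀ : Consts n K s' := hc.of_frame hf
    have a₀ : ∀ x < n, s'.arr 7 x ≤ 1 := by rwa [hf.arr 7 (by decide)]
    have r34 : s'.reg 34 = S := by rw [hf.reg 34 (by decide), hS]
    have r35 : s'.reg 35 = T := by rw [hf.reg 35 (by decide), hT]
    refine (wp_cons (T₂ := 63 * K + 118) (refreshAt_wp c₀ r34 hr (by decide) hSn hk a₀ hI) ?_).mono
      (by omega) fun _ h => h
    intro s₁ h₁ f₁
    have c₁ : Consts n K s₁ := c₀.of_frame f₁
    have a₁ : ∀ x < n, s₁.arr 7 x ≤ 1 := by rwa [f₁.arr 7 (by decide)]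
    have k₁ : s₁.reg 41 = k := by rw [f₁.reg 41 (by decide), hr]
    rw [← f₁.reg 34 (by decide)] at r34
    rw [← f₁.reg 35 (by decide)] at r35
    refine (wp_cons (T₂ := 42 * K + 79) (refreshAt_wp c₁ k₁ r34 (by decide) hk hSn a₁ h₁) ?_).mono
      (by omega) fun _ h => h
    intro s₂ h₂ f₂
    have c₂ : Consts n K s₂ := c₁.of_frame f₂
    have a₂ : ∀ x < n, s₂.arr 7 x ≤ 1 := by rwa [f₂.arr 7 (by decide)]
    have k₂ : s₂.reg 41 = k := by rw [f₂.reg 41 (by decide), k₁]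
    rw [← f₂.reg 35 (by decide)] at r35
    refine (wp_cons (T₂ := 21 * K + 40) (refreshAt_wp c₂ r35 k₂ (by decide) hTn hk a₂ h₂) ?_).mono
      (by omega) fun _ h => h
    intro s₃ h₃ f₃
    have c₃ : Consts n K s₃ := c₂.of_frame f₃
    have a₃ : ∀ x < n, s₃.arr 7 x ≤ 1 := by rwa [f₃.arr 7 (by decide)]
    have k₃ : s₃.reg 41 = k := by rw [f₃.reg 41 (by decide), k₂]
    rw [← f₃.reg 35 (by decide)] at r35
    refine (wp_last (refreshAt_wp c₃ k₃ r35 (by decide) hk hTn a₃ h₃) ?_).mono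
      (by omega) fun _ h => h
    intro s₄ h₄ f₄
    refine h₄.congr rfl rfl fun a _ b _ h => ⟨?_, fun h => h⟩
    grind
  · intro s' h
    exact h.congr rfl rfl fun a ha b hb _ => ⟨⟨fun _ => hb, fun _ => ha⟩, fun h => h⟩

/-- The matrix entry at `(a, b)` of number array `2` is the smallest reduced weight of an edge from
the component with label `a` to the component with label `b`, and index arrays `8` and `9` contain
the ends of such an edge. -/
def KeyOk {n : ℕ} (W : Fin n → Fin n → ℕ) (lab : ℕ → ℕ) (D : Fin n → ℚ) (s : State)
    (a b : ℕ) : Prop :=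
  (∀ u v : Fin n, lab u = a → lab v = b → s.qarr 2 (pos n a b) ≤ W u v - D u - D v) ∧
  ∃ u v : Fin n, lab u = a ∧ lab v = b ∧ s.arr 8 (pos n a b) = u ∧ s.arr 9 (pos n a b) = v ∧
    s.qarr 2 (pos n a b) = W u v - D u - D v

theorem KeyOk.congr {n : ℕ} {W : Fin n → Fin n → ℕ} {lab : ℕ → ℕ} {D : Fin n → ℚ} {s s' : State}
    {a b : ℕ} (h : KeyOk W lab D s a b) (h2 : s'.qarr 2 (pos n a b) = s.qarr 2 (pos n a b))
    (h8 : s'.arr 8 (pos n a b) = s.arr 8 (pos n a b))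
    (h9 : s'.arr 9 (pos n a b) = s.arr 9 (pos n a b)) : KeyOk W lab D s' a b := by
  unfold KeyOk
  rwa [h2, h8, h9]

theorem KeyOk.symm {n : ℕ} {W : Fin n → Fin n → ℕ} (hW : ∀ u v, W u v = W v u) {lab : ℕ → ℕ}
    {D : Fin n → ℚ} {s s' : State} {a b : ℕ} (h : KeyOk W lab D s a b)
    (h2 : s'.qarr 2 (pos n b a) = s.qarr 2 (pos n a b))
    (h8 : s'.arr 8 (pos n b a) = s.arr 9 (pos n a b))
    (h9 : s'.arr 9 (pos n b a) = s.arr 8 (pos n a b)) : KeyOk W lab D s' b a := by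
  obtain ⟨h1, u, v, hu, hv, e8, e9, e2⟩ := h
  refine ⟨fun v u hv hu => ?_, v, u, hv, hu, by rw [h8, e9], by rw [h9, e8], ?_⟩
  · rw [h2, hW v u, sub_right_comm]
    exact h1 u v hu hv
  · rw [h2, hW v u, sub_right_comm, e2]

/-- Computes the reduced weights between the joined component, with label in register `34`, and
the component with label in register `41`. -/
def keyBody : Prog :=
  blk [.op (.load 42 5 41), .ite (.eq 42 41) (.ite (.eq 41 34) .skip
    (blk [ops [.load 43 4 34, .add 43 43 41, .load 44 4 35, .add 44 44 41, .load 45 4 41,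
        .add 45 45 34, .qload 7 2 43, .qsub 7 7 5, .qload 8 2 44, .qsub 8 8 6, .add 46 43 97],
      .ite (.qlt 8 7) (ops [.add 46 44 97, .qadd 7 8 10]) .skip,
      ops [.load 47 8 46, .load 48 9 46, .store 8 43 47, .store 9 43 48, .store 8 45 48,
        .store 9 45 47, .qstore 2 43 7, .qstore 2 45 7]])) .skip]

theorem keyBody_eval {n K S T R : ℕ} {s : State} (hc : Consts n K s) (hS : s.reg 34 = S)
    (hT : s.reg 35 = T) (hR : s.reg 41 = R) (hSn : S < n) (hTn : T < n) (hRn : R < n)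
    (hRR : s.arr 5 R = R) (hRS : R ≠ S) :
    ∃ p k, ((p = pos n S R ∧ k = s.qarr 2 p - s.qreg 5) ∨
        (p = pos n T R ∧ k = s.qarr 2 p - s.qreg 6)) ∧
      k ≤ s.qarr 2 (pos n S R) - s.qreg 5 ∧ k ≤ s.qarr 2 (pos n T R) - s.qreg 6 ∧
      (keyBody.eval s).qarr 2 =
        Function.update (Function.update (s.qarr 2) (pos n S R) k) (pos n R S) k ∧
      (keyBody.eval s).arr 8 =
        Function.update (Function.update (s.arr 8) (pos n S R) (s.arr 8 p)) (pos n R S)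
          (s.arr 9 p) ∧
      (keyBody.eval s).arr 9 =
        Function.update (Function.update (s.arr 9) (pos n S R) (s.arr 9 p)) (pos n R S)
          (s.arr 8 p) := by
  have e1 : S * n + 1 + R = pos n S R := by rw [pos]; omega
  have e2 : T * n + 1 + R = pos n T R := by rw [pos]; omega
  have e3 : R * n + 1 + S = pos n R S := by rw [pos]; omega
  by_cases hlt : s.qarr 2 (pos n T R) - s.qreg 6 < s.qarr 2 (pos n S R) - s.qreg 5
  · refine ⟨pos n T R, _, Or.inr ⟨rfl, rfl⟩, hlt.le, le_rfl, ?_⟩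
    simp [keyBody, Prog.eval, blk, ops, Op.exec, Test.holds, hS, hT, hR, hRR, hRS, hc.off _ hSn,
      hc.off _ hTn, hc.off _ hRn, e1, e2, e3, hc.zero, hc.qzero, hlt]
  · refine ⟨pos n S R, _, Or.inl ⟨rfl, rfl⟩, le_rfl, not_lt.1 hlt, ?_⟩
    simp [keyBody, Prog.eval, blk, ops, Op.exec, Test.holds, hS, hT, hR, hRR, hRS, hc.off _ hSn,
      hc.off _ hTn, hc.off _ hRn, e1, e2, e3, hc.zero, hlt]

theorem keyBody_skip {S R : ℕ} {s : State} (hS : s.reg 34 = S) (hR : s.reg 41 = R)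
    (h : ¬ (s.arr 5 R = R ∧ R ≠ S)) :
    (keyBody.eval s).qarr 2 = s.qarr 2 ∧ (keyBody.eval s).arr 8 = s.arr 8 ∧
      (keyBody.eval s).arr 9 = s.arr 9 := by
  by_cases h1 : s.arr 5 R = R
  · have h2 : R = S := by tauto
    subst h2
    simp [keyBody, Prog.eval, blk, Op.exec, Test.holds, hR, hS, h1]
  · simp [keyBody, Prog.eval, blk, Op.exec, Test.holds, hR, h1]

/-- Computes the reduced weights between the joined component and all others. -/
def keyRow : Prog := forTo 41 0 keyBody

/-- The smallest reduced weight from the joined component to another one is the smaller of those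
from its two parts, corrected by the changes of `D` on the parts. This takes time `O(n)`. -/
theorem keyRow_wp {n K S T : ℕ} {s : State} {W : Fin n → Fin n → ℕ} (hW : ∀ u v, W u v = W v u)
    (hc : Consts n K s) (hS : s.reg 34 = S) (hT : s.reg 35 = T) (hSn : S < n) (hTn : T < n)
    (hST : S ≠ T) {lab : ℕ → ℕ} (hlabS : lab S = S) (hlabT : lab T = T)
    (hlab : ∀ x < n, s.arr 5 x = if lab x = T then S else lab x) {D D' : Fin n → ℚ}
    (hD : ∀ v : Fin n, D' v = D v +
      if lab v = S then s.qreg 5 else if lab v = T then s.qreg 6 else 0)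
    (hkey : ∀ a < n, ∀ b < n, lab a = a → lab b = b → a ≠ b → KeyOk W lab D s a b) :
    wp keyRow (n * 40 + 3) (fun s' => ∀ a < n, ∀ b < n, s.arr 5 a = a → s.arr 5 b = b → a ≠ b →
      KeyOk W (s.arr 5) D' s' a b) s := by
  have halive : ∀ x < n, s.arr 5 x = x → lab x = x ∧ x ≠ T := by
    intro x hx h
    rw [hlab x hx] at h
    split_ifs at h with h1
    · subst h
      exact absurd (hlabS.symm.trans h1) hST
    · exact ⟨h, fun h2 => h1 (h2 ▸ hlabT)⟩
  have hS1 : s.arr 5 S = S := by rw [hlab S hSn, hlabS, if_neg hST]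
  have hcls : ∀ x < n, ∀ r, r ≠ S → (s.arr 5 x = r → lab x = r ∧ r ≠ T) := by
    intro x hx r hr h
    rw [hlab x hx] at h
    split_ifs at h with h1
    · exact absurd h.symm hr
    · exact ⟨h, fun h2 => h1 (h.trans h2)⟩
  have hclsS : ∀ x < n, s.arr 5 x = S ↔ lab x = S ∨ lab x = T := by
    intro x hx
    rw [hlab x hx]
    split_ifs with h1
    · simp [h1]
    · simp [h1]
  refine (wp_for (n := n) (T := 35) (fun k s' =>
    (∀ a < n, ∀ b < n, ¬ (a = S ∧ b < k) → ¬ (b = S ∧ a < k) →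
      s'.qarr 2 (pos n a b) = s.qarr 2 (pos n a b) ∧ s'.arr 8 (pos n a b) = s.arr 8 (pos n a b) ∧
      s'.arr 9 (pos n a b) = s.arr 9 (pos n a b)) ∧
    ∀ r < k, s.arr 5 r = r → r ≠ S → KeyOk W (s.arr 5) D' s' S r ∧ KeyOk W (s.arr 5) D' s' r S)
    hc.n_eq (by decide) (by decide) (by decide) ?_ ?_).mono le_rfl ?_
  · exact ⟨fun _ _ _ _ _ _ => ⟨rfl, rfl, rfl⟩, fun r hr => absurd hr (Nat.not_lt_zero r)⟩
  · rintro k hk s' hf ⟨i1, i2⟩ hr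
    have c' : Consts n K s' := hc.of_frame hf
    have r34 : s'.reg 34 = S := by rw [hf.reg 34 (by decide), hS]
    have r35 : s'.reg 35 = T := by rw [hf.reg 35 (by decide), hT]
    have h5 : s'.arr 5 = s.arr 5 := hf.arr 5 (by decide)
    have q5 : s'.qreg 5 = s.qreg 5 := hf.qreg 5 (by decide)
    have q6 : s'.qreg 6 = s.qreg 6 := hf.qreg 6 (by decide)
    refine wp_eval rfl (by decide) ?_
    by_cases hcase : s'.arr 5 k = k ∧ k ≠ S
    swap
    · obtain ⟨e2, e8, e9⟩ := keyBody_skip r34 hr hcase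
      constructor
      · intro a ha b hb h1 h2
        simp only [State.setReg, e2, e8, e9]
        exact i1 a ha b hb (fun h => h1 ⟨h.1, by omega⟩) (fun h => h2 ⟨h.1, by omega⟩)
      · intro r hrk hrr hrS
        have hrk' : r < k := by
          rcases Nat.lt_succ_iff_lt_or_eq.1 hrk with h | h
          · exact h
          · subst h
            exact absurd ⟨h5 ▸ hrr, hrS⟩ hcase
        obtain ⟨k1, k2⟩ := i2 r hrk' hrr hrS
        exact ⟨k1.congr (congrFun e2 _) (congrFun e8 _) (congrFun e9 _),
          k2.congr (congrFun e2 _) (congrFun e8 _) (congrFun e9 _)⟩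
    · obtain ⟨hkk, hkS⟩ := hcase
      obtain ⟨p, m, hp, hm1, hm2, e2, e8, e9⟩ :=
        keyBody_eval c' r34 r35 hr hSn hTn hk hkk hkS
      rw [h5] at hkk
      obtain ⟨hlk, hkT⟩ := halive k hk hkk
      have hdiff : pos n S k ≠ pos n k S := fun h => hkS ((pos_inj hk hSn).1 h).2
      obtain ⟨oS2, oS8, oS9⟩ := i1 S hSn k hk (by omega) (by omega)
      obtain ⟨oT2, oT8, oT9⟩ := i1 T hTn k hk (by omega) (by omega)
      have kS := hkey S hSn k hk hlabS hlk (Ne.symm hkS)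
      have kT := hkey T hTn k hk hlabT hlk (Ne.symm hkT)
      rw [oS2, q5] at hm1
      rw [oT2, q6] at hm2
      have hDk : ∀ v : Fin n, lab v = k → D' v = D v := fun v hv => by
        rw [hD, hv, if_neg hkS, if_neg hkT, add_zero]
      have hDS : ∀ v : Fin n, lab v = S → D' v = D v + s.qreg 5 := fun v hv => by
        rw [hD, hv, if_pos rfl]
      have hDT : ∀ v : Fin n, lab v = T → D' v = D v + s.qreg 6 := fun v hv => by
        rw [hD, hv, if_neg (Ne.symm hST), if_pos rfl]
      have hnew : KeyOk W (s.arr 5) D' (((keyBody.eval s').setReg 99 1).setReg 41 (k + 1)) S k := by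
        unfold KeyOk
        simp only [State.setReg, e2, e8, e9, Function.update_of_ne hdiff, Function.update_self]
        constructor
        · intro u v hu hv
          obtain ⟨hv', -⟩ := hcls v v.2 k hkS hv
          rw [hDk v hv']
          rcases (hclsS u u.2).1 hu with hu' | hu'
          · have := kS.1 u v hu' hv'
            rw [hDS u hu']
            linarith
          · have := kT.1 u v hu' hv'
            rw [hDT u hu']
            linarith
        · rcases hp with ⟨rfl, hk2⟩ | ⟨rfl, hk2⟩
          · obtain ⟨-, u, v, hu, hv, f8, f9, f2⟩ := kS
            have hv' : s.arr 5 v = k := by rw [hlab v v.2, hv, if_neg hkT]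
            refine ⟨u, v, (hclsS u u.2).2 (Or.inl hu), hv', by rw [oS8, f8], by rw [oS9, f9], ?_⟩
            rw [hk2, oS2, q5, f2, hDS u hu, hDk v hv]
            ring
          · obtain ⟨-, u, v, hu, hv, f8, f9, f2⟩ := kT
            have hv' : s.arr 5 v = k := by rw [hlab v v.2, hv, if_neg hkT]
            refine ⟨u, v, (hclsS u u.2).2 (Or.inr hu), hv', by rw [oT8, f8], by rw [oT9, f9], ?_⟩
            rw [hk2, oT2, q6, f2, hDT u hu, hDk v hv]
            ring
      constructor
      · intro a ha b hb h1 h2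
        have n1 : pos n a b ≠ pos n S k := fun h => by
          have := (pos_inj hb hk).1 h
          omega
        have n2 : pos n a b ≠ pos n k S := fun h => by
          have := (pos_inj hb hSn).1 h
          omega
        simp only [State.setReg, e2, e8, e9, Function.update_of_ne n1, Function.update_of_ne n2]
        exact i1 a ha b hb (fun h => h1 ⟨h.1, by omega⟩) (fun h => h2 ⟨h.1, by omega⟩)
      · intro r hrk hrr hrS
        by_cases hrk' : r = k
        · subst hrk'
          refine ⟨hnew, hnew.symm hW ?_ ?_ ?_⟩ <;>
            simp only [State.setReg, e2, e8, e9, Function.update_of_ne hdiff, Function.update_self]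
        · have hrn : r < n := by omega
          obtain ⟨k1, k2⟩ := i2 r (by omega) hrr hrS
          have n1 : pos n S r ≠ pos n S k := fun h => by
            have := (pos_inj hrn hk).1 h
            omega
          have n2 : pos n S r ≠ pos n k S := fun h => by
            have := (pos_inj hrn hSn).1 h
            omega
          have n3 : pos n r S ≠ pos n S k := fun h => by
            have := (pos_inj hSn hk).1 h
            omega
          have n4 : pos n r S ≠ pos n k S := fun h => by
            have := (pos_inj hSn hSn).1 h
            omega
          refine ⟨k1.congr ?_ ?_ ?_, k2.congr ?_ ?_ ?_⟩ <;>
            simp only [State.setReg, e2, e8, e9, Function.update_of_ne n1, Function.update_of_ne n2,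
              Function.update_of_ne n3, Function.update_of_ne n4]
  · rintro s' ⟨i1, i2⟩ a ha b hb haa hbb hab
    by_cases haS : a = S
    · subst haS
      exact (i2 b hb hbb (Ne.symm hab)).1
    by_cases hbS : b = S
    · subst hbS
      exact (i2 a ha haa haS).2
    obtain ⟨j2, j8, j9⟩ := i1 a ha b hb (by tauto) (by tauto)
    obtain ⟨la, laT⟩ := halive a ha haa
    obtain ⟨lb, lbT⟩ := halive b hb hbb
    obtain ⟨h1, u, v, hu, hv, f8, f9, f2⟩ := hkey a ha b hb la lb hab
    have hDo : ∀ v : Fin n, ∀ r, lab v = r → r ≠ S → r ≠ T → D' v = D v := by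
      intro v r hv h1 h2
      rw [hD, hv, if_neg h1, if_neg h2, add_zero]
    refine ⟨fun u v hu hv => ?_, u, v, ?_, ?_, by rw [j8, f8], by rw [j9, f9], ?_⟩
    · obtain ⟨hu', -⟩ := hcls u u.2 a haS hu
      obtain ⟨hv', -⟩ := hcls v v.2 b hbS hv
      rw [j2, hDo u a hu' haS laT, hDo v b hv' hbS lbT]
      exact h1 u v hu' hv'
    · rw [hlab u u.2, hu, if_neg laT]
    · rw [hlab v v.2, hv, if_neg lbT]
    · rw [j2, f2, hDo u a hu haS laT, hDo v b hv hbS lbT]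

end LCC

/-! ### The main loop of the algorithm of Goemans and Williamson -/

namespace LCC

/-- One iteration in terms of `D` and event times: the edge that becomes tight first, at time `τ'`,
is the one with the smallest `ε`, and `ε = τ' - τ`. -/
theorem gwStep_of_min {V : Type*} {g : ℕ} {W : V → V → ℕ} {F : SimpleGraph V} {d D : V → ℚ}
    {τ τ' : ℚ} (hD : ∀ v, D v = d v - τ * compF g F v) {i j : V} (hc : GWCandidate g F i j)
    (heq : τ' * ((compF g F i : ℚ) + compF g F j) = W i j - D i - D j)
    (hmin : ∀ i' j', GWCandidate g F i' j' →
      τ' * ((compF g F i' : ℚ) + compF g F j') ≤ W i' j' - D i' - D j') :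
    GWStep g W (F, d) (F ⊔ SimpleGraph.edge i j, fun v => D v + τ' * compF g F v) := by
  have hpos : ∀ i' j', GWCandidate g F i' j' → (0 : ℚ) < (compF g F i' : ℚ) + compF g F j' := by
    intro i' j' h
    exact_mod_cast h.2
  have heps : gwEps g W F d i j = τ' - τ := by
    unfold gwEps
    rw [div_eq_iff (hpos i j hc).ne', sub_mul, heq, hD, hD]
    ring
  refine ⟨i, j, hc, fun i' j' h => ?_, rfl, ?_⟩
  · rw [heps]
    unfold gwEps
    rw [le_div_iff₀ (hpos i' j' h)]
    have := hmin i' j' h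
    rw [hD, hD] at this
    nlinarith
  · funext v
    simp only [heps, hD]
    ring

/-- The labels in use. -/
def labels (n : ℕ) (lab : ℕ → ℕ) : Finset ℕ := (Finset.range n).filter fun x => lab x = x

theorem card_labels_join {n : ℕ} {lab lab' : ℕ → ℕ} {S T : ℕ} (hTn : T < n)
    (hS : lab S = S) (hT : lab T = T) (hST : S ≠ T)
    (hlab : ∀ x < n, lab' x = if lab x = T then S else lab x) :
    (labels n lab').card < (labels n lab).card := by
  refine Finset.card_lt_card ⟨fun x hx => ?_, fun hsub => ?_⟩
  · simp only [labels, Finset.mem_filter, Finset.mem_range] at hx ⊢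
    refine ⟨hx.1, ?_⟩
    have := hx.2
    rw [hlab x hx.1] at this
    split_ifs at this with h
    · exact absurd (hS.symm.trans (this ▸ h)) hST
    · exact this
  · have := hsub (show T ∈ labels n lab by simp [labels, hTn, hT])
    simp only [labels, Finset.mem_filter, hlab T hTn, hT, if_true] at this
    exact hST this.2

/-- The state between two iterations of the main loop, when the edges in `F` have been chosen.
With `τ` the total amount of growth so far, `D v` is `d v - τ` if the component of `v` is active
and `d v` otherwise, so that `D` changes only when components change. The event times in the
tournament tree are the values of `τ` at which edges become tight. -/
structure GWInv {n : ℕ} (K g : ℕ) (W : Fin n → Fin n → ℕ) (F : SimpleGraph (Fin n))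
    (D : Fin n → ℚ) (s : State) : Prop where
  hist : ∃ (d : Fin n → ℚ) (τ : ℚ),
    Relation.ReflTransGen (GWStep g W) (⊥, fun _ => 0) (F, d) ∧ ∀ v, D v = d v - τ * compF g F v
  consts : Consts n K s
  dvd : ∀ m ≤ n, s.arr 3 m = 1 ↔ g ∣ m
  forest : Forest n F (s.arr 5) (s.arr 6) (s.arr 11) (s.arr 12)
  act : ∀ u : Fin n, s.arr 7 (s.arr 5 u) = compF g F u
  act_le : ∀ x < n, s.arr 7 x ≤ 1
  key : ∀ a < n, ∀ b < n, s.arr 5 a = a → s.arr 5 b = b → a ≠ b → KeyOk W (s.arr 5) D s a b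
  leaves : Leaves n K (fun _ _ => True) s
  root : s.reg 31 = s.arr 10 1

theorem GWInv.cand {n K g : ℕ} {W : Fin n → Fin n → ℕ} {F : SimpleGraph (Fin n)} {D : Fin n → ℚ}
    {s : State} (h : GWInv K g W F D s) {u v : Fin n} (hc : GWCandidate g F u v) :
    Cand s (s.arr 5 u) (s.arr 5 v) := by
  refine ⟨h.forest.lab_lab u u.2, h.forest.lab_lab v v.2, fun h' => hc.1 ((h.forest.reach u v).2 h'),
    ?_⟩
  rw [h.act, h.act]
  exact hc.2

/-- The root of the tournament tree names an edge that becomes tight first. -/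
theorem GWInv.exists_root {n K g : ℕ} {W : Fin n → Fin n → ℕ} {F : SimpleGraph (Fin n)}
    {D : Fin n → ℚ} {s : State} (h : GWInv K g W F D s) (hr : 0 < s.reg 31) :
    ∃ u v : Fin n, s.arr 8 (s.reg 31) = u ∧ s.arr 9 (s.reg 31) = v ∧ GWCandidate g F u v ∧
      s.qarr 3 (s.reg 31) * ((compF g F u : ℚ) + compF g F v) = W u v - D u - D v ∧
      ∀ u' v' : Fin n, GWCandidate g F u' v' →
        s.qarr 3 (s.reg 31) * ((compF g F u' : ℚ) + compF g F v') ≤ W u' v' - D u' - D v' := by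
  have hK : (0 : ℕ) < 2 ^ K := by positivity
  rw [h.root] at hr ⊢
  rcases h.leaves.tree 1 le_rfl (by omega) with ⟨h1, -⟩ | ⟨-, h2, -, h4, h5⟩
  · omega
  obtain ⟨a, ha, b, hb, hp⟩ := h.leaves.isPos _ h2 (by omega)
  set p := s.arr 10 1 with hp'
  obtain ⟨l1, l2⟩ := h.leaves.leaf a ha b hb trivial
  rw [← hp, h4] at l1
  have hc : Cand s a b := by
    by_contra hc
    rw [if_neg hc] at l1
    omega
  obtain ⟨haa, hbb, hab, hact⟩ := hc
  obtain ⟨-, u, v, hu, hv, e8, e9, e2⟩ := h.key a ha b hb haa hbb hab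
  rw [← hp] at e8 e9 e2 l2
  refine ⟨u, v, e8, e9, ⟨fun hr => hab ?_, ?_⟩, ?_, fun u' v' hc' => ?_⟩
  · rw [← hu, ← hv]
    exact (h.forest.reach u v).1 hr
  · rw [← h.act, ← h.act, hu, hv]
    exact hact
  · rw [← h.act, ← h.act, hu, hv, l2 ⟨haa, hbb, hab, hact⟩, e2]
  · have hcand := h.cand hc'
    have hu' := h.forest.lab_lt u' u'.2
    have hv' := h.forest.lab_lt v' v'.2
    obtain ⟨m1, m2⟩ := h.leaves.leaf _ hu' _ hv' trivial
    rw [if_pos hcand] at m1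
    have hpK := h.consts.pos_lt hu' hv'
    have hle := h5 _ hpK (under_root hpK) (by rw [m1, pos]; omega)
    have h1 := (h.key _ hu' _ hv' hcand.1 hcand.2.1 hcand.2.2.1).1 u' v' rfl rfl
    have h2 := m2 hcand
    rw [h.act, h.act] at h2
    have h3 : (0 : ℚ) ≤ (compF g F u' : ℚ) + compF g F v' := by positivity
    nlinarith [mul_le_mul_of_nonneg_right hle h3]

/-- Without candidates there is no active component: a single component has `n` vertices, and an
active one among several would yield a candidate. -/
theorem GWInv.compF_eq_zero {n K g : ℕ} {W : Fin n → Fin n → ℕ} {F : SimpleGraph (Fin n)}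
    {D : Fin n → ℚ} {s : State} (h : GWInv K g W F D s) (hg : g ∣ n) (hr : s.reg 31 = 0)
    (v : Fin n) : compF g F v = 0 := by
  have hK : (0 : ℕ) < 2 ^ K := by positivity
  have hno : ∀ u v : Fin n, ¬ GWCandidate g F u v := by
    intro u v hc
    have hu := h.forest.lab_lt u u.2
    have hv := h.forest.lab_lt v v.2
    obtain ⟨l1, -⟩ := h.leaves.leaf _ hu _ hv trivial
    rw [if_pos (h.cand hc)] at l1
    rw [h.root] at hr
    have hpK := h.consts.pos_lt hu hv
    rcases h.leaves.tree 1 le_rfl (by omega) with ⟨-, h2⟩ | ⟨h1, -⟩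
    · have := h2 _ hpK (under_root hpK)
      rw [l1, pos] at this
      omega
    · omega
  by_cases hconn : ∀ u, F.Reachable u v
  · rw [LCC.compF_eq_zero, compSize_eq_ncard,
      show {u | F.Reachable u v} = Set.univ from Set.eq_univ_of_forall hconn, Set.ncard_univ]
    simpa using hg
  · obtain ⟨u, hu⟩ := not_forall.1 hconn
    by_contra hne
    exact hno u v ⟨hu, by omega⟩

/-- With the sizes and statuses of the components up to date at the label in register `34`, computes
the changes of `D` on the two parts of the joined component. -/
def statusProg : Prog :=
  blk [ops [.load 38 6 34, .load 38 3 38], .ite (.eq 38 98) (.op (.const 39 0)) (.op (.const 39 1)),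
    .op (.store 7 34 39),
    .ite (.lt 39 36) (.op (.qadd 5 4 10)) (.ite (.lt 36 39) (.op (.qadd 5 7 10))
      (.op (.qadd 5 10 10))),
    .ite (.lt 39 37) (.op (.qadd 6 4 10)) (.ite (.lt 37 39) (.op (.qadd 6 7 10))
      (.op (.qadd 6 10 10)))]

theorem statusProg_eval {S a b x : ℕ} {τ : ℚ} {s : State} (hS : s.reg 34 = S) (ha : s.reg 36 = a)
    (hb : s.reg 37 = b) (ha1 : a ≤ 1) (hb1 : b ≤ 1) (h98 : s.reg 98 = 1) (h10 : s.qreg 10 = 0)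
    (h4 : s.qreg 4 = τ) (h7 : s.qreg 7 = -τ) (hx : x = if s.arr 3 (s.arr 6 S) = 1 then 0 else 1) :
    (statusProg.eval s).arr 7 = Function.update (s.arr 7) S x ∧
    (statusProg.eval s).qreg 5 = τ * a - τ * x ∧ (statusProg.eval s).qreg 6 = τ * b - τ * x := by
  have hcase : (a = 0 ∨ a = 1) ∧ (b = 0 ∨ b = 1) := by omega
  by_cases h : s.arr 3 (s.arr 6 S) = 1
  · obtain ⟨rfl | rfl, rfl | rfl⟩ := hcase <;>
      simp [statusProg, Prog.eval, blk, ops, Op.exec, Test.holds, hS, ha, hb, h98, h10, h4, hx, h]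
  · obtain ⟨rfl | rfl, rfl | rfl⟩ := hcase <;>
      simp [statusProg, Prog.eval, blk, ops, Op.exec, Test.holds, hS, ha, hb, h98, h10, h7, hx, h]

/-- One iteration of the main loop. -/
def gwBody : Prog :=
  blk [ops [.qload 4 3 31, .load 32 8 31, .load 33 9 31, .load 34 5 32, .load 35 5 33,
      .load 36 7 34, .load 37 7 35, .qsub 7 10 4],
    joinProg, statusProg, keyRow, refreshRow, .op (.load 31 10 98)]

/-- One iteration takes time `O(n K)` and joins two components. -/
theorem gwBody_wp {n K g : ℕ} {W : Fin n → Fin n → ℕ} (hW : ∀ u v, W u v = W v u)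
    {F : SimpleGraph (Fin n)} {D : Fin n → ℚ} {s : State} (h : GWInv K g W F D s)
    (hr : 0 < s.reg 31) :
    wp gwBody (n * (84 * K + 214) + 60) (fun s' => (∃ F' D', GWInv K g W F' D' s') ∧
      (labels n (s'.arr 5)).card < (labels n (s.arr 5)).card) s := by
  obtain ⟨u, v, e8, e9, hcuv, heq, hmin⟩ := h.exists_root hr
  set τ := s.qarr 3 (s.reg 31) with hτ
  set S := s.arr 5 u with hSdef
  set T := s.arr 5 v with hTdef
  have hc := h.consts
  have hSn : S < n := h.forest.lab_lt u u.2
  have hTn : T < n := h.forest.lab_lt v v.2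
  have hST : S ≠ T := (h.cand hcuv).2.2.1
  have hlS : s.arr 5 S = S := h.forest.lab_lab u u.2
  have hlT : s.arr 5 T = T := h.forest.lab_lab v v.2
  refine (wp_cons (T₁ := 9) (T₂ := (n * 9 + 20) + (20 + ((n * 40 + 3) +
      ((n * (84 * K + 165) + 3) + (1 + 1)))))
    (R := fun s' => s'.qreg 4 = τ ∧ s'.qreg 7 = -τ ∧ s'.reg 32 = u ∧ s'.reg 33 = v ∧
      s'.reg 34 = S ∧ s'.reg 35 = T ∧ s'.reg 36 = s.arr 7 S ∧ s'.reg 37 = s.arr 7 T)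
    (wp_eval rfl (le_refl 9) ?_) ?_).mono ?_ fun _ h => h
  · simp [Prog.eval, blk, ops, Op.exec, e8, e9, hc.qzero, hτ, hSdef, hTdef]
  swap
  · have : n * (84 * K + 214) = n * 9 + n * 40 + n * (84 * K + 165) := by ring
    omega
  rintro s₁ ⟨q4, q7, r32, r33, r34, r35, r36, r37⟩ f₁
  have c₁ : Consts n K s₁ := hc.of_frame f₁
  have A₁ : ∀ a, s₁.arr a = s.arr a := fun a => f₁.arr a (by simp [ops, blk, Prog.arrs, Op.arrs])
  have Q₁ : ∀ a, s₁.qarr a = s.qarr a := fun a =>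
    f₁.qarr a (by simp [ops, blk, Prog.qarrs, Op.qarrs])
  refine wp_cons (joinProg_wp (F := F) (a := u) (b := v) c₁.n_eq (by simpa only [A₁] using h.forest)
    r32 r33 (by rw [A₁, r34]) (by rw [A₁, r35]) (by rwa [A₁])) ?_
  rintro s₂ ⟨hF₂, lab₂, sz₂, -⟩ f₂
  rw [A₁, ← hSdef, ← hTdef] at lab₂
  rw [A₁, A₁, ← hSdef, ← hTdef] at sz₂
  set F' := F ⊔ SimpleGraph.edge u v with hF'
  have c₂ : Consts n K s₂ := c₁.of_frame f₂
  have a7 : s₂.arr 7 = s.arr 7 := by rw [f₂.arr 7 (by decide), A₁]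
  have a3 : s₂.arr 3 = s.arr 3 := by rw [f₂.arr 3 (by decide), A₁]
  set x := if s₂.arr 3 (s₂.arr 6 S) = 1 then 0 else 1 with hx
  refine wp_cons (T₁ := 20) (R := fun s' => s'.arr 7 = Function.update (s.arr 7) S x ∧
      s'.qreg 5 = τ * s.arr 7 S - τ * x ∧ s'.qreg 6 = τ * s.arr 7 T - τ * x)
    (wp_eval rfl (by decide) ?_) ?_
  · rw [← a7]
    refine statusProg_eval (by rw [f₂.reg 34 (by decide), r34]) (by rw [f₂.reg 36 (by decide), r36,
      a7]) (by rw [f₂.reg 37 (by decide), r37, a7]) ?_ ?_ c₂.one c₂.qzero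
      (by rw [f₂.qreg 4 (by decide), q4]) (by rw [f₂.qreg 7 (by decide), q7]) hx
    · rw [a7]
      exact h.act_le S hSn
    · rw [a7]
      exact h.act_le T hTn
  rintro s₃ ⟨act₃, q5, q6⟩ f₃
  have c₃ : Consts n K s₃ := c₂.of_frame f₃
  have l₃ : s₃.arr 5 = s₂.arr 5 := f₃.arr 5 (by decide)
  have r34₃ : s₃.reg 34 = S := by rw [f₃.reg 34 (by decide), f₂.reg 34 (by decide), r34]
  have r35₃ : s₃.reg 35 = T := by rw [f₃.reg 35 (by decide), f₂.reg 35 (by decide), r35]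
  -- the statuses of the components of the new forest
  have hxle : x ≤ 1 := by rw [hx]; split_ifs <;> omega
  have hnew : ∀ z : Fin n, s₂.arr 5 z = S → compF g F' z = x := by
    intro z hz
    have h1 := hF₂.size z
    rw [hz] at h1
    have h2 : compSize F' z ≤ n := by
      rw [compSize_eq_ncard]
      simpa using Set.ncard_le_card {w | F'.Reachable w z}
    have h3 : s₂.arr 3 (s₂.arr 6 S) = 1 ↔ g ∣ compSize F' z := by
      rw [a3, h1]
      exact h.dvd _ h2
    rw [hx]
    split_ifs with h4
    · exact LCC.compF_eq_zero.2 (h3.1 h4)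
    · exact compF_eq_one.2 fun h5 => h4 (h3.2 h5)
  have hold : ∀ z : Fin n, s.arr 5 z ≠ S → s.arr 5 z ≠ T → compF g F' z = compF g F z := by
    intro z h1 h2
    have hu' : ¬ F.Reachable z u := fun hr => h1 ((h.forest.reach z u).1 hr)
    have hv' : ¬ F.Reachable z v := fun hr => h2 ((h.forest.reach z v).1 hr)
    have h3 := compSize_congr (reachable_iff_of_sup_edge hu' hv')
    have h4 := compF_le_one g F z
    have h5 := compF_le_one g F' z
    have h6 : compF g F' z = 0 ↔ compF g F z = 0 := by
      rw [LCC.compF_eq_zero, LCC.compF_eq_zero, h3]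
    omega
  have hcls : ∀ z : Fin n, s₂.arr 5 z = S ↔ s.arr 5 z = S ∨ s.arr 5 z = T := by
    intro z
    rw [lab₂ z z.2]
    split_ifs with h1
    · simp [h1]
    · simp [h1]
  have act₃' : ∀ z : Fin n, s₃.arr 7 (s₂.arr 5 z) = compF g F' z := by
    intro z
    rw [act₃]
    by_cases h1 : s₂.arr 5 z = S
    · rw [h1, Function.update_self, hnew z h1]
    · have h2 := (hcls z).not.1 h1
      rw [not_or] at h2
      rw [Function.update_of_ne h1, hold z h2.1 h2.2, lab₂ z z.2, if_neg h2.2, h.act]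
  have act₃le : ∀ z < n, s₃.arr 7 z ≤ 1 := by
    intro z hz
    rw [act₃, Function.update_apply]
    split_ifs
    · exact hxle
    · exact h.act_le z hz
  -- the dual variables at time `τ`, less `τ` where the new component is active
  set D' : Fin n → ℚ := fun z => D z + τ * compF g F z - τ * compF g F' z with hD'
  refine wp_cons (keyRow_wp (W := W) (S := S) (T := T) (lab := s.arr 5) (D := D) (D' := D') hW c₃
    r34₃ r35₃ hSn hTn hST hlS hlT (by rwa [l₃]) ?_ ?_) ?_
  · intro z
    rw [q5, q6, hD']
    dsimp only
    split_ifs with h1 h2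
    · rw [hnew z ((hcls z).2 (Or.inl h1)), ← h.act, h1]
      ring
    · rw [hnew z ((hcls z).2 (Or.inr h2)), ← h.act, h2]
      ring
    · rw [hold z h1 h2]
      ring
  · intro a ha b hb haa hbb hab
    refine (h.key a ha b hb haa hbb hab).congr ?_ ?_ ?_
    · rw [f₃.qarr 2 (by decide), f₂.qarr 2 (by decide), Q₁]
    · rw [f₃.arr 8 (by decide), f₂.arr 8 (by decide), A₁]
    · rw [f₃.arr 9 (by decide), f₂.arr 9 (by decide), A₁]
  rintro s₄ hkey f₄
  have c₄ : Consts n K s₄ := c₃.of_frame f₄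
  have l₄ : s₄.arr 5 = s₂.arr 5 := by rw [f₄.arr 5 (by decide), l₃]
  have a₄ : s₄.arr 7 = s₃.arr 7 := f₄.arr 7 (by decide)
  have w₄ : s₄.arr 10 = s.arr 10 := by
    rw [f₄.arr 10 (by decide), f₃.arr 10 (by decide), f₂.arr 10 (by decide), A₁]
  have t₄ : s₄.qarr 3 = s.qarr 3 := by
    rw [f₄.qarr 3 (by decide), f₃.qarr 3 (by decide), f₂.qarr 3 (by decide), Q₁]
  refine wp_cons (refreshRow_wp (S := S) (T := T) c₄ (by rw [f₄.reg 34 (by decide), r34₃])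
    (by rw [f₄.reg 35 (by decide), r35₃]) hSn hTn (by rwa [a₄]) ?_) ?_
  · refine h.leaves.congr w₄ t₄ fun a ha b hb ⟨aS, aT, bS, bT⟩ => ⟨trivial, fun hl => ?_⟩
    have hla : ∀ z < n, z ≠ S → z ≠ T → (s₂.arr 5 z = z ↔ s.arr 5 z = z) := by
      intro z hz h1 h2
      rw [lab₂ z hz]
      split_ifs with h3
      · rw [h3]
        tauto
      · rfl
    have hcand : Cand s₄ a b ↔ Cand s a b := by
      unfold Cand
      rw [l₄, a₄, act₃, hla a ha aS aT, hla b hb bS bT, Function.update_of_ne aS,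
        Function.update_of_ne bS]
    classical
    unfold LeafOk at hl ⊢
    rw [w₄, t₄, a₄, act₃, Function.update_of_ne aS, Function.update_of_ne bS]
    have hq : Cand s a b → s₄.qarr 2 (pos n a b) = s.qarr 2 (pos n a b) := by
      intro hcab
      -- both entries are the smallest reduced weight between two unchanged components
      have hcab' := hcand.2 hcab
      rw [Cand, l₄] at hcab'
      obtain ⟨k1, u₁, v₁, hu₁, hv₁, -, -, k2⟩ := h.key a ha b hb hcab.1 hcab.2.1 hcab.2.2.1
      obtain ⟨m1, u₂, v₂, hu₂, hv₂, -, -, m2⟩ :=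
        hkey a ha b hb (l₃ ▸ hcab'.1) (l₃ ▸ hcab'.2.1) hcab.2.2.1
      rw [l₃] at m1 hu₂ hv₂
      have hcl : ∀ (z : Fin n) r, r ≠ S → (s₂.arr 5 z = r ↔ s.arr 5 z = r ∧ r ≠ T) := by
        intro z r hrS
        rw [lab₂ z z.2]
        split_ifs with h3
        · rw [h3]
          exact ⟨fun h' => absurd h'.symm hrS, fun h' => absurd h'.1.symm h'.2⟩
        · exact ⟨fun h' => ⟨h', fun h'' => h3 (h'.trans h'')⟩, fun h' => h'.1⟩
      have hDe : ∀ (z : Fin n) r, r ≠ S → r ≠ T → s.arr 5 z = r → D' z = D z := by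
        intro z r h1 h2 h3
        rw [hD']
        dsimp only
        rw [hold z (h3 ▸ h1) (h3 ▸ h2)]
        ring
      have b1 := ((hcl u₂ a aS).1 hu₂).1
      have b2 := ((hcl v₂ b bS).1 hv₂).1
      have i1 := k1 u₂ v₂ b1 b2
      have i2 := m1 u₁ v₁ ((hcl u₁ a aS).2 ⟨hu₁, aT⟩) ((hcl v₁ b bS).2 ⟨hv₁, bT⟩)
      rw [hDe u₁ a aS aT hu₁, hDe v₁ b bS bT hv₁] at i2
      rw [hDe u₂ a aS aT b1, hDe v₂ b bS bT b2] at m2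
      linarith
    exact ⟨hl.1.trans (if_congr hcand.symm rfl rfl),
      fun hcab => by rw [hq (hcand.1 hcab)]; exact hl.2 (hcand.1 hcab)⟩
  rintro s₅ hleaf f₅
  have c₅ : Consts n K s₅ := c₄.of_frame f₅
  have l₅ : s₅.arr 5 = s₂.arr 5 := by rw [f₅.arr 5 (by decide), l₄]
  refine wp_last (T := 1) (R := fun s' => s'.reg 31 = s₅.arr 10 1 ∧ s'.arr = s₅.arr ∧
    s'.qarr = s₅.qarr) (wp_eval rfl (le_refl 1) ?_) ?_
  · simp [Prog.eval, Op.exec, c₅.one]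
  rintro s₆ ⟨r31, A₆, Q₆⟩ f₆
  constructor
  · refine ⟨F', D', ?_, c₅.of_frame f₆, ?_, ?_, ?_, ?_, ?_, ?_, ?_⟩
    · obtain ⟨d, τ₀, hist, hD⟩ := h.hist
      exact ⟨_, τ, hist.tail (gwStep_of_min hD hcuv heq hmin), fun z => rfl⟩
    · rw [A₆, f₅.arr 3 (by decide), f₄.arr 3 (by decide), f₃.arr 3 (by decide), a3]
      exact h.dvd
    · rw [A₆, l₅, f₅.arr 6 (by decide), f₄.arr 6 (by decide), f₃.arr 6 (by decide),
        f₅.arr 11 (by decide), f₄.arr 11 (by decide), f₃.arr 11 (by decide),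
        f₅.arr 12 (by decide), f₄.arr 12 (by decide), f₃.arr 12 (by decide)]
      exact hF₂
    · rw [A₆, l₅, f₅.arr 7 (by decide), a₄]
      exact act₃'
    · rw [A₆, f₅.arr 7 (by decide), a₄]
      exact act₃le
    · rw [A₆, l₅]
      intro a ha b hb haa hbb hab
      rw [l₃] at hkey
      refine (hkey a ha b hb haa hbb hab).congr ?_ ?_ ?_
      · rw [Q₆, f₅.qarr 2 (by decide)]
      · rw [A₆, f₅.arr 8 (by decide)]
      · rw [A₆, f₅.arr 9 (by decide)]
    · refine hleaf.congr (by rw [A₆]) (by rw [Q₆]) fun _ _ _ _ h => ⟨h, fun h => ?_⟩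
      unfold LeafOk Cand at *
      rwa [A₆, Q₆]
    · rw [r31, A₆]
  · rw [A₆, l₅]
    exact card_labels_join hTn hlS hlT hST lab₂

/-- The main loop, which runs until there are no more candidates. -/
def gwLoop : Prog := .loop (.lt 97 31) gwBody

/-- There are fewer than `n` joins, so that the loop takes time `O(n² K)`. -/
theorem gwLoop_wp {n K g : ℕ} {W : Fin n → Fin n → ℕ} (hW : ∀ u v, W u v = W v u) (hg : g ∣ n)
    {F : SimpleGraph (Fin n)} {D : Fin n → ℚ} {s : State} (h : GWInv K g W F D s) :
    wp gwLoop ((n * (84 * K + 214) + 61) * n + 1) (fun s' => ∃ F',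
      GoeWill g W (gwPrune g F') ∧ F'.IsAcyclic ∧ (∀ v, g ∣ compSize F' v) ∧
      Forest n F' (s'.arr 5) (s'.arr 6) (s'.arr 11) (s'.arr 12)) s := by
  refine (wp_while (c := n * (84 * K + 214) + 60) (m := (labels n (s.arr 5)).card)
    (fun m s' => m = (labels n (s'.arr 5)).card ∧ ∃ F' D', GWInv K g W F' D' s')
    ⟨rfl, F, D, h⟩ ?_).mono ?_ ?_
  · rintro m s' - ⟨rfl, F', D', h'⟩ hb
    simp only [Test.holds, h'.consts.zero] at hb
    obtain ⟨t, s'', ht, hrun, hI, hlt⟩ := gwBody_wp hW h' hb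
    exact ⟨_, hlt, t, s'', ht.trans (Nat.le_mul_of_pos_right _ (by omega)), hrun, rfl, hI⟩
  · have : (labels n (s.arr 5)).card ≤ n := by
      simpa [labels] using Finset.card_filter_le (Finset.range n) (fun x => s.arr 5 x = x)
    gcongr
  · rintro s' ⟨m, ⟨-, F', D', h'⟩, hb⟩
    simp only [Test.holds, h'.consts.zero, not_lt, Nat.le_zero] at hb
    have h0 := h'.compF_eq_zero hg hb
    obtain ⟨d, τ, hist, -⟩ := h'.hist
    exact ⟨F', ⟨_, hist, h0, rfl⟩, h'.forest.acyclic, fun v => LCC.compF_eq_zero.1 (h0 v),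
      h'.forest⟩

end LCC

/-! ### Rooted forests and Eulerian walks -/

namespace LCC

theorem isChain_congr {V : Type*} {f g : V → ℕ} {h : V → ℕ} {B : List V} {y : V}
    (hfg : ∀ a ∈ B, g a = f a) (hc : (B ++ [y]).IsChain fun a b => f a = h b) :
    (B ++ [y]).IsChain fun a b => g a = h b := by
  induction B with
  | nil => simp
  | cons a B ih =>
    cases B with
    | nil => simpa [hfg a (by simp)] using hc
    | cons b B =>
      simp only [List.cons_append, List.isChain_cons_cons] at hc ih ⊢
      exact ⟨by rw [hfg a (by simp), hc.1], ih (fun a ha => hfg a (by simp [ha])) hc.2⟩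

/-- A linked list from `r` back to `r`, into which `x` is inserted after `y`. -/
theorem isChain_insert {n : ℕ} {nxt : ℕ → ℕ} {B C : List (Fin n)} {r x y : Fin n}
    (hnd : (B ++ y :: C).Nodup) (hx : x ∉ B ++ y :: C)
    (hc : (B ++ y :: (C ++ [r])).IsChain fun a b : Fin n => nxt a = b) :
    (B ++ y :: x :: (C ++ [r])).IsChain fun a b : Fin n =>
      Function.update (Function.update nxt x (nxt y)) y x a = b := by
  set nxt' := Function.update (Function.update nxt x (nxt y)) y x with hnxt
  have hne : ∀ a : Fin n, a ≠ x → a ≠ y → nxt' a = nxt a := by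
    intro a h1 h2
    rw [hnxt, Function.update_of_ne (fun h => h2 (Fin.ext h)),
      Function.update_of_ne (fun h => h1 (Fin.ext h))]
  have hxy : x ≠ y := fun h => hx (by simp [h])
  rw [List.isChain_split] at hc ⊢
  obtain ⟨h1, h2⟩ := hc
  rw [List.nodup_append] at hnd
  obtain ⟨-, hnd2, hnd3⟩ := hnd
  have hyC : y ∉ C := (List.nodup_cons.1 hnd2).1
  refine ⟨isChain_congr (f := fun a : Fin n => nxt a) (fun a ha => hne a ?_ ?_) h1, ?_⟩
  · rintro rfl
    exact hx (by simp [ha])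
  · exact fun h => hnd3 a ha y (by simp) h
  · obtain ⟨z, R, hz⟩ : ∃ z R, C ++ [r] = z :: R := by
      cases C <;> simp
    have h3 : (C ++ [r]).IsChain fun a b : Fin n => nxt a = b := by
      rw [hz] at h2 ⊢
      exact (List.isChain_cons_cons.1 h2).2
    have h4 := isChain_congr (f := fun a : Fin n => nxt a) (g := fun a : Fin n => nxt' a)
      (fun a ha => hne a (fun h => hx (by simp [← h, ha])) fun h => hyC (h ▸ ha)) h3
    rw [hz] at h2 h4 ⊢
    rw [List.isChain_cons_cons, List.isChain_cons_cons]
    refine ⟨by simp [hnxt], ?_, h4⟩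
    have h5 := (List.isChain_cons_cons.1 h2).1
    rw [hnxt, Function.update_of_ne (fun h => hxy (Fin.ext h)), Function.update_self, h5]

/-- The part of a forest `F` that has been explored so far. Explored vertices have been entered
into the list `ord` of length `c`, and `mark` is one more than the position there, or `0`.
Starting at the labels, each further vertex has been attached to its parent `par`. For each label
there is a closed walk that uses each explored edge of the component exactly twice, and `nxt` links
the vertices cyclically in the order of their first occurrences on this walk. -/
structure Rooted {n : ℕ} (F : SimpleGraph (Fin n)) (lab par mark nxt ord : ℕ → ℕ) (c : ℕ) :
    Prop where
  ord_lt : ∀ t < c, ord t < n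
  mark_ord : ∀ t < c, mark (ord t) = t + 1
  ord_mark : ∀ x < n, mark x ≠ 0 → mark x ≤ c ∧ ord (mark x - 1) = x
  root : ∀ x < n, lab x = x → mark x ≠ 0 ∧ par x = x
  parent : ∀ x : Fin n, lab x ≠ x → mark x ≠ 0 →
    ∃ y : Fin n, par x = y ∧ F.Adj x y ∧ mark y ≠ 0 ∧ mark y < mark x
  walk : ∀ r : Fin n, lab r = r → ∃ (p : F.Walk r r) (l : List (Fin n)),
    firstVisits p.support = r :: l ∧
    (r :: (l ++ [r])).IsChain (fun a b : Fin n => nxt a = b) ∧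
    (∀ x : Fin n, x ∈ p.support ↔ lab x = r ∧ mark x ≠ 0) ∧
    ∀ x y : Fin n, lab x = r → lab x ≠ x → mark x ≠ 0 → par x = y → p.edges.count s(x, y) = 2

/-- The detour from `y` to `x` and back at the first visit of `y` uses the edge `x y` twice, and
puts `x` right after `y` in the order of first visits. -/
theorem exists_walk_insert {V : Type*} [DecidableEq V] {F : SimpleGraph V} {r x y : V}
    (p : F.Walk r r) (hy : y ∈ p.support) (hx : x ∉ p.support) (h : F.Adj x y) :
    ∃ (q : F.Walk r r) (B C : List V), firstVisits p.support = B ++ y :: C ∧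
      firstVisits q.support = B ++ y :: x :: C ∧ (∀ z, z ∈ q.support ↔ z ∈ p.support ∨ z = x) ∧
      (∀ e, q.edges.count e = p.edges.count e + if e = s(x, y) then 2 else 0) := by
  let p₁ := p.takeUntil y hy
  let p₂ := p.dropUntil y hy
  have hp : p₁.append p₂ = p := p.take_spec hy
  let q := p₁.append ((SimpleGraph.Walk.cons h.symm (SimpleGraph.Walk.cons h .nil)).append p₂)
  set B := p₁.support.dropLast with hB
  have hs₁ : p₁.support = B ++ [y] := by
    have := List.dropLast_append_getLast (SimpleGraph.Walk.support_ne_nil p₁)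
    rwa [SimpleGraph.Walk.getLast_support, eq_comm] at this
  have hs₂ : p₂.support = y :: p₂.support.tail := p₂.cons_tail_support.symm
  have hsp : p.support = (B ++ [y]) ++ p₂.support.tail := by
    rw [← hs₁, ← SimpleGraph.Walk.support_append, hp]
  have hsq : q.support = (B ++ [y] ++ [x]) ++ (y :: p₂.support.tail) := by
    rw [SimpleGraph.Walk.support_append, hs₁]
    simp
  have hyB : y ∉ B := by
    have h1 := p.count_support_takeUntil_eq_one hy
    change p₁.support.count y = 1 at h1
    rw [hs₁, List.count_append, List.count_singleton_self] at h1
    exact List.count_eq_zero.1 (by omega)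
  rw [hsp] at hx
  simp only [List.mem_append, List.mem_singleton, not_or] at hx
  obtain ⟨⟨hxB, hxy⟩, hxC⟩ := hx
  refine ⟨q, firstVisits B, (firstVisits p₂.support.tail).filter (fun z => decide (z ∉ B ++ [y])),
    ?_, ?_, ?_, ?_⟩
  · rw [hsp, firstVisits_append, firstVisits_append_singleton, if_neg hyB]
    simp
  · rw [hsq, firstVisits_append, firstVisits_append_singleton, firstVisits_append_singleton,
      if_neg hyB, if_neg (by simp [hxB, hxy]), ← List.singleton_append (l := p₂.support.tail),
      firstVisits_append]
    have h1 : firstVisits [y] = [y] := by simp [firstVisits]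
    rw [h1, List.filter_append, List.filter_filter]
    have h2 : List.filter (fun z => decide (z ∉ B ++ [y] ++ [x])) [y] = [] := by simp
    rw [h2, List.nil_append]
    have h3 : List.filter (fun a => decide (a ∉ B ++ [y] ++ [x]) && decide (a ∉ [y]))
        (firstVisits p₂.support.tail) =
        List.filter (fun z => decide (z ∉ B ++ [y])) (firstVisits p₂.support.tail) := by
      refine List.filter_congr fun z hz => ?_
      have : z ≠ x := by
        rintro rfl
        exact hxC (mem_firstVisits.1 hz)
      simp [this]
    rw [h3]
    simp
  · intro z
    rw [hsq, hsp]
    simp only [List.mem_append, List.mem_cons]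
    tauto
  · intro e
    have h1 : q.edges = p₁.edges ++ (s(y, x) :: s(x, y) :: p₂.edges) := by
      simp [q, SimpleGraph.Walk.edges_append]
    rw [h1, ← hp, SimpleGraph.Walk.edges_append, List.count_append, List.count_append,
      List.count_cons, List.count_cons, Sym2.eq_swap (a := y)]
    by_cases he : e = s(x, y)
    · subst he
      simp
      omega
    · simp [he, Ne.symm he]

/-- Exploring the edge `x y` from `y`: inserting `x` after `y` in the linked list keeps up with the
detour to `x` in the Eulerian walk. -/
theorem Rooted.attach {n : ℕ} {F : SimpleGraph (Fin n)} {lab par mark nxt ord : ℕ → ℕ} {c : ℕ}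
    (h : Rooted F lab par mark nxt ord c) (hlab : ∀ u v : Fin n, F.Reachable u v ↔ lab u = lab v)
    {x y : Fin n} (hxy : F.Adj x y) (hx : mark x = 0) (hy : mark y ≠ 0) :
    Rooted F lab (Function.update par x y) (Function.update mark x (c + 1))
      (Function.update (Function.update nxt x (nxt y)) y x) (Function.update ord c x) (c + 1) := by
  have hxl : lab x ≠ x := fun h' => (h.root x x.2 h').1 hx
  have hlxy : lab x = lab y := (hlab x y).1 hxy.reachable
  constructor
  · intro t ht
    rw [Function.update_apply]
    split_ifs with h1
    · exact x.2
    · exact h.ord_lt t (by omega)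
  · intro t ht
    rcases Nat.lt_succ_iff_lt_or_eq.1 ht with h1 | rfl
    · rw [Function.update_of_ne h1.ne, Function.update_of_ne, h.mark_ord t h1]
      intro h2
      have := h.mark_ord t h1
      rw [h2] at this
      omega
    · simp
  · intro z hz hm
    by_cases hzx : z = x
    · subst hzx
      simp
    · rw [Function.update_of_ne hzx] at hm ⊢
      obtain ⟨h1, h2⟩ := h.ord_mark z hz hm
      exact ⟨by omega, by rw [Function.update_of_ne (by omega), h2]⟩
  · intro z hz hl
    have hzx : z ≠ x := fun h' => hxl (h' ▸ hl)
    rw [Function.update_of_ne hzx, Function.update_of_ne hzx]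
    exact h.root z hz hl
  · intro z hl hm
    by_cases hzx : z = x
    · subst hzx
      have hyz : (y : ℕ) ≠ z := fun h' => hxy.ne (Fin.ext h'.symm)
      refine ⟨y, by simp, hxy, by rwa [Function.update_of_ne hyz], ?_⟩
      rw [Function.update_of_ne hyz, Function.update_self]
      have := (h.ord_mark y y.2 hy).1
      omega
    · have hzx' : (z : ℕ) ≠ x := fun h' => hzx (Fin.ext h')
      rw [Function.update_of_ne hzx'] at hm ⊢
      obtain ⟨w, h1, h2, h3, h4⟩ := h.parent z hl hm
      have hwx : (w : ℕ) ≠ x := fun h' => h3 (h' ▸ hx)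
      rw [Function.update_of_ne hzx']
      exact ⟨w, h1, h2, by rwa [Function.update_of_ne hwx], by rwa [Function.update_of_ne hwx]⟩
  · intro r hr
    obtain ⟨p, l, hv, hch, hsup, hcnt⟩ := h.walk r hr
    have hxp : x ∉ p.support := fun h' => ((hsup x).1 h').2 hx
    have hmark : ∀ z : Fin n, z ≠ x → Function.update mark x (c + 1) z = mark z := fun z hz =>
      Function.update_of_ne (fun h' => hz (Fin.ext h')) _ _
    -- the walk of the component of `y` gets a detour; all others stay as they are
    by_cases hyr : lab y = r
    · have hyp : y ∈ p.support := (hsup y).2 ⟨hyr, hy⟩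
      obtain ⟨q, B, C, e1, e2, e3, e4⟩ := exists_walk_insert p hyp hxp hxy
      rw [hv] at e1
      have hnd : (B ++ y :: C).Nodup := by
        rw [← e1, ← hv]
        exact firstVisits_nodup _
      have hxn : x ∉ B ++ y :: C := by
        rw [← e1, ← hv, mem_firstVisits]
        exact hxp
      obtain ⟨l', hl'⟩ : ∃ l', B ++ y :: x :: C = r :: l' := by
        cases B with
        | nil =>
          simp only [List.nil_append, List.cons.injEq] at e1 ⊢
          exact ⟨x :: C, e1.1.symm, rfl⟩
        | cons b B =>
          simp only [List.cons_append, List.cons.injEq] at e1 ⊢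
          exact ⟨B ++ y :: x :: C, e1.1.symm, rfl⟩
      refine ⟨q, l', e2.trans hl', ?_, fun z => ?_, fun z w hz hzl hm hpz => ?_⟩
      · rw [← List.cons_append, ← hl']
        rw [← List.cons_append, e1] at hch
        simpa using isChain_insert hnd hxn (by simpa using hch)
      · rw [e3, hsup]
        by_cases hzx : z = x
        · subst hzx
          simp [hlxy, hyr]
        · simp [hzx, hmark z hzx]
      · rw [e4]
        by_cases hzx : z = x
        · subst hzx
          rw [Function.update_self] at hpz
          have : w = y := Fin.ext hpz.symm
          subst this
          rw [if_pos rfl, List.count_eq_zero_of_not_mem]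
          exact fun he => hxp (p.fst_mem_support_of_mem_edges he)
        · rw [hmark z hzx] at hm
          rw [Function.update_of_ne (fun h' => hzx (Fin.ext h'))] at hpz
          rw [hcnt z w hz hzl hm hpz, if_neg]
          intro he
          obtain ⟨w', h1, -, h3, -⟩ := h.parent z hzl hm
          have : w = w' := Fin.ext (hpz.symm.trans h1)
          subst this
          rcases Sym2.eq_iff.1 he with ⟨rfl, -⟩ | ⟨-, rfl⟩
          · exact hzx rfl
          · exact h3 hx
    · have hxr : lab x ≠ r := fun h' => hyr (hlxy ▸ h')
      refine ⟨p, l, hv, ?_, fun z => ?_, fun z w hz hzl hm hpz => ?_⟩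
      · have hl : ∀ z ∈ r :: l, z ≠ x ∧ z ≠ y := by
          intro z hz
          rw [← hv, mem_firstVisits, hsup] at hz
          exact ⟨fun h' => hxr (h' ▸ hz.1), fun h' => hyr (h' ▸ hz.1)⟩
        rw [← List.cons_append] at hch ⊢
        refine isChain_congr (f := fun a : Fin n => nxt a) (fun a ha => ?_) hch
        obtain ⟨h1, h2⟩ := hl a ha
        rw [Function.update_of_ne (fun h' => h2 (Fin.ext h')),
          Function.update_of_ne (fun h' => h1 (Fin.ext h'))]
      · rw [hsup]
        by_cases hzx : z = x
        · subst hzx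
          simp [hxr]
        · simp [hmark z hzx]
      · have hzx : z ≠ x := fun h' => hxr (h' ▸ hz)
        rw [hmark z hzx] at hm
        rw [Function.update_of_ne (fun h' => hzx (Fin.ext h'))] at hpz
        exact hcnt z w hz hzl hm hpz

end LCC

/-! ### Exploring a forest -/

namespace LCC

theorem Rooted.le {n : ℕ} {F : SimpleGraph (Fin n)} {lab par mark nxt ord : ℕ → ℕ} {c : ℕ}
    (h : Rooted F lab par mark nxt ord c) : c ≤ n := by
  have := Finset.card_le_card_of_injOn (s := Finset.range c) (t := Finset.range n) ord
    (fun t ht => by simpa using h.ord_lt t (by simpa using ht)) fun t ht t' ht' he => by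
      have h1 := h.mark_ord t (by simpa using ht)
      have h2 := h.mark_ord t' (by simpa using ht')
      rw [he, h2] at h1
      omega
  simpa using this

/-- If all vertices have been explored, the list of explored vertices has length `n`. -/
theorem Rooted.eq_of_forall {n : ℕ} {F : SimpleGraph (Fin n)} {lab par mark nxt ord : ℕ → ℕ} {c : ℕ}
    (h : Rooted F lab par mark nxt ord c) (hm : ∀ x < n, mark x ≠ 0) : c = n := by
  refine le_antisymm h.le ?_
  have := Finset.card_le_card_of_injOn (s := Finset.range n) (t := Finset.range c)
    (fun x => mark x - 1) (fun x hx => ?_) fun x hx y hy he => ?_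
  · simpa using this
  · have hx' : x < n := by simpa using hx
    have h1 := (h.ord_mark x hx' (hm x hx')).1
    have h2 := hm x hx'
    simp only [Finset.coe_range, Set.mem_Iio]
    omega
  · have hx' : x < n := by simpa using hx
    have hy' : y < n := by simpa using hy
    rw [← (h.ord_mark x hx' (hm x hx')).2, ← (h.ord_mark y hy' (hm y hy')).2]
    exact congrArg ord he

/-- Makes every label the root of its component, and marks all other vertices as unexplored. -/
def rootProg : Prog :=
  forTo 70 0 (blk [.op (.load 71 5 70), .ite (.eq 71 70)
    (ops [.store 13 70 70, .store 15 70 70, .store 16 72 70, .add 72 72 98, .store 14 70 72])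
    (.op (.store 14 70 97))])

theorem rootProg_wp {n : ℕ} {s : State} (hn : s.reg 0 = n) (h97 : s.reg 97 = 0)
    (h98 : s.reg 98 = 1) (h72 : s.reg 72 = 0) (F : SimpleGraph (Fin n)) :
    wp rootProg (n * 14 + 3) (fun s' =>
      Rooted F (s.arr 5) (s'.arr 13) (s'.arr 14) (s'.arr 15) (s'.arr 16) (s'.reg 72)) s := by
  refine (wp_for (n := n) (T := 9) (fun k s' =>
    (∀ t < s'.reg 72, s'.arr 16 t < k ∧ s'.arr 14 (s'.arr 16 t) = t + 1) ∧
    (∀ x < k, s.arr 5 x = x → s'.arr 14 x ≠ 0 ∧ s'.arr 13 x = x ∧ s'.arr 15 x = x ∧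
      s'.arr 14 x ≤ s'.reg 72 ∧ s'.arr 16 (s'.arr 14 x - 1) = x) ∧
    ∀ x < k, s.arr 5 x ≠ x → s'.arr 14 x = 0) hn (by decide) (by decide) (by decide) ?_ ?_).mono
    le_rfl ?_
  · simp [State.setReg, h72]
  · rintro k hk s' hf ⟨i1, i2, i3⟩ hr
    have g97 : s'.reg 97 = 0 := by rw [hf.reg 97 (by decide), h97]
    have g98 : s'.reg 98 = 1 := by rw [hf.reg 98 (by decide), h98]
    have g5 : s'.arr 5 = s.arr 5 := hf.arr 5 (by decide)
    refine wp_eval rfl (by decide) ?_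
    by_cases hl : s.arr 5 k = k
    · simp only [Prog.eval, blk, ops, List.map, Op.exec, Test.holds, State.setReg, hr, g98, g5, hl,
        ne_eq, Nat.reduceEqDiff, not_false_eq_true, Function.update_of_ne, Function.update_self,
        if_true]
      refine ⟨fun t ht => ?_, fun x hx hxx => ?_, fun x hx hxx => ?_⟩
      · by_cases htc : t = s'.reg 72
        · subst htc
          simp
        · obtain ⟨j1, j2⟩ := i1 t (by omega)
          rw [Function.update_of_ne htc, Function.update_of_ne (by omega)]
          exact ⟨by omega, j2⟩
      · by_cases hxk : x = k
        · subst hxk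
          simp
        · obtain ⟨j1, j2, j3, j4, j5⟩ := i2 x (by omega) hxx
          rw [Function.update_of_ne hxk, Function.update_of_ne hxk, Function.update_of_ne hxk,
            Function.update_of_ne (show s'.arr 14 x - 1 ≠ s'.reg 72 by omega)]
          exact ⟨j1, j2, j3, by omega, j5⟩
      · have hxk : x ≠ k := fun h => hxx (h ▸ hl)
        rw [Function.update_of_ne hxk]
        exact i3 x (by omega) hxx
    · simp only [Prog.eval, blk, ops, List.map, Op.exec, Test.holds, State.setReg, hr, g97, g5, hl,
        ne_eq, Nat.reduceEqDiff, not_false_eq_true, Function.update_of_ne, Function.update_self,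
        if_false]
      refine ⟨fun t ht => ?_, fun x hx hxx => ?_, fun x hx hxx => ?_⟩
      · obtain ⟨j1, j2⟩ := i1 t ht
        rw [Function.update_of_ne (by omega)]
        exact ⟨by omega, j2⟩
      · have hxk : x ≠ k := fun h => hl (h ▸ hxx)
        rw [Function.update_of_ne hxk]
        exact i2 x (by omega) hxx
      · by_cases hxk : x = k
        · subst hxk
          simp
        · rw [Function.update_of_ne hxk]
          exact i3 x (by omega) hxx
  · rintro s' ⟨i1, i2, i3⟩
    have hroot : ∀ x < n, s'.arr 14 x ≠ 0 → s.arr 5 x = x := fun x hx hm => by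
      by_contra hc
      exact hm (i3 x hx hc)
    refine ⟨fun t ht => (i1 t ht).1, fun t ht => (i1 t ht).2, fun x hx hm => ?_, fun x hx hxx => ?_,
      fun x hxx hm => absurd (hroot x x.2 hm) hxx, fun r hr => ?_⟩
    · exact (i2 x hx (hroot x hx hm)).2.2.2
    · exact ⟨(i2 x hx hxx).1, (i2 x hx hxx).2.1⟩
    · refine ⟨.nil, [], by simp [firstVisits], by simpa using (i2 r r.2 hr).2.2.1, fun x => ?_,
        fun x y _ hxx hm => absurd (hroot x x.2 hm) hxx⟩
      rw [SimpleGraph.Walk.support_nil, List.mem_singleton]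
      constructor
      · rintro rfl
        exact ⟨hr, (i2 _ x.2 hr).1⟩
      · rintro ⟨h1, h2⟩
        exact Fin.ext ((hroot x x.2 h2).symm.trans h1)

/-- Attaches the vertex in register `x` to the one in register `y`. -/
def attachOps (x y : ℕ) : Prog :=
  ops [.store 13 x y, .load 79 15 y, .store 15 x 79, .store 15 y x, .store 16 72 x, .add 72 72 98,
    .store 14 x 72]

/-- Uses the edge in slot `74` to attach one of its ends to the other one, if possible. -/
def exploreBody : Prog :=
  blk [ops [.load 75 11 74, .load 76 12 74, .load 77 14 75, .load 78 14 76],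
    .ite (.eq 77 97) (.ite (.eq 78 97) .skip (attachOps 75 76))
      (.ite (.eq 78 97) (attachOps 76 75) .skip)]

theorem exploreBody_wp {n i : ℕ} {s : State} (h97 : s.reg 97 = 0)
    (h98 : s.reg 98 = 1) (hi : s.reg 74 = i) (hin : i < n) {F : SimpleGraph (Fin n)}
    (hF : Forest n F (s.arr 5) (s.arr 6) (s.arr 11) (s.arr 12))
    (h : Rooted F (s.arr 5) (s.arr 13) (s.arr 14) (s.arr 15) (s.arr 16) (s.reg 72)) :
    wp exploreBody 16 (fun s' =>
      Rooted F (s.arr 5) (s'.arr 13) (s'.arr 14) (s'.arr 15) (s'.arr 16) (s'.reg 72) ∧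
      (∀ x < n, s.arr 14 x ≠ 0 → s'.arr 14 x ≠ 0) ∧
      (s.arr 14 (s.arr 11 i) ≠ 0 ∨ s.arr 14 (s.arr 12 i) ≠ 0 →
        s'.arr 14 (s.arr 11 i) ≠ 0 ∧ s'.arr 14 (s.arr 12 i) ≠ 0)) s := by
  refine wp_eval rfl (by decide) ?_
  obtain ⟨a, ha⟩ : ∃ a : Fin n, s.arr 11 i = a := ⟨⟨_, hF.ea_lt i hin⟩, rfl⟩
  obtain ⟨b, hb⟩ : ∃ b : Fin n, s.arr 12 i = b := ⟨⟨_, hF.eb_lt i hin⟩, rfl⟩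
  have hadj : s.arr 14 a ≠ 0 ∧ s.arr 14 b = 0 ∨ s.arr 14 a = 0 ∧ s.arr 14 b ≠ 0 → F.Adj a b := by
    intro hab
    refine (hF.adj a b).2 ⟨?_, i, hin, Or.inl ⟨ha, hb⟩⟩
    rintro rfl
    tauto
  have hnz : ∀ x y c : ℕ, s.arr 14 x ≠ 0 →
      Function.update (s.arr 14) y (c + 1) x ≠ 0 := fun x y c hx => by
    rw [Function.update_apply]
    split_ifs
    · omega
    · exact hx
  by_cases h1 : s.arr 14 a = 0 <;> by_cases h2 : s.arr 14 b = 0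
  · simpa [exploreBody, Prog.eval, blk, ops, Op.exec, Test.holds, hi, ha, hb, h97, h1, h2] using h
  · have := h.attach hF.reach (hadj (Or.inr ⟨h1, h2⟩)) h1 h2
    simp [exploreBody, attachOps, Prog.eval, blk, ops, Op.exec, Test.holds, hi, ha, hb, h97, h98, h1,
      h2]
    exact ⟨this, fun x _ hx => hnz x _ _ hx, hnz _ _ _ h2⟩
  · have := h.attach hF.reach (hadj (Or.inl ⟨h1, h2⟩)).symm h2 h1
    simp [exploreBody, attachOps, Prog.eval, blk, ops, Op.exec, Test.holds, hi, ha, hb, h97, h98, h1,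
      h2]
    exact ⟨this, fun x _ hx => hnz x _ _ hx, hnz _ _ _ h1⟩
  · simpa [exploreBody, Prog.eval, blk, ops, Op.exec, Test.holds, hi, ha, hb, h97, h1, h2] using h

/-- Explores the whole forest: after `k` rounds, all vertices at distance at most `k` from the label
of their component have been reached. -/
def exploreProg : Prog :=
  blk [.op (.const 72 0), rootProg, forTo 73 0 (forTo 74 0 exploreBody)]

theorem exploreProg_wp {n : ℕ} {s : State} (hn : s.reg 0 = n) (h97 : s.reg 97 = 0)
    (h98 : s.reg 98 = 1) {F : SimpleGraph (Fin n)}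
    (hF : Forest n F (s.arr 5) (s.arr 6) (s.arr 11) (s.arr 12)) :
    wp exploreProg (n * (n * 21 + 22) + 8) (fun s' =>
      Rooted F (s.arr 5) (s'.arr 13) (s'.arr 14) (s'.arr 15) (s'.arr 16) n ∧
      ∀ x < n, s'.arr 14 x ≠ 0) s := by
  refine (wp_cons (T₁ := 1) (T₂ := (n * 14 + 3) + (n * (n * (16 + 5) + 3 + 5) + 3 + 1))
    (R := fun s' => s'.reg 72 = 0) (wp_eval rfl (le_refl 1) ?_) ?_).mono ?_ fun _ h => h
  · simp [Prog.eval, Op.exec]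
  swap
  · ring_nf
    omega
  intro s₁ h72 f₁
  refine wp_cons (rootProg_wp (by rw [f₁.reg 0 (by decide), hn]) (by rw [f₁.reg 97 (by decide), h97])
    (by rw [f₁.reg 98 (by decide), h98]) h72 F) ?_
  intro s₂ h₂ f₂
  rw [f₁.arr 5 (by decide)] at h₂
  have g5 : s₂.arr 5 = s.arr 5 := by rw [f₂.arr 5 (by decide), f₁.arr 5 (by decide)]
  have g6 : s₂.arr 6 = s.arr 6 := by rw [f₂.arr 6 (by decide), f₁.arr 6 (by decide)]
  have g11 : s₂.arr 11 = s.arr 11 := by rw [f₂.arr 11 (by decide), f₁.arr 11 (by decide)]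
  have g12 : s₂.arr 12 = s.arr 12 := by rw [f₂.arr 12 (by decide), f₁.arr 12 (by decide)]
  have g0 : s₂.reg 0 = n := by rw [f₂.reg 0 (by decide), f₁.reg 0 (by decide), hn]
  have g97 : s₂.reg 97 = 0 := by rw [f₂.reg 97 (by decide), f₁.reg 97 (by decide), h97]
  have g98 : s₂.reg 98 = 1 := by rw [f₂.reg 98 (by decide), f₁.reg 98 (by decide), h98]
  -- each round goes through all edges and reaches all neighbours of the vertices reached before
  refine wp_last (wp_for (n := n) (fun k s' =>
    Rooted F (s.arr 5) (s'.arr 13) (s'.arr 14) (s'.arr 15) (s'.arr 16) (s'.reg 72) ∧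
    ∀ r v : Fin n, s.arr 5 r = r → ∀ p : F.Walk r v, p.length ≤ k → s'.arr 14 v ≠ 0) g0 (by decide)
    (by decide) (by decide) ?_ ?_) ?_
  · refine ⟨by simpa [State.setReg] using h₂, fun r v hr p hp => ?_⟩
    obtain rfl := SimpleGraph.Walk.eq_of_length_eq_zero (Nat.le_zero.1 hp)
    exact (h₂.root r r.2 hr).1
  · rintro k - s' hf ⟨i1, i2⟩ -
    refine (wp_for (n := n) (T := 16) (fun i s'' =>
      Rooted F (s.arr 5) (s''.arr 13) (s''.arr 14) (s''.arr 15) (s''.arr 16) (s''.reg 72) ∧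
      (∀ x < n, s'.arr 14 x ≠ 0 → s''.arr 14 x ≠ 0) ∧
      ∀ j < i, s'.arr 14 (s.arr 11 j) ≠ 0 ∨ s'.arr 14 (s.arr 12 j) ≠ 0 →
        s''.arr 14 (s.arr 11 j) ≠ 0 ∧ s''.arr 14 (s.arr 12 j) ≠ 0)
      (by rw [hf.reg 0 (by decide), g0]) (by decide)
      (by decide) (by decide) ?_ ?_).mono le_rfl ?_
    · exact ⟨by simpa [State.setReg] using i1, fun x _ h => h,
        fun j hj => absurd hj (Nat.not_lt_zero j)⟩
    · rintro i hi s'' hf' ⟨j1, j2, j3⟩ hr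
      have e5 : s''.arr 5 = s.arr 5 := by rw [hf'.arr 5 (by decide), hf.arr 5 (by decide), g5]
      have e6 : s''.arr 6 = s.arr 6 := by rw [hf'.arr 6 (by decide), hf.arr 6 (by decide), g6]
      have e11 : s''.arr 11 = s.arr 11 := by rw [hf'.arr 11 (by decide), hf.arr 11 (by decide), g11]
      have e12 : s''.arr 12 = s.arr 12 := by rw [hf'.arr 12 (by decide), hf.arr 12 (by decide), g12]
      refine (exploreBody_wp (F := F) (by rw [hf'.reg 97 (by decide), hf.reg 97 (by decide), g97])
        (by rw [hf'.reg 98 (by decide), hf.reg 98 (by decide), g98]) hr hi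
        (by rwa [e5, e6, e11, e12]) (by rwa [e5])).mono le_rfl ?_
      rintro t ⟨k1, k2, k3⟩
      rw [e5] at k1
      rw [e11, e12] at k3
      refine ⟨by simpa [State.setReg] using k1, fun x hx hm => k2 x hx (j2 x hx hm),
        fun j hj hm => ?_⟩
      have hjn : j < n := by omega
      rcases Nat.lt_succ_iff_lt_or_eq.1 hj with hj' | rfl
      · obtain ⟨l1, l2⟩ := j3 j hj' hm
        exact ⟨k2 _ (hF.ea_lt j hjn) l1, k2 _ (hF.eb_lt j hjn) l2⟩
      · exact k3 (hm.imp (j2 _ (hF.ea_lt j hjn)) (j2 _ (hF.eb_lt j hjn)))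
    · rintro t ⟨j1, j2, j3⟩
      refine ⟨by simpa [State.setReg] using j1, fun r v hr p hp => ?_⟩
      simp only [State.setReg]
      rcases Nat.eq_zero_or_pos p.length with h0 | h0
      · obtain rfl := SimpleGraph.Walk.eq_of_length_eq_zero h0
        exact j2 r r.2 (i2 r r hr .nil (Nat.zero_le k))
      · have hnil : ¬ p.Nil := fun h => by
          have := SimpleGraph.Walk.length_eq_zero_iff.2 h
          omega
        have hadj := p.adj_penultimate hnil
        have hlen : p.dropLast.length ≤ k := by
          have := p.length_dropLast_add_one hnil
          omega
        have hm := i2 r _ hr p.dropLast hlen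
        obtain ⟨-, j, hj, hj'⟩ := (hF.adj _ _).1 hadj
        rcases hj' with ⟨e1, e2⟩ | ⟨e1, e2⟩
        · rw [← e1] at hm
          have := (j3 j hj (Or.inl hm)).2
          rwa [e2] at this
        · rw [← e2] at hm
          have := (j3 j hj (Or.inr hm)).1
          rwa [e1] at this
  · rintro s' ⟨i1, i2⟩ -
    have hm : ∀ x < n, s'.arr 14 x ≠ 0 := by
      intro x hx
      have hr := hF.lab_lab x hx
      have hlt := hF.lab_lt x hx
      -- a path has fewer than `n` edges, so that `n` rounds suffice
      obtain ⟨p, hp⟩ := ((hF.reach ⟨_, hlt⟩ ⟨x, hx⟩).2 hr).exists_isPath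
      have := hp.length_lt
      rw [Fintype.card_fin] at this
      exact i2 ⟨_, hlt⟩ ⟨x, hx⟩ hr p this.le
    have := i1.eq_of_forall hm
    rw [this] at i1
    exact ⟨i1, hm⟩

end LCC

/-! ### Pruning in memory -/

namespace LCC

section

variable {n : ℕ} {F : SimpleGraph (Fin n)} {lab par mark nxt ord : ℕ → ℕ} {c : ℕ}

theorem Rooted.reachable_label (h : Rooted F lab par mark nxt ord c) {G : SimpleGraph (Fin n)}
    {m : ℕ} (hG : ∀ z y : Fin n, lab z ≠ z → mark z < m → par z = y → G.Adj z y) (z : Fin n)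
    (hz : mark z ≠ 0) (hzm : mark z < m) : ∃ r : Fin n, lab r = r ∧ G.Reachable z r := by
  induction hk : mark z using Nat.strong_induction_on generalizing z with
  | _ k ih =>
    subst hk
    by_cases hr : lab z = z
    · exact ⟨z, hr, .refl z⟩
    · obtain ⟨y, h1, -, h3, h4⟩ := h.parent z hr hz
      obtain ⟨r, hr', hyr⟩ := ih _ h4 y h3 (h4.trans hzm) rfl
      exact ⟨r, hr', (hG z y hr hzm h1).reachable.trans hyr⟩

/-- The edges of a completely explored forest are the edges from vertices to their parents. -/
theorem Rooted.adj_iff (h : Rooted F lab par mark nxt ord c) (hm : ∀ x < n, mark x ≠ 0)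
    (hF : F.IsAcyclic) (hlab : ∀ u v : Fin n, F.Reachable u v ↔ lab u = lab v) (u v : Fin n) :
    F.Adj u v ↔ (lab u ≠ u ∧ par u = v) ∨ (lab v ≠ v ∧ par v = u) := by
  constructor
  · intro huv
    by_contra hc
    rw [not_or] at hc
    set G := F.deleteEdges {s(u, v)} with hG
    have hadj : ∀ z y : Fin n, lab z ≠ z → mark z < c + 1 → par z = y → G.Adj z y := by
      rintro z y hz - hzy
      obtain ⟨y', h1, h2, -⟩ := h.parent z hz (hm z z.2)
      obtain rfl : y = y' := Fin.ext (hzy.symm.trans h1)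
      rw [hG, SimpleGraph.deleteEdges_adj]
      refine ⟨h2, fun he => ?_⟩
      rcases Sym2.eq_iff.1 (Set.mem_singleton_iff.1 he) with ⟨rfl, rfl⟩ | ⟨rfl, rfl⟩
      · exact hc.1 ⟨hz, hzy⟩
      · exact hc.2 ⟨hz, hzy⟩
    have hall : ∀ z : Fin n, ∃ r : Fin n, lab r = r ∧ G.Reachable z r := fun z =>
      h.reachable_label hadj z (hm z z.2)
        (Nat.lt_succ_of_le (h.ord_mark z z.2 (hm z z.2)).1)
    obtain ⟨r, hr, hur⟩ := hall u
    obtain ⟨r', hr', hvr⟩ := hall v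
    have hle : G ≤ F := SimpleGraph.deleteEdges_le _
    obtain rfl : r = r' := by
      refine Fin.ext ?_
      rw [← hr, ← hr', ← (hlab u r).1 (hur.mono hle), ← (hlab v r').1 (hvr.mono hle)]
      exact (hlab u v).1 huv.reachable
    exact not_reachable_deleteEdges hF huv (hur.trans hvr.symm)
  · rintro (⟨h1, h2⟩ | ⟨h1, h2⟩)
    · obtain ⟨y, h3, h4, -⟩ := h.parent u h1 (hm u u.2)
      obtain rfl : v = y := Fin.ext (h2.symm.trans h3)
      exact h4
    · obtain ⟨y, h3, h4, -⟩ := h.parent v h1 (hm v v.2)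
      obtain rfl : u = y := Fin.ext (h2.symm.trans h3)
      exact h4.symm

/-- An edge from a vertex to its parent determines the vertex. -/
theorem Rooted.edge_ne (h : Rooted F lab par mark nxt ord c) (hm : ∀ x < n, mark x ≠ 0)
    {x y z w : Fin n} (hx : lab x ≠ x) (hxy : par x = y) (hz : lab z ≠ z) (hzw : par z = w)
    (hne : z ≠ x) : s(z, w) ≠ s(x, y) := by
  intro he
  rcases Sym2.eq_iff.1 he with ⟨rfl, -⟩ | ⟨rfl, rfl⟩
  · exact hne rfl
  · obtain ⟨y', h1, -, -, h2⟩ := h.parent w hx (hm w w.2)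
    obtain ⟨w', h3, -, -, h4⟩ := h.parent z hz (hm z z.2)
    obtain rfl : z = y' := Fin.ext (hxy.symm.trans h1)
    obtain rfl : w = w' := Fin.ext (hzw.symm.trans h3)
    omega

/-- Without the edge from `x` to its parent, the roots are not connected to `x`. -/
theorem Rooted.not_reachable_of_root (h : Rooted F lab par mark nxt ord c)
    (hm : ∀ x < n, mark x ≠ 0) (hF : F.IsAcyclic)
    (hlab : ∀ u v : Fin n, F.Reachable u v ↔ lab u = lab v) {x y v : Fin n} (hx : lab x ≠ x)
    (hxy : par x = y) (hv : lab v = v) : ¬ (F.deleteEdges {s(x, y)}).Reachable v x := by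
  intro hr
  set G := F.deleteEdges {s(x, y)} with hG
  have hle : G ≤ F := SimpleGraph.deleteEdges_le _
  obtain ⟨y', h1, h2, h3, h4⟩ := h.parent x hx (hm x x.2)
  obtain rfl : y = y' := Fin.ext (hxy.symm.trans h1)
  obtain ⟨r, hr', hyr⟩ := h.reachable_label (G := G) (m := mark x) (fun z w hz hzm hzw => by
    obtain ⟨w', k1, k2, -⟩ := h.parent z hz (hm z z.2)
    obtain rfl : w = w' := Fin.ext (hzw.symm.trans k1)
    rw [hG, SimpleGraph.deleteEdges_adj]
    exact ⟨k2, h.edge_ne hm hx hxy hz hzw fun he => by rw [he] at hzm; omega⟩) y h3 h4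
  obtain rfl : r = v := by
    refine Fin.ext ?_
    rw [← hr', ← hv, ← (hlab y r).1 (hyr.mono hle), (hlab v x).1 (hr.mono hle)]
    exact (hlab y x).1 h2.symm.reachable
  exact not_reachable_deleteEdges hF h2 (hyr.trans hr).symm

/-- Without the edge from `x` to its parent, a vertex other than `x` is connected to `x` if and only
if its parent is. This is how descendants of `x` are recognized. -/
theorem Rooted.reachable_parent_iff (h : Rooted F lab par mark nxt ord c)
    (hm : ∀ x < n, mark x ≠ 0) {x y z w : Fin n} (hx : lab x ≠ x) (hxy : par x = y)
    (hz : lab z ≠ z) (hzw : par z = w) (hne : z ≠ x) :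
    (F.deleteEdges {s(x, y)}).Reachable z x ↔ (F.deleteEdges {s(x, y)}).Reachable w x := by
  obtain ⟨w', k1, k2, -⟩ := h.parent z hz (hm z z.2)
  obtain rfl : w = w' := Fin.ext (hzw.symm.trans k1)
  have hadj : (F.deleteEdges {s(x, y)}).Adj z w := by
    rw [SimpleGraph.deleteEdges_adj]
    exact ⟨k2, h.edge_ne hm hx hxy hz hzw hne⟩
  exact ⟨fun h' => hadj.symm.reachable.trans h', fun h' => hadj.reachable.trans h'⟩

end

/-- To decide whether an edge is pruned, it suffices to look at one of the two parts into which the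
edge divides its component. -/
theorem forall_dvd_compSize_deleteEdges_iff {V : Type*} [Finite V] {g : ℕ} {F : SimpleGraph V}
    (hg : ∀ v, g ∣ compSize F v) {x y : V} (hxy : F.Adj x y) :
    (∀ v, g ∣ compSize (F.deleteEdges {s(x, y)}) v) ↔
      g ∣ compSize (F.deleteEdges {s(x, y)}) x := by
  refine ⟨fun h => h x, fun h v => ?_⟩
  set G := F.deleteEdges {s(x, y)} with hG
  have hF : G ⊔ SimpleGraph.edge x y = F := deleteEdges_sup_edge hxy
  by_cases hv : G.Reachable v x
  · rwa [compSize_eq_of_reachable hv]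
  · refine dvd_compSize_of_le (SimpleGraph.deleteEdges_le _) (fun u hu hu' => ?_) (hg v)
    rw [← hF, reachable_sup_edge] at hu
    rcases hu with h1 | ⟨h1, -⟩ | ⟨-, h1⟩
    · exact absurd h1 hu'
    · rwa [compSize_eq_of_reachable h1]
    · exact absurd h1.symm hv

/-- Counts the vertex at position `81` of the order of exploration if it is a descendant of the
vertex in register `80`. -/
def subtreeBody : Prog :=
  blk [ops [.load 82 16 81, .load 83 13 82, .load 84 19 83],
    .ite (.eq 82 80) (.op (.const 84 1)) (.ite (.eq 82 83) (.op (.const 84 0)) .skip),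
    ops [.store 19 82 84, .add 85 85 84]]

theorem subtreeBody_wp {t x : ℕ} {s : State} {D : ℕ → ℕ} (ht : s.reg 81 = t) (hx : s.reg 80 = x)
    (hDx : D x = 1) (hroot : s.arr 16 t ≠ x → s.arr 13 (s.arr 16 t) = s.arr 16 t →
      D (s.arr 16 t) = 0)
    (hpar : s.arr 16 t ≠ x → s.arr 13 (s.arr 16 t) ≠ s.arr 16 t →
      D (s.arr 16 t) = s.arr 19 (s.arr 13 (s.arr 16 t))) :
    wp subtreeBody 12 (fun s' =>
      s'.arr 19 = Function.update (s.arr 19) (s.arr 16 t) (D (s.arr 16 t)) ∧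
      s'.reg 85 = s.reg 85 + D (s.arr 16 t)) s := by
  refine wp_eval rfl (by decide) ?_
  by_cases h1 : s.arr 16 t = x
  · simp [subtreeBody, Prog.eval, blk, ops, Op.exec, Test.holds, ht, hx, h1, hDx]
  · by_cases h2 : s.arr 13 (s.arr 16 t) = s.arr 16 t
    · have h3 := hroot h1 h2
      simp [subtreeBody, Prog.eval, blk, ops, Op.exec, Test.holds, ht, hx, h1, h2, h3]
    · have h3 := hpar h1 h2
      simp [subtreeBody, Prog.eval, blk, ops, Op.exec, Test.holds, ht, hx, h1, Ne.symm h2, h3]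

/-- Marks in array `17` the vertices whose edge to the parent survives the pruning. -/
def keepProg : Prog :=
  forTo 80 0 (blk [.op (.load 86 13 80), .ite (.eq 86 80) (.op (.store 17 80 97))
    (blk [.op (.const 85 0), forTo 81 0 subtreeBody, .op (.load 87 3 85),
      .ite (.eq 87 98) (.op (.store 17 80 97)) (.op (.store 17 80 98))])])

/-- Each vertex takes one pass over the order of exploration, in which parents precede their
children; all in all, this takes time `O(n²)`. -/
theorem keepProg_wp {n g : ℕ} {s : State} (hn : s.reg 0 = n) (h97 : s.reg 97 = 0)
    (h98 : s.reg 98 = 1) (hdvd : ∀ m ≤ n, s.arr 3 m = 1 ↔ g ∣ m) {F : SimpleGraph (Fin n)}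
    {lab mark nxt : ℕ → ℕ} (hF : F.IsAcyclic) (hlab : ∀ u v : Fin n, F.Reachable u v ↔ lab u = lab v)
    (h : Rooted F lab (s.arr 13) mark nxt (s.arr 16) n) (hm : ∀ x < n, mark x ≠ 0) :
    wp keepProg (n * (n * 17 + 30) + 3) (fun s' => ∀ x : Fin n, s'.arr 17 x = 1 ↔
      ∃ y : Fin n, lab x ≠ x ∧ s.arr 13 x = y ∧ ¬ g ∣ compSize (F.deleteEdges {s(x, y)}) x) s := by
  classical
  refine (wp_for (n := n) (T := n * 17 + 25) (fun k s' => ∀ x : Fin n, x < k → (s'.arr 17 x = 1 ↔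
      ∃ y : Fin n, lab x ≠ x ∧ s.arr 13 x = y ∧ ¬ g ∣ compSize (F.deleteEdges {s(x, y)}) x))
    hn (by decide) (by decide) (by decide) ?_ ?_).mono (le_refl _) fun s' h x => h x x.2
  · exact fun x hx => absurd hx (Nat.not_lt_zero _)
  rintro k hk s' hf hI hr
  obtain ⟨x, rfl⟩ : ∃ x : Fin n, k = x := ⟨⟨k, hk⟩, rfl⟩
  have g97 : s'.reg 97 = 0 := by rw [hf.reg 97 (by decide), h97]
  have g98 : s'.reg 98 = 1 := by rw [hf.reg 98 (by decide), h98]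
  have g0 : s'.reg 0 = n := by rw [hf.reg 0 (by decide), hn]
  have g13 : s'.arr 13 = s.arr 13 := hf.arr 13 (by decide)
  have g16 : s'.arr 16 = s.arr 16 := hf.arr 16 (by decide)
  have g3 : s'.arr 3 = s.arr 3 := hf.arr 3 (by decide)
  -- it suffices to set the entry of `x` correctly
  have hfin : ∀ s'' : State, ∀ v : ℕ, s''.arr 17 = Function.update (s'.arr 17) x v →
      (v = 1 ↔ ∃ y : Fin n, lab x ≠ x ∧ s.arr 13 x = y ∧
        ¬ g ∣ compSize (F.deleteEdges {s(x, y)}) x) →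
      ∀ z : Fin n, (z : ℕ) < x + 1 → (s''.arr 17 z = 1 ↔
        ∃ y : Fin n, lab z ≠ z ∧ s.arr 13 z = y ∧
          ¬ g ∣ compSize (F.deleteEdges {s(z, y)}) z) := by
    intro s'' v e hv z hz
    rw [e]
    by_cases hzx : z = x
    · subst hzx
      rwa [Function.update_self]
    · have : (z : ℕ) ≠ x := fun h => hzx (Fin.ext h)
      rw [Function.update_of_ne this]
      exact hI z (by omega)
  have hpl : s.arr 13 x = x ↔ lab x = x := by
    refine ⟨fun he => ?_, fun he => (h.root x x.2 he).2⟩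
    by_contra hc
    obtain ⟨y, h1, -, -, h4⟩ := h.parent x hc (hm x x.2)
    rw [← h1, he] at h4
    omega
  refine (wp_cons (T₁ := 1) (R := fun s₁ => s₁.reg 86 = s.arr 13 x) (wp_eval rfl (le_refl 1) ?_)
    (T₂ := ((1 + ((n * (12 + 5) + 3) + (1 + (2 + 1)))) + 1) + 1) ?_).mono (by omega) fun _ h => h
  · simp [Prog.eval, Op.exec, hr, g13]
  intro s₁ r86 f₁
  have r80 : s₁.reg 80 = x := by rw [f₁.reg 80 (by decide), hr]
  refine wp_last (R := fun s'' => ∀ z : Fin n, (z : ℕ) < x + 1 → (s''.arr 17 z = 1 ↔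
        ∃ y : Fin n, lab z ≠ z ∧ s.arr 13 z = y ∧
          ¬ g ∣ compSize (F.deleteEdges {s(z, y)}) z)) (wp_ite (fun hb => ?_) fun hb => ?_)
    fun s'' h _ => h
  · simp only [Test.holds, r86, r80, hpl] at hb
    refine wp_eval rfl (by simp [Prog.cost]) (hfin _ 0 ?_ ?_)
    · simp [Prog.eval, Op.exec, r80, f₁.reg 97 (by decide), g97, f₁.arr 17 (by decide)]
    · simp [hb]
  simp only [Test.holds, r86, r80, hpl] at hb
  obtain ⟨y, hxy, hadj, -⟩ := h.parent x hb (hm x x.2)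
  set G := F.deleteEdges {s(x, y)} with hG
  -- the indicator of the descendants of `x`
  set D : ℕ → ℕ := fun v => if ∃ z : Fin n, v = z ∧ G.Reachable z x then 1 else 0 with hD
  have hDz : ∀ z : Fin n, D z = if G.Reachable z x then 1 else 0 := by
    intro z
    rw [hD]
    dsimp only
    congr 1
    exact propext ⟨fun ⟨z', h1, h2⟩ => by rwa [Fin.ext h1], fun h => ⟨z, rfl, h⟩⟩
  refine wp_cons (T₁ := 1) (R := fun s₂ => s₂.reg 85 = 0) (wp_eval rfl (le_refl 1) ?_) ?_
  · simp [Prog.eval, Op.exec]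
  intro s₂ r85 f₂
  refine wp_cons (wp_for (n := n) (T := 12) (fun t s'' =>
    (∀ j < t, s''.arr 19 (s.arr 16 j) = D (s.arr 16 j)) ∧
    s''.reg 85 = ∑ j ∈ Finset.range t, D (s.arr 16 j))
    (by rw [f₂.reg 0 (by decide), f₁.reg 0 (by decide), g0]) (by decide) (by decide) (by decide)
    ?_ ?_) ?_
  · exact ⟨fun j hj => absurd hj (Nat.not_lt_zero j), by simpa [State.setReg] using r85⟩
  · rintro t ht s'' hf' ⟨i1, i2⟩ hr'
    have k13 : s''.arr 13 = s.arr 13 := by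
      rw [hf'.arr 13 (by decide), f₂.arr 13 (by decide), f₁.arr 13 (by decide), g13]
    have k16 : s''.arr 16 = s.arr 16 := by
      rw [hf'.arr 16 (by decide), f₂.arr 16 (by decide), f₁.arr 16 (by decide), g16]
    obtain ⟨z, hz⟩ : ∃ z : Fin n, s.arr 16 t = z := ⟨⟨_, h.ord_lt t ht⟩, rfl⟩
    have hzm : mark z = t + 1 := by rw [← hz, h.mark_ord t ht]
    refine (subtreeBody_wp (D := D) hr' (x := x)
      (by rw [hf'.reg 80 (by decide), f₂.reg 80 (by decide), r80]) ?_ ?_ ?_).mono le_rfl ?_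
    · rw [hDz, if_pos (.refl x)]
    · rw [k13, k16, hz, hDz]
      intro h1 h2
      have hzl : lab z = z := by
        by_contra hc
        obtain ⟨w, h3, -, -, h4⟩ := h.parent z hc (hm z z.2)
        rw [← h3, h2] at h4
        omega
      exact if_neg (h.not_reachable_of_root hm hF hlab hb hxy hzl)
    · rw [k13, k16, hz]
      intro h1 h2
      have hzl : lab z ≠ z := fun hc => h2 (h.root z z.2 hc).2
      obtain ⟨w, h3, -, h5, h4⟩ := h.parent z hzl (hm z z.2)
      have hw := (h.ord_mark w w.2 h5).2
      have := i1 (mark w - 1) (by omega)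
      rw [hw] at this
      rw [h3, this, hDz, hDz]
      exact if_congr (h.reachable_parent_iff hm hb hxy hzl h3 fun h => h1 (congrArg Fin.val h))
        rfl rfl
    · rintro s₃ ⟨e1, e2⟩
      rw [k16] at e1 e2
      constructor
      · intro j hj
        simp only [State.setReg]
        rw [e1, Function.update_apply]
        split_ifs with hjt
        · rw [hjt]
        · refine i1 j ?_
          rcases Nat.lt_succ_iff_lt_or_eq.1 hj with h' | rfl
          · exact h'
          · exact absurd rfl hjt
      · rw [Finset.sum_range_succ, ← i2]
        simpa [State.setReg] using e2
  rintro s₃ ⟨-, e85⟩ f₃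
  -- the sum over the order of exploration is the size of a component
  have hsum : ∑ j ∈ Finset.range n, D (s.arr 16 j) = compSize G x := by
    have h1 : ∑ j ∈ Finset.range n, D (s.arr 16 j) = ∑ z : Fin n, D z := by
      rw [Finset.sum_range]
      refine Finset.sum_bij (fun (j : Fin n) _ => (⟨s.arr 16 j, h.ord_lt j j.2⟩ : Fin n))
        (fun _ _ => Finset.mem_univ _) (fun i _ j _ he => ?_) (fun z _ => ?_) fun j _ => rfl
      · have h1 := h.mark_ord i i.2
        rw [Fin.mk.inj_iff.1 he, h.mark_ord j j.2] at h1
        exact Fin.ext (by omega)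
      · obtain ⟨h1, h2⟩ := h.ord_mark z z.2 (hm z z.2)
        have := hm z z.2
        exact ⟨⟨mark z - 1, by omega⟩, Finset.mem_univ _, Fin.ext h2⟩
    rw [h1, compSize_eq_ncard, Set.ncard_eq_toFinset_card', Finset.card_eq_sum_ones,
      Set.toFinset_ofPred, Finset.sum_filter]
    exact Finset.sum_congr rfl fun z _ => hDz z
  rw [hsum] at e85
  have hle : compSize G x ≤ n := by
    rw [compSize_eq_ncard]
    simpa using Set.ncard_le_card {w | G.Reachable w x}
  have k3 : s₃.arr 3 = s.arr 3 := by
    rw [f₃.arr 3 (by decide), f₂.arr 3 (by decide), f₁.arr 3 (by decide), g3]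
  have k17 : s₃.arr 17 = s'.arr 17 := by
    rw [f₃.arr 17 (by decide), f₂.arr 17 (by decide), f₁.arr 17 (by decide)]
  have k80 : s₃.reg 80 = x := by rw [f₃.reg 80 (by decide), f₂.reg 80 (by decide), r80]
  have k97 : s₃.reg 97 = 0 := by
    rw [f₃.reg 97 (by decide), f₂.reg 97 (by decide), f₁.reg 97 (by decide), g97]
  have k98 : s₃.reg 98 = 1 := by
    rw [f₃.reg 98 (by decide), f₂.reg 98 (by decide), f₁.reg 98 (by decide), g98]
  refine wp_eval rfl (le_refl 4) (hfin _ (if g ∣ compSize G x then 0 else 1) ?_ ?_)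
  · have hd := hdvd _ hle
    by_cases hgd : g ∣ compSize G x
    · have h1 := hd.2 hgd
      simp [Prog.eval, blk, Op.exec, Test.holds, k3, k80, k97, k98, k17, e85, h1, hgd]
    · have h1 : s.arr 3 (compSize G x) ≠ 1 := fun he => hgd (hd.1 he)
      simp [Prog.eval, blk, Op.exec, Test.holds, k3, k80, k98, k17, e85, h1, hgd]
  · have : (∃ y' : Fin n, lab x ≠ x ∧ s.arr 13 x = y' ∧
        ¬ g ∣ compSize (F.deleteEdges {s(x, y')}) x) ↔ ¬ g ∣ compSize G x := by
      constructor
      · rintro ⟨y', -, h2, h3⟩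
        rwa [hG, show y = y' from Fin.ext (hxy.symm.trans h2)]
      · exact fun h' => ⟨y, hb, hxy, h'⟩
    rw [this]
    split_ifs with h' <;> simp [h']

end LCC

namespace LCC

/-- The forest without edges. -/
def freshProg : Prog :=
  forTo 86 0 (ops [.store 5 86 86, .store 6 86 98, .store 11 86 86, .store 12 86 86])

theorem freshProg_wp {n : ℕ} {s : State} (hn : s.reg 0 = n) (h98 : s.reg 98 = 1) :
    wp freshProg (n * 10 + 3) (fun s' => (∀ x < n, s'.arr 5 x = x ∧ s'.arr 6 x = 1) ∧
      Forest n (⊥ : SimpleGraph (Fin n)) (s'.arr 5) (s'.arr 6) (s'.arr 11) (s'.arr 12)) s := by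
  refine (wp_for (n := n) (T := 5) (fun k s' => ∀ x < k, s'.arr 5 x = x ∧ s'.arr 6 x = 1 ∧
    s'.arr 11 x = x ∧ s'.arr 12 x = x) hn (by decide) (by decide) (by decide) ?_ ?_).mono le_rfl ?_
  · exact fun x hx => absurd hx (Nat.not_lt_zero x)
  · intro k hk s' hf hI hr
    have g98 : s'.reg 98 = 1 := by rw [hf.reg 98 (by decide), h98]
    refine wp_eval rfl (le_refl 5) ?_
    intro x hx
    rcases Nat.lt_succ_iff_lt_or_eq.1 hx with h | rfl
    · have := hI x h
      simpa [ops, blk, Prog.eval, Op.exec, State.setReg, hr, h.ne] using this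
    · simp [ops, blk, Prog.eval, Op.exec, State.setReg, hr, g98]
  · intro s' h
    refine ⟨fun x hx => ⟨(h x hx).1, (h x hx).2.1⟩, SimpleGraph.isAcyclic_bot, fun u hu => ?_,
      fun u hu => ?_, fun u v => ?_, fun u => ?_, fun x hx => ?_, fun x hx => ?_, fun u v => ?_,
      fun x hx _ => ?_⟩
    · rwa [(h u hu).1]
    · rw [(h u hu).1, (h u hu).1]
    · rw [(h u u.2).1, (h v v.2).1, SimpleGraph.reachable_bot, Fin.ext_iff]
    · rw [(h u u.2).1, (h u u.2).2.1, compSize_eq_ncard]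
      simp
    · rwa [(h x hx).2.2.1]
    · rwa [(h x hx).2.2.2]
    · simp only [SimpleGraph.bot_adj, false_iff, not_and, not_exists]
      rintro huv x hx he
      rw [(h x hx).2.2.1, (h x hx).2.2.2] at he
      exact huv (Fin.ext (by omega))
    · rw [(h x hx).2.2.1, (h x hx).2.2.2]

/-- Joins the vertices that are marked in array `17` to their parents. -/
def rebuildProg : Prog :=
  forTo 80 0 (blk [.op (.load 81 17 80), .ite (.eq 81 98)
    (blk [ops [.add 32 80 97, .load 33 13 80, .load 34 5 32, .load 35 5 33], joinProg]) .skip])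

/-- Replaces the forest by its pruned version. -/
def pruneProg : Prog := blk [exploreProg, keepProg, freshProg, rebuildProg]

theorem rebuildProg_wp {n : ℕ} {s : State} (hn : s.reg 0 = n) (h97 : s.reg 97 = 0)
    (h98 : s.reg 98 = 1) {H : SimpleGraph (Fin n)} (hH : H.IsAcyclic)
    (hadj : ∀ u v : Fin n, H.Adj u v ↔
      (s.arr 17 u = 1 ∧ s.arr 13 u = v) ∨ (s.arr 17 v = 1 ∧ s.arr 13 v = u))
    (hpar : ∀ x : Fin n, s.arr 17 x = 1 → ∃ y : Fin n, s.arr 13 x = y)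
    (hinj : ∀ x y z w : Fin n, s.arr 17 x = 1 → s.arr 13 x = y → s.arr 17 z = 1 → s.arr 13 z = w →
      z ≠ x → s(z, w) ≠ s(x, y))
    (hF : Forest n (⊥ : SimpleGraph (Fin n)) (s.arr 5) (s.arr 6) (s.arr 11) (s.arr 12)) :
    wp rebuildProg (n * (n * 9 + 40) + 3) (fun s' =>
      Forest n H (s'.arr 5) (s'.arr 6) (s'.arr 11) (s'.arr 12)) s := by
  refine (wp_for (n := n) (T := n * 9 + 35) (fun k s' => ∃ H' : SimpleGraph (Fin n),
    Forest n H' (s'.arr 5) (s'.arr 6) (s'.arr 11) (s'.arr 12) ∧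
    ∀ u v : Fin n, H'.Adj u v ↔ (s.arr 17 u = 1 ∧ s.arr 13 u = v ∧ (u : ℕ) < k) ∨
      (s.arr 17 v = 1 ∧ s.arr 13 v = u ∧ (v : ℕ) < k))
    hn (by decide) (by decide) (by decide) ?_ ?_).mono (le_refl _) ?_
  · exact ⟨⊥, hF, by simp⟩
  · rintro k hk s' hf ⟨H', hH', hadj'⟩ hr
    obtain ⟨x, rfl⟩ : ∃ x : Fin n, k = x := ⟨⟨k, hk⟩, rfl⟩
    have g97 : s'.reg 97 = 0 := by rw [hf.reg 97 (by decide), h97]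
    have g98 : s'.reg 98 = 1 := by rw [hf.reg 98 (by decide), h98]
    have g0 : s'.reg 0 = n := by rw [hf.reg 0 (by decide), hn]
    have g13 : s'.arr 13 = s.arr 13 := hf.arr 13 (by decide)
    have g17 : s'.arr 17 = s.arr 17 := hf.arr 17 (by decide)
    refine (wp_cons (T₁ := 1) (R := fun s₁ => s₁.reg 81 = s.arr 17 x) (wp_eval rfl (le_refl 1) ?_)
      (T₂ := (5 + (n * 9 + 20 + 1) + 1) + 1) ?_).mono (by omega) fun _ h => h
    · simp [Prog.eval, Op.exec, hr, g17]
    intro s₁ r81 f₁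
    have k98 : s₁.reg 98 = 1 := by rw [f₁.reg 98 (by decide), g98]
    refine wp_last (R := fun t => ∃ H' : SimpleGraph (Fin n),
        Forest n H' (t.arr 5) (t.arr 6) (t.arr 11) (t.arr 12) ∧
        ∀ u v : Fin n, H'.Adj u v ↔ (s.arr 17 u = 1 ∧ s.arr 13 u = v ∧ (u : ℕ) < x + 1) ∨
          (s.arr 17 v = 1 ∧ s.arr 13 v = u ∧ (v : ℕ) < x + 1))
      (wp_ite (fun hb => ?_) fun hb => ?_) fun s'' h _ => h
    swap
    · simp only [Test.holds, r81, k98] at hb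
      refine ⟨1, s₁, by omega, .skip _, H', ?_, fun u v => ?_⟩
      · rwa [f₁.arr 5 (by decide), f₁.arr 6 (by decide), f₁.arr 11 (by decide),
          f₁.arr 12 (by decide)]
      · rw [hadj']
        have hux : ∀ u : Fin n, s.arr 17 u = 1 → ((u : ℕ) < x + 1 ↔ (u : ℕ) < x) := by
          intro u hu
          have : (u : ℕ) ≠ x := fun h => hb (h ▸ hu)
          omega
        refine or_congr (and_congr_right fun h => ?_) (and_congr_right fun h => ?_) <;>
          rw [hux _ h]
    simp only [Test.holds, r81, k98] at hb
    obtain ⟨y, hy⟩ := hpar x hb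
    have hHxy : H.Adj x y := (hadj x y).2 (Or.inl ⟨hb, hy⟩)
    -- the edges added before differ from `x y`, hence `x y` closes no cycle in the forest `H`
    have hle : H' ≤ H.deleteEdges {s(x, y)} := by
      intro u v huv
      rw [SimpleGraph.deleteEdges_adj]
      rcases (hadj' u v).1 huv with ⟨h1, h2, h3⟩ | ⟨h1, h2, h3⟩
      · exact ⟨(hadj u v).2 (Or.inl ⟨h1, h2⟩), hinj x y u v hb hy h1 h2 (by rintro rfl; omega)⟩
      · refine ⟨(hadj u v).2 (Or.inr ⟨h1, h2⟩), ?_⟩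
        rw [Sym2.eq_swap (a := u)]
        exact hinj x y v u hb hy h1 h2 (by rintro rfl; omega)
    have hlab : s'.arr 5 x ≠ s'.arr 5 y := fun he =>
      not_reachable_deleteEdges hH hHxy (((hH'.reach x y).2 he).mono hle)
    refine wp_cons (T₁ := 5) (R := fun t => t.reg 32 = x ∧ t.reg 33 = y ∧
      t.reg 34 = s'.arr 5 x ∧ t.reg 35 = s'.arr 5 y) (wp_eval rfl (le_refl 5) ?_) ?_
    · simp [Prog.eval, blk, ops, Op.exec, f₁.reg 80 (by decide), hr, f₁.reg 97 (by decide), g97,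
        f₁.arr 13 (by decide), g13, hy, f₁.arr 5 (by decide)]
    rintro s₂ ⟨r32, r33, r34, r35⟩ f₂
    have e5 : s₂.arr 5 = s'.arr 5 := by rw [f₂.arr 5 (by decide), f₁.arr 5 (by decide)]
    refine wp_last (joinProg_wp (F := H') (a := x) (b := y)
      (by rw [f₂.reg 0 (by decide), f₁.reg 0 (by decide), g0]) ?_ r32 r33 (by rw [r34, e5])
      (by rw [r35, e5]) (by rwa [e5])) ?_
    · rwa [e5, f₂.arr 6 (by decide), f₁.arr 6 (by decide), f₂.arr 11 (by decide),
        f₁.arr 11 (by decide), f₂.arr 12 (by decide), f₁.arr 12 (by decide)]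
    · rintro t ⟨hF', -⟩ -
      refine ⟨_, hF', fun u v => ?_⟩
      rw [SimpleGraph.sup_adj, SimpleGraph.edge_adj, hadj']
      constructor
      · rintro ((⟨h1, h2, h3⟩ | ⟨h1, h2, h3⟩) | ⟨⟨rfl, rfl⟩ | ⟨rfl, rfl⟩, -⟩)
        · exact Or.inl ⟨h1, h2, by omega⟩
        · exact Or.inr ⟨h1, h2, by omega⟩
        · exact Or.inl ⟨hb, hy, by omega⟩
        · exact Or.inr ⟨hb, hy, by omega⟩
      · have hcase : ∀ u v : Fin n, s.arr 17 u = 1 → s.arr 13 u = v → (u : ℕ) < x + 1 →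
            (u : ℕ) < x ∨ (x = u ∧ y = v) := by
          intro u v h1 h2 h3
          rcases Nat.lt_succ_iff_lt_or_eq.1 h3 with h | h
          · exact Or.inl h
          · have hux : u = x := Fin.ext h
            subst hux
            exact Or.inr ⟨rfl, Fin.ext (hy.symm.trans h2)⟩
        rintro (⟨h1, h2, h3⟩ | ⟨h1, h2, h3⟩)
        · rcases hcase u v h1 h2 h3 with h | ⟨rfl, rfl⟩
          · exact Or.inl (Or.inl ⟨h1, h2, h⟩)
          · exact Or.inr ⟨Or.inl ⟨rfl, rfl⟩, hHxy.ne⟩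
        · rcases hcase v u h1 h2 h3 with h | ⟨rfl, rfl⟩
          · exact Or.inl (Or.inr ⟨h1, h2, h⟩)
          · exact Or.inr ⟨Or.inr ⟨rfl, rfl⟩, hHxy.ne'⟩
  · rintro s' ⟨H', hH', hadj'⟩
    have : H' = H := by
      ext u v
      rw [hadj', hadj]
      simp
    rwa [this] at hH'

theorem pruneProg_wp {n g : ℕ} {s : State} (hn : s.reg 0 = n) (h97 : s.reg 97 = 0)
    (h98 : s.reg 98 = 1) (hdvd : ∀ m ≤ n, s.arr 3 m = 1 ↔ g ∣ m) {F : SimpleGraph (Fin n)}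
    (hF : Forest n F (s.arr 5) (s.arr 6) (s.arr 11) (s.arr 12)) (hg : ∀ v, g ∣ compSize F v) :
    wp pruneProg (n * (n * 47 + 102) + 18) (fun s' =>
      Forest n (gwPrune g F) (s'.arr 5) (s'.arr 6) (s'.arr 11) (s'.arr 12)) s := by
  refine (wp_cons (exploreProg_wp hn h97 h98 hF) (T₂ := (n * (n * 17 + 30) + 3) +
    ((n * 10 + 3) + ((n * (n * 9 + 40) + 3) + 1))) ?_).mono ?_ fun _ h => h
  swap
  · ring_nf
    omega
  rintro s₁ ⟨hR, hm⟩ f₁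
  have g0 : s₁.reg 0 = n := by rw [f₁.reg 0 (by decide), hn]
  have g97 : s₁.reg 97 = 0 := by rw [f₁.reg 97 (by decide), h97]
  have g98 : s₁.reg 98 = 1 := by rw [f₁.reg 98 (by decide), h98]
  refine wp_cons (keepProg_wp (g := g) g0 g97 g98 (by rwa [f₁.arr 3 (by decide)]) hF.acyclic
    hF.reach hR hm) ?_
  intro s₂ hkeep f₂
  refine wp_cons (freshProg_wp (n := n) (by rw [f₂.reg 0 (by decide), g0])
    (by rw [f₂.reg 98 (by decide), g98])) ?_
  rintro s₃ ⟨-, hfresh⟩ f₃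
  have e13 : s₃.arr 13 = s₁.arr 13 := by rw [f₃.arr 13 (by decide), f₂.arr 13 (by decide)]
  have e17 : s₃.arr 17 = s₂.arr 17 := f₃.arr 17 (by decide)
  have hnl : ∀ x : Fin n, s₃.arr 17 x = 1 → s.arr 5 x ≠ x := by
    intro x hx
    rw [e17] at hx
    exact ((hkeep x).1 hx).choose_spec.1
  refine wp_last (rebuildProg_wp (H := gwPrune g F)
    (by rw [f₃.reg 0 (by decide), f₂.reg 0 (by decide), g0])
    (by rw [f₃.reg 97 (by decide), f₂.reg 97 (by decide), g97])
    (by rw [f₃.reg 98 (by decide), f₂.reg 98 (by decide), g98])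
    (hF.acyclic.anti (gwPrune_le g F)) ?_ ?_ ?_ hfresh) fun s' h _ => h
  · have hone : ∀ u v : Fin n, s.arr 5 u ≠ u → s₁.arr 13 u = v → F.Adj u v →
        (s(u, v) ∉ {e | ∀ v, g ∣ compSize (F.deleteEdges {e}) v} ↔ s₂.arr 17 u = 1) := by
      intro u v hu huv hadj
      rw [Set.mem_ofPred_eq, forall_dvd_compSize_deleteEdges_iff hg hadj, hkeep]
      constructor
      · exact fun h => ⟨v, hu, huv, h⟩
      · rintro ⟨w, -, h1, h2⟩
        rwa [show v = w from Fin.ext (huv.symm.trans h1)]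
    intro u v
    rw [gwPrune_eq, SimpleGraph.deleteEdges_adj, e13, e17]
    have hadj := hR.adj_iff hm hF.acyclic hF.reach
    constructor
    · rintro ⟨h1, h2⟩
      rcases (hadj u v).1 h1 with ⟨h3, h4⟩ | ⟨h3, h4⟩
      · exact Or.inl ⟨(hone u v h3 h4 h1).1 h2, h4⟩
      · rw [Sym2.eq_swap] at h2
        exact Or.inr ⟨(hone v u h3 h4 h1.symm).1 h2, h4⟩
    · rintro (⟨h1, h2⟩ | ⟨h1, h2⟩)
      · have h3 := hnl u (e17 ▸ h1)
        have h4 := (hadj u v).2 (Or.inl ⟨h3, h2⟩)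
        exact ⟨h4, (hone u v h3 h2 h4).2 h1⟩
      · have h3 := hnl v (e17 ▸ h1)
        have h4 := (hadj v u).2 (Or.inl ⟨h3, h2⟩)
        rw [Sym2.eq_swap]
        exact ⟨h4.symm, (hone v u h3 h2 h4).2 h1⟩
  · intro x hx
    obtain ⟨y, h, -⟩ := hR.parent x (hnl x hx) (hm x x.2)
    exact ⟨y, by rw [e13, h]⟩
  · intro x y z w h1 h2 h3 h4 hne
    rw [e13] at h2 h4
    exact hR.edge_ne hm (hnl x h1) h2 (hnl z h3) h4 hne

end LCC

/-! ### Phases in memory -/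

namespace LCC

/-- Marks the labels of illegal components in array `20`. -/
def illegalProg : Prog :=
  forTo 50 0 (blk [ops [.store 19 50 97, .load 51 6 50, .load 51 2 51, .load 52 5 50, .const 53 0],
    .ite (.eq 52 50) (.ite (.eq 51 98) .skip (.op (.const 53 1))) .skip, .op (.store 20 50 53)])

theorem illegalProg_wp {n : ℕ} {s : State} (hn : s.reg 0 = n) (h97 : s.reg 97 = 0)
    (h98 : s.reg 98 = 1) :
    wp illegalProg (n * 16 + 3) (fun s' => ∀ x < n, s'.arr 19 x = 0 ∧
      (s'.arr 20 x = 1 ↔ s.arr 5 x = x ∧ s.arr 2 (s.arr 6 x) ≠ 1)) s := by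
  refine wp_for (n := n) (T := 11) (fun k s' => ∀ x < k, s'.arr 19 x = 0 ∧
      (s'.arr 20 x = 1 ↔ s.arr 5 x = x ∧ s.arr 2 (s.arr 6 x) ≠ 1)) hn (by decide) (by decide)
      (by decide) (fun x hx => absurd hx (Nat.not_lt_zero x)) ?_
  intro k hk s' hf hI hr
  have g97 : s'.reg 97 = 0 := by rw [hf.reg 97 (by decide), h97]
  have g98 : s'.reg 98 = 1 := by rw [hf.reg 98 (by decide), h98]
  have g5 : s'.arr 5 = s.arr 5 := hf.arr 5 (by decide)
  have g6 : s'.arr 6 = s.arr 6 := hf.arr 6 (by decide)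
  have g2 : s'.arr 2 = s.arr 2 := hf.arr 2 (by decide)
  refine wp_eval rfl (by decide) fun x hx => ?_
  by_cases hxk : x = k
  · subst hxk
    by_cases h1 : s.arr 5 x = x <;> by_cases h2 : s.arr 2 (s.arr 6 x) = 1 <;>
      simp [Prog.eval, blk, ops, Op.exec, Test.holds, State.setReg, hr, g97, g98, g5, g6, g2, h1, h2]
  · obtain ⟨i1, i2⟩ := hI x (by omega)
    by_cases h1 : s.arr 5 k = k <;> by_cases h2 : s.arr 2 (s.arr 6 k) = 1 <;>
      simpa [Prog.eval, blk, ops, Op.exec, Test.holds, State.setReg, hr, g97, g98, g5, g6, g2, h1,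
        h2, hxk] using ⟨i1, i2⟩

/-- Index arrays `17` and `18` contain the ends of a lightest edge leaving the component with label
`a` among the pairs in `P`, and number array `4` its weight; the entry of array `19` is `0` as long
as there is no such edge. -/
def BestOk {n : ℕ} (W : Fin n → Fin n → ℕ) (lab : ℕ → ℕ) (P : Fin n → Fin n → Prop) (s : State)
    (a : ℕ) : Prop :=
  (s.arr 19 a = 0 ∧ ∀ u v, P u v → lab u = a → lab v = a) ∨
  (s.arr 19 a = 1 ∧ ∃ u v : Fin n, s.arr 17 a = u ∧ s.arr 18 a = v ∧ s.qarr 4 a = W u v ∧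
    lab u = a ∧ lab v ≠ a ∧ ∀ u' v', P u' v' → lab u' = a → lab v' ≠ a → W u v ≤ W u' v')

/-- Registers the edge in registers `54` and `55` as the best one for the label in register `56`. -/
def storeBest : Prog := ops [.store 19 56 98, .qstore 4 56 20, .store 17 56 54, .store 18 56 55]

/-- Compares the pair in registers `54` and `55` with the best edge found so far. -/
def scanBody : Prog :=
  blk [ops [.load 56 5 54, .load 57 5 55], .ite (.eq 56 57) .skip
    (blk [ops [.load 58 4 54, .add 58 58 55, .qload 20 1 58, .load 59 19 56],
      .ite (.eq 59 97) storeBest (blk [.op (.qload 21 4 56), .ite (.qlt 20 21) storeBest .skip])])]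

theorem scanBody_wp {n K : ℕ} {W : Fin n → Fin n → ℕ} {s : State} (hc : Consts n K s)
    (hW : ∀ u v : Fin n, s.qarr 1 (pos n u v) = W u v) {P : Fin n → Fin n → Prop} {u v : Fin n}
    (hu : s.reg 54 = u) (hv : s.reg 55 = v) (hlt : s.arr 5 u < n)
    (h : ∀ a < n, BestOk W (s.arr 5) P s a) :
    wp scanBody 24 (fun s' => ∀ a < n, BestOk W (s.arr 5) (fun x y => P x y ∨ x = u ∧ y = v) s' a)
      s := by
  refine wp_eval rfl (by decide) ?_
  have e1 : (u : ℕ) * n + 1 + v = pos n u v := by rw [pos]; omega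
  by_cases hl : s.arr 5 u = s.arr 5 v
  · intro a han
    have hx : BestOk W (s.arr 5) (fun x y => P x y ∨ x = u ∧ y = v) s a := by
      rcases h a han with ⟨h1, h2⟩ | ⟨h1, x, y, h2, h3, h4, h5, h6, h7⟩
      · refine Or.inl ⟨h1, ?_⟩
        rintro x y (hp | ⟨rfl, rfl⟩) hx
        · exact h2 x y hp hx
        · rw [← hl, hx]
      · refine Or.inr ⟨h1, x, y, h2, h3, h4, h5, h6, ?_⟩
        rintro x' y' (hp | ⟨rfl, rfl⟩) hx hy
        · exact h7 x' y' hp hx hy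
        · exact absurd (hl.symm.trans hx) hy
    have e : scanBody.eval s = { s with reg := (scanBody.eval s).reg } := by
      simp [scanBody, Prog.eval, blk, ops, Op.exec, Test.holds, hu, hv, hl]
    rw [e]
    exact hx
  · -- the effect of the program: either the new edge is stored, or it is not better
    have key : ((scanBody.eval s).arr = s.arr ∧ (scanBody.eval s).qarr = s.qarr ∧
          s.arr 19 (s.arr 5 u) ≠ 0 ∧ s.qarr 4 (s.arr 5 u) ≤ W u v) ∨
        ((scanBody.eval s).arr 19 = Function.update (s.arr 19) (s.arr 5 u) 1 ∧
          (scanBody.eval s).arr 17 = Function.update (s.arr 17) (s.arr 5 u) u ∧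
          (scanBody.eval s).arr 18 = Function.update (s.arr 18) (s.arr 5 u) v ∧
          (scanBody.eval s).qarr 4 = Function.update (s.qarr 4) (s.arr 5 u) (W u v) ∧
          (s.arr 19 (s.arr 5 u) = 0 ∨ (W u v : ℚ) < s.qarr 4 (s.arr 5 u))) := by
      by_cases h1 : s.arr 19 (s.arr 5 u) = 0
      · right
        simp [scanBody, storeBest, Prog.eval, blk, ops, Op.exec, Test.holds, hu, hv, hl,
          hc.off u u.2, e1, hW, h1, hc.one, hc.zero]
      · by_cases h2 : (W u v : ℚ) < s.qarr 4 (s.arr 5 u)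
        · right
          simp [scanBody, storeBest, Prog.eval, blk, ops, Op.exec, Test.holds, hu, hv, hl,
            hc.off u u.2, e1, hW, h1, hc.one, hc.zero, h2]
        · left
          have h3 := not_lt.1 h2
          simp [scanBody, storeBest, Prog.eval, blk, ops, Op.exec, Test.holds, hu, hv, hl,
            hc.off u u.2, e1, hW, h1, hc.zero, h2, h3]
    intro a han
    rcases key with ⟨ka, kq, k1, k2⟩ | ⟨k19, k17, k18, k4, k1⟩
    · unfold BestOk
      rw [ka, kq]
      rcases h a han with ⟨h1, h2⟩ | ⟨h1, x, y, h2, h3, h4, h5, h6, h7⟩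
      · refine Or.inl ⟨h1, ?_⟩
        rintro x y (hp | ⟨rfl, rfl⟩) hx
        · exact h2 x y hp hx
        · rw [hx] at k1
          exact absurd h1 k1
      · refine Or.inr ⟨h1, x, y, h2, h3, h4, h5, h6, ?_⟩
        rintro x' y' (hp | ⟨rfl, rfl⟩) hx hy
        · exact h7 x' y' hp hx hy
        · rw [hx, h4] at k2
          exact_mod_cast k2
    · unfold BestOk
      rw [k19, k17, k18, k4]
      by_cases ha : a = s.arr 5 u
      · subst ha
        simp only [Function.update_self]
        refine Or.inr ⟨trivial, u, v, rfl, rfl, rfl, rfl, Ne.symm hl, ?_⟩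
        rintro x' y' (hp | ⟨rfl, rfl⟩) hx hy
        · rcases h (s.arr 5 u) hlt with ⟨h1, h2⟩ | ⟨h1, x, y, h2, h3, h4, h5, h6, h7⟩
          · exact absurd (h2 x' y' hp hx) hy
          · have h8 := h7 x' y' hp hx hy
            rw [h1, h4] at k1
            rcases k1 with k1 | k1
            · exact absurd k1 one_ne_zero
            · have : W u v < W x y := by exact_mod_cast k1
              omega
        · exact le_rfl
      · simp only [Function.update_of_ne ha]
        rcases h a han with ⟨h1, h2⟩ | ⟨h1, x, y, h2, h3, h4, h5, h6, h7⟩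
        · refine Or.inl ⟨h1, ?_⟩
          rintro x y (hp | ⟨rfl, rfl⟩) hx
          · exact h2 x y hp hx
          · exact absurd hx.symm ha
        · refine Or.inr ⟨h1, x, y, h2, h3, h4, h5, h6, ?_⟩
          rintro x' y' (hp | ⟨rfl, rfl⟩) hx hy
          · exact h7 x' y' hp hx hy
          · exact absurd hx.symm ha

/-- Finds a lightest edge leaving each component. -/
def scanProg : Prog := forTo 54 0 (forTo 55 0 scanBody)

theorem scanProg_wp {n K : ℕ} {W : Fin n → Fin n → ℕ} {s : State} (hc : Consts n K s)
    (hW : ∀ u v : Fin n, s.qarr 1 (pos n u v) = W u v)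
    (hlt : ∀ u < n, s.arr 5 u < n) (h : ∀ a < n, BestOk W (s.arr 5) (fun _ _ => False) s a) :
    wp scanProg (n * (n * 29 + 8) + 3) (fun s' => ∀ a < n, BestOk W (s.arr 5) (fun _ _ => True) s' a)
      s := by
  have hmono : ∀ {P P' : Fin n → Fin n → Prop} {t t' : State}, t'.arr = t.arr → t'.qarr = t.qarr →
      (∀ u v, P u v ↔ P' u v) → (∀ a < n, BestOk W (s.arr 5) P t a) →
      ∀ a < n, BestOk W (s.arr 5) P' t' a := by
    intro P P' t t' h1 h2 h3 h4 a ha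
    have : P = P' := funext fun u => funext fun v => propext (h3 u v)
    subst this
    unfold BestOk
    rw [h1, h2]
    exact h4 a ha
  refine (wp_for (n := n) (T := n * 29 + 3) (fun i s' =>
    ∀ a < n, BestOk W (s.arr 5) (fun x _ => (x : ℕ) < i) s' a) hc.n_eq (by decide) (by decide)
    (by decide) ?_ ?_).mono (le_refl _) ?_
  · exact hmono rfl rfl (fun u v => by simp) h
  · intro i hi s' hf hI hr
    have c' : Consts n K s' := hc.of_frame hf
    refine (wp_for (n := n) (T := 24) (fun j s'' =>
      ∀ a < n, BestOk W (s.arr 5) (fun x y => (x : ℕ) < i ∨ ((x : ℕ) = i ∧ (y : ℕ) < j)) s'' a) c'.n_eq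
      (by decide) (by decide) (by decide) ?_ ?_).mono (le_refl _) ?_
    · exact hmono rfl rfl (fun u v => by simp) hI
    · intro j hj s'' hf' hJ hr'
      have g5 : s''.arr 5 = s.arr 5 := by rw [hf'.arr 5 (by decide), hf.arr 5 (by decide)]
      have q1 : s''.qarr 1 = s.qarr 1 := by rw [hf'.qarr 1 (by decide), hf.qarr 1 (by decide)]
      have hs := scanBody_wp (u := ⟨i, hi⟩) (v := ⟨j, hj⟩) (c'.of_frame hf') (W := W)
        (by rwa [q1]) (by rw [hf'.reg 54 (by decide), hr]) hr' (by rw [g5]; exact hlt i hi)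
        (by rw [g5]; exact hJ)
      rw [g5] at hs
      refine hs.mono le_rfl fun t ht => hmono rfl rfl (fun u v => ?_) ht
      rw [Fin.ext_iff, Fin.ext_iff]
      dsimp only
      omega
    · intro t ht
      refine hmono rfl rfl (fun u v => ?_) ht
      have := v.2
      omega
  · intro t ht
    exact hmono rfl rfl (fun u v => by simp) ht

/-- Adds the edges that have been found for the illegal components, except for those that would
close a cycle. -/
def linkProg : Prog :=
  forTo 50 0 (blk [.op (.load 51 20 50), .ite (.eq 51 98)
    (blk [ops [.load 32 17 50, .load 33 18 50, .load 34 5 32, .load 35 5 33],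
      .ite (.eq 34 35) .skip joinProg]) .skip])

theorem linkProg_wp {n : ℕ} {s : State} (hn : s.reg 0 = n) (h98 : s.reg 98 = 1)
    {H K : SimpleGraph (Fin n)} (hH : Forest n H (s.arr 5) (s.arr 6) (s.arr 11) (s.arr 12))
    (hHK : H ≤ K) (e : Fin n → Fin n × Fin n)
    (he : ∀ x : Fin n, s.arr 20 x = 1 → s.arr 17 x = (e x).1 ∧ s.arr 18 x = (e x).2 ∧
      K.Adj (e x).1 (e x).2) :
    wp linkProg (n * (n * 9 + 40) + 3) (fun s' => ∃ H' : SimpleGraph (Fin n),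
      Forest n H' (s'.arr 5) (s'.arr 6) (s'.arr 11) (s'.arr 12) ∧ H ≤ H' ∧ H' ≤ K ∧
      ∀ x : Fin n, s.arr 20 x = 1 → H'.Reachable (e x).1 (e x).2) s := by
  -- an edge that is left out would close a cycle, so its ends are connected anyway
  refine (wp_for (n := n) (T := n * 9 + 35) (fun k s' => ∃ H' : SimpleGraph (Fin n),
      Forest n H' (s'.arr 5) (s'.arr 6) (s'.arr 11) (s'.arr 12) ∧ H ≤ H' ∧ H' ≤ K ∧
      ∀ x : Fin n, (x : ℕ) < k → s.arr 20 x = 1 → H'.Reachable (e x).1 (e x).2)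
    hn (by decide) (by decide) (by decide)
    ⟨H, hH, le_rfl, hHK, fun x hx => absurd hx (Nat.not_lt_zero _)⟩ ?_).mono (le_refl _)
    fun t ⟨H', h1, h2, h3, h4⟩ => ⟨H', h1, h2, h3, fun x => h4 x x.2⟩
  rintro k hk s' hf ⟨H', hF', hle, hleK, hreach⟩ hr
  obtain ⟨y, rfl⟩ : ∃ y : Fin n, k = y := ⟨⟨k, hk⟩, rfl⟩
  have g0 : s'.reg 0 = n := by rw [hf.reg 0 (by decide), hn]
  have g98 : s'.reg 98 = 1 := by rw [hf.reg 98 (by decide), h98]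
  have g17 : s'.arr 17 = s.arr 17 := hf.arr 17 (by decide)
  have g18 : s'.arr 18 = s.arr 18 := hf.arr 18 (by decide)
  have g20 : s'.arr 20 = s.arr 20 := hf.arr 20 (by decide)
  refine (wp_cons (T₁ := 1) (R := fun s₁ => s₁.reg 51 = s.arr 20 y) (wp_eval rfl (le_refl 1) ?_)
    (T₂ := (5 + (n * 9 + 20 + 1 + 1) + 1) + 1) ?_).mono (by omega) fun _ h => h
  · simp [Prog.eval, Op.exec, hr, g20]
  intro s₁ r51 f₁
  refine wp_last (R := fun t => ∃ H' : SimpleGraph (Fin n),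
      Forest n H' (t.arr 5) (t.arr 6) (t.arr 11) (t.arr 12) ∧ H ≤ H' ∧ H' ≤ K ∧
      ∀ x : Fin n, (x : ℕ) < y + 1 → s.arr 20 x = 1 → H'.Reachable (e x).1 (e x).2)
    (wp_ite (fun hb => ?_) fun hb => ?_) fun t h _ => h
  swap
  · simp only [Test.holds, r51, f₁.reg 98 (by decide), g98] at hb
    refine ⟨1, s₁, by omega, .skip _, H', ?_, hle, hleK, fun x hx h20 => ?_⟩
    · rwa [f₁.arr 5 (by decide), f₁.arr 6 (by decide), f₁.arr 11 (by decide),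
        f₁.arr 12 (by decide)]
    · rcases Nat.lt_succ_iff_lt_or_eq.1 hx with h | h'
      · exact hreach x h h20
      · exact absurd (Fin.ext h' ▸ h20) hb
  simp only [Test.holds, r51, f₁.reg 98 (by decide), g98] at hb
  obtain ⟨e17, e18, hK⟩ := he y hb
  refine wp_cons (T₁ := 5) (R := fun t => t.reg 32 = (e y).1 ∧ t.reg 33 = (e y).2 ∧
    t.reg 34 = s'.arr 5 (e y).1 ∧ t.reg 35 = s'.arr 5 (e y).2) (wp_eval rfl (le_refl 5) ?_) ?_
  · simp [Prog.eval, blk, ops, Op.exec, f₁.reg 50 (by decide), hr, f₁.arr 17 (by decide), g17,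
      f₁.arr 18 (by decide), g18, e17, e18, f₁.arr 5 (by decide)]
  rintro s₂ ⟨r32, r33, r34, r35⟩ f₂
  have k5 : s₂.arr 5 = s'.arr 5 := by rw [f₂.arr 5 (by decide), f₁.arr 5 (by decide)]
  have hF₂ : Forest n H' (s₂.arr 5) (s₂.arr 6) (s₂.arr 11) (s₂.arr 12) := by
    rwa [k5, f₂.arr 6 (by decide), f₁.arr 6 (by decide), f₂.arr 11 (by decide),
      f₁.arr 11 (by decide), f₂.arr 12 (by decide), f₁.arr 12 (by decide)]
  refine wp_last (R := fun t => ∃ H' : SimpleGraph (Fin n),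
      Forest n H' (t.arr 5) (t.arr 6) (t.arr 11) (t.arr 12) ∧ H ≤ H' ∧ H' ≤ K ∧
      ∀ x : Fin n, (x : ℕ) < y + 1 → s.arr 20 x = 1 → H'.Reachable (e x).1 (e x).2)
    (wp_ite (fun hb' => ?_) fun hb' => ?_) fun t h _ => h
  · simp only [Test.holds, r34, r35] at hb'
    refine ⟨1, s₂, by omega, .skip _, H', hF₂, hle, hleK, fun x hx h20 => ?_⟩
    rcases Nat.lt_succ_iff_lt_or_eq.1 hx with h | h'
    · exact hreach x h h20
    · rw [show x = y from Fin.ext h']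
      exact (hF'.reach _ _).2 hb'
  · simp only [Test.holds, r34, r35] at hb'
    refine (joinProg_wp (F := H') (a := (e y).1) (b := (e y).2)
      (by rw [f₂.reg 0 (by decide), f₁.reg 0 (by decide), g0]) hF₂ r32 r33 (by rw [r34, k5])
      (by rw [r35, k5]) (by rwa [k5])).mono le_rfl ?_
    rintro t ⟨hF'', -⟩
    refine ⟨_, hF'', hle.trans le_sup_left, sup_le hleK ?_, fun x hx h20 => ?_⟩
    · intro u v huv
      rw [SimpleGraph.edge_adj] at huv
      rcases huv.1 with ⟨rfl, rfl⟩ | ⟨rfl, rfl⟩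
      · exact hK
      · exact hK.symm
    · rcases Nat.lt_succ_iff_lt_or_eq.1 hx with h | h'
      · exact (hreach x h h20).mono le_sup_left
      · rw [show x = y from Fin.ext h']
        refine SimpleGraph.Adj.reachable ?_
        rw [SimpleGraph.sup_adj, SimpleGraph.edge_adj]
        exact Or.inr ⟨Or.inl ⟨rfl, rfl⟩, hK.ne⟩

/-- One phase; without illegal components, the forest does not change. -/
def phaseProg : Prog := blk [illegalProg, scanProg, linkProg]

theorem phaseProg_wp {n K : ℕ} {L : Set ℕ} {W : Fin n → Fin n → ℕ} {s : State}
    (hc : Consts n K s) (hW : ∀ u v : Fin n, s.qarr 1 (pos n u v) = W u v)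
    (hok : ∀ m ≤ n, s.arr 2 m = 1 ↔ m ∈ close L) (hn : n ∈ close L) {H : SimpleGraph (Fin n)}
    (hH : Forest n H (s.arr 5) (s.arr 6) (s.arr 11) (s.arr 12)) :
    wp phaseProg (n * (n * 38 + 64) + 10) (fun s' => ∃ H' : SimpleGraph (Fin n),
      Forest n H' (s'.arr 5) (s'.arr 6) (s'.arr 11) (s'.arr 12) ∧
      (Phase L W H H' ∨ (H' = H ∧ ∀ c : H.ConnectedComponent, ¬ Illegal L c))) s := by
  classical
  refine (wp_cons (illegalProg_wp hc.n_eq hc.zero hc.one) (T₂ := (n * (n * 29 + 8) + 3) +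
    (n * (n * 9 + 40) + 3 + 1)) ?_).mono ?_ fun _ h => h
  swap
  · ring_nf
    omega
  intro s₁ h₁ f₁
  have c₁ : Consts n K s₁ := hc.of_frame f₁
  have g5 : s₁.arr 5 = s.arr 5 := f₁.arr 5 (by decide)
  have g6 : s₁.arr 6 = s.arr 6 := f₁.arr 6 (by decide)
  have h5 : ∀ v : Fin n, s.arr 5 (s.arr 5 v) = s.arr 5 v := fun v => hH.lab_lab v v.2
  have hill : ∀ v : Fin n, s₁.arr 20 (s.arr 5 v) = 1 ↔ Illegal L (H.connectedComponentMk v) := by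
    intro v
    rw [(h₁ _ (hH.lab_lt v v.2)).2, hH.size, illegal_mk]
    have : compSize H v ≤ n := by
      rw [compSize_eq_ncard]
      simpa using Set.ncard_le_card {w | H.Reachable w v}
    rw [Ne, hok _ this]
    simp [h5]
  refine wp_cons (scanProg_wp (W := W) c₁ (by rwa [f₁.qarr 1 (by decide)])
    (by rw [g5]; exact hH.lab_lt) fun a ha => Or.inl ⟨(h₁ a ha).1, by simp⟩) ?_
  intro s₂ h₂ f₂
  rw [g5] at h₂
  have k5 : s₂.arr 5 = s.arr 5 := by rw [f₂.arr 5 (by decide), g5]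
  have k20 : s₂.arr 20 = s₁.arr 20 := f₂.arr 20 (by decide)
  have hH₂ : Forest n H (s₂.arr 5) (s₂.arr 6) (s₂.arr 11) (s₂.arr 12) := by
    rwa [k5, f₂.arr 6 (by decide), g6, f₂.arr 11 (by decide), f₁.arr 11 (by decide),
      f₂.arr 12 (by decide), f₁.arr 12 (by decide)]
  have hsupp : ∀ u v : Fin n, u ∈ (H.connectedComponentMk v).supp ↔ s.arr 5 u = s.arr 5 v :=
    fun u v => mem_supp_mk.trans (hH.reach u v)
  have hbest : ∀ v : Fin n, Illegal L (H.connectedComponentMk v) → ∃ a b : Fin n,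
      s₂.arr 17 (s.arr 5 v) = a ∧ s₂.arr 18 (s.arr 5 v) = b ∧
      LightestOut W (H.connectedComponentMk v).supp (a, b) := by
    intro v hv
    rcases h₂ _ (hH.lab_lt v v.2) with ⟨-, h⟩ | ⟨-, a, b, h1, h2, -, h4, h5, h6⟩
    · -- a component that no edge leaves has `n` vertices and is legal
      exfalso
      refine hv ?_
      have : (H.connectedComponentMk v).supp = Set.univ := by
        refine Set.eq_univ_of_forall fun u => (hsupp u v).2 (h v u trivial rfl)
      rw [this, Set.ncard_univ]
      simpa using hn
    · refine ⟨a, b, h1, h2, (hsupp a v).2 h4, fun h => h5 ((hsupp b v).1 h), fun x hx y hy => ?_⟩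
      exact h6 x y trivial ((hsupp x v).1 hx) fun h => hy ((hsupp y v).2 h)
  -- the edge found for each illegal component
  have hchoice : ∀ c : H.ConnectedComponent, ∃ p : Fin n × Fin n, Illegal L c →
      LightestOut W c.supp p ∧ ∀ v, H.connectedComponentMk v = c →
        s₂.arr 17 (s.arr 5 v) = p.1 ∧ s₂.arr 18 (s.arr 5 v) = p.2 := by
    intro c
    induction c using SimpleGraph.ConnectedComponent.ind with
    | _ v =>
    by_cases hv : Illegal L (H.connectedComponentMk v)
    · obtain ⟨a, b, h1, h2, h3⟩ := hbest v hv
      refine ⟨(a, b), fun _ => ⟨h3, fun u hu => ?_⟩⟩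
      rw [SimpleGraph.ConnectedComponent.eq, hH.reach] at hu
      rw [hu]
      exact ⟨h1, h2⟩
    · exact ⟨(v, v), fun h => absurd h hv⟩
  choose e he using hchoice
  set G := H ⊔ SimpleGraph.fromEdgeSet
    {x | ∃ c, Illegal L c ∧ x = s((e c).1, (e c).2)} with hG
  have hGadj : ∀ c, Illegal L c → G.Adj (e c).1 (e c).2 := by
    intro c hc
    have h := (he c hc).1
    rw [hG, SimpleGraph.sup_adj, SimpleGraph.fromEdgeSet_adj]
    exact Or.inr ⟨⟨c, hc, rfl⟩, fun h' => h.2.1 (h' ▸ h.1)⟩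
  have hex : ∀ x : Fin n, s₂.arr 20 x = 1 →
      s.arr 5 x = x ∧ Illegal L (H.connectedComponentMk x) := by
    intro x h20
    rw [k20] at h20
    have h1 := ((h₁ x x.2).2.1 h20).1
    refine ⟨h1, (hill x).1 ?_⟩
    rwa [h1]
  refine wp_last (linkProg_wp (K := G) (by rw [f₂.reg 0 (by decide), c₁.n_eq])
    (by rw [f₂.reg 98 (by decide), c₁.one]) hH₂ le_sup_left
    (fun x => e (H.connectedComponentMk x)) ?_) ?_
  · intro x h20
    obtain ⟨hx, hix⟩ := hex x h20
    obtain ⟨h1, h2⟩ := (he _ hix).2 x rfl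
    rw [hx] at h1 h2
    exact ⟨h1, h2, hGadj _ hix⟩
  · rintro s' ⟨H', hF', hle, hleG, hreach⟩ -
    refine ⟨H', hF', ?_⟩
    by_cases hex' : ∃ c : H.ConnectedComponent, Illegal L c
    · refine Or.inl ⟨hex', e, fun c hc => (he c hc).1, G, hG, hle, hleG, hF'.acyclic, ?_⟩
      have hadj : ∀ u v, G.Adj u v → H'.Reachable u v := by
        have hone : ∀ c, Illegal L c → H'.Reachable (e c).1 (e c).2 := by
          intro c hc
          induction c using SimpleGraph.ConnectedComponent.ind with
          | _ v =>
          have h1 : s.arr 5 v < n := hH.lab_lt v v.2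
          have h2 : H.connectedComponentMk ⟨s.arr 5 v, h1⟩ = H.connectedComponentMk v := by
            rw [SimpleGraph.ConnectedComponent.eq, hH.reach]
            exact h5 v
          rw [← h2]
          exact hreach ⟨s.arr 5 v, h1⟩ (by rw [k20]; exact (hill v).2 hc)
        intro u v huv
        rw [hG, SimpleGraph.sup_adj, SimpleGraph.fromEdgeSet_adj] at huv
        rcases huv with h | ⟨⟨c, hc, h⟩, -⟩
        · exact (hle h).reachable
        · rcases Sym2.eq_iff.1 h with ⟨rfl, rfl⟩ | ⟨rfl, rfl⟩
          · exact hone c hc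
          · exact (hone c hc).symm
      rintro u v ⟨p⟩
      induction p with
      | nil => exact .refl _
      | cons h _ ih => exact (hadj _ _ h).trans ih
    · rw [not_exists] at hex'
      refine Or.inr ⟨le_antisymm (hleG.trans ?_) hle, hex'⟩
      refine sup_le le_rfl fun u v huv => ?_
      obtain ⟨⟨c, hc, -⟩, -⟩ := (SimpleGraph.fromEdgeSet_adj _).1 huv
      exact absurd hc (hex' c)

/-- After `p_L + 1` phases there are no illegal components left. -/
theorem rep_phaseProg_wp {n K : ℕ} {L : Set ℕ} {W : Fin n → Fin n → ℕ} {s : State}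
    (hc : Consts n K s) (hW : ∀ u v : Fin n, s.qarr 1 (pos n u v) = W u v)
    (hok : ∀ m ≤ n, s.arr 2 m = 1 ↔ m ∈ close L) (hn : n ∈ close L) {H₀ : SimpleGraph (Fin n)}
    (hg : ∀ v, gL L ∣ compSize H₀ v)
    (hH : Forest n H₀ (s.arr 5) (s.arr 6) (s.arr 11) (s.arr 12)) :
    wp (rep (pL L + 1) phaseProg) ((pL L + 1) * (n * (n * 38 + 64) + 10) + 1) (fun s' =>
      Consts n K s' ∧ s'.arr 2 = s.arr 2 ∧ s'.arr 3 = s.arr 3 ∧ s'.arr 1 = s.arr 1 ∧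
      s'.qarr 0 = s.qarr 0 ∧ ∃ H : SimpleGraph (Fin n),
        Forest n H (s'.arr 5) (s'.arr 6) (s'.arr 11) (s'.arr 12) ∧
        Relation.ReflTransGen (Phase L W) H₀ H ∧ ∀ c : H.ConnectedComponent, ¬ Illegal L c) s := by
  refine (wp_rep (fun k s' => Consts n K s' ∧ s'.arr 2 = s.arr 2 ∧ s'.arr 3 = s.arr 3 ∧
    s'.arr 1 = s.arr 1 ∧ s'.qarr 0 = s.qarr 0 ∧ s'.qarr 1 = s.qarr 1 ∧ ∃ H : SimpleGraph (Fin n),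
      Forest n H (s'.arr 5) (s'.arr 6) (s'.arr 11) (s'.arr 12) ∧
      Relation.ReflTransGen (Phase L W) H₀ H ∧ (∀ v, gL L ∣ compSize H v) ∧
      ∀ v, compSize H v ∉ close L → (k + 1) * gL L ≤ compSize H v) (pL L + 1) ?_ ?_).mono le_rfl ?_
  · refine ⟨hc, rfl, rfl, rfl, rfl, rfl, H₀, hH, .refl, hg, fun v _ => ?_⟩
    rw [zero_add, one_mul]
    exact Nat.le_of_dvd (compSize_pos H₀ v) (hg v)
  · rintro k s' ⟨hc', h2, h3, h1, hq0, hq1, H, hH', hchain, hg', hbig⟩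
    refine (phaseProg_wp (W := W) hc' (by rwa [hq1]) (by rwa [h2]) hn hH').frame.mono le_rfl ?_
    rintro t ⟨⟨H', hF', hP⟩, f⟩
    refine ⟨hc'.of_frame f, by rw [f.arr 2 (by decide), h2], by rw [f.arr 3 (by decide), h3],
      by rw [f.arr 1 (by decide), h1], by rw [f.qarr 0 (by decide), hq0],
      by rw [f.qarr 1 (by decide), hq1], H', hF', ?_⟩
    rcases hP with hP | ⟨rfl, hP⟩
    · refine ⟨hchain.tail hP, hP.dvd hg', fun v hv => ?_⟩
      rw [add_mul _ 1, one_mul]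
      exact hP.add_le_compSize hg' hbig v hv
    · exact ⟨hchain, hg', fun v hv => absurd hv (hP (H'.connectedComponentMk v))⟩
  · rintro t ⟨hc', h2, h3, h1, hq0, -, H, hH', hchain, hg', hbig⟩
    refine ⟨hc', h2, h3, h1, hq0, H, hH', hchain, fun c => ?_⟩
    induction c using SimpleGraph.ConnectedComponent.ind with
    | _ v =>
    intro hv
    have hv' := illegal_mk.1 hv
    have h4 : (pL L + 1) * gL L ≤ compSize H v :=
      (Nat.mul_le_mul_right _ (Nat.le_succ _)).trans (hbig v hv')
    exact lt_irrefl _ (lt_of_illegal hg' hv' h4)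

end LCC

/-! ### Cutting off a cycle and orienting it -/

namespace LCC

theorem cycleEdges_range_map {V : Type*} (f : ℕ → V) (m : ℕ) :
    cycleEdges ((List.range m).map f) = (List.range m).map fun i => (f i, f ((i + 1) % m)) := by
  unfold cycleEdges
  refine List.ext_getElem (by simp) fun i h1 h2 => ?_
  simp [List.getElem_rotate]

theorem cycleWeight_range_map {V : Type*} (w : V → V → ℕ) (f : ℕ → V) (m : ℕ) :
    cycleWeight w ((List.range m).map f) = ∑ i ∈ Finset.range m, w (f i) (f ((i + 1) % m)) := by
  rw [cycleWeight, cycleEdges_range_map, List.map_map]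
  rfl

theorem mem_cycleEdges_reverse {V : Type*} {l : List V} {x y : V}
    (h : (x, y) ∈ cycleEdges l.reverse) : (y, x) ∈ cycleEdges l := by
  obtain ⟨i, hi, he⟩ := mem_cycleEdges.1 h
  rw [List.length_reverse] at hi
  simp only [List.getElem_reverse, List.length_reverse, Prod.mk.injEq] at he
  obtain ⟨rfl, rfl⟩ := he
  have hlt := Nat.mod_lt (i + 1) (show 0 < l.length by omega)
  refine mem_cycleEdges.2 ⟨l.length - 1 - (i + 1) % l.length, by omega, ?_⟩
  rw [Prod.mk.injEq]
  refine ⟨rfl, ?_⟩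
  congr 1
  rcases Nat.lt_or_ge (i + 1) l.length with h1 | h1
  · rw [Nat.mod_eq_of_lt h1, Nat.mod_eq_of_lt (by omega)]
    omega
  · have h2 : i + 1 = l.length := by omega
    rw [h2, Nat.mod_self, Nat.sub_zero, Nat.sub_add_cancel (by omega), Nat.mod_self]
    omega

theorem Frame.forTo {i N : ℕ} {p : Prog} {s s' : State} (h : Frame p s s') :
    Frame (LCC.forTo i N p) s s' := by
  have h' : Frame (.loop (.lt i N) (blk [p, .op (.const 99 1), .op (.add i i 99)])) s s' :=
    ⟨h.left.reg, h.left.arr, h.left.qreg, h.left.qarr⟩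
  exact h'.left.right

/-- Runs through the cycle whose vertices are linked by `nxt`, starting at the vertex in register
`69`; register `68` contains its length. In each round, `inner` is executed with a vertex in
register `88` and its successor on the cycle in register `91`. -/
def passProg (inner : Prog) : Prog :=
  blk [.op (.add 88 69 97), forTo 92 68 (blk [ops [.load 89 15 88, .add 90 92 98],
    .ite (.eq 90 68) (.op (.add 91 69 97)) (.op (.add 91 89 97)), inner, .op (.add 88 89 97)])]

/-- The vertices are `f 0, …, f (m - 1)`; the successor of the last one on the cycle is `f 0`,
although `nxt` leads on to the next cycle. Here `J i` is an invariant of `inner`. -/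
theorem passProg_wp {n m T : ℕ} {inner : Prog} {s : State} (hregs : ∀ x ∈ inner.regs, 93 ≤ x ∧ x < 97)
    (harr : 15 ∉ inner.arrs) (h97 : s.reg 97 = 0) (h98 : s.reg 98 = 1) {f : ℕ → Fin n} (hm : 0 < m)
    (h68 : s.reg 68 = m) (h69 : s.reg 69 = f 0)
    (hnxt : ∀ i, i + 1 < m → s.arr 15 (f i) = f (i + 1)) (J : ℕ → State → Prop)
    (hJ : ∀ i s' s'', s''.arr = s'.arr → s''.qreg = s'.qreg → J i s' → J i s'') (h0 : J 0 s)
    (hinner : ∀ i < m, ∀ s', Frame (passProg inner) s s' → J i s' → s'.reg 88 = f i →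
      s'.reg 91 = f ((i + 1) % m) → wp inner T (J (i + 1)) s') :
    wp (passProg inner) (m * (T + 12) + 5) (fun s' => J m s' ∧ s'.reg 88 = s.arr 15 (f (m - 1)))
      s := by
  have hr : ∀ x, x < 93 ∨ 97 ≤ x → x ∉ inner.regs := fun x hx hin => by
    have := hregs x hin
    omega
  have hF : ∀ {t t' : State}, Frame (passProg inner) t t' →
      t'.reg 97 = t.reg 97 ∧ t'.reg 98 = t.reg 98 ∧ t'.reg 69 = t.reg 69 ∧ t'.reg 68 = t.reg 68 ∧
      t'.arr 15 = t.arr 15 := by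
    intro t t' h
    refine ⟨h.reg 97 ?_, h.reg 98 ?_, h.reg 69 ?_, h.reg 68 ?_, h.arr 15 ?_⟩
    all_goals simp [passProg, forTo, blk, ops, Prog.regs, Op.regs, Prog.arrs, Op.arrs, harr, hr]
  refine (wp_cons (T₁ := 1) (R := fun s₁ => s₁.reg 88 = f 0 ∧ s₁.arr = s.arr ∧ s₁.qreg = s.qreg)
    (wp_eval rfl (le_refl 1) ?_) (T₂ := (m * (T + 7 + 5) + 3) + 1) ?_).mono
    (by rw [show T + 7 + 5 = T + 12 from rfl]; omega) fun _ h => h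
  · simp [Prog.eval, Op.exec, h69, h97]
  rintro s₁ ⟨e88, earr, eq⟩ f₁
  refine wp_last (wp_for (n := m) (T := T + 7) (fun i s' => J i s' ∧
    s'.reg 88 = if i = 0 then (f 0 : ℕ) else s.arr 15 (f (i - 1))) ?_ ?_ ?_ (by decide) ?_ ?_) ?_
  · rw [f₁.reg 68 (by simp [Prog.regs, Op.regs]), h68]
  · simp [blk, ops, Prog.regs, Op.regs, hr]
  · simp [blk, ops, Prog.regs, Op.regs, hr]
  · exact ⟨hJ 0 s _ earr eq h0, by simpa [State.setReg] using e88⟩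
  · rintro i hi s' hf ⟨hJi, h88⟩ h92
    have hfr : Frame (passProg inner) s s' := (Frame.left f₁).trans (Frame.right (Frame.left hf))
    obtain ⟨k97, k98, k69, k68, k15⟩ := hF hfr
    have h88' : s'.reg 88 = f i := by
      rw [h88]
      split_ifs with h
      · rw [h]
      · rw [hnxt (i - 1) (by omega), Nat.sub_add_cancel (by omega)]
    refine (wp_cons (T₁ := 3) (R := fun t => t.reg 89 = s.arr 15 (f i) ∧ t.reg 90 = i + 1 ∧
      t.arr = s'.arr ∧ t.qreg = s'.qreg) (wp_eval rfl (le_refl 3) ?_)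
      (T₂ := 2 + (T + (1 + 1))) ?_).mono (by omega) fun _ h => h
    · simp [Prog.eval, blk, ops, Op.exec, h88', h92, k98, h98, k15]
    rintro t ⟨t89, t90, tarr, tq⟩ ft
    refine wp_cons (T₁ := 2) (R := fun t' => t'.reg 91 = f ((i + 1) % m) ∧ t'.arr = s'.arr ∧
      t'.qreg = s'.qreg) (wp_eval rfl (by decide) ?_) ?_
    · have u68 : t.reg 68 = m := by
        rw [ft.reg 68 (by simp [ops, blk, Prog.regs, Op.regs]), k68, h68]
      have u69 : t.reg 69 = f 0 := by
        rw [ft.reg 69 (by simp [ops, blk, Prog.regs, Op.regs]), k69, h69]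
      have u97 : t.reg 97 = 0 := by
        rw [ft.reg 97 (by simp [ops, blk, Prog.regs, Op.regs]), k97, h97]
      by_cases him : i + 1 = m
      · simp [Prog.eval, Test.holds, Op.exec, t90, u68, him, u69, u97, tarr, tq]
      · rw [Nat.mod_eq_of_lt (by omega), ← hnxt i (by omega)]
        simp [Prog.eval, Test.holds, Op.exec, t90, u68, him, t89, u97, tarr, tq]
    rintro t' ⟨v91, varr, vq⟩ ft'
    have hfr' : Frame (passProg inner) s t' :=
      hfr.trans ((Frame.right (Frame.left (Frame.forTo (Frame.left ft)))).trans
        (Frame.right (Frame.left (Frame.forTo (Frame.right (Frame.left ft'))))))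
    have v88 : t'.reg 88 = f i := by
      rw [ft'.reg 88 (by simp [Prog.regs, Op.regs]),
        ft.reg 88 (by simp [ops, blk, Prog.regs, Op.regs]), h88']
    have v89 : t'.reg 89 = s.arr 15 (f i) := by
      rw [ft'.reg 89 (by simp [Prog.regs, Op.regs]), t89]
    have v97 : t'.reg 97 = 0 := by rw [(hF hfr').1, h97]
    refine wp_cons (hinner i hi t' hfr' (hJ i s' t' varr vq hJi) v88 v91) ?_
    intro t'' hJ'' ft''
    refine wp_last (T := 1) (R := fun q => q.reg 88 = s.arr 15 (f i) ∧ q.arr = t''.arr ∧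
      q.qreg = t''.qreg) (wp_eval rfl (le_refl 1) ?_) ?_
    · simp [Prog.eval, Op.exec, ft''.reg 89 (hr _ (by omega)), v89, ft''.reg 97 (hr _ (by omega)),
        v97]
    · rintro q ⟨q88, qa, qq⟩ -
      exact ⟨hJ _ t'' _ qa qq hJ'', by simpa [State.setReg] using q88⟩
  · rintro s' ⟨h1, h2⟩ -
    rw [if_neg hm.ne'] at h2
    exact ⟨h1, h2⟩

/-- Adds up the weights of the cycle in both directions. -/
def weighInner : Prog :=
  ops [.load 93 4 88, .add 93 93 91, .sub 93 93 98, .qload 13 0 93, .qadd 11 11 13,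
    .load 94 4 91, .add 94 94 88, .sub 94 94 98, .qload 13 0 94, .qadd 12 12 13]

theorem weighPass_wp {n m K : ℕ} {w : Fin n → Fin n → ℕ} {s : State} (hc : Consts n K s)
    (hin : ∀ u v : Fin n, s.qarr 0 (u * n + v) = w u v) {f : ℕ → Fin n} (hm : 0 < m)
    (h68 : s.reg 68 = m) (h69 : s.reg 69 = f 0)
    (hnxt : ∀ i, i + 1 < m → s.arr 15 (f i) = f (i + 1)) (h11 : s.qreg 11 = 0)
    (h12 : s.qreg 12 = 0) :
    wp (passProg weighInner) (m * 24 + 5) (fun s' =>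
      s'.qreg 11 = cycleWeight w ((List.range m).map f) ∧
      s'.qreg 12 = cycleWeight w ((List.range m).map f).reverse) s := by
  refine (passProg_wp (T := 12) (by decide) (by decide) hc.zero hc.one hm h68 h69 hnxt
    (fun i s' => s'.qreg 11 = ((∑ j ∈ Finset.range i, w (f j) (f ((j + 1) % m)) : ℕ) : ℚ) ∧
      s'.qreg 12 = ((∑ j ∈ Finset.range i, w (f ((j + 1) % m)) (f j) : ℕ) : ℚ)) ?_ ?_ ?_).mono
    (by omega) ?_
  · intro i s' s'' _ hq h
    rwa [hq]
  · simp [h11, h12]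
  · rintro i hi s' hf ⟨i1, i2⟩ h88 h91
    have c' : Consts n K s' := hc.of_frame hf
    have q0 : s'.qarr 0 = s.qarr 0 := hf.qarr 0 (by decide)
    have e : ∀ u v : Fin n, (u : ℕ) * n + 1 + v - 1 = u * n + v := fun u v => by omega
    refine wp_eval rfl (by decide) ?_
    rw [Finset.sum_range_succ, Finset.sum_range_succ]
    simp [weighInner, Prog.eval, blk, ops, Op.exec, h88, h91, c'.off _ (f i).2,
      c'.off _ (f ((i + 1) % m)).2, c'.one, e, q0, hin, i1, i2]
  · rintro s' ⟨⟨h1, h2⟩, -⟩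
    rw [cycleWeight_reverse, cycleWeight_range_map, cycleWeight_range_map]
    exact ⟨h1, h2⟩

/-- Some orientation of least weight of the cycle `b` has been written to the output array. -/
def Written {n : ℕ} (w : Fin n → Fin n → ℕ) (out : ℕ → ℕ) (b : List (Fin n)) : Prop :=
  ∃ o, (o = b ∨ o = b.reverse) ∧ cycleWeight w o ≤ cycleWeight w b ∧
    cycleWeight w o ≤ cycleWeight w b.reverse ∧ ∀ e ∈ cycleEdges o, out (e.1 : ℕ) = (e.2 : ℕ)

theorem Written.congr {n : ℕ} {w : Fin n → Fin n → ℕ} {out out' : ℕ → ℕ} {b : List (Fin n)}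
    (h : Written w out b) (he : ∀ x ∈ b, out' (x : ℕ) = out (x : ℕ)) : Written w out' b := by
  obtain ⟨o, h1, h2, h3, h4⟩ := h
  refine ⟨o, h1, h2, h3, fun e heo => ?_⟩
  rw [← h4 e heo]
  have := (mem_of_mem_cycleEdges heo).1
  refine he _ ?_
  rcases h1 with rfl | rfl
  · exact this
  · simpa using this

theorem storeFwd_wp {n m K : ℕ} {s : State} (hc : Consts n K s) {f : ℕ → Fin n} (hm : 0 < m)
    (h68 : s.reg 68 = m) (h69 : s.reg 69 = f 0)
    (hnxt : ∀ i, i + 1 < m → s.arr 15 (f i) = f (i + 1))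
    (hinj : ∀ i < m, ∀ j < m, f i = f j → i = j) :
    wp (passProg (.op (.store 0 88 91))) (m * 24 + 5) (fun s' =>
      (∀ e ∈ cycleEdges ((List.range m).map f), s'.arr 0 (e.1 : ℕ) = (e.2 : ℕ)) ∧
      (∀ x : Fin n, (∀ i < m, f i ≠ x) → s'.arr 0 x = s.arr 0 x) ∧
      s'.reg 88 = s.arr 15 (f (m - 1))) s := by
  refine (passProg_wp (T := 1) (by decide) (by decide) hc.zero hc.one hm h68 h69 hnxt
    (fun i s' => (∀ j < i, s'.arr 0 (f j) = f ((j + 1) % m)) ∧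
      ∀ x : Fin n, (∀ j < i, f j ≠ x) → s'.arr 0 x = s.arr 0 x) ?_ ?_ ?_).mono (by omega) ?_
  · intro i s' s'' ha _ h
    rwa [ha]
  · exact ⟨fun j hj => absurd hj (Nat.not_lt_zero j), fun x _ => rfl⟩
  · rintro i hi s' hf ⟨i1, i2⟩ h88 h91
    refine wp_eval rfl (le_refl 1) ?_
    simp only [Prog.eval, Op.exec, h88, h91, Function.update_self]
    refine ⟨fun j hj => ?_, fun x hx => ?_⟩
    · by_cases hji : j = i
      · rw [hji, Function.update_self]
      · rw [Function.update_of_ne fun h => hji (hinj j (by omega) i hi (Fin.ext h)),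
          i1 j (by omega)]
    · rw [Function.update_of_ne fun h => hx i (by omega) (Fin.ext h.symm)]
      exact i2 x fun j hj => hx j (by omega)
  · rintro s' ⟨⟨h1, h2⟩, h3⟩
    refine ⟨fun e he => ?_, h2, h3⟩
    rw [cycleEdges_range_map] at he
    obtain ⟨i, hi, rfl⟩ := List.mem_map.1 he
    exact h1 i (List.mem_range.1 hi)

theorem storeBwd_wp {n m K : ℕ} {s : State} (hc : Consts n K s) {f : ℕ → Fin n} (hm : 0 < m)
    (h68 : s.reg 68 = m) (h69 : s.reg 69 = f 0)
    (hnxt : ∀ i, i + 1 < m → s.arr 15 (f i) = f (i + 1))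
    (hinj : ∀ i < m, ∀ j < m, f i = f j → i = j) :
    wp (passProg (.op (.store 0 91 88))) (m * 24 + 5) (fun s' =>
      (∀ e ∈ cycleEdges ((List.range m).map f).reverse, s'.arr 0 (e.1 : ℕ) = (e.2 : ℕ)) ∧
      (∀ x : Fin n, (∀ i < m, f i ≠ x) → s'.arr 0 x = s.arr 0 x) ∧
      s'.reg 88 = s.arr 15 (f (m - 1))) s := by
  have hmod : ∀ i, (i + 1) % m < m := fun i => Nat.mod_lt _ hm
  have hmi : ∀ i < m, (i + 1) % m = if i + 1 = m then 0 else i + 1 := by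
    intro i hi
    split_ifs with h
    · rw [h, Nat.mod_self]
    · exact Nat.mod_eq_of_lt (by omega)
  refine (passProg_wp (T := 1) (by decide) (by decide) hc.zero hc.one hm h68 h69 hnxt
    (fun i s' => (∀ j < i, s'.arr 0 (f ((j + 1) % m)) = f j) ∧
      ∀ x : Fin n, (∀ j < m, f j ≠ x) → s'.arr 0 x = s.arr 0 x) ?_ ?_ ?_).mono (by omega) ?_
  · intro i s' s'' ha _ h
    rwa [ha]
  · exact ⟨fun j hj => absurd hj (Nat.not_lt_zero j), fun x _ => rfl⟩
  · rintro i hi s' hf ⟨i1, i2⟩ h88 h91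
    refine wp_eval rfl (le_refl 1) ?_
    simp only [Prog.eval, Op.exec, h88, h91, Function.update_self]
    refine ⟨fun j hj => ?_, fun x hx => ?_⟩
    · by_cases hji : j = i
      · rw [hji, Function.update_self]
      · rw [Function.update_of_ne, i1 j (by omega)]
        intro h
        have h1 := hinj _ (hmod j) _ (hmod i) (Fin.ext h)
        rw [hmi j (by omega), hmi i hi] at h1
        split_ifs at h1 <;> omega
    · rw [Function.update_of_ne fun h => hx _ (hmod i) (Fin.ext h.symm)]
      exact i2 x hx
  · rintro s' ⟨⟨h1, h2⟩, h3⟩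
    refine ⟨fun e he => ?_, h2, h3⟩
    have he' := mem_cycleEdges_reverse (x := e.1) (y := e.2) he
    rw [cycleEdges_range_map] at he'
    obtain ⟨i, hi, hei⟩ := List.mem_map.1 he'
    rw [Prod.mk.injEq] at hei
    rw [← hei.1, ← hei.2]
    exact h1 i (List.mem_range.1 hi)

/-- Cuts off the next cycle, starting at the vertex in register `67`, when register `66` contains
the number of vertices that are left. -/
def cutBody : Prog :=
  blk [ops [.load 68 1 66, .sub 66 66 68, .add 69 67 97, .qconst 11 0, .qconst 12 0],
    passProg weighInner,
    .ite (.qlt 12 11) (passProg (.op (.store 0 91 88))) (passProg (.op (.store 0 88 91))),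
    .op (.add 67 88 97)]

/-- A cycle of length `m` takes time `O(m)`. -/
theorem cutBody_wp {n m K : ℕ} {w : Fin n → Fin n → ℕ} {s : State} (hc : Consts n K s)
    (hin : ∀ u v : Fin n, s.qarr 0 (u * n + v) = w u v) {f : ℕ → Fin n} (hm : 0 < m)
    (h1 : s.arr 1 (s.reg 66) = m) (h67 : s.reg 67 = f 0)
    (hnxt : ∀ i, i + 1 < m → s.arr 15 (f i) = f (i + 1))
    (hinj : ∀ i < m, ∀ j < m, f i = f j → i = j) :
    wp cutBody (69 * m) (fun s' => s'.reg 66 = s.reg 66 - m ∧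
      s'.reg 67 = s.arr 15 (f (m - 1)) ∧ Written w (s'.arr 0) ((List.range m).map f) ∧
      ∀ x : Fin n, (∀ i < m, f i ≠ x) → s'.arr 0 x = s.arr 0 x) s := by
  refine (wp_cons (T₁ := 6) (R := fun t => t.reg 68 = m ∧ t.reg 66 = s.reg 66 - m ∧
    t.reg 69 = f 0 ∧ t.qreg 11 = 0 ∧ t.qreg 12 = 0) (wp_eval rfl (le_refl 6) ?_)
    (T₂ := (m * 24 + 5) + ((m * 24 + 5 + 1) + (1 + 1))) ?_).mono (by omega) fun _ h => h
  · simp [Prog.eval, blk, ops, Op.exec, h1, h67, hc.zero]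
  rintro s₁ ⟨e68, e66, e69, e11, e12⟩ f₁
  have c₁ : Consts n K s₁ := hc.of_frame f₁
  have n₁ : s₁.arr 15 = s.arr 15 := f₁.arr 15 (by decide)
  refine wp_cons (weighPass_wp (w := w) c₁ (by rwa [f₁.qarr 0 (by decide)]) hm e68 e69
    (by rwa [n₁]) e11 e12) ?_
  rintro s₂ ⟨w11, w12⟩ f₂
  have c₂ : Consts n K s₂ := c₁.of_frame f₂
  have n₂ : s₂.arr 15 = s.arr 15 := by rw [f₂.arr 15 (by decide), n₁]
  have o₂ : s₂.arr 0 = s.arr 0 := by rw [f₂.arr 0 (by decide), f₁.arr 0 (by decide)]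
  have g68 : s₂.reg 68 = m := by rw [f₂.reg 68 (by decide), e68]
  have g69 : s₂.reg 69 = f 0 := by rw [f₂.reg 69 (by decide), e69]
  have g66 : s₂.reg 66 = s.reg 66 - m := by rw [f₂.reg 66 (by decide), e66]
  refine wp_cons (R := fun t => t.reg 88 = s.arr 15 (f (m - 1)) ∧
    Written w (t.arr 0) ((List.range m).map f) ∧
    ∀ x : Fin n, (∀ i < m, f i ≠ x) → t.arr 0 x = s.arr 0 x) (wp_ite (fun hb => ?_) fun hb => ?_) ?_
  · simp only [Test.holds, w11, w12] at hb
    have hle : cycleWeight w ((List.range m).map f).reverse <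
        cycleWeight w ((List.range m).map f) := by exact_mod_cast hb
    refine (storeBwd_wp c₂ hm g68 g69 (by rwa [n₂]) hinj).mono le_rfl ?_
    rintro t ⟨t1, t2, t3⟩
    exact ⟨by rw [t3, n₂], ⟨_, Or.inr rfl, hle.le, le_rfl, t1⟩, fun x hx => by rw [t2 x hx, o₂]⟩
  · simp only [Test.holds, w11, w12, not_lt] at hb
    have hle : cycleWeight w ((List.range m).map f) ≤
        cycleWeight w ((List.range m).map f).reverse := by exact_mod_cast hb
    refine (storeFwd_wp c₂ hm g68 g69 (by rwa [n₂]) hinj).mono le_rfl ?_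
    rintro t ⟨t1, t2, t3⟩
    exact ⟨by rw [t3, n₂], ⟨_, Or.inl rfl, le_rfl, hle, t1⟩, fun x hx => by rw [t2 x hx, o₂]⟩
  · rintro t ⟨t1, t2, t3⟩ f₃
    have t66 : t.reg 66 = s.reg 66 - m := by rw [f₃.reg 66 (by decide), g66]
    have t97 : t.reg 97 = 0 := by rw [f₃.reg 97 (by decide), c₂.zero]
    refine wp_last (T := 1) (R := fun q => q.reg 67 = t.reg 88 ∧ q.arr = t.arr)
      (wp_eval rfl (le_refl 1) ?_) ?_
    · simp [Prog.eval, Op.exec, t97]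
    · rintro q ⟨q1, q2⟩ f₄
      rw [f₄.reg 66 (by decide), t66, q1, t1, q2]
      exact ⟨rfl, rfl, t2, t3⟩

end LCC

/-! ### Cutting Hamiltonian cycles of all components -/

namespace LCC

/-- The table of last summands yields lengths in `l` that add up to `N`; cutting the list of `N`
vertices accordingly takes time `O(N)`. -/
theorem cutLoop_wp {n K N : ℕ} {l : List ℕ} {w : Fin n → Fin n → ℕ} {s : State}
    (hc : Consts n K s) (hin : ∀ u v : Fin n, s.qarr 0 (u * n + v) = w u v) (hl : ∀ x ∈ l, 0 < x)
    (hdp : ∀ m ≤ n, DpOk l (s.arr 2) (s.arr 1) m) (hNn : N ≤ n) (hN : N ∈ close {x | x ∈ l})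
    {f : ℕ → Fin n} (h66 : s.reg 66 = N) (h67 : s.reg 67 = f 0)
    (hnxt : ∀ i < N, s.arr 15 (f i) = f (i + 1))
    (hinj : ∀ i < N, ∀ j < N, f i = f j → i = j) :
    wp (.loop (.lt 97 66) cutBody) (70 * N + 1) (fun s' =>
      (∃ bs : List (List (Fin n)), bs.flatten = (List.range N).map f ∧
        ∀ b ∈ bs, b.length ∈ l ∧ Written w (s'.arr 0) b) ∧
      ∀ x : Fin n, (∀ i < N, f i ≠ x) → s'.arr 0 x = s.arr 0 x) s := by
  -- `m` vertices are left, and `m` is always a sum of elements of `l`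
  refine (wp_while (c := 69) (m := N) (fun m s' => m ≤ N ∧ s'.reg 66 = m ∧ s'.reg 67 = f (N - m) ∧
    m ∈ close {x | x ∈ l} ∧
    (∃ bs : List (List (Fin n)), bs.flatten = (List.range (N - m)).map f ∧
        ∀ b ∈ bs, b.length ∈ l ∧ Written w (s'.arr 0) b) ∧
      ∀ x : Fin n, (∀ i < N, f i ≠ x) → s'.arr 0 x = s.arr 0 x) ?_ ?_).frame.mono le_rfl ?_
  · exact ⟨le_rfl, h66, by rw [Nat.sub_self, h67], hN, ⟨[], by simp, by simp⟩, fun x _ => rfl⟩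
  · rintro m s' hf ⟨hm, i66, i67, icl, ⟨bs, hbs, hb⟩, iun⟩ ht
    have c' : Consts n K s' := hc.of_frame hf
    simp only [Test.holds, c'.zero, i66] at ht
    obtain ⟨d1, d2⟩ := hdp m (by omega)
    obtain ⟨e1, e2, e3⟩ := d2 ht (d1.2 icl)
    have h15 : s'.arr 15 = s.arr 15 := hf.arr 15 (by decide)
    set k := s.arr 1 m with hk
    have hk0 : 0 < k := hl _ e1
    refine ⟨m - k, by omega, ?_⟩
    rw [Nat.sub_sub_self e2]
    have hrun := cutBody_wp (w := w) (m := k) (f := fun i => f (N - m + i)) c'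
      (by rwa [hf.qarr 0 (by decide)]) hk0 (by rw [i66, hf.arr 1 (by decide)]) i67
      (fun i hi => by rw [h15, hnxt _ (by omega), add_assoc])
      (fun i hi j hj h => by have := hinj _ (by omega) _ (by omega) h; omega)
    refine hrun.mono le_rfl ?_
    rintro t ⟨t66, t67, tw, tun⟩
    refine ⟨by omega, by rw [t66, i66], ?_, e3, ⟨bs ++ [(List.range k).map fun i => f (N - m + i)],
      ?_, ?_⟩, fun x hx => ?_⟩
    · rw [t67, h15, hnxt _ (by omega)]
      congr 2
      omega
    · rw [List.flatten_append, hbs, show N - (m - k) = N - m + k by omega, List.range_add]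
      simp
    · intro b hbm
      rcases List.mem_append.1 hbm with h | h
      · refine ⟨(hb b h).1, (hb b h).2.congr fun x hx => tun x fun i hi he => ?_⟩
        have : x ∈ bs.flatten := List.mem_flatten.2 ⟨b, h, hx⟩
        rw [hbs] at this
        obtain ⟨j, hj, hjx⟩ := List.mem_map.1 this
        rw [List.mem_range] at hj
        have := hinj j (by omega) (N - m + i) (by omega) (hjx.trans he.symm)
        omega
      · rw [List.mem_singleton] at h
        subst h
        exact ⟨by simpa using e1, tw⟩
    · rw [tun x fun i hi => hx _ (by omega), iun x hx]
  · rintro s' ⟨⟨m, ⟨hm, i66, -, -, ⟨bs, hbs, hb⟩, iun⟩, ht⟩, hf⟩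
    simp only [Test.holds, i66, hf.reg 97 (by decide), hc.zero] at ht
    exact ⟨⟨bs, by rw [hbs, show N - m = N by omega], hb⟩, iun⟩

/-- Cuts the Hamiltonian cycles of all components, which are linked by array `15`. -/
def cutProg : Prog :=
  forTo 64 0 (blk [.op (.load 65 5 64), .ite (.eq 65 64)
    (blk [ops [.load 66 6 64, .add 67 64 97], .loop (.lt 97 66) cutBody]) .skip])

theorem cutProg_wp {n K : ℕ} {l : List ℕ} {w : Fin n → Fin n → ℕ} {s : State}
    (hc : Consts n K s) (hin : ∀ u v : Fin n, s.qarr 0 (u * n + v) = w u v) (hl : ∀ x ∈ l, 0 < x)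
    (hdp : ∀ m ≤ n, DpOk l (s.arr 2) (s.arr 1) m) (A : Fin n → List (Fin n))
    (hA : ∀ r : Fin n, s.arr 5 r = r → (∃ t, A r = r :: t ∧
      (r :: (t ++ [r])).IsChain fun a b : Fin n => s.arr 15 a = b) ∧ (A r).Nodup ∧
      (A r).length = s.arr 6 r ∧ s.arr 6 r ∈ close {x | x ∈ l} ∧ ∀ x ∈ A r, s.arr 5 x = r) :
    wp cutProg (n * (70 * n + 13) + 3) (fun s' => ∀ r : Fin n, s.arr 5 r = r →
      ∃ bs : List (List (Fin n)), bs.flatten = A r ∧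
        ∀ b ∈ bs, b.length ∈ l ∧ Written w (s'.arr 0) b) s := by
  refine (wp_for (n := n) (T := 70 * n + 8) (fun i s' => ∀ r : Fin n, (r : ℕ) < i → s.arr 5 r = r →
      ∃ bs : List (List (Fin n)), bs.flatten = A r ∧
        ∀ b ∈ bs, b.length ∈ l ∧ Written w (s'.arr 0) b) hc.n_eq (by decide) (by decide) (by decide)
      (fun r hr => absurd hr (Nat.not_lt_zero _)) ?_).mono le_rfl fun s' h r => h r r.2
  intro k hk s' hf hI hik
  have c' : Consts n K s' := hc.of_frame hf
  refine (wp_cons (T₁ := 1) (T₂ := 70 * n + 7) (R := fun t => t.reg 65 = s.arr 5 k ∧ t.arr = s'.arr)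
    (wp_eval rfl le_rfl ?_) ?_).mono (by omega) fun _ h => h
  · simp [Prog.eval, Op.exec, hik, hf.arr 5 (by decide)]
  rintro s₁ ⟨e65, earr⟩ f₁
  have g64 : s₁.reg 64 = k := by rw [f₁.reg 64 (by decide), hik]
  have c₁ : Consts n K s₁ := c'.of_frame f₁
  refine (wp_last (T := (70 * n + 5) + 1) (R := fun t => ∀ r : Fin n, (r : ℕ) < k + 1 →
    s.arr 5 r = r → ∃ bs : List (List (Fin n)), bs.flatten = A r ∧
        ∀ b ∈ bs, b.length ∈ l ∧ Written w (t.arr 0) b) (wp_ite (fun hb => ?_) fun hb => ?_)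
        fun _ h _ => h)
  · simp only [Test.holds, e65, g64] at hb
    obtain ⟨⟨t, ht, hch⟩, hnd, hlen, hcl, hlab⟩ := hA ⟨k, hk⟩ hb
    set r : Fin n := ⟨k, hk⟩
    have hlen' : (A r).length ≤ n := by simpa using hnd.length_le_card
    have hch' := List.isChain_iff_getElem.1 hch
    have hf0 : ∀ i (hi : i < (A r).length), (A r).getD i r = (A r)[i] := fun i hi => by
      simp [hi]
    refine (wp_cons (T₁ := 3) (R := fun t => t.reg 66 = (A r).length ∧ t.reg 67 = r ∧
      t.arr = s'.arr) (wp_eval rfl le_rfl ?_) (T₂ := 70 * (A r).length + 1 + 1) ?_).mono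
      (by omega) fun _ h => h
    · simp [Prog.eval, blk, ops, Op.exec, g64, earr, hf.arr 6 (by decide), hlen, c₁.zero, r]
    rintro s₂ ⟨a66, a67, aarr⟩ f₂
    have c₂ : Consts n K s₂ := c₁.of_frame f₂
    refine wp_last (cutLoop_wp (w := w) (N := (A r).length) (f := fun i => (A r).getD i r) c₂
      (by rwa [f₂.qarr 0 (by decide), f₁.qarr 0 (by decide), hf.qarr 0 (by decide)]) hl
      (by rwa [aarr, hf.arr 2 (by decide), hf.arr 1 (by decide)]) hlen' (by rwa [hlen]) a66
      (by rw [a67, ht]; rfl) ?_ ?_) ?_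
    · intro i hi
      rw [aarr, hf.arr 15 (by decide)]
      have hi' : i + 1 < (r :: (t ++ [r])).length := by
        rw [ht] at hi
        simpa using hi
      have h1 := hch' i hi'
      have h2 : ∀ j (hj : j < (r :: (t ++ [r])).length),
          (A r).getD j r = (r :: (t ++ [r]))[j] := by
        intro j hj
        rw [← List.getD_eq_getElem _ r hj, ht, ← List.cons_append]
        rcases Nat.lt_or_ge j (r :: t).length with h | h
        · rw [List.getD_append _ _ _ _ h]
        · rw [List.getD_append_right _ _ _ _ h, List.getD_eq_default _ _ h]
          rcases h0 : j - (r :: t).length with _ | i <;> simp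
      rw [h2 i (by omega), h2 (i + 1) hi', h1]
    · intro i hi j hj h
      simp only [hf0 i hi, hf0 j hj] at h
      exact hnd.getElem_inj_iff.1 h
    · rintro t' ⟨⟨bs, hbs, hb'⟩, hun⟩ -
      intro q hq hqr
      by_cases hqk : q = r
      · subst hqk
        refine ⟨bs, ?_, hb'⟩
        rw [hbs]
        exact List.ext_getElem (by simp) fun i h1 h2 => by simp [h2]
      · obtain ⟨bs', hbs', hb''⟩ := hI q (by
          have : (q : ℕ) ≠ k := fun h => hqk (Fin.ext h)
          omega) hqr
        refine ⟨bs', hbs', fun b hbm => ⟨(hb'' b hbm).1, (hb'' b hbm).2.congr fun x hx => ?_⟩⟩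
        rw [hun x fun i hi he => ?_, aarr]
        have h1 : x ∈ A q := by
          rw [← hbs']
          exact List.mem_flatten.2 ⟨b, hbm, hx⟩
        have h2 : x ∈ A r := by
          rw [← he]
          simp only [hf0 i hi]
          exact List.getElem_mem _
        have h3 := (hA q hqr).2.2.2.2 x h1
        rw [hlab x h2] at h3
        exact hqk (Fin.ext h3.symm)
  · simp only [Test.holds, e65, g64] at hb
    refine wp_eval rfl (Nat.le_add_left 1 _) ?_
    intro q hq hqr
    obtain ⟨bs', hbs', hb''⟩ := hI q (by
      have : (q : ℕ) ≠ k := fun h => hb (by rw [← h, hqr])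
      omega) hqr
    exact ⟨bs', hbs', by simpa [Prog.eval, earr] using hb''⟩

end LCC

/-! ### From memory contents to an output of the algorithm -/

namespace LCC

section

variable {n : ℕ} {H : SimpleGraph (Fin n)} {lab par mark nxt ord : ℕ → ℕ} {c : ℕ}

/-- A completely explored forest yields Eulerian cycles of all components with duplicated edges, and
`nxt` links the corresponding Hamiltonian cycles. -/
theorem Rooted.exists_tours (h : Rooted H lab par mark nxt ord c) (hm : ∀ x < n, mark x ≠ 0)
    (hH : H.IsAcyclic) (hlab : ∀ u v : Fin n, H.Reachable u v ↔ lab u = lab v) :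
    ∃ A : Fin n → List (Fin n), ∀ r : Fin n, lab r = r →
      (∃ p : H.Walk r r, firstVisits p.support = A r ∧
        ∀ u v, H.Adj u v → lab u = r → p.edges.count s(u, v) = 2) ∧
      (∃ t, A r = r :: t ∧ (r :: (t ++ [r])).IsChain fun a b : Fin n => nxt a = b) ∧
      ∀ x, x ∈ A r ↔ lab x = r := by
  suffices hex : ∀ r : Fin n, ∃ B : List (Fin n), lab r = r →
      (∃ p : H.Walk r r, firstVisits p.support = B ∧
        ∀ u v, H.Adj u v → lab u = r → p.edges.count s(u, v) = 2) ∧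
      (∃ t, B = r :: t ∧ (r :: (t ++ [r])).IsChain fun a b : Fin n => nxt a = b) ∧
      ∀ x, x ∈ B ↔ lab x = r by
    choose A hA using hex
    exact ⟨A, hA⟩
  intro r
  by_cases hr : lab r = r
  swap
  · exact ⟨[], fun h => absurd h hr⟩
  obtain ⟨p, t, h1, h2, h3, h4⟩ := h.walk r hr
  refine ⟨_, fun _ => ⟨⟨p, rfl, fun u v huv hu => ?_⟩, ⟨t, h1, h2⟩, fun x => ?_⟩⟩
  · have hv : lab v = r := by rw [← (hlab u v).1 huv.reachable, hu]
    rcases (h.adj_iff hm hH hlab u v).1 huv with ⟨h5, h6⟩ | ⟨h5, h6⟩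
    · exact h4 u v hu h5 (hm u u.2) h6
    · rw [Sym2.eq_swap]
      exact h4 v u hv h5 (hm v v.2) h6
  · rw [mem_firstVisits, h3]
    exact ⟨And.left, fun h => ⟨h, hm x x.2⟩⟩

theorem length_eq_compSize {A : List (Fin n)} (hA : A.Nodup) {r : Fin n}
    (h : ∀ x, x ∈ A ↔ H.Reachable x r) : A.length = compSize H r := by
  rw [compSize_eq_ncard, ← List.toFinset_card_of_nodup hA, ← Set.ncard_coe_finset]
  congr 1
  ext x
  simp [h]

/-- The output array describes a possible output of the algorithm if it contains cycles that
arise from Eulerian walks of the components of a forest obtained by the phases. -/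
theorem apxDir_of_written {L : Set ℕ} {w : Fin n → Fin n → ℕ} {H₀ : SimpleGraph (Fin n)}
    (hn : n ∈ close L) (hgw : GoeWill (gL L) (symWeight w) H₀)
    (hph : Relation.ReflTransGen (Phase L (symWeight w)) H₀ H)
    (hleg : ∀ c : H.ConnectedComponent, ¬ Illegal L c) (hlt : ∀ u < n, lab u < n)
    (hlab2 : ∀ u < n, lab (lab u) = lab u)
    (hlab : ∀ u v : Fin n, H.Reachable u v ↔ lab u = lab v) {A : Fin n → List (Fin n)}
    (hA : ∀ r : Fin n, lab r = r →
      (∃ p : H.Walk r r, firstVisits p.support = A r ∧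
        ∀ u v, H.Adj u v → lab u = r → p.edges.count s(u, v) = 2) ∧
      ∀ x, x ∈ A r ↔ lab x = r) {out : ℕ → ℕ}
    (hout : ∀ r : Fin n, lab r = r → ∃ bs : List (List (Fin n)), bs.flatten = A r ∧
        ∀ b ∈ bs, b.length ∈ L ∧ Written w out b) :
    ApxDir L w (some (Finset.univ.filter fun e : Fin n × Fin n => out (e.1 : ℕ) = (e.2 : ℕ))) := by
  classical
  have hrep : ∀ c : H.ConnectedComponent, ∃ r : Fin n, lab r = r ∧ H.connectedComponentMk r = c := by
    intro c
    induction c using SimpleGraph.ConnectedComponent.ind with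
    | _ v =>
    refine ⟨⟨lab v, hlt v v.2⟩, hlab2 v v.2, SimpleGraph.ConnectedComponent.eq.2 ?_⟩
    rw [hlab]
    exact hlab2 v v.2
  choose rep hrep1 hrep2 using hrep
  choose bs hbs1 hbs2 using fun c => hout (rep c) (hrep1 c)
  have hsupp : ∀ (c : H.ConnectedComponent) (u : Fin n), u ∈ c.supp ↔ lab u = rep c := by
    intro c u
    conv_lhs => rw [← hrep2 c]
    rw [mem_supp_mk, hlab, hrep1]
  have hnd : ∀ c, (A (rep c)).Nodup := by
    intro c
    obtain ⟨p, hp, -⟩ := (hA _ (hrep1 c)).1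
    rw [← hp]
    exact firstVisits_nodup _
  -- the orientation in which `b` has been written
  let o : List (Fin n) → List (Fin n) := fun b => if h : Written w out b then h.choose else b
  have ho : ∀ b, (∃ c, b ∈ bs c) → (o b = b ∨ o b = b.reverse) ∧
      cycleWeight w (o b) ≤ cycleWeight w b ∧ cycleWeight w (o b) ≤ cycleWeight w b.reverse ∧
      ∀ e ∈ cycleEdges (o b), out (e.1 : ℕ) = (e.2 : ℕ) := by
    rintro b ⟨c, hb⟩
    have h := (hbs2 c b hb).2
    simp only [o, dif_pos h]
    exact h.choose_spec
  rw [ApxDir, Fintype.card_fin]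
  refine ⟨hn, {b | ∃ c, b ∈ bs c}, ⟨by rwa [Fintype.card_fin], H₀, H, hgw, hph, hleg, bs,
    fun c => ?_, rfl⟩, o, fun b hb => ⟨(ho b hb).1, (ho b hb).2.1, (ho b hb).2.2.1⟩, fun e => ?_⟩
  · obtain ⟨p, hp, hcount⟩ := (hA _ (hrep1 c)).1
    refine ⟨rep c, (hsupp c _).2 (hrep1 c), p, fun u v huv hu => ?_, ?_, fun b hb => (hbs2 c b hb).1⟩
    · exact hcount u v huv ((hsupp c u).1 hu)
    · rw [hbs1, ← hp]
  · rw [Finset.mem_filter]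
    constructor
    · rintro ⟨-, he⟩
      set c := H.connectedComponentMk e.1
      -- every vertex lies on a cycle, so that its entry in the output is its successor there
      have h1 : e.1 ∈ (bs c).flatten := by
        rw [hbs1, (hA _ (hrep1 c)).2, ← hsupp]
        exact mem_supp_mk.2 (.refl _)
      obtain ⟨b, hb, heb⟩ := List.mem_flatten.1 h1
      have hbn : b.Nodup := by
        have h2 := hnd c
        rw [← hbs1, List.nodup_flatten] at h2
        exact h2.1 b hb
      obtain ⟨h3, -, -, h4⟩ := ho b ⟨c, hb⟩
      obtain ⟨u, hu, -⟩ : ∃! u, (e.1, u) ∈ cycleEdges (o b) := by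
        refine existsUnique_succ ?_ ?_ <;> rcases h3 with h3 | h3 <;> rw [h3] <;> simpa
      have h5 : u = e.2 := Fin.ext ((h4 _ hu).symm.trans he)
      exact ⟨b, ⟨c, hb⟩, by rwa [h5] at hu⟩
    · rintro ⟨b, hb, he⟩
      exact ⟨Finset.mem_univ _, (ho b hb).2.2.2 e he⟩

end

end LCC

/-! ### Initialization -/

namespace LCC

/-- Two nested loops over all pairs of indices. The invariant `J P` says that the pairs that
satisfy `P` have been treated. -/
theorem wp_grid {i j : ℕ} {body : Prog} {T n : ℕ} (J : (ℕ → ℕ → Prop) → State → Prop) {s : State}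
    (hn : s.reg 0 = n) (hi : i ∉ 99 :: j :: body.regs) (hj : j ∉ 99 :: body.regs)
    (h0 : 0 ∉ 99 :: i :: j :: body.regs)
    (hJ : ∀ P P' : ℕ → ℕ → Prop, ∀ s s' : State, s'.arr = s.arr → s'.qarr = s.qarr →
      (∀ a < n, ∀ b < n, P' a b → P a b) → J P s → J P' s')
    (hs : J (fun _ _ => False) s)
    (hstep : ∀ a < n, ∀ b < n, ∀ P s', Frame (forTo i 0 (forTo j 0 body)) s s' → J P s' →
      s'.reg i = a → s'.reg j = b → wp body T (J fun x y => P x y ∨ x = a ∧ y = b) s') :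
    wp (forTo i 0 (forTo j 0 body)) (n * (n * (T + 5) + 8) + 3) (J fun _ _ => True) s := by
  simp only [List.mem_cons, not_or] at hi hj h0
  have hregs : (forTo j 0 body).regs = j :: (body.regs ++ [99, j]) := by
    simp [forTo, blk, Prog.regs, Op.regs]
  refine (wp_for (n := n) (T := n * (T + 5) + 3) (fun k s' => J (fun x _ => x < k) s') hn
    (by simp [hregs, hi]) (by simp [hregs, h0]) hi.1 ?_ ?_).mono (by simp [add_assoc]) ?_
  · exact hJ _ _ s _ rfl rfl (fun a _ b _ h => absurd h (Nat.not_lt_zero a)) hs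
  · intro k hk s' hf hI hik
    have hn' : s'.reg 0 = n := by
      rw [hf.reg 0, hn]
      simp [forTo, blk, Prog.regs, Op.regs, h0]
    refine (wp_for (n := n) (T := T) (fun m t => J (fun x y => x < k ∨ x = k ∧ y < m) t) hn'
      hj.2 (by simp [h0]) hj.1 ?_ ?_).mono le_rfl ?_
    · refine hJ _ _ s' _ rfl rfl (fun a _ b _ h => ?_) hI
      exact h.resolve_right fun h => Nat.not_lt_zero _ h.2
    · intro m hm t hft hIt hjm
      have hft' : Frame (forTo i 0 (forTo j 0 body)) s' t := hft.forTo
      refine (hstep k hk m hm _ t (hf.trans hft') hIt ?_ hjm).mono le_rfl fun t' h => ?_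
      · rw [hft.reg i (by simp [hregs, hi]), hik]
      · refine hJ _ _ t' _ rfl rfl (fun a _ b _ h => ?_) h
        omega
    · intro t ht
      refine hJ _ _ t _ rfl rfl (fun a _ b hb h => ?_) ht
      omega
  · exact fun s' h => hJ _ _ s' s' rfl rfl (fun a ha _ _ _ => ha) h

/-- Computes the offsets of the rows of a matrix. -/
def offProg : Prog := blk [.op (.add 76 98 97), forTo 70 0 (ops [.store 4 70 76, .add 76 76 0])]

theorem offProg_wp {n : ℕ} {s : State} (hn : s.reg 0 = n) (h97 : s.reg 97 = 0)
    (h98 : s.reg 98 = 1) :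
    wp offProg (n * 8 + 5) (fun s' => s'.reg 76 = n * n + 1 ∧ ∀ a < n, s'.arr 4 a = a * n + 1)
      s := by
  refine (wp_cons (T₁ := 1) (R := fun t => t.reg 76 = 1) (wp_eval rfl le_rfl ?_)
    (T₂ := n * 8 + 3 + 1) ?_).mono (by omega) fun _ h => h
  · simp [Prog.eval, Op.exec, h97, h98]
  intro s₁ e76 f₁
  have g0 : s₁.reg 0 = n := by rw [f₁.reg 0 (by decide), hn]
  refine wp_last (wp_for (n := n) (T := 3) (fun k t => t.reg 76 = k * n + 1 ∧
    ∀ a < k, t.arr 4 a = a * n + 1) g0 (by decide) (by decide) (by decide) ?_ ?_) fun _ h _ => h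
  · exact ⟨by simpa [State.setReg] using e76, fun a ha => absurd ha (Nat.not_lt_zero a)⟩
  · rintro k hk s' hf ⟨i1, i2⟩ hr
    have h0 : s'.reg 0 = n := by rw [hf.reg 0 (by decide), g0]
    refine wp_eval rfl le_rfl ⟨?_, fun a ha => ?_⟩
    · simp [Prog.eval, blk, ops, Op.exec, State.setReg, i1, h0]
      ring
    · simp only [Prog.eval, blk, ops, List.map, Op.exec, State.setReg, Function.update_self, hr, i1]
      rcases Nat.lt_succ_iff_lt_or_eq.1 ha with h | rfl
      · rw [Function.update_of_ne h.ne, i2 a h]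
      · rw [Function.update_self]

/-- Determines a power of two that is large enough for the number of leaves of the tournament
tree. -/
def sizeProg : Prog := blk [.op (.const 2 1), .loop (.lt 2 76) (.op (.add 2 2 2))]

theorem sizeProg_wp {m M : ℕ} {s : State} (h76 : s.reg 76 = m) (hM : m ≤ 2 ^ M) :
    wp sizeProg (2 * M + 3) (fun s' => ∃ K ≤ M, s'.reg 2 = 2 ^ K ∧ m ≤ 2 ^ K) s := by
  refine (wp_cons (T₁ := 1) (R := fun t => t.reg 2 = 1) (wp_eval rfl le_rfl ?_)
    (T₂ := 2 * M + 1 + 1) ?_).mono (by omega) fun _ h => h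
  · simp [Prog.eval, Op.exec]
  intro s₁ e2 f₁
  have g76 : s₁.reg 76 = m := by rw [f₁.reg 76 (by decide), h76]
  refine wp_last (wp_while (c := 1) (m := M) (fun k t => k ≤ M ∧ t.reg 2 = 2 ^ (M - k))
    ⟨le_rfl, by simpa using e2⟩ ?_).frame ?_
  · rintro k t hf ⟨i1, i2⟩ hb
    simp only [Test.holds, i2, hf.reg 76 (by decide), g76] at hb
    have hk : k ≠ 0 := by
      rintro rfl
      exact absurd hM (by simpa using hb)
    refine ⟨k - 1, by omega, wp_eval rfl (by simp only [Prog.cost]; omega) ⟨by omega, ?_⟩⟩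
    rw [show M - (k - 1) = M - k + 1 by omega, pow_succ]
    simp [Prog.eval, Op.exec, i2]
    ring
  · rintro t ⟨⟨k, ⟨i1, i2⟩, hb⟩, hf⟩ -
    simp only [Test.holds, i2, hf.reg 76 (by decide), g76, not_lt] at hb
    exact ⟨M - k, Nat.sub_le _ _, i2, hb⟩

/-- Computes the symmetrized weights. -/
def weightBody : Prog :=
  ops [.load 73 4 70, .add 73 73 71, .sub 74 73 98, .load 75 4 71, .add 75 75 70, .sub 75 75 98,
    .qload 1 0 74, .qload 2 0 75, .qadd 1 1 2, .qstore 1 73 1, .qstore 2 73 1, .store 8 73 70,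
    .store 9 73 71]

/-- Initializes the symmetrized weights, the reduced weights and the edges for all pairs of
vertices. -/
def weightProg : Prog := forTo 70 0 (forTo 71 0 weightBody)

theorem weightProg_wp {n K : ℕ} {w : Fin n → Fin n → ℕ} {s : State} (hc : Consts n K s)
    (hin : ∀ u v : Fin n, s.qarr 0 (u * n + v) = w u v) :
    wp weightProg (n * (n * 19 + 8) + 3) (fun s' => ∀ u v : Fin n,
      s'.arr 8 (pos n u v) = u ∧ s'.arr 9 (pos n u v) = v ∧
      s'.qarr 1 (pos n u v) = symWeight w u v ∧ s'.qarr 2 (pos n u v) = symWeight w u v) s := by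
  refine (wp_grid (T := 14) (fun P s' => ∀ u v : Fin n, P u v →
      s'.arr 8 (pos n u v) = u ∧ s'.arr 9 (pos n u v) = v ∧
      s'.qarr 1 (pos n u v) = symWeight w u v ∧ s'.qarr 2 (pos n u v) = symWeight w u v) hc.n_eq
      (by decide) (by decide) (by decide) ?_ ?_ ?_).mono le_rfl fun s' h u v => h u v trivial
  · intro P P' s s' h1 h2 h h' u v hP
    rw [h1, h2]
    exact h' u v (h u u.2 v v.2 hP)
  · exact fun _ _ h => h.elim
  · intro a ha b hb P s' hf hI h70 h71
    have c' : Consts n K s' := hc.of_frame hf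
    have hq : s'.qarr 0 = s.qarr 0 := hf.qarr 0 (by decide)
    refine wp_eval rfl (by decide) ?_
    have e1 : a * n + 1 + b = pos n a b := by rw [pos]; omega
    have e2 : pos n a b - 1 = a * n + b := rfl
    have e3 : b * n + 1 + a - 1 = b * n + a := by omega
    have k1 : s.qarr 0 (a * n + b) = w ⟨a, ha⟩ ⟨b, hb⟩ := hin ⟨a, ha⟩ ⟨b, hb⟩
    have k2 : s.qarr 0 (b * n + a) = w ⟨b, hb⟩ ⟨a, ha⟩ := hin ⟨b, hb⟩ ⟨a, ha⟩
    intro u v huv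
    simp only [weightBody, Prog.eval, blk, ops, List.map, Op.exec, h70, h71, c'.off a ha,
      c'.off b hb, c'.one, hq, Function.update_self, ne_eq, Nat.reduceEqDiff, not_false_eq_true,
      Function.update_of_ne, e1, e2, e3, k1, k2]
    by_cases hne : (u : ℕ) = a ∧ (v : ℕ) = b
    · obtain ⟨rfl, rfl⟩ := hne
      simp [symWeight]
    · have hp : pos n u v ≠ pos n a b := fun h => hne ((pos_inj v.2 hb).1 h)
      simpa [Function.update_of_ne hp] using hI u v (huv.resolve_right hne)

/-- Determines which components are active when every vertex is a component of its own. -/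
def actProg : Prog :=
  blk [.op (.load 74 3 98), .ite (.eq 74 98) (.op (.const 74 0)) (.op (.const 74 1)),
    forTo 70 0 (.op (.store 7 70 74))]

theorem actProg_wp {n g : ℕ} {s : State} (hn : s.reg 0 = n) (h98 : s.reg 98 = 1)
    (hdvd : ∀ m ≤ n, s.arr 3 m = 1 ↔ g ∣ m) :
    wp actProg (n * 6 + 7) (fun s' => ∀ x < n, s'.arr 7 x = if g ∣ 1 then 0 else 1) s := by
  refine (wp_cons (T₁ := 1) (R := fun t => t.reg 74 = s.arr 3 1) (wp_eval rfl le_rfl ?_)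
    (T₂ := 2 + (n * 6 + 3 + 1)) ?_).mono (by omega) fun _ h => h
  · simp [Prog.eval, Op.exec, h98]
  intro s₁ e74 f₁
  refine wp_cons (T₁ := 2) (R := fun t => 0 < n → t.reg 74 = if g ∣ 1 then 0 else 1)
    (wp_eval rfl (by decide) fun h0 => ?_) ?_
  · have g98 : s₁.reg 98 = 1 := by rw [f₁.reg 98 (by decide), h98]
    by_cases hg : g ∣ 1
    · rw [if_pos hg]
      simp [Prog.eval, Test.holds, Op.exec, e74, g98, (hdvd 1 h0).2 hg]
    · have h3 : s.arr 3 1 ≠ 1 := fun h => hg ((hdvd 1 h0).1 h)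
      rw [if_neg hg]
      simp [Prog.eval, Test.holds, Op.exec, e74, g98, h3]
  intro s₂ g74 f₂
  have g0 : s₂.reg 0 = n := by rw [f₂.reg 0 (by decide), f₁.reg 0 (by decide), hn]
  refine wp_last (wp_for (n := n) (T := 1) (fun k t => ∀ x < k,
    t.arr 7 x = if g ∣ 1 then 0 else 1) g0 (by decide) (by decide) (by decide) ?_ ?_)
    fun _ h _ => h
  · exact fun x hx => absurd hx (Nat.not_lt_zero x)
  · intro k hk s' hf hI hr
    refine wp_eval rfl le_rfl fun x hx => ?_
    simp only [Prog.eval, Op.exec, State.setReg, Function.update_self, hr,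
      hf.reg 74 (by decide), g74 (Nat.zero_lt_of_lt hk)]
    rcases Nat.lt_succ_iff_lt_or_eq.1 hx with h | rfl
    · rw [Function.update_of_ne h.ne, hI x h]
    · rw [Function.update_self]

/-- Builds up the tournament tree. -/
def treeProg : Prog := forTo 70 0 (forTo 71 0 (refreshAt 70 71))

theorem treeProg_wp {n K : ℕ} {s : State} (hc : Consts n K s) (hact : ∀ x < n, s.arr 7 x ≤ 1)
    (h10 : ∀ x, s.arr 10 x = 0) :
    wp treeProg (n * (n * (21 * K + 44) + 8) + 3) (Leaves n K fun _ _ => True) s := by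
  refine wp_grid (T := 21 * K + 39) (fun P s' => Leaves n K P s') hc.n_eq (by decide) (by decide)
    (by decide) ?_ ?_ ?_
  · intro P P' s s' h1 h2 h hJ
    refine hJ.congr (by rw [h1]) (by rw [h2]) fun a ha b hb hP => ⟨h a ha b hb hP, fun h => ?_⟩
    simpa [LeafOk, Cand, h1, h2] using h
  · exact ⟨fun i _ _ => Or.inl ⟨h10 i, fun q _ _ => h10 _⟩, fun q _ h => absurd (h10 _) h,
      fun _ _ _ _ h => h.elim⟩
  · intro a ha b hb P s' hf hI h70 h71
    have c' : Consts n K s' := hc.of_frame hf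
    exact refreshAt_wp c' h70 h71 (by decide) ha hb (by rwa [hf.arr 7 (by decide)]) hI

end LCC

/-! ### The whole program -/

namespace LCC

/-- Sets up the first state of the main loop of the algorithm of Goemans and Williamson. -/
def initProg : Prog :=
  blk [offProg, sizeProg, weightProg, freshProg, actProg, treeProg, .op (.load 31 10 98)]

/-- Initially every vertex is a component of its own and all dual variables are zero, so that
reduced weights are symmetrized weights. -/
theorem initProg_wp {n M g : ℕ} {w : Fin n → Fin n → ℕ} {s : State} (hn : s.reg 0 = n)
    (h97 : s.reg 97 = 0) (h98 : s.reg 98 = 1) (hq : s.qreg 10 = 0) (hM : n * n + 1 ≤ 2 ^ M)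
    (hin : ∀ u v : Fin n, s.qarr 0 (u * n + v) = w u v)
    (hdvd : ∀ m ≤ n, s.arr 3 m = 1 ↔ g ∣ m) (h10 : ∀ x, s.arr 10 x = 0) :
    wp initProg (n * (n * (21 * M + 63) + 40) + 2 * M + 26) (fun s' => ∃ K ≤ M,
      GWInv K g (symWeight w) ⊥ (fun _ => 0) s' ∧
      ∀ u v : Fin n, s'.qarr 1 (pos n u v) = symWeight w u v) s := by
  refine (wp_cons (offProg_wp hn h97 h98) (T₂ := (2 * M + 3) + ((n * (n * 19 + 8) + 3) +
    ((n * 10 + 3) + ((n * 6 + 7) + (n * (n * (21 * M + 44) + 8) + 3 + (1 + 1)))))) ?_).mono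
    ?_ fun _ h => h
  swap
  · ring_nf
    omega
  rintro s₁ ⟨e76, e4⟩ f₁
  refine wp_cons (sizeProg_wp e76 hM) ?_
  rintro s₂ ⟨K, hK, e2, hle⟩ f₂
  have c₂ : Consts n K s₂ := by
    refine ⟨?_, e2, ?_, ?_, ?_, ?_, hle⟩
    · rw [f₂.reg 0 (by decide), f₁.reg 0 (by decide), hn]
    · rw [f₂.reg 97 (by decide), f₁.reg 97 (by decide), h97]
    · rw [f₂.reg 98 (by decide), f₁.reg 98 (by decide), h98]
    · rw [f₂.qreg 10 (by decide), f₁.qreg 10 (by decide), hq]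
    · rwa [f₂.arr 4 (by decide)]
  refine wp_cons (weightProg_wp (w := w) c₂
    (by rwa [f₂.qarr 0 (by decide), f₁.qarr 0 (by decide)])) ?_
  intro s₃ hw f₃
  have c₃ : Consts n K s₃ := c₂.of_frame f₃
  refine wp_cons (freshProg_wp c₃.n_eq c₃.one) ?_
  rintro s₄ ⟨h56, hF⟩ f₄
  have c₄ : Consts n K s₄ := c₃.of_frame f₄
  have d₄ : ∀ m ≤ n, s₄.arr 3 m = 1 ↔ g ∣ m := by
    rwa [f₄.arr 3 (by decide), f₃.arr 3 (by decide), f₂.arr 3 (by decide), f₁.arr 3 (by decide)]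
  refine wp_cons (actProg_wp c₄.n_eq c₄.one d₄) ?_
  intro s₅ h7 f₅
  have c₅ : Consts n K s₅ := c₄.of_frame f₅
  have hact : ∀ x < n, s₅.arr 7 x ≤ 1 := by
    intro x hx
    rw [h7 x hx]
    split_ifs <;> simp
  refine (wp_cons (treeProg_wp c₅ hact (by rwa [f₅.arr 10 (by decide), f₄.arr 10 (by decide),
    f₃.arr 10 (by decide), f₂.arr 10 (by decide), f₁.arr 10 (by decide)]))
    (T₂ := 2) ?_).mono (by gcongr) fun _ h => h
  intro s₆ hT f₆
  have c₆ : Consts n K s₆ := c₅.of_frame f₆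
  refine wp_last (T := 1) (R := fun t => t.reg 31 = s₆.arr 10 1 ∧ t.arr = s₆.arr ∧
    t.qarr = s₆.qarr) (wp_eval rfl le_rfl ?_) ?_
  · simp [Prog.eval, Op.exec, c₆.one]
  rintro s₇ ⟨e31, earr, eq⟩ f₇
  have a5 : s₇.arr 5 = s₄.arr 5 := by rw [earr, f₆.arr 5 (by decide), f₅.arr 5 (by decide)]
  have a7 : s₇.arr 7 = s₅.arr 7 := by rw [earr, f₆.arr 7 (by decide)]
  have hwt : ∀ u v : Fin n, s₇.arr 8 (pos n u v) = u ∧ s₇.arr 9 (pos n u v) = v ∧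
      s₇.qarr 1 (pos n u v) = symWeight w u v ∧ s₇.qarr 2 (pos n u v) = symWeight w u v := by
    rwa [earr, eq, f₆.arr 8 (by decide), f₅.arr 8 (by decide), f₄.arr 8 (by decide),
      f₆.arr 9 (by decide), f₅.arr 9 (by decide), f₄.arr 9 (by decide),
      f₆.qarr 1 (by decide), f₅.qarr 1 (by decide), f₄.qarr 1 (by decide),
      f₆.qarr 2 (by decide), f₅.qarr 2 (by decide), f₄.qarr 2 (by decide)]
  refine ⟨K, hK, ⟨⟨fun _ => 0, 0, .refl, fun v => by simp⟩, c₆.of_frame f₇, ?_, ?_, ?_, ?_, ?_, ?_,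
    by rw [e31, earr]⟩, fun u v => (hwt u v).2.2.1⟩
  · rwa [earr, f₆.arr 3 (by decide), f₅.arr 3 (by decide)]
  · rwa [a5, earr, f₆.arr 6 (by decide), f₅.arr 6 (by decide), f₆.arr 11 (by decide),
      f₅.arr 11 (by decide), f₆.arr 12 (by decide), f₅.arr 12 (by decide)]
  · intro u
    have h1 : compSize (⊥ : SimpleGraph (Fin n)) u = 1 := by
      rw [← hF.size, (h56 u u.2).1, (h56 u u.2).2]
    rw [a5, a7, (h56 u u.2).1, h7 u u.2]
    split_ifs with hg
    · exact (compF_eq_zero.2 (by rwa [h1])).symm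
    · exact (compF_eq_one.2 (by rwa [h1])).symm
  · rwa [a7]
  · intro a ha b hb _ _ _
    rw [a5]
    have h8 := hwt ⟨a, ha⟩ ⟨b, hb⟩
    refine ⟨fun u v hu hv => ?_, ⟨a, ha⟩, ⟨b, hb⟩, (h56 a ha).1, (h56 b hb).1, h8.1, h8.2.1, ?_⟩
    · rw [(h56 u u.2).1] at hu
      rw [(h56 v v.2).1] at hv
      subst hu hv
      rw [h8.2.2.2]
      simp
    · rw [h8.2.2.2]
      simp
  · exact hT.congr (by rw [earr]) (by rw [eq]) fun a _ b _ h => ⟨h, fun h => by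
      simpa [LeafOk, Cand, earr, eq] using h⟩

/-- Everything that has to be done if `n` is a sum of elements of `L`. -/
def coverProg (p : ℕ) : Prog :=
  blk [initProg, gwLoop, pruneProg, rep (p + 1) phaseProg, exploreProg, cutProg,
    .op (.add 1 98 97)]

/-- A bound for the number of steps of `coverProg`. -/
def coverTime (p n M : ℕ) : ℕ :=
  (n * (n * (21 * M + 63) + 40) + 2 * M + 26) + (((n * (84 * M + 214) + 61) * n + 1) +
    ((n * (n * 47 + 102) + 18) + (((p + 1) * (n * (n * 38 + 64) + 10) + 1) +
    ((n * (n * 21 + 22) + 8) + ((n * (70 * n + 13) + 3) + (1 + 1))))))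

theorem coverProg_wp {n M : ℕ} {L : Set ℕ} {l : List ℕ} {w : Fin n → Fin n → ℕ} {s : State}
    (hn : s.reg 0 = n) (h97 : s.reg 97 = 0) (h98 : s.reg 98 = 1) (hq : s.qreg 10 = 0)
    (hM : n * n + 1 ≤ 2 ^ M) (hin : ∀ u v : Fin n, s.qarr 0 (u * n + v) = w u v)
    (hdvd : ∀ m ≤ n, s.arr 3 m = 1 ↔ gL L ∣ m) (h10 : ∀ x, s.arr 10 x = 0)
    (hl : ∀ x ∈ l, 0 < x) (hlL : ∀ x ∈ l, x ∈ L) (hcl : ∀ m, m ∈ close L ↔ m ∈ close {x | x ∈ l})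
    (hdp : ∀ m ≤ n, DpOk l (s.arr 2) (s.arr 1) m) (hnL : n ∈ close L) :
    wp (coverProg (pL L)) (coverTime (pL L) n M) (fun s' => s'.reg 1 = 1 ∧
      ApxDir L w (some (Finset.univ.filter fun e : Fin n × Fin n =>
        s'.arr 0 (e.1 : ℕ) = (e.2 : ℕ)))) s := by
  have hW : ∀ u v, symWeight w u v = symWeight w v u := fun u v => add_comm _ _
  refine wp_cons (initProg_wp hn h97 h98 hq hM hin hdvd h10) ?_
  rintro s₁ ⟨K, hKM, hI, hW₁⟩ f₁
  have c₁ := hI.consts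
  refine wp_cons ((gwLoop_wp hW (gL_dvd hnL) hI).mono (by gcongr) fun _ h => h) ?_
  rintro s₂ ⟨F, hgw, -, hFg, hF⟩ f₂
  have c₂ : Consts n K s₂ := c₁.of_frame f₂
  refine wp_cons (pruneProg_wp c₂.n_eq c₂.zero c₂.one (by rwa [f₂.arr 3 (by decide),
    f₁.arr 3 (by decide)]) hF hFg) ?_
  intro s₃ hF₃ f₃
  have c₃ : Consts n K s₃ := c₂.of_frame f₃
  have u1 : s₃.arr 1 = s.arr 1 := by
    rw [f₃.arr 1 (by decide), f₂.arr 1 (by decide), f₁.arr 1 (by decide)]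
  have u2 : s₃.arr 2 = s.arr 2 := by
    rw [f₃.arr 2 (by decide), f₂.arr 2 (by decide), f₁.arr 2 (by decide)]
  have uq : s₃.qarr 0 = s.qarr 0 := by
    rw [f₃.qarr 0 (by decide), f₂.qarr 0 (by decide), f₁.qarr 0 (by decide)]
  refine wp_cons (rep_phaseProg_wp (L := L) c₃ (W := symWeight w)
    (by rwa [f₃.qarr 1 (by decide), f₂.qarr 1 (by decide)])
    (fun m hm => by rw [u2, (hdp m hm).1, hcl]) hnL (dvd_compSize_gwPrune hF.acyclic hFg) hF₃) ?_
  rintro s₄ ⟨c₄, v2, -, v1, vq, H, hH, hph, hleg⟩ -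
  refine wp_cons (exploreProg_wp c₄.n_eq c₄.zero c₄.one hH) ?_
  rintro s₅ ⟨hR, hm⟩ f₅
  have c₅ : Consts n K s₅ := c₄.of_frame f₅
  have x5 : s₅.arr 5 = s₄.arr 5 := f₅.arr 5 (by decide)
  have x6 : s₅.arr 6 = s₄.arr 6 := f₅.arr 6 (by decide)
  obtain ⟨A, hA⟩ := hR.exists_tours hm hH.acyclic hH.reach
  refine wp_cons (cutProg_wp (l := l) (w := w) c₅
    (by rwa [f₅.qarr 0 (by decide), vq, uq]) hl
    (by rwa [f₅.arr 2 (by decide), f₅.arr 1 (by decide), v2, v1, u2, u1]) A ?_) ?_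
  · rw [x5, x6]
    intro r hr
    obtain ⟨⟨p, hp, -⟩, h2, h3⟩ := hA r hr
    have hnd : (A r).Nodup := hp ▸ firstVisits_nodup _
    have hsz : s₄.arr 6 r = compSize H r := by rw [← hH.size, hr]
    refine ⟨h2, hnd, ?_, ?_, fun x hx => (h3 x).1 hx⟩
    · rw [hsz]
      refine length_eq_compSize hnd fun x => ?_
      rw [h3, hH.reach, hr]
    · rw [hsz]
      exact (hcl _).1 (not_not.1 (hleg (H.connectedComponentMk r)))
  · rw [x5]
    intro s₆ h₆ f₆
    refine wp_last (T := 1) (R := fun t => t.reg 1 = 1 ∧ t.arr = s₆.arr) (wp_eval rfl le_rfl ?_) ?_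
    · simp [Prog.eval, Op.exec, f₆.reg 98 (by decide), f₆.reg 97 (by decide), c₅.one, c₅.zero]
    · rintro s₇ ⟨e1, earr⟩ -
      refine ⟨e1, ?_⟩
      rw [earr]
      exact apxDir_of_written hnL hgw hph hleg hH.lab_lt hH.lab_lab hH.reach
        (fun r hr => ⟨(hA r hr).1, (hA r hr).2.2⟩) fun r hr => by
          obtain ⟨bs, h1, h2⟩ := h₆ r hr
          exact ⟨bs, h1, fun b hb => ⟨hlL _ (h2 b hb).1, (h2 b hb).2⟩⟩

end LCC

namespace LCC

theorem inputState_qarr {n : ℕ} (w : Fin n → Fin n → ℕ) (u v : Fin n) :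
    (inputState w).qarr 0 (u * n + v) = w u v := by
  have h : ∀ a b : Fin n, (a : ℕ) * n + b = u * n + v ↔ a = u ∧ b = v := by
    intro a b
    rw [Fin.ext_iff, Fin.ext_iff, ← pos_inj b.2 v.2, pos, pos, add_left_inj]
  simp only [inputState, if_true, h]
  rw [Finset.sum_eq_single u, Finset.sum_eq_single v]
  · simp
  · intro b _ hb
    simp [hb]
  · simp
  · intro a _ ha
    simp [ha]
  · simp

/-- The multiples of `g` are the sums of elements of a list with at most one entry. -/
theorem exists_list_dvd_iff (g : ℕ) :
    ∃ l : List ℕ, (∀ x ∈ l, 0 < x) ∧ ∀ m, m ∈ close {x | x ∈ l} ↔ g ∣ m := by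
  rcases Nat.eq_zero_or_pos g with rfl | hg
  · refine ⟨[], by simp, fun m => ?_⟩
    simp [mem_close_iff]
  · refine ⟨[g], by simpa, fun m => ?_⟩
    have : {x | x ∈ [g]} = {g} := by ext; simp
    rw [mem_close_iff, this, ← mem_multiples, AddSubmonoid.multiples_eq_closure]

/-- The program for ApxDir: `l` generates the sums of elements of `L`, `l'` generates the multiples
of `g_L`, and `p` is `p_L`. -/
def apxProg (p : ℕ) (l l' : List ℕ) : Prog :=
  blk [dpProg 2 1 l, dpProg 3 22 l', .op (.load 79 2 0), .ite (.eq 79 98) (coverProg p) .skip]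

/-- A bound for the number of steps of `apxProg`. The tournament tree needs at least `n ^ 2 + 1`
leaves, and `2 ^ (2 * log n + 2)` leaves suffice. -/
def apxTime (p a b n : ℕ) : ℕ :=
  (n * (12 * a + 10) + 10) + ((n * (12 * b + 10) + 10) +
    (1 + (coverTime p n (2 * Nat.log 2 n + 2) + 1 + 1)))

theorem sq_lt_two_pow_log (n : ℕ) : n * n + 1 ≤ 2 ^ (2 * Nat.log 2 n + 2) := by
  have h : n < 2 ^ (Nat.log 2 n + 1) := Nat.lt_pow_succ_log_self one_lt_two n
  have e : 2 ^ (2 * Nat.log 2 n + 2) = 2 ^ (Nat.log 2 n + 1) * 2 ^ (Nat.log 2 n + 1) := by ring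
  rw [e]
  exact Nat.mul_self_lt_mul_self h

/-- If `n` is not a sum of elements of `L`, register `1` keeps its initial value `0`, which stands
for the output `⊥`. -/
theorem apxProg_wp {n : ℕ} {L : Set ℕ} {l l' : List ℕ} (hl : ∀ x ∈ l, 0 < x)
    (hlL : ∀ x ∈ l, x ∈ L) (hcl : ∀ m, m ∈ close L ↔ m ∈ close {x | x ∈ l})
    (hl' : ∀ x ∈ l', 0 < x) (hcl' : ∀ m, m ∈ close {x | x ∈ l'} ↔ gL L ∣ m)
    (w : Fin n → Fin n → ℕ) :
    wp (apxProg (pL L) l l') (apxTime (pL L) l.length l'.length n)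
      (fun s => ApxDir L w (outputOf n s)) (inputState w) := by
  refine wp_cons (dpProg_wp (n := n) (by decide) hl rfl fun _ => rfl) ?_
  rintro s₁ ⟨hdp, -⟩ f₁
  obtain ⟨r₁, a₁, q₁, k₁⟩ := dpProg_frame f₁
  refine wp_cons (dpProg_wp (n := n) (by decide) hl' (by rw [r₁ 0 (by decide)]; rfl) fun m => by
    rw [a₁ 3 (by decide) (by decide)]; rfl) ?_
  rintro s₂ ⟨hdp', h98⟩ f₂
  obtain ⟨r₂, a₂, q₂, k₂⟩ := dpProg_frame f₂
  have h0 : s₂.reg 0 = n := by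
    rw [r₂ 0 (by decide), r₁ 0 (by decide)]
    rfl
  refine wp_cons (T₁ := 1) (R := fun t => t.reg 79 = s₂.arr 2 n) (wp_eval rfl le_rfl ?_) ?_
  · simp [Prog.eval, Op.exec, h0]
  intro s₃ e79 f₃
  have b2 : s₃.arr 2 = s₁.arr 2 := by
    rw [f₃.arr 2 (by decide), a₂ 2 (by decide) (by decide)]
  have b1 : s₃.arr 1 = s₁.arr 1 := by
    rw [f₃.arr 1 (by decide), a₂ 1 (by decide) (by decide)]
  have g98 : s₃.reg 98 = 1 := by rw [f₃.reg 98 (by decide), h98]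
  have e79' : s₃.reg 79 = s₁.arr 2 n := by rw [e79, a₂ 2 (by decide) (by decide)]
  refine wp_last (wp_ite (fun hb => ?_) fun hb => ?_) fun _ h _ => h
  · simp only [Test.holds, e79', g98] at hb
    have hnL : n ∈ close L := by rw [hcl, ← (hdp n le_rfl).1, hb]
    refine (coverProg_wp (L := L) (l := l) (w := w) ?_ ?_ g98 ?_ (sq_lt_two_pow_log n) ?_ ?_ ?_
      hl hlL hcl (by rwa [b1, b2]) hnL).mono le_rfl ?_
    · rw [f₃.reg 0 (by decide), h0]
    · rw [f₃.reg 97 (by decide), r₂ 97 (by decide), r₁ 97 (by decide)]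
      rfl
    · rw [f₃.qreg 10 (by decide), q₂, q₁]
      rfl
    · rw [f₃.qarr 0 (by decide), k₂, k₁]
      exact inputState_qarr w
    · intro m hm
      rw [f₃.arr 3 (by decide), (hdp' m hm).1, hcl']
    · rw [f₃.arr 10 (by decide), a₂ 10 (by decide) (by decide), a₁ 10 (by decide) (by decide)]
      exact fun _ => rfl
    · rintro t ⟨h1, h2⟩
      rw [outputOf, h1, if_neg one_ne_zero]
      exact h2
  · simp only [Test.holds, e79', g98] at hb
    have hnL : n ∉ close L := by rwa [hcl, ← (hdp n le_rfl).1]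
    have h1 : s₃.reg 1 = 0 := by
      rw [f₃.reg 1 (by decide), r₂ 1 (by decide), r₁ 1 (by decide)]
      rfl
    have hT : 1 ≤ coverTime (pL L) n (2 * Nat.log 2 n + 2) := by
      unfold coverTime
      omega
    refine wp_eval rfl hT ?_
    rw [Prog.eval, outputOf, if_pos h1, ApxDir, Fintype.card_fin]
    exact hnL

theorem apxTime_le (p a b : ℕ) {n : ℕ} (hn : 2 ≤ n) : apxTime p a b n ≤
    (210 + (625 + 38 * (p + 1)) + (258 + 64 * (p + 1) + 12 * a + 12 * b) + 4 +
      (86 + 10 * (p + 1))) * (n ^ 2 * Nat.log 2 n) := by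
  have hx : 1 ≤ Nat.log 2 n := Nat.log_pos one_lt_two hn
  have h1 : n ^ 2 ≤ n ^ 2 * Nat.log 2 n := Nat.le_mul_of_pos_right _ hx
  have h2 : n ≤ n ^ 2 * Nat.log 2 n := (Nat.le_self_pow two_ne_zero n).trans h1
  have h3 : 1 ≤ n ^ 2 * Nat.log 2 n := by omega
  have h4 : Nat.log 2 n ≤ n ^ 2 * Nat.log 2 n := Nat.le_mul_of_pos_left _ (by positivity)
  generalize hy : n ^ 2 * Nat.log 2 n = y at *
  -- expansion by monomials, each of which is at most `n ^ 2 * log n`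
  calc apxTime p a b n = 210 * y + (625 + 38 * (p + 1)) * n ^ 2 +
      (258 + 64 * (p + 1) + 12 * a + 12 * b) * n + 4 * Nat.log 2 n + (86 + 10 * (p + 1)) * 1 := by
        rw [apxTime, coverTime, ← hy]
        ring
    _ ≤ 210 * y + (625 + 38 * (p + 1)) * y + (258 + 64 * (p + 1) + 12 * a + 12 * b) * y + 4 * y +
      (86 + 10 * (p + 1)) * y := by gcongr
    _ = _ := by ring

theorem isBigO_apxTime (p a b : ℕ) : (fun n : ℕ => (apxTime p a b n : ℝ)) =O[Filter.atTop]
    (fun n : ℕ => (n : ℝ) ^ 2 * Real.log n) := by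
  set C := 210 + (625 + 38 * (p + 1)) + (258 + 64 * (p + 1) + 12 * a + 12 * b) + 4 +
      (86 + 10 * (p + 1)) with hC
  refine IsBigO.of_bound (C / Real.log 2) ?_
  filter_upwards [Filter.eventually_ge_atTop 2] with n hn
  have h2 : (0 : ℝ) < Real.log 2 := Real.log_pos one_lt_two
  have h1 : (Nat.log 2 n : ℝ) ≤ Real.log n / Real.log 2 := by
    simpa [Real.logb] using Real.natLog_le_logb n 2
  have h3 : (0 : ℝ) ≤ Real.log n := Real.log_natCast_nonneg n
  rw [Real.norm_of_nonneg (Nat.cast_nonneg _), Real.norm_of_nonneg (by positivity)]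
  calc (apxTime p a b n : ℝ) ≤ ((C * (n ^ 2 * Nat.log 2 n) : ℕ) : ℝ) := by
        exact_mod_cast apxTime_le p a b hn
    _ = C * (n ^ 2 * Nat.log 2 n) := by push_cast; ring
    _ ≤ C * (n ^ 2 * (Real.log n / Real.log 2)) := by gcongr
    _ = C / Real.log 2 * (n ^ 2 * Real.log n) := by ring

end LCC

theorem mainTheorem2 (L : Set ℕ) (hL : ∀ l ∈ L, 2 ≤ l) :
    -- approximation ratio: correctness of every possible output of ApxDir
    (∀ (n : ℕ) (w : Fin n → Fin n → ℕ), LCC.TriangleIneq w →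
      ∀ out : Option (Finset (Fin n × Fin n)), LCC.ApxDir L w out →
        (out = none → ¬ ∃ C : Finset (Fin n × Fin n), LCC.IsLCycleCover L C) ∧
        ∀ C : Finset (Fin n × Fin n), out = some C →
          LCC.IsLCycleCover L C ∧
          ∀ C' : Finset (Fin n × Fin n), LCC.IsLCycleCover L C' →
            LCC.weight w C ≤ 2 * n * (LCC.pL L + 4) * LCC.weight w C') ∧
    -- running time: a random-access program that carries out ApxDir in `O(n ^ 2 log n)` steps
    (∃ (P : LCC.Prog) (T : ℕ → ℕ),
      (fun n : ℕ => (T n : ℝ)) =O[Filter.atTop] (fun n : ℕ => (n : ℝ) ^ 2 * Real.log n) ∧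
      ∀ (n : ℕ) (w : Fin n → Fin n → ℕ), LCC.TriangleIneq w →
        ∃ (t : ℕ) (s : LCC.State), t ≤ T n ∧ LCC.Run P (LCC.inputState w) t s ∧
          LCC.ApxDir L w (LCC.outputOf n s)) ∧
    -- the bound relating the symmetrized weights to the directed ones
    (∀ (n : ℕ) (w : Fin n → Fin n → ℕ), LCC.TriangleIneq w →
      ∀ C : Finset (Fin n × Fin n), LCC.IsCycleCover C →
        LCC.weight (LCC.symWeight w) C ≤ n * LCC.weight w C) := by
  refine ⟨fun n w hw out hout => ⟨?_, ?_⟩, ?_, fun n w hw C hC => ?_⟩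
  · rintro rfl ⟨C, hC⟩
    have := LCC.card_mem_close hC
    exact hout this
  · rintro C rfl
    simpa using LCC.ApxDir.correct hL hw hout
  · obtain ⟨l, hlL, hcl⟩ := LCC.exists_list_close_eq L
    obtain ⟨l', hl', hcl'⟩ := LCC.exists_list_dvd_iff (LCC.gL L)
    refine ⟨LCC.apxProg (LCC.pL L) l l', LCC.apxTime (LCC.pL L) l.length l'.length,
      LCC.isBigO_apxTime _ _ _, fun n w _ => ?_⟩
    obtain ⟨t, s, ht, hrun, hout⟩ := LCC.apxProg_wp
      (fun x hx => two_pos.trans_le (hL x (hlL x hx))) hlL hcl hl' hcl' w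
    exact ⟨t, s, ht, hrun, hout⟩
  · simpa using LCC.weight_symWeight_le hw hC
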